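/- Let $1<\alpha\le 2$ and let $X$ be either $C_0(0,1)$, the Banach space of complex continuous functions on $(0,1)$ vanishing at both end points (with the supremum norm), or $L^1[0,1]$ (complex-valued). For $g\in X$ put $I^\alpha g(x)=\int_0^x\frac{(x-s)^{\alpha-1}}{\Gamma(\alpha)}\,g(s)\,ds$, and let $A^\alpha$ be the fractional derivative operator of order $\alpha$ with Dirichlet boundary conditions on $X$, i.e. $$D(A^\alpha)=\{f\in X:\ f(x)=I^\alpha g(x)-I^\alpha g(1)\,x^{\alpha-1}\ \text{for some } g\in X\},\qquad A^\alpha f=g$$ (the identity being understood almost everywhere if $X=L^1[0,1]$). Then: 1. There exists $M>0$ (depending only on $\alpha$ and $X$) such that every $\lambda\in\mathbb C$ with $\operatorname{Re}\lambda\ge 0$ belongs to the resolvent set of $A^\alpha$, and $\|R(\lambda,A^\alpha)\|\le M/|\lambda|$ for all such $\lambda\neq 0$, where $R(\lambda,A^\alpha)=(\lambda-A^\alpha)^{-1}$. 2. $A^\alpha$ is the generator of a strongly continuous semigroup on $X$, and this semigroup is analytic: it extends, for some $\delta\in(0,\pi/2]$, to a holomorphic operator-valued function $T$ on the sector $\{z\ne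 0:|\arg z|<\delta\}$ satisfying $T(z+w)=T(z)T(w)$ there and $T(z)f\to f$ for every $f \in X$ as $z\to 0$ within each sector $\{z\neq 0: |\arg z|<\delta'\}$ with $0<\delta'<\delta$. -/

import Mathlib

open Set Filter MeasureTheory
open scoped Topology ZeroAtInfty

noncomputable section

/-- The fractional antiderivative `I^α g (x) = ∫₀ˣ (x - s)^(α - 1) / Γ(α) * g s ds`. -/
def fracIntegral (α : ℝ) (g : ℝ → ℂ) (x : ℝ) : ℂ :=
  ∫ s in (0 : ℝ)..x, (((x - s) ^ (α - 1) / Real.Gamma α : ℝ) : ℂ) * g s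

/-- The function `x ↦ I^α g (x) - I^α g (1) x^(α - 1)`, which vanishes at `0` and `1` and whose
fractional derivative of order `α` is `g`. -/
def dirichletAntideriv (α : ℝ) (g : ℝ → ℂ) (x : ℝ) : ℂ :=
  fracIntegral α g x - fracIntegral α g 1 * ((x ^ (α - 1) : ℝ) : ℂ)

theorem fracIntegral_fubini (g : ℝ → ℂ) (hg : Integrable g) (K : ℝ → ℝ → ℝ) (hK : Continuous (Function.uncurry K))
    (t : ℝ) (ht : 0 ≤ t) :
    (∫ u in (0:ℝ)..t, ∫ s in (0:ℝ)..u, (K u s : ℂ) * g s)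
      = ∫ s in (0:ℝ)..t, ((∫ u in s..t, K u s : ℝ) : ℂ) * g s := by
  obtain ⟨C, hC⟩ := (isCompact_Icc.prod isCompact_Icc :
    IsCompact (Icc (0:ℝ) t ×ˢ Icc (0:ℝ) t)).exists_bound_of_continuousOn hK.continuousOn
  set D : Set (ℝ × ℝ) := {p | p.1 ∈ Ioc 0 t ∧ p.2 ∈ Ioc 0 p.1} with hD
  have hDm : MeasurableSet D := by
    have : D = {p : ℝ × ℝ | 0 < p.1} ∩ {p | p.1 ≤ t} ∩ ({p | 0 < p.2} ∩ {p | p.2 ≤ p.1}) := by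
      ext p; simp [hD]
    rw [this]
    exact ((measurableSet_lt measurable_const measurable_fst).inter
      (measurableSet_le measurable_fst measurable_const)).inter
      ((measurableSet_lt measurable_const measurable_snd).inter
      (measurableSet_le measurable_snd measurable_fst))
  set F : ℝ × ℝ → ℂ := D.indicator (fun p => (K p.1 p.2 : ℂ) * g p.2) with hF
  have hI : Integrable F (volume.prod volume) := by
    have h1 : Integrable (fun p : ℝ × ℝ => ((Ioc (0:ℝ) t).indicator (fun _ => (C : ℂ)) p.1) * g p.2)
        (volume.prod volume) :=
      Integrable.mul_prod (f := (Ioc (0:ℝ) t).indicator (fun _ => (C : ℂ)))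
        ((integrable_indicator_iff measurableSet_Ioc).2 (by simp)) hg
    refine h1.mono ?_ (Eventually.of_forall ?_)
    · refine AEStronglyMeasurable.indicator ?_ hDm
      refine AEStronglyMeasurable.mul ?_ hg.aestronglyMeasurable.comp_snd
      exact (Complex.continuous_ofReal.comp hK).aestronglyMeasurable
    · intro p
      by_cases hp : p ∈ D
      · have hp' := hp
        obtain ⟨⟨a, b⟩, c, d⟩ := hp'
        rw [hF, indicator_of_mem hp, norm_mul, norm_mul,
          indicator_of_mem (show p.1 ∈ Ioc 0 t from ⟨a, b⟩)]
        refine mul_le_mul_of_nonneg_right ?_ (norm_nonneg _)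
        have := hC p (by exact ⟨⟨a.le, b⟩, ⟨c.le, d.trans b⟩⟩)
        simp only [Function.uncurry, Complex.norm_real] at this ⊢
        exact this.trans (le_abs_self _)
      · rw [hF, indicator_of_notMem hp, norm_zero]; positivity
  have hsw := integral_integral_swap (f := fun u s => F (u, s)) hI
  have hL : (∫ u in (0:ℝ)..t, ∫ s in (0:ℝ)..u, (K u s : ℂ) * g s) = ∫ u, ∫ s, F (u, s) := by
    rw [intervalIntegral.integral_of_le ht, ← integral_indicator measurableSet_Ioc]
    congr 1; ext u
    by_cases hu : u ∈ Ioc 0 t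
    · rw [indicator_of_mem hu, intervalIntegral.integral_of_le hu.1.le,
        ← integral_indicator measurableSet_Ioc]
      congr 1; ext s
      by_cases hs : s ∈ Ioc 0 u
      · rw [indicator_of_mem hs, hF, indicator_of_mem (by exact ⟨hu, hs⟩)]
      · rw [indicator_of_notMem hs, hF, indicator_of_notMem (by exact fun h => hs h.2)]
    · rw [indicator_of_notMem hu]
      have : (fun s => F (u, s)) = fun _ => 0 := by
        ext s; rw [hF, indicator_of_notMem (by exact fun h => hu h.1)]
      rw [this, integral_zero]
  rw [hL, hsw, intervalIntegral.integral_of_le ht, ← integral_indicator measurableSet_Ioc]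
  congr 1; ext s
  by_cases hs : s ∈ Ioc 0 t
  · rw [indicator_of_mem hs, ← intervalIntegral.integral_ofReal,
      ← intervalIntegral.integral_mul_const, intervalIntegral.integral_of_le hs.2,
      ← integral_Icc_eq_integral_Ioc, ← integral_indicator measurableSet_Icc]
    congr 1; ext u
    by_cases hu : u ∈ Icc s t
    · rw [indicator_of_mem hu, hF,
        indicator_of_mem (by exact ⟨⟨hs.1.trans_le hu.1, hu.2⟩, hs.1, hu.1⟩)]
    · rw [indicator_of_notMem hu, hF, indicator_of_notMem (by exact fun h => hu ⟨h.2.2, h.1.2⟩)]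
  · rw [indicator_of_notMem hs]
    have : (fun u => F (u, s)) = fun _ => 0 := by
      ext u; rw [hF, indicator_of_notMem (by exact fun h => hs ⟨h.2.1, h.2.2.trans h.1.2⟩)]
    rw [this, integral_zero]

theorem fracIntegral_beta (α : ℝ) (s t : ℝ) (hst : s ≤ t) :
    ∫ u in s..t, (t - u) ^ (2 - α) * (u - s) ^ (α - 1)
      = (t - s) ^ 2 * ∫ v in (0:ℝ)..1, (1 - v) ^ (2 - α) * v ^ (α - 1) := by
  rcases hst.eq_or_lt with rfl | hst
  · simp
  have hpos : 0 < t - s := sub_pos.2 hst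
  have := intervalIntegral.mul_integral_comp_add_mul (a := 0) (b := 1)
    (f := fun u => (t - u) ^ (2 - α) * (u - s) ^ (α - 1)) (t - s) s
  simp only [mul_zero, mul_one, add_zero, add_sub_cancel] at this
  rw [← this, pow_two, mul_assoc, ← intervalIntegral.integral_const_mul (t - s)
    (fun v => (1 - v) ^ (2 - α) * v ^ (α - 1))]
  congr 1
  apply intervalIntegral.integral_congr
  intro v hv
  rw [uIcc_of_le zero_le_one] at hv
  have e1 : t - (s + (t - s) * v) = (t - s) * (1 - v) := by ring
  have e2 : s + (t - s) * v - s = (t - s) * v := by ring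
  have e3 : (t - s) ^ (2 - α) * (t - s) ^ (α - 1) = t - s := by
    rw [← Real.rpow_add hpos]; norm_num
  simp only [e1, e2]
  rw [Real.mul_rpow hpos.le (by linarith [hv.2]), Real.mul_rpow hpos.le hv.1]
  linear_combination ((1 - v) ^ (2 - α) * v ^ (α - 1)) * e3

theorem fracIntegral_unique (α : ℝ) (h1 : 1 < α) (h2 : α ≤ 2) (g : ℝ → ℂ) (hg : Integrable g) (c : ℂ)
    (h : ∀ᵐ x ∂(volume : Measure ℝ), x ∈ Ioo (0:ℝ) 1 →
      fracIntegral α g x = c * ((x ^ (α - 1) : ℝ) : ℂ)) :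
    ∀ᵐ x ∂(volume : Measure ℝ), x ∈ Ioo (0:ℝ) 1 → g x = 0 := by
  set B : ℝ := ∫ v in (0:ℝ)..1, (1 - v) ^ (2 - α) * v ^ (α - 1) with hB
  have hc1 : Continuous fun x : ℝ => x ^ (α - 1) :=
    Real.continuous_rpow_const (by linarith)
  have hc2 : Continuous fun x : ℝ => x ^ (2 - α) :=
    Real.continuous_rpow_const (by linarith)
  have hBpos : 0 < B := by
    apply intervalIntegral.intervalIntegral_pos_of_pos_on
    · exact ((hc2.comp (continuous_const.sub continuous_id)).mul hc1).intervalIntegrable _ _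
    · intro x hx
      exact mul_pos (Real.rpow_pos_of_pos (by linarith [hx.2]) _) (Real.rpow_pos_of_pos hx.1 _)
    · norm_num
  have hB0 : (B : ℂ) ≠ 0 := by exact_mod_cast hBpos.ne'
  have hG : (Real.Gamma α : ℂ) ≠ 0 := by exact_mod_cast (Real.Gamma_pos_of_pos (by linarith)).ne'
  set c' : ℂ := c * Real.Gamma α with hc'
  -- the double integral
  have hP : ∀ t ∈ Ioo (0:ℝ) 1, (∫ s in (0:ℝ)..t, (((t - s) ^ 2 : ℝ) : ℂ) * g s)
      = c' * ((t ^ 2 : ℝ) : ℂ) := by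
    intro t ht
    have e := fracIntegral_fubini g hg (fun u s => (t - u) ^ (2 - α) * (u - s) ^ (α - 1))
      ((hc2.comp (continuous_const.sub continuous_fst)).mul
        (hc1.comp (continuous_fst.sub continuous_snd))) t ht.1.le
    have eR : (∫ s in (0:ℝ)..t,
        ((∫ u in s..t, (t - u) ^ (2 - α) * (u - s) ^ (α - 1) : ℝ) : ℂ) * g s)
        = B * ∫ s in (0:ℝ)..t, (((t - s) ^ 2 : ℝ) : ℂ) * g s := by
      rw [← intervalIntegral.integral_const_mul]
      apply intervalIntegral.integral_congr
      intro s hs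
      rw [uIcc_of_le ht.1.le] at hs
      simp only
      rw [fracIntegral_beta α s t hs.2, ← hB]
      push_cast; ring
    have eL : (∫ u in (0:ℝ)..t, ∫ s in (0:ℝ)..u,
        (((t - u) ^ (2 - α) * (u - s) ^ (α - 1) : ℝ) : ℂ) * g s)
        = c' * ((t ^ 2 * B : ℝ) : ℂ) := by
      have := fracIntegral_beta α 0 t ht.1.le
      rw [sub_zero, ← hB] at this
      rw [← this, ← intervalIntegral.integral_ofReal, ← intervalIntegral.integral_const_mul]
      apply intervalIntegral.integral_congr_ae
      filter_upwards [h] with u hu hut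
      rw [uIoc_of_le ht.1.le] at hut
      have := hu ⟨hut.1, hut.2.trans_lt ht.2⟩
      have e3 : ∀ s : ℝ, (((t - u) ^ (2 - α) * (u - s) ^ (α - 1) : ℝ) : ℂ) * g s
          = (((t - u) ^ (2 - α) : ℝ) : ℂ) * Real.Gamma α *
            ((((u - s) ^ (α - 1) / Real.Gamma α : ℝ) : ℂ) * g s) := by
        intro s; push_cast; field_simp
      simp_rw [e3]
      rw [intervalIntegral.integral_const_mul]
      unfold fracIntegral at this
      rw [this, hc']
      push_cast; ring_nf
    rw [eL, eR] at e
    have : (B : ℂ) * (∫ s in (0:ℝ)..t, (((t - s) ^ 2 : ℝ) : ℂ) * g s)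
        = B * (c' * ((t ^ 2 : ℝ) : ℂ)) := by rw [← e]; push_cast; ring
    exact mul_left_cancel₀ hB0 this
  set G : ℝ → ℂ := fun t => ∫ s in (0:ℝ)..t, g s with hGdef
  have hGc : Continuous G := intervalIntegral.continuous_primitive (fun a b => hg.intervalIntegrable) 0
  set H : ℝ → ℂ := fun t => ∫ u in (0:ℝ)..t, G u with hHdef
  have hHd : ∀ t, HasDerivAt H (G t) t := fun t =>
    intervalIntegral.integral_hasDerivAt_right (hGc.intervalIntegrable _ _)
      (hGc.stronglyMeasurableAtFilter _ _) hGc.continuousAt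
  have hHc : Continuous H := continuous_iff_continuousAt.2 fun t => (hHd t).continuousAt
  have hH : ∀ t, 0 ≤ t → H t = ∫ s in (0:ℝ)..t, ((t - s : ℝ) : ℂ) * g s := by
    intro t ht
    have := fracIntegral_fubini g hg (fun _ _ => 1) continuous_const t ht
    simpa using this
  have hPH : ∀ t, 0 ≤ t → 2 * (∫ u in (0:ℝ)..t, H u) = ∫ s in (0:ℝ)..t, (((t - s) ^ 2 : ℝ) : ℂ) * g s := by
    intro t ht
    have := fracIntegral_fubini g hg (fun u s => u - s) (continuous_fst.sub continuous_snd) t ht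
    have e : ∀ s : ℝ, (∫ u in s..t, (u - s)) = (t - s) ^ 2 / 2 := by
      intro s
      rw [intervalIntegral.integral_comp_sub_right (fun x => x)]; simp
    simp_rw [e] at this
    have e2 : (∫ u in (0:ℝ)..t, H u) = ∫ u in (0:ℝ)..t, ∫ s in (0:ℝ)..u, ((u - s : ℝ) : ℂ) * g s := by
      apply intervalIntegral.integral_congr
      intro u hu
      rw [uIcc_of_le ht] at hu
      exact hH u hu.1
    rw [e2, this, ← intervalIntegral.integral_const_mul]
    congr 1; ext s; push_cast; ring
  -- differentiate
  have hHt : ∀ t ∈ Ioo (0:ℝ) 1, H t = c' * t := by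
    intro t ht
    have d1 : HasDerivAt (fun t => 2 * ∫ u in (0:ℝ)..t, H u) (2 * H t) t :=
      (intervalIntegral.integral_hasDerivAt_right (hHc.intervalIntegrable _ _)
        (hHc.stronglyMeasurableAtFilter _ _) hHc.continuousAt).const_mul 2
    have d2 : HasDerivAt (fun t : ℝ => c' * ((t ^ 2 : ℝ) : ℂ)) (c' * ((2 * t : ℝ) : ℂ)) t := by
      have : HasDerivAt (fun t : ℝ => t ^ 2) (2 * t) t := by simpa using hasDerivAt_pow 2 t
      exact (this.ofReal_comp).const_mul c'
    have ev : (fun t => 2 * ∫ u in (0:ℝ)..t, H u) =ᶠ[𝓝 t] fun t : ℝ => c' * ((t ^ 2 : ℝ) : ℂ) := by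
      filter_upwards [isOpen_Ioo.mem_nhds ht] with u hu
      rw [hPH u hu.1.le, hP u hu]
    have := d1.unique (d2.congr_of_eventuallyEq ev)
    push_cast at this
    linear_combination this / 2
  have hGt : ∀ t ∈ Ioo (0:ℝ) 1, G t = c' := by
    intro t ht
    have d2 : HasDerivAt (fun t : ℝ => c' * (t : ℂ)) c' t := by
      simpa using ((hasDerivAt_id t).ofReal_comp).const_mul c'
    have ev : H =ᶠ[𝓝 t] fun t : ℝ => c' * (t : ℂ) := by
      filter_upwards [isOpen_Ioo.mem_nhds ht] with u hu using hHt u hu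
    exact (hHd t).unique (d2.congr_of_eventuallyEq ev)
  have hgd : ∀ᵐ x ∂(volume : Measure ℝ), HasDerivAt G (g x) x := by
    filter_upwards [LocallyIntegrable.ae_hasDerivAt_integral hg.locallyIntegrable] with x hx using hx 0
  filter_upwards [hgd] with x hx hx1
  have ev : G =ᶠ[𝓝 x] fun _ : ℝ => c' := by
    filter_upwards [isOpen_Ioo.mem_nhds hx1] with u hu using hGt u hu
  exact hx.unique ((hasDerivAt_const x c').congr_of_eventuallyEq ev)

theorem fracIntegral_congr {α : ℝ} {g g' : ℝ → ℂ}
    (h : g =ᵐ[volume.restrict (Icc (0 : ℝ) 1)] g') {x : ℝ} (hx : x ∈ Icc (0 : ℝ) 1) :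
    fracIntegral α g x = fracIntegral α g' x := by
  apply intervalIntegral.integral_congr_ae
  filter_upwards [(ae_restrict_iff' measurableSet_Icc).1 h] with s hs hsx
  rw [uIoc_of_le hx.1] at hsx
  rw [hs ⟨hsx.1.le, hsx.2.trans hx.2⟩]

theorem fracIntegral_intervalIntegrable {α : ℝ} (hα : 1 < α) {g : ℝ → ℂ}
    (hg : IntegrableOn g (Icc (0 : ℝ) 1)) {x : ℝ} (hx : x ∈ Icc (0 : ℝ) 1) :
    IntervalIntegrable (fun s => (((x - s) ^ (α - 1) / Real.Gamma α : ℝ) : ℂ) * g s)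
      volume 0 x := by
  have h1 : IntervalIntegrable g volume 0 x := by
    rw [intervalIntegrable_iff_integrableOn_Icc_of_le hx.1]
    exact hg.mono_set (Icc_subset_Icc_right hx.2)
  refine h1.continuousOn_mul (Continuous.continuousOn ?_)
  exact Complex.continuous_ofReal.comp
    (((Real.continuous_rpow_const (by linarith)).comp
      (continuous_const.sub continuous_id)).div_const _)

theorem dirichletAntideriv_congr {α : ℝ} {g g' : ℝ → ℂ}
    (h : g =ᵐ[volume.restrict (Icc (0 : ℝ) 1)] g') {x : ℝ} (hx : x ∈ Icc (0 : ℝ) 1) :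
    dirichletAntideriv α g x = dirichletAntideriv α g' x := by
  unfold dirichletAntideriv
  rw [fracIntegral_congr h hx, fracIntegral_congr h ⟨zero_le_one, le_rfl⟩]

theorem dirichletAntideriv_add {α : ℝ} (hα : 1 < α) {g g' : ℝ → ℂ}
    (hg : IntegrableOn g (Icc (0 : ℝ) 1)) (hg' : IntegrableOn g' (Icc (0 : ℝ) 1))
    {x : ℝ} (hx : x ∈ Icc (0 : ℝ) 1) :
    dirichletAntideriv α (g + g') x = dirichletAntideriv α g x + dirichletAntideriv α g' x := by
  have key : ∀ y ∈ Icc (0 : ℝ) 1,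
      fracIntegral α (g + g') y = fracIntegral α g y + fracIntegral α g' y := by
    intro y hy
    unfold fracIntegral
    rw [← intervalIntegral.integral_add (fracIntegral_intervalIntegrable hα hg hy)
      (fracIntegral_intervalIntegrable hα hg' hy)]
    simp only [Pi.add_apply, mul_add]
  unfold dirichletAntideriv
  rw [key x hx, key 1 ⟨zero_le_one, le_rfl⟩]
  ring

theorem dirichletAntideriv_smul (α : ℝ) (c : ℂ) (g : ℝ → ℂ) (x : ℝ) :
    dirichletAntideriv α (c • g) x = c * dirichletAntideriv α g x := by
  have key : ∀ y, fracIntegral α (c • g) y = c * fracIntegral α g y := by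
    intro y
    unfold fracIntegral
    rw [← intervalIntegral.integral_const_mul]
    congr 1; ext s
    simp only [Pi.smul_apply, smul_eq_mul]
    ring
  unfold dirichletAntideriv
  rw [key, key]
  ring

theorem dirichletAntideriv_unique {α : ℝ} (h1 : 1 < α) (h2 : α ≤ 2) {g : ℝ → ℂ}
    (hg : IntegrableOn g (Icc (0 : ℝ) 1))
    (h : dirichletAntideriv α g =ᵐ[volume.restrict (Icc (0 : ℝ) 1)] 0) :
    g =ᵐ[volume.restrict (Icc (0 : ℝ) 1)] 0 := by
  have hgi : g =ᵐ[volume.restrict (Icc (0 : ℝ) 1)] (Icc (0 : ℝ) 1).indicator g :=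
    (indicator_ae_eq_restrict measurableSet_Icc).symm
  have := fracIntegral_unique α h1 h2 ((Icc (0 : ℝ) 1).indicator g)
    ((integrable_indicator_iff measurableSet_Icc).2 hg) (fracIntegral α g 1) (by
      filter_upwards [(ae_restrict_iff' measurableSet_Icc).1 h] with x hx hx1
      have hxI : x ∈ Icc (0 : ℝ) 1 := Ioo_subset_Icc_self hx1
      rw [← fracIntegral_congr hgi hxI]
      exact sub_eq_zero.1 (hx hxI))
  rw [← Measure.restrict_congr_set (Ioo_ae_eq_Icc (a := (0 : ℝ)) (b := 1))]
  rw [EventuallyEq, ae_restrict_iff' measurableSet_Ioo]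
  filter_upwards [this] with x hx hx1
  rw [← indicator_of_mem (Ioo_subset_Icc_self hx1) g]
  exact hx hx1

/-- The Banach space `C₀(0,1)` of continuous complex functions on `(0,1)` vanishing at both ends. -/
abbrev C0Unit : Type := C₀(Ioo (0 : ℝ) 1, ℂ)

/-- The Banach space `L¹[0,1]` of (classes of) integrable complex functions. -/
abbrev L1Unit : Type := Lp ℂ 1 (volume.restrict (Icc (0 : ℝ) 1))

/-- Extension of a function in `C₀(0,1)` to the real line by zero. -/
def C0Unit.zeroExtend (g : C0Unit) : ℝ → ℂ :=
  Function.extend Subtype.val g 0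

theorem C0Unit.zeroExtend_coe (g : C0Unit) (x : Ioo (0 : ℝ) 1) : g.zeroExtend x = g x :=
  Subtype.val_injective.extend_apply _ _ _

theorem C0Unit.zeroExtend_of_notMem (g : C0Unit) {x : ℝ} (hx : x ∉ Ioo (0 : ℝ) 1) :
    g.zeroExtend x = 0 :=
  Function.extend_apply' _ _ _ (fun ⟨y, hy⟩ => hx (hy ▸ y.2))

theorem C0Unit.zeroExtend_add (g g' : C0Unit) :
    (g + g').zeroExtend = g.zeroExtend + g'.zeroExtend := by
  ext x
  by_cases hx : x ∈ Ioo (0 : ℝ) 1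
  · simpa using (g + g').zeroExtend_coe ⟨x, hx⟩ |>.trans
      (congrArg₂ (· + ·) (g.zeroExtend_coe ⟨x, hx⟩) (g'.zeroExtend_coe ⟨x, hx⟩)).symm
  · simp [zeroExtend_of_notMem _ hx]

theorem C0Unit.zeroExtend_smul (c : ℂ) (g : C0Unit) :
    (c • g).zeroExtend = c • g.zeroExtend := by
  ext x
  by_cases hx : x ∈ Ioo (0 : ℝ) 1
  · simpa using (c • g).zeroExtend_coe ⟨x, hx⟩ |>.trans
      (congrArg (c * ·) (g.zeroExtend_coe ⟨x, hx⟩)).symm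
  · simp [zeroExtend_of_notMem _ hx]

theorem C0Unit.continuousOn_zeroExtend (g : C0Unit) :
    ContinuousOn g.zeroExtend (Ioo (0 : ℝ) 1) := by
  rw [continuousOn_iff_continuous_domRestrict]
  have : (Ioo (0 : ℝ) 1).domRestrict g.zeroExtend = g := by
    ext x; exact g.zeroExtend_coe x
  rw [this]
  exact map_continuous g

theorem C0Unit.integrableOn_zeroExtend (g : C0Unit) :
    IntegrableOn g.zeroExtend (Icc (0 : ℝ) 1) := by
  rw [integrableOn_Icc_iff_integrableOn_Ioo]
  refine IntegrableOn.of_bound (by simp) ?_ ‖g‖ ?_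
  · exact g.continuousOn_zeroExtend.aestronglyMeasurable measurableSet_Ioo
  · refine (ae_restrict_iff' measurableSet_Ioo).2 (Eventually.of_forall fun x hx => ?_)
    have := g.zeroExtend_coe ⟨x, hx⟩
    simp only at this
    rw [this]
    exact g.toBCF.norm_coe_le_norm ⟨x, hx⟩

/-- The graph `{(f, g) : f = I^α g - I^α g (1) x^(α - 1)}` in `C₀(0,1)`. -/
def fracDirichletGraphC0 (α : ℝ) (hα : 1 < α) : Submodule ℂ (C0Unit × C0Unit) where
  carrier := {p | ∀ x : Ioo (0 : ℝ) 1, p.1 x = dirichletAntideriv α p.2.zeroExtend x}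
  zero_mem' := by
    intro x
    have : (0 : C0Unit).zeroExtend = (0 : ℂ) • (0 : C0Unit).zeroExtend := by
      rw [← C0Unit.zeroExtend_smul, zero_smul]
    simp only [Prod.fst_zero, Prod.snd_zero]
    rw [this, dirichletAntideriv_smul]
    simp
  add_mem' := by
    intro p q hp hq x
    simp only [Prod.fst_add, Prod.snd_add]
    rw [C0Unit.zeroExtend_add, dirichletAntideriv_add hα p.2.integrableOn_zeroExtend
      q.2.integrableOn_zeroExtend (Ioo_subset_Icc_self x.2), ← hp x, ← hq x]
    rfl
  smul_mem' := by
    intro c p hp x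
    simp only [Prod.smul_fst, Prod.smul_snd]
    rw [C0Unit.zeroExtend_smul, dirichletAntideriv_smul, ← hp x]
    rfl

/-- The graph `{(f, g) : f = I^α g - I^α g (1) x^(α - 1)}` in `L¹[0,1]`. -/
def fracDirichletGraphL1 (α : ℝ) (hα : 1 < α) : Submodule ℂ (L1Unit × L1Unit) where
  carrier := {p | p.1 =ᵐ[volume.restrict (Icc (0 : ℝ) 1)] dirichletAntideriv α p.2}
  zero_mem' := by
    have h0 := Lp.coeFn_zero ℂ 1 (volume.restrict (Icc (0 : ℝ) 1))
    filter_upwards [h0, ae_restrict_mem measurableSet_Icc] with x hx hxI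
    simp only [Prod.fst_zero, Prod.snd_zero]
    rw [hx, dirichletAntideriv_congr h0 hxI, ← zero_smul ℂ (0 : ℝ → ℂ), dirichletAntideriv_smul]
    simp
  add_mem' := by
    intro p q hp hq
    filter_upwards [hp, hq, Lp.coeFn_add p.1 q.1, ae_restrict_mem measurableSet_Icc]
      with x h1 h2 h3 hxI
    simp only [Prod.fst_add, Prod.snd_add]
    rw [h3, dirichletAntideriv_congr (Lp.coeFn_add p.2 q.2) hxI, dirichletAntideriv_add hα
      (L1.integrable_coeFn p.2) (L1.integrable_coeFn q.2) hxI, ← h1, ← h2]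
    rfl
  smul_mem' := by
    intro c p hp
    filter_upwards [hp, Lp.coeFn_smul c p.1, ae_restrict_mem measurableSet_Icc] with x h1 h3 hxI
    simp only [Prod.smul_fst, Prod.smul_snd]
    rw [h3, dirichletAntideriv_congr (Lp.coeFn_smul c p.2) hxI, dirichletAntideriv_smul, ← h1]
    rfl

/-- The fractional derivative operator `A^α` of order `α` on `C₀(0,1)` with Dirichlet boundary
conditions: `D(A^α) = {f : f = I^α g - I^α g (1) x^(α - 1), g ∈ C₀(0,1)}` and `A^α f = g`. -/
def fracDirichletC0 (α : ℝ) (hα : 1 < α) : C0Unit →ₗ.[ℂ] C0Unit :=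
  (fracDirichletGraphC0 α hα).toLinearPMap

/-- The fractional derivative operator `A^α` of order `α` on `L¹[0,1]` with Dirichlet boundary
conditions: `D(A^α) = {f : f = I^α g - I^α g (1) x^(α - 1), g ∈ L¹[0,1]}` and `A^α f = g`. -/
def fracDirichletL1 (α : ℝ) (hα : 1 < α) : L1Unit →ₗ.[ℂ] L1Unit :=
  (fracDirichletGraphL1 α hα).toLinearPMap

/-- `g` is determined by `f`, so that `fracDirichletC0` has the intended graph. -/
theorem fracDirichletC0_graph (α : ℝ) (h1 : 1 < α) (h2 : α ≤ 2) :
    (fracDirichletC0 α h1).graph = fracDirichletGraphC0 α h1 := by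
  refine Submodule.toLinearPMap_graph_eq _ ?_
  rintro ⟨f, g⟩ hfg rfl
  have h0 : g.zeroExtend =ᵐ[volume.restrict (Icc (0 : ℝ) 1)] 0 := by
    refine dirichletAntideriv_unique h1 h2 g.integrableOn_zeroExtend ?_
    rw [← Measure.restrict_congr_set (Ioo_ae_eq_Icc (a := (0 : ℝ)) (b := 1))]
    filter_upwards [ae_restrict_mem measurableSet_Ioo] with x hx
    exact (hfg ⟨x, hx⟩).symm
  rw [← Measure.restrict_congr_set (Ioo_ae_eq_Icc (a := (0 : ℝ)) (b := 1))] at h0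
  have := Measure.eqOn_open_of_ae_eq h0 isOpen_Ioo
    g.continuousOn_zeroExtend continuousOn_const
  ext x
  rw [← g.zeroExtend_coe x]
  exact this x.2

/-- `g` is determined by `f`, so that `fracDirichletL1` has the intended graph. -/
theorem fracDirichletL1_graph (α : ℝ) (h1 : 1 < α) (h2 : α ≤ 2) :
    (fracDirichletL1 α h1).graph = fracDirichletGraphL1 α h1 := by
  refine Submodule.toLinearPMap_graph_eq _ ?_
  rintro ⟨f, g⟩ hfg rfl
  refine Lp.ext ((dirichletAntideriv_unique h1 h2 (L1.integrable_coeFn g) ?_).trans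
    (Lp.coeFn_zero ℂ 1 _).symm)
  exact EventuallyEq.trans (EventuallyEq.symm hfg) (Lp.coeFn_zero ℂ 1 _)

section Semigroups

/-- `R` is the resolvent `R(z, A) = (z - A)⁻¹` of the operator `A` at the point `z` (in particular
`z` belongs to the resolvent set of `A`). -/
def IsResolventAt {X : Type*} [NormedAddCommGroup X] [NormedSpace ℂ X]
    (A : X →ₗ.[ℂ] X) (z : ℂ) (R : X →L[ℂ] X) : Prop :=
  (∀ g : X, ∃ h : R g ∈ A.domain, z • R g - A ⟨R g, h⟩ = g) ∧
    ∀ f : A.domain, R (z • (f : X) - A f) = f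

/-- A strongly continuous semigroup of bounded linear operators on `X`. -/
structure C0Semigroup (X : Type*) [NormedAddCommGroup X] [NormedSpace ℂ X] where
  toFun : NNReal → X →L[ℂ] X
  map_zero : toFun 0 = ContinuousLinearMap.id ℂ X
  map_add : ∀ s t : NNReal, toFun (s + t) = (toFun s).comp (toFun t)
  tendsto_zero : ∀ x : X, Tendsto (fun t => toFun t x) (𝓝[>] 0) (𝓝 x)

/-- `A` is the infinitesimal generator of `S`: `f ∈ D(A)` and `A f = g` if and only if
`(S(t) f - f) / t → g` as `t ↓ 0`. -/
def C0Semigroup.HasGenerator {X : Type*} [NormedAddCommGroup X] [NormedSpace ℂ X]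
    (S : C0Semigroup X) (A : X →ₗ.[ℂ] X) : Prop :=
  ∀ f g : X, (f, g) ∈ A.graph ↔
    Tendsto (fun t : NNReal => ((t : ℝ) : ℂ)⁻¹ • (S.toFun t f - f)) (𝓝[>] 0) (𝓝 g)

/-- The open sector `{z ≠ 0 : |arg z| < δ}`. -/
def openSector (δ : ℝ) : Set ℂ :=
  {z | z ≠ 0 ∧ |z.arg| < δ}

/-- `S` is an analytic semigroup: for some `δ ∈ (0, π/2]` it extends to a holomorphic family
`T(z)` of bounded operators on the sector of half-angle `δ`, with the semigroup law there, and with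
`T(z) x → x` as `z → 0` inside every smaller sector. -/
def C0Semigroup.IsAnalytic {X : Type*} [NormedAddCommGroup X] [NormedSpace ℂ X]
    (S : C0Semigroup X) : Prop :=
  ∃ δ : ℝ, 0 < δ ∧ δ ≤ Real.pi / 2 ∧ ∃ T : ℂ → X →L[ℂ] X,
    (∀ t : NNReal, 0 < t → T ((t : ℝ) : ℂ) = S.toFun t) ∧
    (∀ z ∈ openSector δ, ∀ w ∈ openSector δ, T (z + w) = (T z).comp (T w)) ∧
    DifferentiableOn ℂ T (openSector δ) ∧
    ∀ δ' : ℝ, 0 < δ' → δ' < δ → ∀ x : X,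
      Tendsto (fun z => T z x) (𝓝[openSector δ'] 0) (𝓝 x)

end Semigroups

end

/-! Write u_l(x) = x^(α-1) E_{α,α}(l x^α) (`mlSol`). Solving l f - A f = g by the Volterra equation
u_l - u_0 = l u_0 * u_l and fitting the value at 1 gives, whenever u_l(1) ≠ 0, a resolvent with the
explicit continuous kernel u_l(x) u_l(1-s)/u_l(1) - u_l(x-s) (`resKernel`). For l = 0 this kernel is
that of -A⁻¹, so inverting l - A is the resolvent identity between the parameters l and 0
(`kernelInt_resKernel_comp`).

u_l(1) ≠ 0 for Re l ≥ 0 (`mlSol_one_ne_zero`) is an energy argument. With w = u_l' and P = I^(2-α) w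
one has P' = l u_l. If u_l(1) = 0, integration by parts gives ∫ P conj(w) = -l ∫ |u_l|², with real
part ≤ 0. But the kernel of I^(2-α) is a positive superposition of exponentials e^(-tx), hence of
positive type, so the real part is also ≥ 0. This forces w = 0 and contradicts P(0+) = 1. For α = 2
simply P = w.

The bound M/|l| is Schur's test on the kernel. The reflection (x,s) ↦ (1-s,1-x) preserves the
kernel, so one bound on ∫ |k(x,s)| ds serves C₀(0,1) and L¹[0,1] at once. Bounded l are handled by
compactness and the nonvanishing. For large l, scaling reduces to |l| = 1 on a long interval [0,t]
with t^α = |l|. There l = e^(iαψ) with |ψ| ≤ π/(2α), and u_l(y) is a multiple of exp(e^(iψ) y) up to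
O(1/(1+y²)) (`exists_mlSol_asymptotics`). The leading exponentials cancel in the kernel and leave
bumps of width 1 (`norm_green_le`); undoing the scaling produces t^(1-α) t⁻¹ = 1/|l|.

The asymptotics come from Laplace transforms: that of u_l is 1/(s^α - l). The remainder is defined
outright as a difference of two integrals along the rays arg z = ±5π/8, its transform is computed by
residues in the coordinate log z (`laplace_mlRem`), and uniqueness of the Laplace transform
identifies the two sides.

Generation is general theory (`exists_analytic_semigroup`). A Neumann series carries the estimate
into a sector wider than the half plane, and the Dunford integral of e^(λz) R(λ) over a hyperbola
scaled by 1/z is a bounded holomorphic family T(z) with T' = AT = TA on the domain and T(z) → 1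
strongly. A derivative argument yields the semigroup law and the uniqueness. The normalising
constant of the integral is only shown to be nonzero, not evaluated.

Density of the domain: A⁻¹ sends monomials to multiples of x^(α-1)(x^(m+1) - 1). Weierstrass
approximation then gives x^(α-1) h(x) with h(1) = 0, and these functions approximate everything in
C₀(0,1); the image of that domain is dense in L¹. -/

noncomputable section

/-! ### Algebra and perturbation of resolvents. -/

section Resolvent

variable {X : Type*} [NormedAddCommGroup X] [NormedSpace ℂ X] {A : X →ₗ.[ℂ] X}
  {z w : ℂ} {R S : X →L[ℂ] X}

namespace IsResolventAt

/-- Turns questions about the domain of the unbounded operator into an equation for a bounded one;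
all later domain arguments go through this form. -/
theorem mem_graph_iff (h : IsResolventAt A z R) {f g : X} :
    (f, g) ∈ A.graph ↔ R (z • f - g) = f := by
  rw [LinearPMap.mem_graph_iff]
  constructor
  · rintro ⟨y, hy, hy'⟩
    simp only at hy hy'
    rw [← hy, ← hy']
    exact h.2 y
  · intro hf
    obtain ⟨hd, e⟩ := h.1 (z • f - g)
    refine ⟨⟨_, hd⟩, hf, ?_⟩
    simp only [hf] at e ⊢
    simpa using e

theorem of_graph (h1 : ∀ g, (R g, z • R g - g) ∈ A.graph)
    (h2 : ∀ f g, (f, g) ∈ A.graph → R (z • f - g) = f) : IsResolventAt A z R := by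
  refine ⟨fun g => ?_, fun f => h2 _ _ (A.mem_graph f)⟩
  obtain ⟨y, hy, hy'⟩ := (LinearPMap.mem_graph_iff A).1 (h1 g)
  simp only at hy hy'
  refine ⟨hy ▸ y.2, ?_⟩
  have : (⟨R g, hy ▸ y.2⟩ : A.domain) = y := Subtype.ext hy.symm
  rw [this, hy']
  simp

theorem mem_graph (h : IsResolventAt A z R) (g : X) : (R g, z • R g - g) ∈ A.graph := by
  rw [h.mem_graph_iff]; simp

/-- The resolvent identity. -/
theorem identity (hR : IsResolventAt A z R) (hS : IsResolventAt A w S) :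
    R = S + (w - z) • (R * S) := by
  ext g
  have h := hR.mem_graph_iff.1 (hS.mem_graph g)
  have e : z • S g - (w • S g - g) = g - (w - z) • S g := by module
  rw [e, map_sub, map_smul, sub_eq_iff_eq_add] at h
  simpa using h

theorem unique (hR : IsResolventAt A z R) (hS : IsResolventAt A z S) : R = S := by
  simpa using hR.identity hS

/-- The resolvent identity read in both orders gives (w - z) R S = R - S = (w - z) S R. -/
theorem commute (hR : IsResolventAt A z R) (hS : IsResolventAt A w S) : R * S = S * R := by
  rcases eq_or_ne z w with rfl | hzw
  · rw [hR.unique hS]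
  have h1 := hR.identity hS
  have h2 := hS.identity hR
  have h3 : (w - z) • (R * S - S * R) = 0 := by
    have : (w - z) • (R * S) = R - S := eq_sub_of_add_eq' h1.symm
    have h' : (z - w) • (S * R) = S - R := eq_sub_of_add_eq' h2.symm
    rw [smul_sub, this, ← neg_sub z w, neg_smul, h']; abel
  rcases smul_eq_zero.1 h3 with h | h
  · exact absurd (sub_eq_zero.1 h).symm hzw
  · exact sub_eq_zero.1 h

/-- Neumann series: w - A = V (z - A) with V = 1 + (w - z) R, and the perturbation has norm at most
1/2, so V is invertible and R V⁻¹ inverts w - A. -/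
theorem exists_near [CompleteSpace X] (h : IsResolventAt A z R) (hw : ‖w - z‖ * ‖R‖ ≤ 1 / 2) :
    ∃ S : X →L[ℂ] X, IsResolventAt A w S ∧ ‖S‖ ≤ 2 * ‖R‖ := by
  have hB : ‖-((w - z) • R)‖ ≤ 1 / 2 := by rwa [norm_neg, norm_smul]
  obtain ⟨V, hV⟩ := isUnit_one_sub_of_norm_lt_one (hB.trans_lt (by norm_num))
  have hV1 : (V : X →L[ℂ] X) = 1 + (w - z) • R := by rw [hV, sub_neg_eq_add]
  have hc : R * ↑V⁻¹ = ↑V⁻¹ * R := by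
    have : Commute R (V : X →L[ℂ] X) := by
      rw [hV1]; exact (Commute.one_right R).add_right ((Commute.refl R).smul_right _)
    exact this.units_inv_right
  -- For v = V⁻¹ g one has v = g - (w - z) R v, hence ‖v‖ ≤ ‖g‖ + ‖v‖/2.
  have hVn : ‖(↑V⁻¹ : X →L[ℂ] X)‖ ≤ 2 := by
    refine ContinuousLinearMap.opNorm_le_bound _ (by norm_num) fun g => ?_
    have e : (V : X →L[ℂ] X) ((↑V⁻¹ : X →L[ℂ] X) g) = g := by
      rw [← mul_apply_eq_comp, V.mul_inv]; rfl
    set v := (↑V⁻¹ : X →L[ℂ] X) g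
    have e2 : v = g + (-((w - z) • R)) v := by
      rw [hV1] at e
      simp at e ⊢
      rw [← e]; simp
    have := norm_add_le g ((-((w - z) • R)) v)
    rw [← e2] at this
    have h3 := ContinuousLinearMap.le_of_opNorm_le _ hB v
    linarith
  refine ⟨R * ↑V⁻¹, of_graph (fun g => ?_) (fun f g hfg => ?_), ?_⟩
  · have e : (V : X →L[ℂ] X) ((↑V⁻¹ : X →L[ℂ] X) g) = g := by
      rw [← mul_apply_eq_comp, V.mul_inv]; rfl
    have h1 := h.mem_graph ((↑V⁻¹ : X →L[ℂ] X) g)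
    rw [mul_apply_eq_comp]
    generalize (↑V⁻¹ : X →L[ℂ] X) g = v at e h1 ⊢
    have e' : v + (w - z) • R v = g := by rw [← e, hV1]; simp
    have : w • R v - g = z • R v - v := by rw [← e']; module
    rwa [this]
  · have h1 := h.mem_graph_iff.1 hfg
    have e : R (w • f - g) = (V : X →L[ℂ] X) f := by
      rw [hV1]
      have : w • f - g = (z • f - g) + (w - z) • f := by module
      rw [this, map_add, h1]; simp
    rw [hc, mul_apply_eq_comp, e, ← mul_apply_eq_comp, V.inv_mul]; rfl
  · refine (norm_mul_le _ _).trans ?_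
    nlinarith [norm_nonneg R]

end IsResolventAt

/-- The cone-like region `{z ≠ 0 : Re z > -ε |z|}`, a sector of half-angle more than `π/2`. -/
def wideSector (ε : ℝ) : Set ℂ := {z | z ≠ 0 ∧ -(ε * ‖z‖) < z.re}

theorem isOpen_wideSector (ε : ℝ) : IsOpen (wideSector ε) :=
  (isOpen_ne).inter (isOpen_lt (by fun_prop : Continuous fun z : ℂ => -(ε * ‖z‖)) Complex.continuous_re)

/-- A point z of the sector with Re z < 0 lies within ε‖z‖ of the point i Im z, where the bound
M/|·| is available, so the Neumann series applies. In 4M one factor 2 comes from that series and one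
from |Im z| ≥ (1 - ε)‖z‖ ≥ ‖z‖/2. -/
theorem exists_resolvent_wideSector [CompleteSpace X] {M : ℝ} (hM : 0 < M)
    (hres : ∀ z : ℂ, 0 ≤ z.re → ∃ R : X →L[ℂ] X, IsResolventAt A z R ∧ (z ≠ 0 → ‖R‖ ≤ M / ‖z‖)) :
    ∃ ε : ℝ, 0 < ε ∧ ε < 1 / 2 ∧ ∃ Rf : ℂ → X →L[ℂ] X, ∀ z ∈ wideSector ε,
      IsResolventAt A z (Rf z) ∧ ‖Rf z‖ ≤ 4 * M / ‖z‖ := by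
  -- The perturbation step needs ε M/(1 - ε) ≤ 1/2, that is 2εM + ε ≤ 1; this choice gives 2εM + 2ε
  -- = 1.
  set ε : ℝ := 1 / (2 * M + 2) with hε
  have hε0 : 0 < ε := by positivity
  have hε1 : ε < 1 / 2 := by
    rw [hε]; exact one_div_lt_one_div_of_lt (by norm_num) (by linarith)
  have hεM : ε * M * 2 + 2 * ε = 1 := by rw [hε]; field_simp
  refine ⟨ε, hε0, hε1, ?_⟩
  have key : ∀ z : ℂ, ∃ R : X →L[ℂ] X, z ∈ wideSector ε → 
      IsResolventAt A z R ∧ ‖R‖ ≤ 4 * M / ‖z‖ := by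
    intro z
    by_cases hz : z ∈ wideSector ε
    swap
    · exact ⟨0, fun h => absurd h hz⟩
    obtain ⟨hz0, hzr⟩ := hz
    have hzp : 0 < ‖z‖ := norm_pos_iff.2 hz0
    rcases le_total 0 z.re with h | h
    · obtain ⟨R, hR, hb⟩ := hres z h
      refine ⟨R, fun _ => ⟨hR, (hb hz0).trans ?_⟩⟩
      gcongr; linarith
    · set z0 : ℂ := z.im * Complex.I with hz0d
      have hd : ‖z - z0‖ ≤ ε * ‖z‖ := by
        have : z - z0 = (z.re : ℂ) := by
          apply Complex.ext <;> simp [hz0d]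
        rw [this, Complex.norm_real, Real.norm_eq_abs, abs_of_nonpos h]; linarith
      have hn : (1 - ε) * ‖z‖ ≤ ‖z0‖ := by
        have := norm_sub_norm_le z z0
        linarith
      have hn0 : 0 < ‖z0‖ := lt_of_lt_of_le (mul_pos (by linarith) hzp) hn
      obtain ⟨R, hR, hb⟩ := hres z0 (by simp [hz0d])
      have hb := hb (norm_pos_iff.1 hn0)
      have hb2 : ‖R‖ ≤ 2 * M / ‖z‖ := by
        refine hb.trans ?_
        rw [div_le_div_iff₀ hn0 hzp]
        nlinarith [mul_pos hM hzp]
      have hb3 : ‖R‖ * ‖z‖ ≤ M / (1 - ε) := by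
        rw [le_div_iff₀ (by linarith)]
        rw [le_div_iff₀ hn0] at hb
        nlinarith [mul_le_mul_of_nonneg_left hn (norm_nonneg R)]
      obtain ⟨S, hS, hSb⟩ := hR.exists_near (w := z) (by
        have h1 : ‖z - z0‖ * ‖R‖ ≤ ε * (‖R‖ * ‖z‖) := by
          nlinarith [mul_le_mul_of_nonneg_right hd (norm_nonneg R)]
        refine h1.trans ((mul_le_mul_of_nonneg_left hb3 hε0.le).trans ?_)
        rw [mul_div_assoc', div_le_iff₀ (by linarith)]
        linarith)
      refine ⟨S, fun _ => ⟨hS, hSb.trans ?_⟩⟩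
      calc 2 * ‖R‖ ≤ 2 * (2 * M / ‖z‖) := by linarith
        _ = 4 * M / ‖z‖ := by ring
  choose Rf hRf using key
  exact ⟨Rf, fun z hz => hRf z hz⟩

/-- Local boundedness and the resolvent identity give continuity; the same identity then shows that
the difference quotient is exactly -R(w) R(z). -/
theorem hasDerivAt_resolvent {U : Set ℂ} (hU : IsOpen U) {Rf : ℂ → X →L[ℂ] X}
    (hRf : ∀ z ∈ U, IsResolventAt A z (Rf z)) {C : ℝ} (hz : z ∈ U)
    (hC : ∀ᶠ w in 𝓝 z, ‖Rf w‖ ≤ C) : HasDerivAt Rf (-(Rf z * Rf z)) z := by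
  have hcont : Tendsto Rf (𝓝 z) (𝓝 (Rf z)) := by
    rw [tendsto_iff_norm_sub_tendsto_zero]
    refine squeeze_zero' (Eventually.of_forall fun _ => norm_nonneg _)
      (g := fun w => ‖w - z‖ * (C * ‖Rf z‖)) ?_ ?_
    · filter_upwards [hC, hU.mem_nhds hz] with w hw hwU
      rw [(hRf w hwU).identity (hRf z hz), add_sub_cancel_left, norm_smul, norm_sub_rev]
      gcongr
      exact (norm_mul_le _ _).trans (by gcongr)
    · have : Tendsto (fun w => ‖w - z‖ * (C * ‖Rf z‖)) (𝓝 z) (𝓝 (‖z - z‖ * (C * ‖Rf z‖))) :=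
        Continuous.tendsto (by fun_prop) z
      simpa using this
  rw [hasDerivAt_iff_tendsto_slope]
  have h2 : Tendsto (fun w => -(Rf w * Rf z)) (𝓝[≠] z) (𝓝 (-(Rf z * Rf z))) :=
    ((hcont.mono_left nhdsWithin_le_nhds).mul_const _).neg
  refine h2.congr' ?_
  filter_upwards [self_mem_nhdsWithin, nhdsWithin_le_nhds (hU.mem_nhds hz)] with w hw hwU
  rw [slope_def_module]
  have : Rf w - Rf z = (z - w) • (Rf w * Rf z) := by
    rw [sub_eq_iff_eq_add']; exact (hRf w hwU).identity (hRf z hz)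
  rw [this, smul_smul, ← neg_sub w z, mul_neg, inv_mul_cancel₀ (sub_ne_zero.2 hw), neg_smul, one_smul]

end Resolvent

/-! ### Laplace transform: inversion, uniqueness, powers. -/

section Laplace

open scoped FourierTransform
open Complex (I)

/-- Inversion of the Laplace transform along a vertical line. -/
theorem laplace_inversion {f : ℝ → ℂ} {σ x : ℝ} (hx : 0 < x) (hfx : ContinuousAt f x)
    (hf : IntegrableOn (fun y : ℝ => Complex.exp (-(σ * y)) * f y) (Ioi 0))
    (hF : Integrable fun ξ : ℝ => ∫ y in Ioi (0 : ℝ), Complex.exp (-((σ + ξ * I) * y)) * f y) :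
    Complex.exp (-(σ * x)) * f x = (2 * Real.pi : ℝ)⁻¹ *
      ∫ ξ : ℝ, Complex.exp (ξ * I * x) *
        ∫ y in Ioi (0 : ℝ), Complex.exp (-((σ + ξ * I) * y)) * f y := by
  set F : ℝ → ℂ := fun ξ => ∫ y in Ioi (0 : ℝ), Complex.exp (-((σ + ξ * I) * y)) * f y with hFd
  -- On the line Re s = σ the Laplace transform is, after the frequency change ξ = 2πw, the Fourier
  -- transform of e^(-σy) f(y) cut off to y > 0; Fourier inversion at the continuity point x
  -- finishes.
  set h : ℝ → ℂ := (Ioi (0 : ℝ)).indicator fun y => Complex.exp (-(σ * y)) * f y with hh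
  have hpi : (2 * Real.pi) ≠ 0 := by positivity
  have hhi : Integrable h := (integrable_indicator_iff measurableSet_Ioi).2 hf
  have hFh : 𝓕 h = fun w => F (2 * Real.pi * w) := by
    ext w
    rw [Real.fourier_real_eq_integral_exp_smul, hFd]
    simp only
    rw [← integral_indicator measurableSet_Ioi]
    congr 1; ext v
    by_cases hv : v ∈ Ioi (0 : ℝ)
    · rw [hh, indicator_of_mem hv, indicator_of_mem hv, smul_eq_mul, ← mul_assoc, ← Complex.exp_add]
      congr 2; push_cast; ring
    · rw [hh, indicator_of_notMem hv, indicator_of_notMem hv, smul_zero]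
  have hhx : ContinuousAt h x := by
    have : ContinuousAt (fun y : ℝ => Complex.exp (-(σ * y)) * f y) x :=
      ContinuousAt.mul (by fun_prop) hfx
    refine this.congr ?_
    filter_upwards [isOpen_Ioi.mem_nhds hx] with y hy
    rw [hh, indicator_of_mem hy]
  have key := hhi.fourierInv_fourier_eq (by rw [hFh]; exact hF.comp_mul_left' hpi) hhx
  rw [hFh, Real.fourierInv_eq', hh, indicator_of_mem (show x ∈ Ioi 0 from hx)] at key
  rw [← key]
  have e := Measure.integral_comp_mul_left (fun ξ : ℝ => Complex.exp (ξ * I * x) * F ξ) (2 * Real.pi)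
  rw [abs_of_pos (by positivity)] at e
  rw [← Complex.real_smul, ← e]
  congr 1; ext v
  rw [smul_eq_mul]
  congr 2
  simp
  ring

theorem laplace_injective {f : ℝ → ℂ} {σ : ℝ} (hfc : ContinuousOn f (Ioi 0))
    (hf : IntegrableOn (fun y : ℝ => Complex.exp (-(σ * y)) * f y) (Ioi 0))
    (h0 : ∀ ξ : ℝ, ∫ y in Ioi (0 : ℝ), Complex.exp (-((σ + ξ * I) * y)) * f y = 0)
    {x : ℝ} (hx : 0 < x) : f x = 0 := by
  have := laplace_inversion hx (hfc.continuousAt (isOpen_Ioi.mem_nhds hx)) hf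
    (by simp_rw [h0]; exact integrable_zero _ _ _)
  simp_rw [h0] at this
  simpa [Complex.exp_ne_zero] using this

theorem integrableOn_rpow_mul_exp {a σ : ℝ} (ha : 0 < a) (hσ : 0 < σ) :
    IntegrableOn (fun x : ℝ => x ^ (a - 1) * Real.exp (-(σ * x))) (Ioi 0) := by
  have := Real.GammaIntegral_convergent ha
  rw [← mul_zero σ, ← integrableOn_Ioi_comp_mul_left_iff _ _ hσ] at this
  have h2 := this.const_mul ((σ ^ (a - 1))⁻¹)
  refine IntegrableOn.congr_fun h2 (fun x hx => ?_) (by simp)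
  have hx : 0 < x := hx
  rw [Real.mul_rpow hσ.le hx.le]
  have := (Real.rpow_pos_of_pos hσ (a - 1)).ne'
  field_simp

/-- The Laplace transform of a power, at a complex point of the right half plane. -/
theorem integral_rpow_mul_cexp {a : ℝ} (ha : 0 < a) {s : ℂ} (hs : 0 < s.re) :
    ∫ x in Ioi (0 : ℝ), Complex.exp (-(s * x)) * ((x ^ (a - 1) : ℝ) : ℂ)
      = Real.Gamma a * s ^ (-a : ℂ) := by
  set U : Set ℂ := {z | 0 < z.re} with hU
  have hUo : IsOpen U := isOpen_lt continuous_const Complex.continuous_re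
  set G : ℂ → ℂ := fun s => ∫ x in Ioi (0 : ℝ), Complex.exp (-(s * x)) * ((x ^ (a - 1) : ℝ) : ℂ)
    with hG
  have hmeas : ∀ b : ℝ, ∀ s : ℂ, AEStronglyMeasurable (fun x : ℝ => Complex.exp (-(s * x)) *
      ((x ^ b : ℝ) : ℂ)) (volume.restrict (Ioi 0)) := by
    intro b s
    refine ContinuousOn.aestronglyMeasurable ?_ measurableSet_Ioi
    refine ContinuousOn.mul (by fun_prop) ?_
    refine Complex.continuous_ofReal.comp_continuousOn fun x hx => ?_
    exact (Real.continuousAt_rpow_const _ _ (Or.inl (ne_of_gt hx))).continuousWithinAt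
  have hGd : DifferentiableOn ℂ G U := by
    intro z hz
    have hzr : 0 < z.re := hz
    refine DifferentiableAt.differentiableWithinAt ?_
    have hnb : {w : ℂ | z.re / 2 < w.re} ∈ 𝓝 z :=
      (isOpen_lt continuous_const Complex.continuous_re).mem_nhds (by simp; linarith)
    have := hasDerivAt_integral_of_dominated_loc_of_deriv_le (𝕜 := ℂ) (μ := volume.restrict (Ioi 0))
      (F := fun s (x : ℝ) => Complex.exp (-(s * x)) * ((x ^ (a - 1) : ℝ) : ℂ))
      (F' := fun s (x : ℝ) => (-x * Complex.exp (-(s * x))) * ((x ^ (a - 1) : ℝ) : ℂ))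
      (bound := fun x => x ^ ((a + 1) - 1) * Real.exp (-(z.re / 2 * x)))
      hnb (Eventually.of_forall fun s => hmeas _ s) ?_ ?_ ?_
      (integrableOn_rpow_mul_exp (by linarith) (by linarith)) ?_
    · exact this.2.differentiableAt
    · refine (integrableOn_rpow_mul_exp ha hzr).mono' (hmeas _ _) ?_
      filter_upwards [ae_restrict_mem measurableSet_Ioi] with x hx
      have hx : 0 < x := hx
      rw [norm_mul, Complex.norm_exp, Complex.norm_real, Real.norm_of_nonneg (by positivity), mul_comm]
      simp
    · refine ContinuousOn.aestronglyMeasurable ?_ measurableSet_Ioi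
      refine ContinuousOn.mul (by fun_prop) ?_
      refine Complex.continuous_ofReal.comp_continuousOn fun x hx => ?_
      exact (Real.continuousAt_rpow_const _ _ (Or.inl (ne_of_gt hx))).continuousWithinAt
    · filter_upwards [ae_restrict_mem measurableSet_Ioi] with x hx w hw
      have hx : 0 < x := hx
      have hw : z.re / 2 < w.re := hw
      rw [norm_mul, norm_mul, norm_neg, Complex.norm_exp, Complex.norm_real, Complex.norm_real,
        Real.norm_of_nonneg hx.le, Real.norm_of_nonneg (by positivity)]
      have e : x ^ ((a + 1) - 1) = x * x ^ (a - 1) := by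
        rw [show (a + 1) - 1 = 1 + (a - 1) by ring, Real.rpow_add hx, Real.rpow_one]
      rw [e, mul_right_comm]
      gcongr
      simp
      nlinarith
    · filter_upwards with x w _
      have : HasDerivAt (fun s : ℂ => Complex.exp (-(s * x))) (Complex.exp (-(w * x)) * (-(1 * x))) w :=
        (((hasDerivAt_id w).mul_const (x : ℂ)).neg).cexp
      refine (this.mul_const _).congr_deriv ?_
      ring
  have hHd : DifferentiableOn ℂ (fun s : ℂ => Real.Gamma a * s ^ (-a : ℂ)) U := by
    intro z hz
    refine DifferentiableAt.differentiableWithinAt ?_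
    exact (DifferentiableAt.cpow_const differentiableAt_id (Or.inl hz)).const_mul _
  have hpre : IsPreconnected U := (convex_halfSpace_re_gt 0).isPreconnected
  -- Identity theorem: both sides are holomorphic on the right half plane and agree at the real
  -- points 1 + 1/(n+1), which accumulate at 1.
  have heq : EqOn G (fun s : ℂ => Real.Gamma a * s ^ (-a : ℂ)) U := by
    refine (hGd.analyticOnNhd hUo).eqOn_of_preconnected_of_frequently_eq
      (hHd.analyticOnNhd hUo) hpre (z₀ := 1) (by simp [hU]) ?_
    have hreal : ∀ r : ℝ, 0 < r → G r = Real.Gamma a * (r : ℂ) ^ (-a : ℂ) := by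
      intro r hr
      have h := Real.integral_rpow_mul_exp_neg_mul_Ioi ha hr
      simp only [hG]
      have e : ∀ x : ℝ, Complex.exp (-(r * x)) * ((x ^ (a - 1) : ℝ) : ℂ)
          = ((x ^ (a - 1) * Real.exp (-(r * x)) : ℝ) : ℂ) := by
        intro x; push_cast; ring
      simp_rw [e]
      rw [integral_complex_ofReal, h, one_div, Real.inv_rpow hr.le, ← Real.rpow_neg hr.le]
      push_cast
      rw [Complex.ofReal_cpow hr.le]; push_cast; ring
    have ht : Tendsto (fun n : ℕ => ((1 + 1 / ((n : ℝ) + 1) : ℝ) : ℂ)) atTop (𝓝[≠] 1) := by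
      rw [tendsto_nhdsWithin_iff]
      constructor
      · have := (tendsto_one_div_add_atTop_nhds_zero_nat (𝕜 := ℝ)).const_add 1
        have := (Complex.continuous_ofReal.tendsto _).comp this
        simpa [Function.comp_def] using this
      · refine Eventually.of_forall fun n => ?_
        have : (0 : ℝ) < 1 / ((n : ℝ) + 1) := by positivity
        simp only [mem_compl_iff, mem_singleton_iff]
        norm_cast
        intro h
        have : 1 + 1 / ((n : ℝ) + 1) = 1 := by exact_mod_cast h
        linarith
    refine ht.frequently (Frequently.of_forall fun n => ?_)
    exact hreal _ (by positivity)
  exact heq hs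

end Laplace

/-! ### The hyperbolic contour and its deformation to a vertical line. -/

section Contour

open Complex (I)

/-- A branch of a hyperbola around the origin, opening to the left. -/
def hyp (η t : ℝ) : ℂ := ((2 - η * √(1 + t ^ 2) : ℝ) : ℂ) + t * I

/-- The derivative of `hyp η`. -/
def hypDeriv (η t : ℝ) : ℂ := ((-(η * (t / √(1 + t ^ 2))) : ℝ) : ℂ) + I

theorem hyp_re (η t : ℝ) : (hyp η t).re = 2 - η * √(1 + t ^ 2) := by simp [hyp]

theorem hyp_im (η t : ℝ) : (hyp η t).im = t := by simp [hyp]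

theorem hasDerivAt_sqrt_one_add_sq (t : ℝ) :
    HasDerivAt (fun t : ℝ => √(1 + t ^ 2)) (t / √(1 + t ^ 2)) t := by
  have h : HasDerivAt (fun t : ℝ => 1 + t ^ 2) (2 * t) t := by
    simpa using (hasDerivAt_pow 2 t).const_add 1
  convert h.sqrt (by positivity) using 1
  field_simp

theorem hasDerivAt_hyp (η t : ℝ) : HasDerivAt (hyp η) (hypDeriv η t) t := by
  have h1 := (((hasDerivAt_sqrt_one_add_sq t).const_mul η).const_sub 2).ofReal_comp
  have h2 : HasDerivAt (fun t : ℝ => (t : ℂ) * I) I t := by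
    simpa using (Complex.ofRealCLM.hasDerivAt (x := t)).mul_const I
  exact h1.add h2

theorem continuous_hyp (η : ℝ) : Continuous (hyp η) :=
  continuous_iff_continuousAt.2 fun t => (hasDerivAt_hyp η t).continuousAt

theorem continuous_hypDeriv (η : ℝ) : Continuous (hypDeriv η) := by
  unfold hypDeriv
  refine Continuous.add (Complex.continuous_ofReal.comp ?_) continuous_const
  refine (continuous_const.mul (continuous_id.div (by fun_prop) fun t => ?_)).neg
  positivity

theorem sqrt_one_add_sq_le (t : ℝ) : √(1 + t ^ 2) ≤ 1 + |t| := by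
  rw [Real.sqrt_le_left (by positivity)]
  nlinarith [sq_abs t, abs_nonneg t]

theorem abs_le_sqrt_one_add_sq (t : ℝ) : |t| ≤ √(1 + t ^ 2) :=
  Real.abs_le_sqrt (by linarith)

variable {η : ℝ}

theorem norm_hypDeriv_le (h0 : 0 ≤ η) (h1 : η ≤ 1 / 4) (t : ℝ) : ‖hypDeriv η t‖ ≤ 2 := by
  have hp : 0 < √(1 + t ^ 2) := by positivity
  have h2 : |t / √(1 + t ^ 2)| ≤ 1 := by
    rw [abs_div, abs_of_pos hp, div_le_one hp]; exact abs_le_sqrt_one_add_sq t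
  refine (norm_add_le _ _).trans ?_
  rw [Complex.norm_real, Complex.norm_I, Real.norm_eq_abs, abs_neg, abs_mul, abs_of_nonneg h0]
  nlinarith [abs_nonneg (t / √(1 + t ^ 2))]

theorem abs_le_norm_hyp (η t : ℝ) : |t| ≤ ‖hyp η t‖ := by
  simpa [hyp_im] using Complex.abs_im_le_norm (hyp η t)

/-- The abscissa 2 is chosen for this: if |t| ≤ 1 then √(1+t²) ≤ 2 and the real part is at least 2 -
2η ≥ 1, otherwise the imaginary part suffices. -/
theorem one_le_norm_hyp (h0 : 0 ≤ η) (h1 : η ≤ 1 / 4) (t : ℝ) : 1 ≤ ‖hyp η t‖ := by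
  rcases le_total 1 |t| with h | h
  · exact h.trans (abs_le_norm_hyp η t)
  · refine le_trans ?_ (Complex.re_le_norm _)
    rw [hyp_re]
    nlinarith [sqrt_one_add_sq_le t]

theorem hyp_ne_zero (h0 : 0 ≤ η) (h1 : η ≤ 1 / 4) (t : ℝ) : hyp η t ≠ 0 :=
  norm_pos_iff.1 (zero_lt_one.trans_le (one_le_norm_hyp h0 h1 t))

theorem norm_exp_hyp_le (h0 : 0 ≤ η) (t : ℝ) :
    ‖Complex.exp (hyp η t)‖ ≤ Real.exp 2 * Real.exp (-(η * |t|)) := by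
  rw [Complex.norm_exp, hyp_re, ← Real.exp_add, Real.exp_le_exp]
  nlinarith [abs_le_sqrt_one_add_sq t]

/-- Bounds how far the contour leans to the left; the slack against the wide sector is spent on
dividing by a complex time. -/
theorem neg_mul_norm_le_hyp_re (h0 : 0 ≤ η) (h1 : η ≤ 1 / 4) (t : ℝ) :
    -(η * ‖hyp η t‖) ≤ (hyp η t).re := by
  rw [hyp_re]
  nlinarith [sqrt_one_add_sq_le t, abs_le_norm_hyp η t]

theorem integrable_exp_neg_mul_abs {b : ℝ} (hb : 0 < b) :
    Integrable fun t : ℝ => Real.exp (-(b * |t|)) := by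
  rw [← integrableOn_univ, ← Iic_union_Ioi (a := (0 : ℝ)), integrableOn_union]
  constructor
  · refine (integrableOn_exp_mul_Iic hb 0).congr_fun (fun t ht => ?_) measurableSet_Iic
    simp only
    rw [abs_of_nonpos ht]; ring_nf
  · refine (integrableOn_exp_mul_Ioi (neg_neg_of_pos hb) 0).congr_fun (fun t ht => ?_) measurableSet_Ioi
    simp only
    rw [abs_of_pos ht]; ring_nf

theorem tendsto_exp_neg_mul_abs {b : ℝ} (hb : 0 < b) :
    Tendsto (fun t : ℝ => Real.exp (-(b * |t|))) atTop (𝓝 0) ∧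
      Tendsto (fun t : ℝ => Real.exp (-(b * |t|))) atBot (𝓝 0) := by
  constructor
  · exact Real.tendsto_exp_neg_atTop_nhds_zero.comp (tendsto_abs_atTop_atTop.const_mul_atTop hb)
  · exact Real.tendsto_exp_neg_atTop_nhds_zero.comp (tendsto_abs_atBot_atTop.const_mul_atTop hb)

/-- Integration of a derivative along the hyperbola. -/
theorem integral_hyp_deriv_eq_zero {E : Type*} [NormedAddCommGroup E] [NormedSpace ℂ E]
    [CompleteSpace E] (h0 : 0 < η) {F F' : ℝ → E} {C : ℝ}
    (hF : ∀ t, HasDerivAt F (F' t) t)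
    (hFb : ∀ t, ‖F t‖ ≤ C * Real.exp (-(η * |t|)))
    (hF'i : Integrable F') :
    ∫ t, F' t = 0 := by
  obtain ⟨h1, h2⟩ := tendsto_exp_neg_mul_abs h0
  have := integral_of_hasDerivAt_of_tendsto hF hF'i
    (squeeze_zero_norm hFb (by simpa using h2.const_mul C))
    (squeeze_zero_norm hFb (by simpa using h1.const_mul C))
  simpa using this

theorem integrable_exp_hyp_smul {E : Type*} [NormedAddCommGroup E] [NormedSpace ℂ E]
    (h0 : 0 < η) (h1 : η ≤ 1 / 4) {g : ℝ → E} (hg : Continuous g) {C : ℝ} (hC : ∀ t, ‖g t‖ ≤ C) :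
    Integrable fun t => (Complex.exp (hyp η t) * hypDeriv η t) • g t := by
  refine ((integrable_exp_neg_mul_abs h0).const_mul (Real.exp 2 * 2 * C)).mono' ?_ ?_
  · exact (((continuous_hyp η).cexp.mul (continuous_hypDeriv η)).smul hg).aestronglyMeasurable
  · refine Eventually.of_forall fun t => ?_
    rw [norm_smul, norm_mul]
    have e1 := norm_exp_hyp_le h0.le t
    have e2 := norm_hypDeriv_le h0.le h1 t
    calc _ ≤ (Real.exp 2 * Real.exp (-(η * |t|)) * 2) * C := by
            gcongr
            exact hC t
      _ = _ := by ring

/-- The form e^c dc is exact and decays at both ends. This is what removes the constant term of λ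
R(λ) = 1 + A R(λ) under the contour integral. -/
theorem integral_exp_hyp (h0 : 0 < η) (h1 : η ≤ 1 / 4) :
    ∫ t, Complex.exp (hyp η t) * hypDeriv η t = 0 := by
  refine integral_hyp_deriv_eq_zero (F := fun t => Complex.exp (hyp η t)) h0
    (fun t => (hasDerivAt_hyp η t).cexp) (norm_exp_hyp_le h0.le) ?_
  have := integrable_exp_hyp_smul h0 h1 (g := fun _ => (1 : ℂ)) continuous_const (C := 1) (by simp)
  simpa using this

/-- Three integrations by parts in one: the derivative of e^c (1/c + 1/c² + 2/c³) is e^c (1/c -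
6/c⁴) c'. The fourth power supplies the decay that is lost when η tends to 0 and the exponential no
longer decays along the contour. -/
theorem integral_exp_hyp_div (h0 : 0 < η) (h1 : η ≤ 1 / 4) :
    ∫ t, Complex.exp (hyp η t) * hypDeriv η t / hyp η t
      = 6 * ∫ t, Complex.exp (hyp η t) * hypDeriv η t / hyp η t ^ 4 := by
  have hne := hyp_ne_zero h0.le h1
  have hinv : Continuous fun t => (hyp η t)⁻¹ := (continuous_hyp η).inv₀ hne
  have hb : ∀ t, ‖(hyp η t)⁻¹‖ ≤ 1 := fun t => by
    rw [norm_inv]; exact inv_le_one_of_one_le₀ (one_le_norm_hyp h0.le h1 t)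
  have i1 := integrable_exp_hyp_smul h0 h1 hinv hb
  have i4 := integrable_exp_hyp_smul h0 h1 (g := fun t => ((hyp η t)⁻¹) ^ 4) (hinv.pow 4) (C := 1)
    (fun t => by rw [norm_pow]; exact pow_le_one₀ (norm_nonneg _) (hb t))
  have i6 : Integrable fun t => (6 : ℂ) • (Complex.exp (hyp η t) * hypDeriv η t) •
      (hyp η t)⁻¹ ^ 4 := i4.smul (6 : ℂ)
  have key := integral_hyp_deriv_eq_zero (C := Real.exp 2 * 4) (E := ℂ) h0
    (F := fun t => Complex.exp (hyp η t) *
      ((hyp η t)⁻¹ + (hyp η t)⁻¹ ^ 2 + 2 * (hyp η t)⁻¹ ^ 3))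
    (F' := fun t => (Complex.exp (hyp η t) * hypDeriv η t) • (hyp η t)⁻¹ -
      (6 : ℂ) • (Complex.exp (hyp η t) * hypDeriv η t) • (hyp η t)⁻¹ ^ 4) ?_ ?_
    (i1.sub i6)
  · rw [integral_sub i1 i6, integral_smul, sub_eq_zero] at key
    simpa [div_eq_mul_inv] using key
  · intro t
    have d := hasDerivAt_hyp η t
    have dinv := d.fun_inv (hne t)
    have := d.cexp.mul ((dinv.add (dinv.pow 2)).add ((dinv.pow 3).const_mul 2))
    refine this.congr_deriv ?_
    have := hne t
    simp only [smul_eq_mul, Pi.add_apply, Pi.pow_apply]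
    norm_num
    field_simp
    ring
  · intro t
    rw [norm_mul]
    have := norm_add₃_le (a := (hyp η t)⁻¹) (b := (hyp η t)⁻¹ ^ 2) (c := 2 * (hyp η t)⁻¹ ^ 3)
    rw [norm_mul, norm_pow, norm_pow, Complex.norm_ofNat] at this
    have h2 := pow_le_one₀ (n := 2) (norm_nonneg _) (hb t)
    have h3 := pow_le_one₀ (n := 3) (norm_nonneg _) (hb t)
    calc _ ≤ (Real.exp 2 * Real.exp (-(η * |t|))) * 4 :=
          mul_le_mul (norm_exp_hyp_le h0.le t) (this.trans (by linarith [hb t]))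
            (norm_nonneg _) (by positivity)
      _ = _ := by ring

theorem inv_norm_hyp_sq_le (h0 : 0 ≤ η) (h1 : η ≤ 1 / 4) (t : ℝ) :
    (‖hyp η t‖ ^ 2)⁻¹ ≤ 2 * (1 + t ^ 2)⁻¹ := by
  have a := one_le_norm_hyp h0 h1 t
  have b := abs_le_norm_hyp η t
  rw [← div_eq_mul_inv, inv_eq_one_div, div_le_div_iff₀ (by positivity) (by positivity)]
  nlinarith [sq_abs t, abs_nonneg t]

/-- Uniform in η, and valid for the vertical line η = 0 as well, where only the power decays. -/
theorem norm_exp_hyp_div_pow_le (h0 : 0 ≤ η) (h1 : η ≤ 1 / 4) (t : ℝ) :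
    ‖Complex.exp (hyp η t) / hyp η t ^ 4‖ ≤ 4 * Real.exp 2 * ((1 + t ^ 2)⁻¹ * (1 + t ^ 2)⁻¹) := by
  have := inv_norm_hyp_sq_le h0 h1 t
  rw [norm_div, norm_pow, div_eq_mul_inv]
  have e : (‖hyp η t‖ ^ 4)⁻¹ = (‖hyp η t‖ ^ 2)⁻¹ * (‖hyp η t‖ ^ 2)⁻¹ := by
    rw [← mul_inv]; ring
  have e2 : ‖Complex.exp (hyp η t)‖ ≤ Real.exp 2 := by
    refine (norm_exp_hyp_le h0 t).trans (mul_le_of_le_one_right (by positivity) ?_)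
    rw [Real.exp_le_one_iff]
    have := mul_nonneg h0 (abs_nonneg t); linarith
  rw [e]
  calc _ ≤ Real.exp 2 * ((2 * (1 + t ^ 2)⁻¹) * (2 * (1 + t ^ 2)⁻¹)) := by gcongr
    _ = _ := by ring

/-- Deformation invariance of the contour integral of φ(z) = e^z/z⁴. The aperture is η = r² so that
the vertical line r = 0 is an interior point of the parameter interval. Since φ(z) dz is closed, the
r-derivative of φ(c) ∂_t c is the t-derivative of φ(c) ∂_r c, which vanishes at both ends. -/
theorem hasDerivAt_integral_hyp {r : ℝ} (hr : r ∈ Ioo (-(1 / 2) : ℝ) (1 / 2)) :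
    HasDerivAt (fun r : ℝ => ∫ t, Complex.exp (hyp (r ^ 2) t) * hypDeriv (r ^ 2) t /
      hyp (r ^ 2) t ^ 4) 0 r := by
  have hη : ∀ r ∈ Ioo (-(1 / 2) : ℝ) (1 / 2), 0 ≤ r ^ 2 ∧ r ^ 2 ≤ 1 / 4 := fun r hr =>
    ⟨by positivity, by nlinarith [hr.1, hr.2]⟩
  set j : ℝ → ℝ := fun t => √(1 + t ^ 2)
  have hj0 : ∀ t, 0 < j t := fun t => by positivity
  have hjc : Continuous j := by fun_prop
  set P : ℝ → ℝ → ℂ := fun r t => Complex.exp (hyp (r ^ 2) t) / hyp (r ^ 2) t ^ 4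
  -- `P` and `Q` are e^z/z⁴ and its complex derivative evaluated on the contour.
  set Q : ℝ → ℝ → ℂ := fun r t => Complex.exp (hyp (r ^ 2) t) / hyp (r ^ 2) t ^ 4 -
    4 * (Complex.exp (hyp (r ^ 2) t) / hyp (r ^ 2) t ^ 5)
  set F' : ℝ → ℝ → ℂ := fun r t => Q r t * (-(2 * r * j t : ℝ)) * hypDeriv (r ^ 2) t +
    P r t * (-(2 * r * (t / j t) : ℝ)) with hF'
  have hne : ∀ r ∈ Ioo (-(1 / 2) : ℝ) (1 / 2), ∀ t, hyp (r ^ 2) t ≠ 0 := fun r hr =>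
    hyp_ne_zero (hη r hr).1 (hη r hr).2
  have hPc : ∀ r ∈ Ioo (-(1 / 2) : ℝ) (1 / 2), Continuous (P r) := fun r hr =>
    (continuous_hyp _).cexp.div ((continuous_hyp _).pow 4) fun t => pow_ne_zero _ (hne r hr t)
  have hQc : ∀ r ∈ Ioo (-(1 / 2) : ℝ) (1 / 2), Continuous (Q r) := fun r hr =>
    (hPc r hr).sub (continuous_const.mul ((continuous_hyp _).cexp.div ((continuous_hyp _).pow 5)
      fun t => pow_ne_zero _ (hne r hr t)))
  have hPd : ∀ r ∈ Ioo (-(1 / 2) : ℝ) (1 / 2), ∀ t, HasDerivAt (P r) (Q r t * hypDeriv (r ^ 2) t) t := by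
    intro r hr t
    have d := hasDerivAt_hyp (r ^ 2) t
    refine (d.cexp.div (d.pow 4) (pow_ne_zero _ (hne r hr t))).congr_deriv ?_
    have := hne r hr t
    simp only [Q]
    field_simp
    norm_num
    ring
  have hPb : ∀ r ∈ Ioo (-(1 / 2) : ℝ) (1 / 2), ∀ t,
      ‖P r t‖ ≤ 4 * Real.exp 2 * ((1 + t ^ 2)⁻¹ * (1 + t ^ 2)⁻¹) := fun r hr =>
    norm_exp_hyp_div_pow_le (hη r hr).1 (hη r hr).2
  have hQb : ∀ r ∈ Ioo (-(1 / 2) : ℝ) (1 / 2), ∀ t,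
      ‖Q r t‖ ≤ 5 * (4 * Real.exp 2 * ((1 + t ^ 2)⁻¹ * (1 + t ^ 2)⁻¹)) := by
    intro r hr t
    have e : Q r t = P r t * (1 - 4 * (hyp (r ^ 2) t)⁻¹) := by
      have := hne r hr t
      simp only [P, Q]; field_simp
    have b : ‖(hyp (r ^ 2) t)⁻¹‖ ≤ 1 := by
      rw [norm_inv]; exact inv_le_one_of_one_le₀ (one_le_norm_hyp (hη r hr).1 (hη r hr).2 t)
    rw [e, norm_mul, mul_comm (5 : ℝ)]
    refine mul_le_mul (hPb r hr t) ?_ (norm_nonneg _) (by positivity)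
    refine (norm_sub_le _ _).trans ?_
    rw [norm_mul]; simp at b ⊢; linarith
  have hjle : ∀ t, j t ≤ 1 + t ^ 2 := fun t => by
    rw [Real.sqrt_le_left (by positivity)]; nlinarith [sq_nonneg t]
  have hjt : ∀ t, |t / j t| ≤ 1 := fun t => by
    rw [abs_div, abs_of_pos (hj0 t), div_le_one (hj0 t)]; exact abs_le_sqrt_one_add_sq t
  have hF'b : ∀ r ∈ Ioo (-(1 / 2) : ℝ) (1 / 2), ∀ t,
      ‖F' r t‖ ≤ (44 * Real.exp 2) * (1 + t ^ 2)⁻¹ := by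
    intro r hr t
    have hr2 : |2 * r| ≤ 1 := by rw [abs_le]; constructor <;> linarith [hr.1, hr.2]
    have hs : (1 + t ^ 2)⁻¹ ≤ 1 := inv_le_one_of_one_le₀ (by nlinarith [sq_nonneg t])
    have hs0 : 0 < (1 + t ^ 2)⁻¹ := by positivity
    have hse : (1 + t ^ 2)⁻¹ * (1 + t ^ 2) = 1 := inv_mul_cancel₀ (by positivity)
    refine (norm_add_le _ _).trans ?_
    rw [norm_mul, norm_mul, norm_mul, norm_neg, norm_neg, Complex.norm_real, Complex.norm_real,
      Real.norm_eq_abs, Real.norm_eq_abs, abs_mul, abs_mul (2 * r), abs_of_pos (hj0 t)]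
    have t1 : ‖Q r t‖ * (|2 * r| * j t) * ‖hypDeriv (r ^ 2) t‖ ≤
        (5 * (4 * Real.exp 2 * ((1 + t ^ 2)⁻¹ * (1 + t ^ 2)⁻¹))) * (1 * (1 + t ^ 2)) * 2 := by
      gcongr
      · exact hQb r hr t
      · exact hjle t
      · exact norm_hypDeriv_le (hη r hr).1 (hη r hr).2 t
    have t2 : ‖P r t‖ * (|2 * r| * |t / j t|) ≤
        (4 * Real.exp 2 * ((1 + t ^ 2)⁻¹ * 1)) * (1 * 1) := by
      gcongr
      · refine (hPb r hr t).trans ?_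
        gcongr
      · exact hjt t
    have e3 : (5 * (4 * Real.exp 2 * ((1 + t ^ 2)⁻¹ * (1 + t ^ 2)⁻¹))) * (1 * (1 + t ^ 2)) * 2
        = 40 * Real.exp 2 * (1 + t ^ 2)⁻¹ := by
      linear_combination (40 * Real.exp 2 * (1 + t ^ 2)⁻¹) * hse
    rw [e3] at t1
    linarith
  have hF'c : ∀ r ∈ Ioo (-(1 / 2) : ℝ) (1 / 2), Continuous (F' r) := by
    intro r hr
    refine Continuous.add (Continuous.mul (Continuous.mul (hQc r hr) ?_) (continuous_hypDeriv _))
      (Continuous.mul (hPc r hr) ?_)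
    · exact (Complex.continuous_ofReal.comp (by fun_prop)).neg
    · exact (Complex.continuous_ofReal.comp (continuous_const.mul
        (continuous_id.div hjc fun t => (hj0 t).ne'))).neg
  have hFc : ∀ r ∈ Ioo (-(1 / 2) : ℝ) (1 / 2), Continuous (fun t =>
      Complex.exp (hyp (r ^ 2) t) * hypDeriv (r ^ 2) t / hyp (r ^ 2) t ^ 4) := fun r hr =>
    ((continuous_hyp _).cexp.mul (continuous_hypDeriv _)).div ((continuous_hyp _).pow 4)
      fun t => pow_ne_zero _ (hne r hr t)
  have hinteg := integrable_inv_one_add_sq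
  have hnhds := isOpen_Ioo.mem_nhds hr
  have main := hasDerivAt_integral_of_dominated_loc_of_deriv_le (𝕜 := ℝ) (μ := volume) (F' := F')
    (F := fun r t => Complex.exp (hyp (r ^ 2) t) * hypDeriv (r ^ 2) t / hyp (r ^ 2) t ^ 4)
    (bound := fun t => (44 * Real.exp 2) * (1 + t ^ 2)⁻¹) hnhds
    (by filter_upwards [hnhds] with r hr using (hFc r hr).aestronglyMeasurable)
    (by
      refine (hinteg.const_mul (8 * Real.exp 2)).mono' (hFc r hr).aestronglyMeasurable
        (Eventually.of_forall fun t => ?_)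
      have hs : (1 + t ^ 2)⁻¹ ≤ 1 := inv_le_one_of_one_le₀ (by nlinarith [sq_nonneg t])
      have e : Complex.exp (hyp (r ^ 2) t) * hypDeriv (r ^ 2) t / hyp (r ^ 2) t ^ 4
        = P r t * hypDeriv (r ^ 2) t := by simp only [P]; ring
      rw [e, norm_mul]
      calc _ ≤ (4 * Real.exp 2 * ((1 + t ^ 2)⁻¹ * 1)) * 2 := by
            gcongr
            · refine (hPb r hr t).trans ?_
              gcongr
            · exact norm_hypDeriv_le (hη r hr).1 (hη r hr).2 t
        _ = _ := by ring)
    (hF'c r hr).aestronglyMeasurable (Eventually.of_forall fun t r hr => hF'b r hr t)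
    (hinteg.const_mul _) (Eventually.of_forall fun t r hr => by
      have dsq : HasDerivAt (fun r : ℝ => r ^ 2) (2 * r) r := by simpa using hasDerivAt_pow 2 r
      have d1 : HasDerivAt (fun r : ℝ => hyp (r ^ 2) t) (-(2 * r * j t : ℝ) : ℂ) r := by
        exact (((dsq.mul_const (j t)).const_sub 2).ofReal_comp.add_const ((t : ℂ) * I)).congr_deriv
          (by push_cast; ring)
      have d2 : HasDerivAt (fun r : ℝ => hypDeriv (r ^ 2) t) (-(2 * r * (t / j t) : ℝ) : ℂ) r := by
        exact ((dsq.mul_const (t / j t)).neg.ofReal_comp.add_const I).congr_deriv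
          (by push_cast; ring)
      refine ((d1.cexp.mul d2).div (d1.pow 4) (pow_ne_zero _ (hne r hr t))).congr_deriv ?_
      have := hne r hr t
      simp only [F', P, Q]
      field_simp
      norm_num
      ring)
  -- With ∂_r c = -2r√(1+t²), the integrand is the total t-derivative of (∂_r c) e^c/c⁴.
  suffices h : ∫ t, F' r t = 0 by rw [← h]; exact main.2
  have hG : ∀ t, HasDerivAt (fun t => (-(2 * r * j t : ℝ) : ℂ) * P r t) (F' r t) t := by
    intro t
    have d1 : HasDerivAt (fun t => (-(2 * r * j t : ℝ) : ℂ)) (-(2 * r * (t / j t) : ℝ)) t := by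
      have := ((hasDerivAt_sqrt_one_add_sq t).const_mul (2 * r)).neg.ofReal_comp
      simpa using this
    refine (d1.mul (hPd r hr t)).congr_deriv ?_
    simp only [F']; ring
  have hlim : ∀ t, ‖(-(2 * r * j t : ℝ) : ℂ) * P r t‖ ≤ 4 * Real.exp 2 * (1 + t ^ 2)⁻¹ := by
    intro t
    have hr2 : |2 * r| ≤ 1 := by rw [abs_le]; constructor <;> linarith [hr.1, hr.2]
    have hse : (1 + t ^ 2)⁻¹ * (1 + t ^ 2) = 1 := inv_mul_cancel₀ (by positivity)
    rw [norm_mul, norm_neg, Complex.norm_real, Real.norm_eq_abs, abs_mul, abs_of_pos (hj0 t)]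
    calc _ ≤ (1 * (1 + t ^ 2)) * (4 * Real.exp 2 * ((1 + t ^ 2)⁻¹ * (1 + t ^ 2)⁻¹)) := by
          gcongr
          · exact hjle t
          · exact hPb r hr t
      _ = _ := by linear_combination (4 * Real.exp 2 * (1 + t ^ 2)⁻¹) * hse
  have hsq : ∀ l : Filter ℝ, Tendsto (fun t : ℝ => t ^ 2) l atTop →
      Tendsto (fun t : ℝ => 4 * Real.exp 2 * (1 + t ^ 2)⁻¹) l (𝓝 0) := by
    intro l hl
    simpa using (tendsto_inv_atTop_zero.comp (tendsto_atTop_add_const_left _ 1 hl)).const_mul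
      (4 * Real.exp 2)
  have := integral_of_hasDerivAt_of_tendsto hG main.1
    (squeeze_zero_norm hlim (hsq _ (by
      have := (tendsto_pow_atTop (α := ℝ) two_ne_zero).comp tendsto_neg_atBot_atTop
      simpa [Function.comp_def] using this)))
    (squeeze_zero_norm hlim (hsq _ (tendsto_pow_atTop two_ne_zero)))
  simpa using this

end Contour

/-! ### Nonvanishing of the normalising constant. -/

section Contour

open Complex (I)

/-- The value is 2πi by Cauchy, but nonvanishing is enough. Deforming to the line Re z = 2 turns the
integral into the Laplace inversion integral of Γ(4)/s⁴ at y = 1; were it zero, inversion would give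
1³ = 0. -/
theorem integral_exp_hyp_div_ne_zero {η : ℝ} (h0 : 0 < η) (h1 : η < 1 / 4) :
    ∫ t, Complex.exp (hyp η t) * hypDeriv η t / hyp η t ≠ 0 := by
  rw [integral_exp_hyp_div h0 h1.le]
  refine mul_ne_zero (by norm_num) ?_
  have hs : √η ∈ Ioo (-(1 / 2) : ℝ) (1 / 2) := by
    refine ⟨by have := Real.sqrt_nonneg η; linarith, ?_⟩
    rw [Real.sqrt_lt' (by norm_num)]; linarith
  have hconst := isOpen_Ioo.is_const_of_deriv_eq_zero (𝕜 := ℝ) (s := Ioo (-(1 / 2) : ℝ) (1 / 2))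
    isPreconnected_Ioo (fun r hr => (hasDerivAt_integral_hyp hr).differentiableAt.differentiableWithinAt)
    (fun r hr => (hasDerivAt_integral_hyp hr).deriv) hs (show (0 : ℝ) ∈ _ by constructor <;> norm_num)
  rw [Real.sq_sqrt h0.le] at hconst
  rw [hconst]
  have hF : ∀ ξ : ℝ, ∫ y in Ioi (0 : ℝ), Complex.exp (-((((2 : ℝ) : ℂ) + ξ * I) * y)) *
      ((y ^ ((4 : ℝ) - 1) : ℝ) : ℂ) = Real.Gamma 4 * (((2 : ℂ) + ξ * I) ^ 4)⁻¹ := by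
    intro ξ
    rw [integral_rpow_mul_cexp (by norm_num) (by simp)]
    congr 1
    rw [Complex.cpow_neg]
    norm_num
  have hre : ∀ ξ : ℝ, 1 + ξ ^ 2 ≤ ‖(2 : ℂ) + ξ * I‖ ^ 2 := by
    intro ξ
    rw [← Complex.normSq_eq_norm_sq, Complex.normSq_apply]
    simp; nlinarith
  have hne : ∀ ξ : ℝ, (2 : ℂ) + ξ * I ≠ 0 := fun ξ h => by
    have := hre ξ; rw [h] at this; simp at this; nlinarith
  have key := laplace_inversion (σ := 2) (x := 1) (f := fun y => ((y ^ ((4 : ℝ) - 1) : ℝ) : ℂ))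
    one_pos ?_ ?_ ?_
  · simp_rw [hF] at key
    intro h
    have e : ∫ ξ : ℝ, Complex.exp (ξ * I * ((1 : ℝ) : ℂ)) *
        (Real.Gamma 4 * (((2 : ℂ) + ξ * I) ^ 4)⁻¹) = 0 := by
      have : (fun ξ : ℝ => Complex.exp (ξ * I * ((1 : ℝ) : ℂ)) *
        (Real.Gamma 4 * (((2 : ℂ) + ξ * I) ^ 4)⁻¹)) = fun ξ : ℝ =>
          (Real.Gamma 4 * Complex.exp (-2) * I⁻¹) * (Complex.exp (hyp (0 ^ 2) ξ) *
            hypDeriv (0 ^ 2) ξ / hyp (0 ^ 2) ξ ^ 4) := by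
        ext ξ
        have h2 : hyp (0 ^ 2) ξ = 2 + ξ * I := by simp [hyp]
        have h3 : hypDeriv (0 ^ 2) ξ = I := by simp [hypDeriv]
        have h4 : Complex.exp (ξ * I * ((1 : ℝ) : ℂ)) = Complex.exp (-2) * Complex.exp (2 + ξ * I) := by
          rw [← Complex.exp_add]; congr 1; push_cast; ring
        rw [h2, h3, h4]
        have := hne ξ
        field_simp
      rw [this, integral_const_mul, h, mul_zero]
    rw [e] at key
    simp [Complex.exp_ne_zero] at key
  · exact (Complex.continuous_ofReal.continuousAt).comp
      (Real.continuousAt_rpow_const _ _ (Or.inl one_ne_zero))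
  · have := (integrableOn_rpow_mul_exp (a := 4) (σ := 2) (by norm_num) (by norm_num)).ofReal (𝕜 := ℂ)
    refine IntegrableOn.congr_fun this (fun y _ => ?_) measurableSet_Ioi
    simp only [RCLike.ofReal_mul]
    rw [mul_comm]; congr 1
    simp
  · simp_rw [hF]
    refine Integrable.const_mul ?_ _
    refine integrable_inv_one_add_sq.mono' ?_ (Eventually.of_forall fun ξ => ?_)
    · exact (Continuous.inv₀ (by fun_prop) fun ξ => pow_ne_zero _ (hne ξ)).aestronglyMeasurable
    · rw [norm_inv, norm_pow]
      have := hre ξ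
      refine inv_anti₀ (by positivity) ?_
      nlinarith [sq_nonneg ξ]

end Contour

/-! ### The Dunford integral as a holomorphic family. -/

section Construction

open Complex (I)

/-- The open sector `{|Im z| < κ Re z}` around the positive half-line. -/
def narrowSector (κ : ℝ) : Set ℂ := {z | |z.im| < κ * z.re}

theorem isOpen_narrowSector (κ : ℝ) : IsOpen (narrowSector κ) :=
  isOpen_lt (continuous_abs.comp Complex.continuous_im) (continuous_const.mul Complex.continuous_re)

theorem re_pos_of_mem_narrowSector {κ : ℝ} (hκ : 0 < κ) {z : ℂ} (hz : z ∈ narrowSector κ) :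
    0 < z.re :=
  pos_of_mul_pos_right ((abs_nonneg _).trans_lt hz) hκ.le

theorem ne_zero_of_mem_narrowSector {κ : ℝ} {z : ℂ} (hz : z ∈ narrowSector κ) : z ≠ 0 := by
  rintro rfl
  simp [narrowSector] at hz

/-- Re(c / z) has the sign of Re(c conj z), to which the real parts contribute at least -(ε/4)|c||z|
and the imaginary parts at least -(ε/4)|c||z|; the total -ε/2 is still above -ε. -/
theorem hyp_div_mem_wideSector {ε : ℝ} (h0 : 0 < ε) (h1 : ε < 1 / 2) {z : ℂ}
    (hz : z ∈ narrowSector (ε / 4)) (t : ℝ) : hyp (ε / 4) t / z ∈ wideSector ε := by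
  have hre := re_pos_of_mem_narrowSector (by positivity) hz
  have hz0 := ne_zero_of_mem_narrowSector hz
  have hzn : 0 < ‖z‖ := norm_pos_iff.2 hz0
  have hc0 := hyp_ne_zero (η := ε / 4) (by positivity) (by linarith) t
  have hcn : 0 < ‖hyp (ε / 4) t‖ := norm_pos_iff.2 hc0
  refine ⟨div_ne_zero hc0 hz0, ?_⟩
  have hc := neg_mul_norm_le_hyp_re (η := ε / 4) (by positivity) (by linarith) t
  have him := Complex.abs_im_le_norm (hyp (ε / 4) t)
  have hzre := Complex.re_le_norm z
  have hz' : |z.im| < ε / 4 * z.re := hz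
  set c := hyp (ε / 4) t
  rw [Complex.div_re, ← add_div, norm_div, lt_div_iff₀ (Complex.normSq_pos.2 hz0),
    Complex.normSq_eq_norm_sq]
  have e : -(ε * (‖c‖ / ‖z‖)) * ‖z‖ ^ 2 = -(ε * ‖c‖ * ‖z‖) := by field_simp
  rw [e]
  have a1 : -(ε / 4 * ‖c‖ * ‖z‖) ≤ c.re * z.re := by
    have := mul_le_mul_of_nonneg_right hc hre.le
    nlinarith [mul_le_mul_of_nonneg_left hzre (by positivity : 0 ≤ ε / 4 * ‖c‖)]
  have a2 : |c.im * z.im| ≤ ε / 4 * ‖c‖ * ‖z‖ := by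
    rw [abs_mul]
    calc |c.im| * |z.im| ≤ ‖c‖ * (ε / 4 * ‖z‖) := by
          gcongr
          exact hz'.le.trans (by gcongr)
      _ = _ := by ring
  have := neg_abs_le (c.im * z.im)
  nlinarith [mul_pos (mul_pos h0 hcn) hzn]

theorem tendsto_of_bounded_of_dense {ι X : Type*} [NormedAddCommGroup X] [NormedSpace ℂ X]
    {S : Set X} (hS : Dense S) {l : Filter ι} {T : ι → X →L[ℂ] X} {B : ℝ}
    (hB : ∀ᶠ z in l, ‖T z‖ ≤ B) (hT : ∀ f ∈ S, Tendsto (fun z => T z f) l (𝓝 f)) (f : X) :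
    Tendsto (fun z => T z f) l (𝓝 f) := by
  rw [Metric.tendsto_nhds]
  intro δ hδ
  set B' := max B 0
  have hB' : 0 ≤ B' := le_max_right _ _
  obtain ⟨f', hf', hff'⟩ := hS.exists_dist_lt f (ε := δ / (2 * (B' + 1))) (by positivity)
  filter_upwards [hB, (Metric.tendsto_nhds.1 (hT f' hf')) (δ / 2) (by positivity)] with z hz hz'
  rw [dist_eq_norm] at hz' hff' ⊢
  have e : T z f - f = T z (f - f') - (f - f') + (T z f' - f') := by rw [map_sub]; abel
  have h4 : ‖T z (f - f')‖ ≤ B' * ‖f - f'‖ :=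
    ContinuousLinearMap.le_of_opNorm_le _ (hz.trans (le_max_left _ _)) _
  have h5 : (B' + 1) * ‖f - f'‖ < δ / 2 := by
    calc _ < (B' + 1) * (δ / (2 * (B' + 1))) := by gcongr
      _ = δ / 2 := by field_simp
  rw [e]
  have h6 := norm_add_le (T z (f - f') - (f - f')) (T z f' - f')
  have h7 := norm_sub_le (T z (f - f')) (f - f')
  linarith

variable {X : Type*} [NormedAddCommGroup X] [NormedSpace ℂ X] [CompleteSpace X] {A : X →ₗ.[ℂ] X}

/-- T(z) is the normalised integral of e^(λz) R(λ) dλ over the contour λ = c(t)/z. Rescaling the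
contour with z makes the exponential factor independent of z, and ‖R(c/z)‖ ≤ C‖z‖/‖c‖ then bounds
T(z) uniformly. -/
theorem exists_holomorphic_family {ε C : ℝ} (h0 : 0 < ε) (h1 : ε < 1 / 2) {Rf : ℂ → X →L[ℂ] X}
    (hRf : ∀ z ∈ wideSector ε, IsResolventAt A z (Rf z) ∧ ‖Rf z‖ ≤ C / ‖z‖)
    (hdense : Dense (A.domain : Set X)) :
    ∃ T T' : ℂ → X →L[ℂ] X, ∃ B : ℝ, (∀ z ∈ narrowSector (ε / 4), ‖T z‖ ≤ B) ∧
      (∀ z ∈ narrowSector (ε / 4), HasDerivAt T (T' z) z) ∧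
      (∀ z ∈ narrowSector (ε / 4), ∀ f, (T z f, T' z f) ∈ A.graph) ∧
      (∀ z ∈ narrowSector (ε / 4), ∀ f g, (f, g) ∈ A.graph → (T z f, T z g) ∈ A.graph) ∧
      ∀ f, Tendsto (fun z => T z f) (𝓝[narrowSector (ε / 4)] 0) (𝓝 f) := by
  set η := ε / 4 with hη
  have hη0 : 0 < η := by positivity
  have hη1 : η < 1 / 4 := by rw [hη]; linarith
  set c : ℝ → ℂ := hyp η with hc
  set w : ℝ → ℂ := fun t => Complex.exp (c t) * hypDeriv η t with hw
  set K : ℂ := ∫ t, w t / c t with hK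
  have hK0 : K ≠ 0 := integral_exp_hyp_div_ne_zero hη0 hη1
  have hcne : ∀ t, c t ≠ 0 := hyp_ne_zero hη0.le hη1.le
  have hc1 : ∀ t, 1 ≤ ‖c t‖ := one_le_norm_hyp hη0.le hη1.le
  have hcc : Continuous c := continuous_hyp η
  have hwc : Continuous w := hcc.cexp.mul (continuous_hypDeriv η)
  have hwint : Integrable fun t => ‖w t‖ := by
    have := integrable_exp_hyp_smul hη0 hη1.le (g := fun _ => (1 : ℂ)) continuous_const (C := 1)
      (by simp)
    simpa [hw, hc] using this.norm
  have hw0 : ∫ t, w t = 0 := integral_exp_hyp hη0 hη1.le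
  have hmem : ∀ z ∈ narrowSector η, ∀ t, c t / z ∈ wideSector ε := fun z hz t =>
    hyp_div_mem_wideSector h0 h1 hz t
  have hzne : ∀ z ∈ narrowSector η, z ≠ 0 := fun z hz => ne_zero_of_mem_narrowSector hz
  have hone : (1 : ℂ) ∈ wideSector ε := ⟨one_ne_zero, by simp; linarith⟩
  have hC : 0 ≤ C := by
    have := (norm_nonneg _).trans (hRf 1 hone).2
    simpa using this
  have hRd : ∀ z ∈ wideSector ε, HasDerivAt Rf (-(Rf z * Rf z)) z := by
    intro z hz
    have hzn : 0 < ‖z‖ := norm_pos_iff.2 hz.1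
    refine hasDerivAt_resolvent (isOpen_wideSector ε) (fun z hz => (hRf z hz).1) hz
      (C := C / (‖z‖ / 2)) ?_
    have : ∀ᶠ w in 𝓝 z, ‖z‖ / 2 < ‖w‖ :=
      (isOpen_lt continuous_const continuous_norm).mem_nhds (by simp only [mem_ofPred_eq]; linarith)
    filter_upwards [this, (isOpen_wideSector ε).mem_nhds hz] with w hw hwS
    exact (hRf w hwS).2.trans (by gcongr)
  have hRb : ∀ z ∈ narrowSector η, ∀ t, ‖Rf (c t / z)‖ ≤ C * ‖z‖ / ‖c t‖ := by
    intro z hz t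
    refine (hRf _ (hmem z hz t)).2.trans (le_of_eq ?_)
    rw [norm_div]
    have := norm_pos_iff.2 (hzne z hz)
    have := zero_lt_one.trans_le (hc1 t)
    field_simp
  have hRc : ∀ z ∈ narrowSector η, Continuous fun t => Rf (c t / z) := by
    intro z hz
    refine continuous_iff_continuousAt.2 fun t => ?_
    exact (hRd _ (hmem z hz t)).continuousAt.comp (f := fun t => c t / z)
      (hcc.div_const z).continuousAt
  have hRb1 : ∀ z ∈ narrowSector η, ∀ t, ‖Rf (c t / z)‖ ≤ C * ‖z‖ := fun z hz t =>
    (hRb z hz t).trans (div_le_self (by positivity) (hc1 t))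
  have hcRb : ∀ z ∈ narrowSector η, ∀ t, ‖c t • Rf (c t / z)‖ ≤ C * ‖z‖ := by
    intro z hz t
    rw [norm_smul]
    have h2 : 0 < ‖c t‖ := zero_lt_one.trans_le (hc1 t)
    calc _ ≤ ‖c t‖ * (C * ‖z‖ / ‖c t‖) := by gcongr; exact hRb z hz t
      _ = _ := by field_simp
  have hcRRb : ∀ z ∈ narrowSector η, ∀ t, ‖c t • (Rf (c t / z) * Rf (c t / z))‖ ≤ (C * ‖z‖) ^ 2 := by
    intro z hz t
    rw [← smul_mul_assoc, pow_two]
    exact (norm_mul_le _ _).trans (mul_le_mul (hcRb z hz t) (hRb1 z hz t) (norm_nonneg _)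
      (by positivity))
  have hint : ∀ {E : Type _} [NormedAddCommGroup E] [NormedSpace ℂ E] (g : ℝ → E) (M : ℝ),
      Continuous g → (∀ t, ‖g t‖ ≤ M) → Integrable fun t => w t • g t := fun g M hg hM =>
    integrable_exp_hyp_smul hη0 hη1.le hg hM
  -- integrability of the three basic integrands
  have iR : ∀ z ∈ narrowSector η, Integrable fun t => w t • Rf (c t / z) := fun z hz =>
    hint _ _ (hRc z hz) (hRb1 z hz)
  have icR : ∀ z ∈ narrowSector η, Integrable fun t => w t • (c t • Rf (c t / z)) := fun z hz =>
    hint _ _ (hcc.smul (hRc z hz)) (hcRb z hz)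
  have icRR : ∀ z ∈ narrowSector η,
      Integrable fun t => w t • (c t • (Rf (c t / z) * Rf (c t / z))) := fun z hz =>
    hint _ _ (hcc.smul ((hRc z hz).mul (hRc z hz))) (hcRRb z hz)
  -- integration by parts on the contour
  have parts : ∀ z ∈ narrowSector η, ∫ t, w t • (c t • Rf (c t / z)) =
      -∫ t, w t • (Rf (c t / z) - z⁻¹ • (c t • (Rf (c t / z) * Rf (c t / z)))) := by
    intro z hz
    have i2 : Integrable fun t => w t • (Rf (c t / z) - z⁻¹ • (c t • (Rf (c t / z) * Rf (c t / z)))) := by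
      have := (iR z hz).sub ((icRR z hz).smul z⁻¹)
      refine this.congr (Eventually.of_forall fun t => ?_)
      simp only [Pi.sub_apply, Pi.smul_apply]
      module
    have key := integral_hyp_deriv_eq_zero (η := η) (C := Real.exp 2 * (C * ‖z‖)) hη0
      (F := fun t => Complex.exp (c t) • (c t • Rf (c t / z)))
      (F' := fun t => w t • (c t • Rf (c t / z)) +
        w t • (Rf (c t / z) - z⁻¹ • (c t • (Rf (c t / z) * Rf (c t / z))))) ?_ ?_
      ((icR z hz).add i2)
    · rw [integral_add (icR z hz) i2] at key
      exact eq_neg_of_add_eq_zero_left key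
    · intro t
      have d : HasDerivAt c (hypDeriv η t) t := hasDerivAt_hyp η t
      have dR := (hRd _ (hmem z hz t)).scomp t (d.div_const z)
      refine (d.cexp.smul (d.smul dR)).congr_deriv ?_
      simp only [hw, Pi.smul_apply', Function.comp_apply, div_eq_mul_inv]
      module
    · intro t
      rw [norm_smul]
      have := norm_exp_hyp_le hη0.le t
      calc _ ≤ (Real.exp 2 * Real.exp (-(η * |t|))) * (C * ‖z‖) := by
            gcongr
            exact hcRb z hz t
        _ = _ := by ring
  set T : ℂ → X →L[ℂ] X := fun z => K⁻¹ • ∫ t, w t • (z⁻¹ • Rf (c t / z)) with hT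
  -- This is A T(z): with λ = c/z, A R(λ) = λ R(λ) - 1, and the constant integrates to zero. That it
  -- is also the derivative of T follows from `parts`.
  set T' : ℂ → X →L[ℂ] X := fun z => K⁻¹ • (z⁻¹ ^ 2 • ∫ t, w t • (c t • Rf (c t / z))) with hT'
  have hTe : ∀ z, T z = K⁻¹ • (z⁻¹ • ∫ t, w t • Rf (c t / z)) := by
    intro z
    simp only [hT]
    rw [← integral_smul z⁻¹]
    congr 2; ext1 t
    rw [smul_comm]
  refine ⟨T, T', ‖K⁻¹‖ * ∫ t, ‖w t‖ * C, ?_, ?_, ?_, ?_, ?_⟩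
  · intro z hz
    rw [hT, norm_smul]
    gcongr
    refine norm_integral_le_of_norm_le (hwint.mul_const C) (Eventually.of_forall fun t => ?_)
    rw [norm_smul, norm_smul, norm_inv]
    gcongr
    have hzn := norm_pos_iff.2 (hzne z hz)
    calc _ ≤ ‖z‖⁻¹ * (C * ‖z‖) := by gcongr; exact hRb1 z hz t
      _ = C := by field_simp
  · intro z hz
    have hzn := norm_pos_iff.2 (hzne z hz)
    -- Away from the origin, on |v| > |z|/2, the differentiated integrand is dominated uniformly in
    -- v by (C + C²)·2/|z| times the weight.
    set U : Set ℂ := narrowSector η ∩ {v | ‖z‖ / 2 < ‖v‖} with hU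
    have hUn : U ∈ 𝓝 z := ((isOpen_narrowSector η).inter
      (isOpen_lt continuous_const continuous_norm)).mem_nhds ⟨hz, by simp only [mem_ofPred_eq]; linarith⟩
    set G' : ℂ → ℝ → X →L[ℂ] X := fun z t => w t • (-(z⁻¹ ^ 2 •
      (Rf (c t / z) - z⁻¹ • (c t • (Rf (c t / z) * Rf (c t / z)))))) with hG'
    have hG'c : ∀ z ∈ narrowSector η, Continuous (G' z) := fun z hz =>
      hwc.smul (((((hRc z hz).sub ((hcc.smul ((hRc z hz).mul (hRc z hz))).const_smul z⁻¹)).const_smul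
        (z⁻¹ ^ 2))).neg)
    have main := hasDerivAt_integral_of_dominated_loc_of_deriv_le (𝕜 := ℂ) (μ := volume) (F' := G')
      (F := fun z t => w t • (z⁻¹ • Rf (c t / z)))
      (bound := fun t => ‖w t‖ * ((C + C ^ 2) * (2 / ‖z‖))) hUn
      (by
        filter_upwards [hUn] with v hv
        exact (hwc.smul ((hRc v hv.1).const_smul v⁻¹)).aestronglyMeasurable)
      (by
        refine ((iR z hz).smul z⁻¹).congr (Eventually.of_forall fun t => ?_)
        simp only [Pi.smul_apply]; rw [smul_comm])
      (hG'c z hz).aestronglyMeasurable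
      (Eventually.of_forall fun t v hv => by
        have hvn : 0 < ‖v‖ := norm_pos_iff.2 (hzne v hv.1)
        rw [hG', norm_smul, norm_neg, norm_smul, norm_pow, norm_inv]
        refine mul_le_mul_of_nonneg_left ?_ (norm_nonneg _)
        have b1 : ‖Rf (c t / v) - v⁻¹ • (c t • (Rf (c t / v) * Rf (c t / v)))‖ ≤
            C * ‖v‖ + ‖v‖⁻¹ * (C * ‖v‖) ^ 2 := by
          refine (norm_sub_le _ _).trans (add_le_add (hRb1 v hv.1 t) ?_)
          rw [norm_smul, norm_inv]
          gcongr
          exact hcRRb v hv.1 t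
        calc _ ≤ ‖v‖⁻¹ ^ 2 * (C * ‖v‖ + ‖v‖⁻¹ * (C * ‖v‖) ^ 2) := by gcongr
          _ = (C + C ^ 2) * (1 / ‖v‖) := by field_simp
          _ ≤ _ := by
            refine mul_le_mul_of_nonneg_left ?_ (by positivity)
            rw [div_le_div_iff₀ hvn hzn]
            have : ‖z‖ / 2 < ‖v‖ := hv.2
            linarith)
      (hwint.mul_const _)
      (Eventually.of_forall fun t v hv => by
        have hv0 := hzne v hv.1
        have d1 := hasDerivAt_inv hv0
        have d2 : HasDerivAt (fun v : ℂ => c t / v) (-(c t * v⁻¹ ^ 2)) v := by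
          refine (d1.const_mul (c t)).congr_deriv ?_
          field_simp
        have dR := (hRd _ (hmem v hv.1 t)).scomp v d2
        refine ((d1.smul dR).const_smul (w t)).congr_deriv ?_
        simp only [hG', Function.comp_apply]
        have e : (v ^ 2)⁻¹ = v⁻¹ ^ 2 := by simp
        rw [e]
        module)
    refine (main.2.const_smul K⁻¹).congr_deriv ?_
    simp only [hT']
    congr 1
    rw [parts z hz, ← integral_neg, ← integral_smul]
    congr 1; ext1 t
    simp only [hG']
    module
  · intro z hz f
    rw [(hRf 1 hone).1.mem_graph_iff]
    have hz0 := hzne z hz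
    have e1 : T z - T' z = K⁻¹ • ∫ t, w t • (z⁻¹ • ((1 - c t / z) • Rf (c t / z))) := by
      rw [hTe, hT']
      simp only
      have i1 : Integrable fun t => z⁻¹ • w t • Rf (c t / z) := (iR z hz).smul z⁻¹
      have i2 : Integrable fun t => z⁻¹ ^ 2 • w t • (c t • Rf (c t / z)) :=
        (icR z hz).smul (z⁻¹ ^ 2)
      rw [← smul_sub, ← integral_smul z⁻¹, ← integral_smul (z⁻¹ ^ 2), ← integral_sub i1 i2]
      congr 2; ext1 t
      simp only [div_eq_mul_inv]
      module
    -- Graph membership is tested through the resolvent at 1: (1 - λ) R(1) R(λ) = R(λ) - R(1), and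
    -- the term R(1) integrates to zero.
    have e2 : Rf 1 * (T z - T' z) = T z := by
      have hi : Integrable fun t => w t • (z⁻¹ • ((1 - c t / z) • Rf (c t / z))) := by
        have := ((iR z hz).smul z⁻¹).sub ((icR z hz).smul (z⁻¹ ^ 2))
        refine this.congr (Eventually.of_forall fun t => ?_)
        simp only [Pi.sub_apply, Pi.smul_apply, div_eq_mul_inv]
        module
      have hcomm := (ContinuousLinearMap.mul ℂ (X →L[ℂ] X) (Rf 1)).integral_comp_comm hi
      simp only [ContinuousLinearMap.mul_apply'] at hcomm
      have e3 : ∀ t, Rf 1 * (w t • (z⁻¹ • ((1 - c t / z) • Rf (c t / z)))) =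
          w t • (z⁻¹ • Rf (c t / z)) - w t • (z⁻¹ • Rf 1) := by
        intro t
        have := (hRf 1 hone).1.identity (hRf _ (hmem z hz t)).1
        have h' : (1 - c t / z) • (Rf 1 * Rf (c t / z)) = Rf (c t / z) - Rf 1 := by
          nth_rw 2 [this]
          module
        rw [mul_smul_comm, mul_smul_comm, mul_smul_comm, h']
        module
      rw [e1, mul_smul_comm, ← hcomm]
      simp_rw [e3]
      rw [integral_sub, integral_smul_const, hw0, zero_smul, sub_zero]
      · refine ((iR z hz).smul z⁻¹).congr (Eventually.of_forall fun t => ?_)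
        simp only [Pi.smul_apply]; rw [smul_comm]
      · exact hint _ ‖z⁻¹ • Rf 1‖ continuous_const fun t => le_rfl
    have := DFunLike.congr_fun e2 f
    simpa using this
  · intro z hz f g hfg
    rw [(hRf 1 hone).1.mem_graph_iff] at hfg ⊢
    have hcomm : Rf 1 * T z = T z * Rf 1 := by
      rw [hTe, mul_smul_comm, mul_smul_comm, smul_mul_assoc, smul_mul_assoc]
      have c1 := (ContinuousLinearMap.mul ℂ (X →L[ℂ] X) (Rf 1)).integral_comp_comm (iR z hz)
      have c2 := ((ContinuousLinearMap.mul ℂ (X →L[ℂ] X)).flip (Rf 1)).integral_comp_comm (iR z hz)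
      simp only [ContinuousLinearMap.mul_apply', ContinuousLinearMap.flip_apply] at c1 c2
      rw [← c1, ← c2]
      congr 3; ext1 t
      rw [mul_smul_comm, smul_mul_assoc, (hRf 1 hone).1.commute (hRf _ (hmem z hz t)).1]
    have := DFunLike.congr_fun hcomm ((1 : ℂ) • f - g)
    rw [mul_apply_eq_comp, mul_apply_eq_comp, hfg, map_sub, map_smul] at this
    exact this
  · -- strong continuity at the origin, first on the domain
    have hbd : ∀ z ∈ narrowSector η, ‖T z‖ ≤ ‖K⁻¹‖ * ∫ t, ‖w t‖ * C := by
      intro z hz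
      rw [hT, norm_smul]
      gcongr
      refine norm_integral_le_of_norm_le (hwint.mul_const C) (Eventually.of_forall fun t => ?_)
      rw [norm_smul, norm_smul, norm_inv]
      gcongr
      have hzn := norm_pos_iff.2 (hzne z hz)
      calc _ ≤ ‖z‖⁻¹ * (C * ‖z‖) := by gcongr; exact hRb1 z hz t
        _ = C := by field_simp
    set B := ‖K⁻¹‖ * ∫ t, ‖w t‖ * C with hB
    have hB0 : 0 ≤ B := by positivity
    -- Since λ R(λ) f - f = R(λ) g, the difference T(z) f - f is the integral of e^c c⁻¹ R(c/z) g,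
    -- which is O(‖z‖). The normalising constant is used here to write f itself as a contour
    -- integral.
    have hdom : ∀ f g, (f, g) ∈ A.graph → ∀ z ∈ narrowSector η,
        ‖T z f - f‖ ≤ ‖K⁻¹‖ * ∫ t, ‖w t‖ * (C * ‖z‖ * ‖g‖) := by
      intro f g hfg z hz
      have hz0 := hzne z hz
      have hcinv : Continuous fun t => (c t)⁻¹ := hcc.inv₀ hcne
      have hcinvb : ∀ t, ‖(c t)⁻¹‖ ≤ 1 := fun t => by
        rw [norm_inv]; exact inv_le_one_of_one_le₀ (hc1 t)
      have ii : Integrable fun t => w t • (c t)⁻¹ :=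
        integrable_exp_hyp_smul hη0 hη1.le hcinv hcinvb
      have e1 : f = K⁻¹ • ∫ t, w t • ((c t)⁻¹ • f) := by
        have : (fun t => w t • ((c t)⁻¹ • f)) = fun t => (w t / c t) • f := by
          ext1 t; rw [smul_smul, div_eq_mul_inv]
        rw [this, integral_smul_const, ← hK, smul_smul, inv_mul_cancel₀ hK0, one_smul]
      have iT : Integrable fun t => w t • (z⁻¹ • Rf (c t / z)) := by
        refine ((iR z hz).smul z⁻¹).congr (Eventually.of_forall fun t => ?_)
        simp only [Pi.smul_apply]; rw [smul_comm]
      have e2 : T z f = K⁻¹ • ∫ t, w t • (z⁻¹ • Rf (c t / z) f) := by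
        simp only [hT, smul_apply]
        rw [ContinuousLinearMap.integral_apply iT]
        rfl
      have i1 : Integrable fun t => w t • (z⁻¹ • Rf (c t / z) f) :=
        iT.apply_continuousLinearMap f
      have i2 : Integrable fun t => w t • ((c t)⁻¹ • f) := by
        refine (ii.smul_const f).congr (Eventually.of_forall fun t => ?_)
        simp only [smul_eq_mul]; rw [smul_smul]
      have e3 : T z f - f = K⁻¹ • ∫ t, w t • ((c t)⁻¹ • Rf (c t / z) g) := by
        nth_rw 2 [e1]
        rw [e2, ← smul_sub, ← integral_sub i1 i2]
        congr 2; ext1 t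
        have h' := (hRf _ (hmem z hz t)).1.mem_graph_iff.1 hfg
        rw [map_sub, map_smul] at h'
        have hct := hcne t
        have : (c t)⁻¹ • f = z⁻¹ • Rf (c t / z) f - (c t)⁻¹ • Rf (c t / z) g := by
          nth_rw 1 [← h']
          rw [smul_sub, smul_smul]
          congr 2
          field_simp
        rw [this]; module
      rw [e3, norm_smul]
      gcongr
      refine norm_integral_le_of_norm_le (hwint.mul_const _) (Eventually.of_forall fun t => ?_)
      rw [norm_smul, norm_smul]
      refine mul_le_mul_of_nonneg_left ?_ (norm_nonneg _)
      calc _ ≤ 1 * (C * ‖z‖ * ‖g‖) := by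
            gcongr
            · exact hcinvb t
            · exact ContinuousLinearMap.le_of_opNorm_le _ (hRb1 z hz t) g
        _ = _ := one_mul _
    refine tendsto_of_bounded_of_dense hdense (B := B) ?_ ?_
    · filter_upwards [self_mem_nhdsWithin] with z hz using hbd z hz
    · intro f hf
      obtain ⟨g, hg⟩ := LinearPMap.mem_domain_iff.1 hf
      have hlim : Tendsto (fun z : ℂ => ‖K⁻¹‖ * ∫ t, ‖w t‖ * (C * ‖z‖ * ‖g‖)) (𝓝 0) (𝓝 0) := by
        simp_rw [integral_mul_const]
        have : Continuous fun z : ℂ => ‖K⁻¹‖ * ((∫ t, ‖w t‖) * (C * ‖z‖ * ‖g‖)) := by fun_prop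
        simpa using this.tendsto 0
      rw [tendsto_iff_norm_sub_tendsto_zero]
      refine squeeze_zero' (Eventually.of_forall fun _ => norm_nonneg _) ?_
        (hlim.mono_left nhdsWithin_le_nhds)
      filter_upwards [self_mem_nhdsWithin] with z hz using hdom f g hg z hz

end Construction

/-! ### Strongly continuous semigroups: local bounds, orbits, generators. -/

namespace C0Semigroup

variable {X : Type*} [NormedAddCommGroup X] [NormedSpace ℂ X] (S : C0Semigroup X)

theorem commute (s t : NNReal) (f : X) : S.toFun s (S.toFun t f) = S.toFun t (S.toFun s f) := by
  rw [← ContinuousLinearMap.comp_apply, ← ContinuousLinearMap.comp_apply, ← S.map_add, ← S.map_add,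
    add_comm]

/-- Otherwise some t_n → 0 has ‖S(t_n)‖ → ∞, while every orbit along t_n converges; this contradicts
Banach–Steinhaus. -/
theorem exists_bound_near_zero [CompleteSpace X] :
    ∃ δ : NNReal, 0 < δ ∧ ∃ C : ℝ, 1 ≤ C ∧ ∀ t ≤ δ, ‖S.toFun t‖ ≤ C := by
  by_contra! hcon
  have h : ∀ n : ℕ, ∃ t : NNReal, t ≤ 1 / ((n : NNReal) + 1) ∧ (n : ℝ) + 1 < ‖S.toFun t‖ := fun n =>
    hcon (1 / (n + 1)) (by positivity) (n + 1) (by linarith [n.cast_nonneg (α := ℝ)])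
  choose t ht1 ht2 using h
  have ht0 : ∀ n, 0 < t n := by
    intro n
    rw [pos_iff_ne_zero]
    intro h0
    have := ht2 n
    rw [h0, S.map_zero] at this
    have h1 := ContinuousLinearMap.norm_id_le (𝕜 := ℂ) (E := X)
    linarith [n.cast_nonneg (α := ℝ)]
  have htl : Tendsto t atTop (𝓝[>] 0) := by
    rw [tendsto_nhdsWithin_iff]
    refine ⟨?_, Eventually.of_forall ht0⟩
    exact tendsto_of_tendsto_of_tendsto_of_le_of_le tendsto_const_nhds
      (tendsto_one_div_add_atTop_nhds_zero_nat (𝕜 := NNReal)) (fun _ => zero_le) ht1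
  obtain ⟨C, hC⟩ := banach_steinhaus (g := fun n => S.toFun (t n)) fun x => by
    obtain ⟨C, hC⟩ := ((S.tendsto_zero x).comp htl).norm.bddAbove_range
    exact ⟨C, fun n => hC ⟨n, rfl⟩⟩
  obtain ⟨n, hn⟩ := exists_nat_gt C
  linarith [hC n, ht2 n]

theorem exists_bound [CompleteSpace X] (t : NNReal) : ∃ C : ℝ, ∀ s ≤ t, ‖S.toFun s‖ ≤ C := by
  obtain ⟨δ, hδ, C, hC1, hC⟩ := S.exists_bound_near_zero
  have key : ∀ n : ℕ, ∀ s ≤ n * δ, ‖S.toFun s‖ ≤ C ^ (n + 1) := by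
    intro n
    induction n with
    | zero =>
      intro s hs
      simpa using hC s (by simpa using hs.trans (by simp))
    | succ n ih =>
      intro s hs
      rcases le_total s δ with h | h
      · exact (hC s h).trans (le_self_pow₀ hC1 (by simp))
      · have e : s = δ + (s - δ) := (add_tsub_cancel_of_le h).symm
        rw [e, S.map_add, pow_succ']
        refine (ContinuousLinearMap.opNorm_comp_le _ _).trans ?_
        gcongr
        · exact hC δ le_rfl
        · refine ih _ ?_
          rw [tsub_le_iff_right]
          push_cast at hs
          linarith
  obtain ⟨n, hn⟩ := exists_nat_gt (t / δ)
  refine ⟨C ^ (n + 1), fun s hs => key n s (hs.trans ?_)⟩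
  rw [div_lt_iff₀ hδ] at hn
  exact hn.le

theorem tendsto_zero' (f : X) : Tendsto (fun t => S.toFun t f) (𝓝 0) (𝓝 f) := by
  have h1 : Tendsto (fun t => S.toFun t f) (pure 0) (𝓝 f) := by
    rw [tendsto_pure_left]
    intro s hs
    simpa [S.map_zero] using mem_of_mem_nhds hs
  have : (𝓝 (0 : NNReal)) = pure 0 ⊔ 𝓝[>] 0 := by
    rw [← nhdsNE_sup_pure, sup_comm]
    congr 2
    ext x
    simp [pos_iff_ne_zero]
  rw [this]
  exact h1.sup (S.tendsto_zero f)

theorem continuous_apply [CompleteSpace X] (f : X) : Continuous fun t => S.toFun t f := by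
  rw [continuous_iff_continuousAt]
  intro t
  obtain ⟨C, hC⟩ := S.exists_bound (t + 1)
  have hC0 : 0 ≤ C := (norm_nonneg _).trans (hC 0 zero_le)
  have key : ∀ a b : NNReal, a ≤ t + 1 → a ≤ b →
      ‖S.toFun b f - S.toFun a f‖ ≤ C * ‖S.toFun (b - a) f - f‖ := by
    intro a b ha hab
    have e : S.toFun b f = S.toFun a (S.toFun (b - a) f) := by
      rw [← ContinuousLinearMap.comp_apply, ← S.map_add, add_tsub_cancel_of_le hab]
    rw [e, ← map_sub]
    exact ContinuousLinearMap.le_of_opNorm_le _ (hC a ha) _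
  rw [ContinuousAt, tendsto_iff_norm_sub_tendsto_zero]
  -- Subtraction of nonnegative reals is truncated, so this sum is |s - t|.
  have hd : Tendsto (fun s : NNReal => (s - t) + (t - s)) (𝓝 t) (𝓝 0) := by
    have : Continuous fun s : NNReal => (s - t) + (t - s) := by fun_prop
    simpa using this.tendsto t
  have hlim : Tendsto (fun s : NNReal => C * ‖S.toFun ((s - t) + (t - s)) f - f‖) (𝓝 t) (𝓝 0) := by
    have := ((((S.tendsto_zero' f).comp hd).sub_const f).norm).const_mul C
    simpa using this
  have hlt : ∀ᶠ s in 𝓝 t, s ≤ t + 1 := by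
    filter_upwards [Iio_mem_nhds (show t < t + 1 from lt_add_one t)] with s hs using le_of_lt hs
  refine squeeze_zero' (Eventually.of_forall fun _ => norm_nonneg _) ?_ hlim
  filter_upwards [hlt] with s hs
  rcases le_total s t with h | h
  · rw [norm_sub_rev, tsub_eq_zero_of_le h, zero_add]
    exact key s t hs h
  · rw [tsub_eq_zero_of_le h, add_zero]
    exact key t s (by simp) h

/-- Only the right derivative is available directly, from S(s) - S(t) = S(t)(S(s-t) - 1); it
suffices for the constancy arguments that follow. -/
theorem hasDerivWithinAt {f g : X}
    (h : Tendsto (fun t : NNReal => ((t : ℝ) : ℂ)⁻¹ • (S.toFun t f - f)) (𝓝[>] 0) (𝓝 g))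
    {t : ℝ} (ht : 0 ≤ t) :
    HasDerivWithinAt (fun t : ℝ => S.toFun t.toNNReal f) (S.toFun t.toNNReal g) (Ici t) t := by
  rw [hasDerivWithinAt_iff_tendsto_slope, Ici_sdiff_left]
  have hm : Tendsto (fun s : ℝ => (s - t).toNNReal) (𝓝[>] t) (𝓝[>] 0) := by
    rw [tendsto_nhdsWithin_iff]
    constructor
    · have : Continuous fun s : ℝ => (s - t).toNNReal := by fun_prop
      have := this.tendsto t
      simp only [sub_self, Real.toNNReal_zero] at this
      exact this.mono_left nhdsWithin_le_nhds
    · filter_upwards [self_mem_nhdsWithin] with s hs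
      simpa using hs
  have := ((S.toFun t.toNNReal).continuous.tendsto g).comp (h.comp hm)
  refine this.congr' ?_
  filter_upwards [self_mem_nhdsWithin] with s hs
  have hs : t < s := hs
  simp only [Function.comp_apply, map_smul, map_sub]
  rw [← ContinuousLinearMap.comp_apply, ← S.map_add, ← Real.toNNReal_add ht (by linarith),
    slope_def_module, Real.coe_toNNReal _ (by linarith : (0:ℝ) ≤ s - t), ← Complex.ofReal_inv]
  rw [add_sub_cancel, Complex.coe_smul]

theorem HasGenerator.map_mem_graph {S : C0Semigroup X} {A : X →ₗ.[ℂ] X} (hS : S.HasGenerator A)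
    {f g : X} (h : (f, g) ∈ A.graph) (s : NNReal) : (S.toFun s f, S.toFun s g) ∈ A.graph := by
  rw [hS] at h ⊢
  refine (((S.toFun s).continuous.tendsto g).comp h).congr fun t => ?_
  simp only [Function.comp_apply, map_smul, map_sub]
  rw [S.commute]

/-- An operator with a resolvent at `1` that extends the way a bounded semigroup differentiates
is its generator. -/
theorem hasGenerator_of_isResolventAt [CompleteSpace X] {A : X →ₗ.[ℂ] X} {R : X →L[ℂ] X}
    (hR : IsResolventAt A 1 R) {C : ℝ} (hC : ∀ t, ‖S.toFun t‖ ≤ C)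
    (hA : ∀ f g, (f, g) ∈ A.graph →
      Tendsto (fun t : NNReal => ((t : ℝ) : ℂ)⁻¹ • (S.toFun t f - f)) (𝓝[>] 0) (𝓝 g)) :
    S.HasGenerator A := by
  intro f g
  refine ⟨hA f g, fun h => ?_⟩
  have hm := hR.mem_graph (f - g)
  have h2 := hA _ _ hm
  set f' := R (f - g)
  -- The generator maps v to v, so e^(-t) S(t) v is constant; boundedness of S leaves only v = 0,
  -- and hence f lies in the domain of A.
  set v := f - f' with hv
  have h3 : Tendsto (fun t : NNReal => ((t : ℝ) : ℂ)⁻¹ • (S.toFun t v - v)) (𝓝[>] 0) (𝓝 v) := by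
    have e : v = g - ((1 : ℂ) • f' - (f - g)) := by rw [hv]; module
    have := h.sub h2
    rw [← e] at this
    refine this.congr fun t => ?_
    rw [hv, map_sub]; module
  have hconst : ∀ t : ℝ, 0 ≤ t → Real.exp (-t) • S.toFun t.toNNReal v = v := by
    intro t ht
    have hcont : Continuous fun t : ℝ => Real.exp (-t) • S.toFun t.toNNReal v := by
      have := (S.continuous_apply v).comp continuous_real_toNNReal
      exact (Real.continuous_exp.comp continuous_neg).smul this
    have := constant_of_has_deriv_right_zero (a := 0) (b := t) hcont.continuousOn
      (fun s hs => by
        have d1 : HasDerivAt (fun t : ℝ => Real.exp (-t)) (-Real.exp (-s)) s := by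
          simpa using (hasDerivAt_neg s).exp
        refine (d1.hasDerivWithinAt.smul (S.hasDerivWithinAt h3 hs.1)).congr_deriv ?_
        module) t ⟨ht, le_rfl⟩
    simpa [S.map_zero] using this
  have hv0 : v = 0 := by
    by_contra hne
    have hvp : 0 < ‖v‖ := norm_pos_iff.2 hne
    have hb : ∀ t : ℝ, 0 ≤ t → Real.exp t ≤ C := by
      intro t ht
      have e := hconst t ht
      have h1 : ‖v‖ ≤ Real.exp (-t) * (C * ‖v‖) := by
        calc ‖v‖ = ‖Real.exp (-t) • S.toFun t.toNNReal v‖ := by rw [e]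
          _ = Real.exp (-t) * ‖S.toFun t.toNNReal v‖ := by
            rw [norm_smul, Real.norm_of_nonneg (Real.exp_pos _).le]
          _ ≤ _ := by
            gcongr
            exact ContinuousLinearMap.le_of_opNorm_le _ (hC _) v
      rw [Real.exp_neg, ← div_eq_inv_mul, le_div_iff₀ (Real.exp_pos t)] at h1
      nlinarith
    have h1 := hb (max C 0) (le_max_right _ _)
    have h2 := Real.add_one_le_exp (max C 0)
    linarith [le_max_left C 0]
  have e : f = f' := sub_eq_zero.1 hv0
  have : (f', (1 : ℂ) • f' - (f - g)) = (f, g) := by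
    rw [← e]; congr 1; module
  rwa [this] at hm

end C0Semigroup

/-! ### From the holomorphic family to an analytic semigroup. -/

section Generation

theorem narrowSector_add {κ : ℝ} {z w : ℂ} (hz : z ∈ narrowSector κ) (hw : w ∈ narrowSector κ) :
    z + w ∈ narrowSector κ := by
  have hz : |z.im| < κ * z.re := hz
  have hw : |w.im| < κ * w.re := hw
  change |(z + w).im| < κ * (z + w).re
  rw [Complex.add_im, Complex.add_re]
  linarith [abs_add_le z.im w.im]

theorem narrowSector_smul {κ r : ℝ} {z : ℂ} (hr : 0 < r) (hz : z ∈ narrowSector κ) :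
    r • z ∈ narrowSector κ := by
  have hz : |z.im| < κ * z.re := hz
  change |(r • z).im| < κ * (r • z).re
  rw [Complex.smul_im, Complex.smul_re, smul_eq_mul, smul_eq_mul, abs_mul, abs_of_pos hr]
  nlinarith

theorem ofReal_mem_narrowSector {κ t : ℝ} (hκ : 0 < κ) (ht : 0 < t) : (t : ℂ) ∈ narrowSector κ := by
  simp [narrowSector]; positivity

theorem openSector_subset_narrowSector {κ : ℝ} :
    openSector (Real.arctan κ) ⊆ narrowSector κ := by
  rintro z ⟨hz0, hz⟩
  have hpi := Real.arctan_lt_pi_div_two κ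
  have hre : 0 < z.re := by
    have := (Complex.abs_arg_lt_pi_div_two_iff (z := z)).1 (hz.trans hpi)
    exact this.resolve_right hz0
  have h1 := (abs_lt.1 hz)
  have hlt : |Real.tan z.arg| < κ := by
    rw [abs_lt]
    constructor
    · have := Real.tan_lt_tan_of_lt_of_lt_pi_div_two (by linarith) (by linarith) h1.1
      rwa [Real.tan_neg, Real.tan_arctan] at this
    · have := Real.tan_lt_tan_of_lt_of_lt_pi_div_two (by linarith) (by linarith) h1.2
      rwa [Real.tan_arctan] at this
  rw [Complex.tan_arg, abs_div, abs_of_pos hre, div_lt_iff₀ hre] at hlt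
  exact hlt

variable {X : Type*} [NormedAddCommGroup X] [NormedSpace ℂ X] {A : X →ₗ.[ℂ] X}
  {κ B : ℝ} {T T' : ℂ → X →L[ℂ] X}

/-- Both sides are values of the single-valued operator A at T(z) f. -/
theorem family_deriv_mul (hgr : ∀ z ∈ narrowSector κ, ∀ f, (T z f, T' z f) ∈ A.graph)
    (hcomm : ∀ z ∈ narrowSector κ, ∀ f g, (f, g) ∈ A.graph → (T z f, T z g) ∈ A.graph)
    {z : ℂ} (hz : z ∈ narrowSector κ) {f g : X} (h : (f, g) ∈ A.graph) : T' z f = T z g :=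
  A.mem_graph_snd_inj (hgr z hz f) (hcomm z hz f g h) rfl

/-- The product T((1-s)z) T(w+sz) is constant for 0 ≤ s < 1: at s = 0 it is T(z) T(w), and as s → 1
it tends strongly to T(z+w), the first factor being bounded and strongly convergent to 1. -/
theorem family_add (hB : ∀ z ∈ narrowSector κ, ‖T z‖ ≤ B)
    (hder : ∀ z ∈ narrowSector κ, HasDerivAt T (T' z) z)
    (hgr : ∀ z ∈ narrowSector κ, ∀ f, (T z f, T' z f) ∈ A.graph)
    (hcomm : ∀ z ∈ narrowSector κ, ∀ f g, (f, g) ∈ A.graph → (T z f, T z g) ∈ A.graph)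
    (hlim : ∀ f, Tendsto (fun z => T z f) (𝓝[narrowSector κ] 0) (𝓝 f))
    {z w : ℂ} (hz : z ∈ narrowSector κ) (hw : w ∈ narrowSector κ) :
    T (z + w) = (T z).comp (T w) := by
  have hm1 : ∀ s : ℝ, s < 1 → (1 - s) • z ∈ narrowSector κ := fun s hs =>
    narrowSector_smul (by linarith) hz
  have hm2 : ∀ s : ℝ, 0 ≤ s → w + s • z ∈ narrowSector κ := by
    intro s hs
    rcases hs.eq_or_lt with rfl | hs
    · simpa using hw
    · exact narrowSector_add hw (narrowSector_smul hs hz)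
  set H : ℝ → X →L[ℂ] X := fun s => T ((1 - s) • z) * T (w + s • z) with hH
  have hHd : ∀ s : ℝ, 0 ≤ s → s < 1 → HasDerivAt H 0 s := by
    intro s h0 h1
    have p1 : HasDerivAt (fun s : ℝ => (1 - s) • z) (-z) s := by
      simpa using ((hasDerivAt_id s).const_sub 1).smul_const z
    have p2 : HasDerivAt (fun s : ℝ => w + s • z) z s := by
      simpa using ((hasDerivAt_id s).smul_const z).const_add w
    have d1 := (hder _ (hm1 s h1)).scomp s p1
    have d2 := (hder _ (hm2 s h0)).scomp s p2
    refine (d1.mul d2).congr_deriv ?_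
    -- Both products are T · A · T, because T commutes with A; this makes the two terms of the
    -- product rule cancel.
    have e : T' ((1 - s) • z) * T (w + s • z) = T ((1 - s) • z) * T' (w + s • z) := by
      ext f
      exact family_deriv_mul hgr hcomm (hm1 s h1) (hgr _ (hm2 s h0) f)
    simp only [Function.comp_apply]
    rw [smul_mul_assoc, mul_smul_comm, e]
    module
  have hconst : ∀ s : ℝ, 0 ≤ s → s < 1 → H s = T z * T w := by
    intro s h0 h1
    have := constant_of_has_deriv_right_zero (f := H) (a := 0) (b := s)
      (fun r hr => (hHd r hr.1 (hr.2.trans_lt h1)).continuousAt.continuousWithinAt)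
      (fun r hr => (hHd r hr.1 (hr.2.trans h1)).hasDerivWithinAt) s ⟨h0, le_rfl⟩
    rw [this, hH]; simp
  ext f
  have htend : Tendsto (fun s : ℝ => H s f) (𝓝[<] 1) (𝓝 (T (z + w) f)) := by
    have c1 : Tendsto (fun s : ℝ => (1 - s) • z) (𝓝[<] 1) (𝓝[narrowSector κ] 0) := by
      rw [tendsto_nhdsWithin_iff]
      constructor
      · have : Continuous fun s : ℝ => (1 - s) • z := by fun_prop
        have := this.tendsto 1
        simp only [sub_self, zero_smul] at this
        exact this.mono_left nhdsWithin_le_nhds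
      · filter_upwards [self_mem_nhdsWithin] with s hs using hm1 s hs
    have c2 : Tendsto (fun s : ℝ => T (w + s • z) f) (𝓝[<] 1) (𝓝 (T (z + w) f)) := by
      have hc : ContinuousAt (fun s : ℝ => T (w + s • z)) 1 := by
        have h1 := (hder _ (hm2 1 zero_le_one)).continuousAt
        exact ContinuousAt.comp (f := fun s : ℝ => w + s • z) h1 (by fun_prop)
      have h2 : Tendsto (fun s : ℝ => T (w + s • z)) (𝓝[<] 1) (𝓝 (T (z + w))) := by
        have := hc.tendsto
        simp only [one_smul, add_comm w z] at this
        simpa only [add_comm w] using this.mono_left nhdsWithin_le_nhds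
      exact ((ContinuousLinearMap.apply ℂ X f).continuous.tendsto _).comp h2
    have c3 := (hlim (T (z + w) f)).comp c1
    have c4 : Tendsto (fun s : ℝ => T ((1 - s) • z) (T (w + s • z) f - T (z + w) f)) (𝓝[<] 1) (𝓝 0) := by
      refine squeeze_zero_norm' (a := fun s : ℝ => B * ‖T (w + s • z) f - T (z + w) f‖) ?_ ?_
      · filter_upwards [self_mem_nhdsWithin] with s hs
        exact ContinuousLinearMap.le_of_opNorm_le _ (hB _ (hm1 s hs)) _
      · have := (c2.sub_const (T (z + w) f)).norm.const_mul B
        simpa using this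
    have := c3.add c4
    rw [add_zero] at this
    refine this.congr fun s => ?_
    simp only [Function.comp_apply, hH, map_sub, mul_apply_eq_comp]
    abel
  refine tendsto_nhds_unique htend ?_
  refine tendsto_const_nhds.congr' ?_
  have : Ioo (0 : ℝ) 1 ∈ 𝓝[<] (1 : ℝ) := Ioo_mem_nhdsLT one_pos
  filter_upwards [this] with s hs
  rw [hconst s hs.1.le hs.2]; rfl

/-- A semigroup with generator `A` coincides with any holomorphic family differentiating like it. -/
theorem C0Semigroup.HasGenerator.eq_family [CompleteSpace X] {S : C0Semigroup X} (hS : S.HasGenerator A)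
    (hdense : Dense (A.domain : Set X)) (hκ : 0 < κ) (hB : ∀ z ∈ narrowSector κ, ‖T z‖ ≤ B)
    (hder : ∀ z ∈ narrowSector κ, HasDerivAt T (T' z) z)
    (hgr : ∀ z ∈ narrowSector κ, ∀ f, (T z f, T' z f) ∈ A.graph)
    (hcomm : ∀ z ∈ narrowSector κ, ∀ f g, (f, g) ∈ A.graph → (T z f, T z g) ∈ A.graph)
    (hlim : ∀ f, Tendsto (fun z => T z f) (𝓝[narrowSector κ] 0) (𝓝 f))
    {t : NNReal} (ht : 0 < t) : T ((t : ℝ) : ℂ) = S.toFun t := by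
  have ht' : (0 : ℝ) < t := ht
  have hdom : ∀ f ∈ A.domain, T ((t : ℝ) : ℂ) f = S.toFun t f := by
    intro f hf
    obtain ⟨g, hfg⟩ := LinearPMap.mem_domain_iff.1 hf
    have hm : ∀ s : ℝ, s < t → ((t - s : ℝ) : ℂ) ∈ narrowSector κ := fun s hs =>
      ofReal_mem_narrowSector hκ (by linarith)
    set u : ℝ → X := fun s => S.toFun s.toNNReal f with hu
    have huc : Continuous u := (S.continuous_apply f).comp continuous_real_toNNReal
    -- Constancy of s ↦ T(t-s) S(s) f on [0,t) compares the two evolutions: the value at 0 is T(t) f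
    -- and the limit at t is S(t) f.
    set H : ℝ → X := fun s => T ((t - s : ℝ) : ℂ) (u s) with hH
    -- Operators are viewed as real-linear so that the product rule for an operator applied to a
    -- vector is available in a real variable.
    set Lr := ContinuousLinearMap.restrictScalarsL ℂ X X ℝ ℝ
    have hTd : ∀ s : ℝ, s < t → HasDerivAt (fun s : ℝ => Lr (T ((t - s : ℝ) : ℂ)))
        (Lr (-T' ((t - s : ℝ) : ℂ))) s := by
      intro s hs
      have p : HasDerivAt (fun s : ℝ => ((t - s : ℝ) : ℂ)) (((-1 : ℝ) : ℂ)) s :=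
        ((hasDerivAt_id s).const_sub (t : ℝ)).ofReal_comp
      have := Lr.hasFDerivAt.comp_hasDerivAt s ((hder _ (hm s hs)).scomp s p)
      refine this.congr_deriv ?_
      simp
    have hHd : ∀ s ∈ Ico (0 : ℝ) t, HasDerivWithinAt H 0 (Ici s) s := by
      intro s hs
      have d := (hTd s hs.2).hasDerivWithinAt (s := Ici s) |>.clm_apply
        (S.hasDerivWithinAt ((hS f g).1 hfg) hs.1)
      refine d.congr_deriv ?_
      have := family_deriv_mul hgr hcomm (hm s hs.2) (hS.map_mem_graph hfg s.toNNReal)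
      change -(T' ((t - s : ℝ) : ℂ)) (S.toFun s.toNNReal f) +
        T ((t - s : ℝ) : ℂ) (S.toFun s.toNNReal g) = 0
      rw [this]
      simp
    have hHc : ContinuousOn H (Ico 0 t) := by
      intro s hs
      exact ContinuousAt.continuousWithinAt
        (ContinuousAt.clm_apply (f := fun s : ℝ => Lr (T ((t - s : ℝ) : ℂ)))
          (hTd s hs.2).continuousAt huc.continuousAt)
    have hconst : ∀ s : ℝ, 0 ≤ s → s < t → H s = T ((t : ℝ) : ℂ) f := by
      intro s h0 h1
      have := constant_of_has_deriv_right_zero (f := H) (a := 0) (b := s)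
        (hHc.mono fun r hr => ⟨hr.1, hr.2.trans_lt h1⟩)
        (fun r hr => hHd r ⟨hr.1, hr.2.trans h1⟩) s ⟨h0, le_rfl⟩
      rw [this, hH, hu]; simp [S.map_zero]
    have c1 : Tendsto (fun s : ℝ => ((t - s : ℝ) : ℂ)) (𝓝[<] (t : ℝ)) (𝓝[narrowSector κ] 0) := by
      rw [tendsto_nhdsWithin_iff]
      constructor
      · have : Continuous fun s : ℝ => ((t - s : ℝ) : ℂ) := by fun_prop
        have := this.tendsto t
        simp only [sub_self, Complex.ofReal_zero] at this
        exact this.mono_left nhdsWithin_le_nhds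
      · filter_upwards [self_mem_nhdsWithin] with s hs using hm s hs
    have c2 : Tendsto u (𝓝[<] (t : ℝ)) (𝓝 (S.toFun t f)) := by
      have := huc.tendsto t
      simp only [hu, Real.toNNReal_coe] at this
      exact this.mono_left nhdsWithin_le_nhds
    have c3 := (hlim (S.toFun t f)).comp c1
    have c4 : Tendsto (fun s : ℝ => T ((t - s : ℝ) : ℂ) (u s - S.toFun t f)) (𝓝[<] (t : ℝ)) (𝓝 0) := by
      refine squeeze_zero_norm' (a := fun s : ℝ => B * ‖u s - S.toFun t f‖) ?_ ?_
      · filter_upwards [self_mem_nhdsWithin] with s hs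
        exact ContinuousLinearMap.le_of_opNorm_le _ (hB _ (hm s hs)) _
      · have := (c2.sub_const (S.toFun t f)).norm.const_mul B
        simpa using this
    have htend : Tendsto H (𝓝[<] (t : ℝ)) (𝓝 (S.toFun t f)) := by
      have := c3.add c4
      rw [add_zero] at this
      refine this.congr fun s => ?_
      simp only [Function.comp_apply, hH, map_sub]
      abel
    refine (tendsto_nhds_unique htend (tendsto_const_nhds.congr' ?_)).symm
    filter_upwards [Ioo_mem_nhdsLT ht'] with s hs
    rw [hconst s hs.1.le hs.2]
  have := Continuous.ext_on hdense (T ((t : ℝ) : ℂ)).continuous (S.toFun t).continuous hdom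
  exact DFunLike.coe_injective this

/-- An operator with dense domain whose resolvent is bounded by `M / |z|` on the closed right half
plane generates a strongly continuous semigroup, and that semigroup is analytic. -/
theorem exists_analytic_semigroup [CompleteSpace X] {M : ℝ} (hM : 0 < M)
    (hres : ∀ z : ℂ, 0 ≤ z.re → ∃ R : X →L[ℂ] X, IsResolventAt A z R ∧ (z ≠ 0 → ‖R‖ ≤ M / ‖z‖))
    (hdense : Dense (A.domain : Set X)) :
    (∃ S : C0Semigroup X, S.HasGenerator A) ∧
      ∀ S : C0Semigroup X, S.HasGenerator A → S.IsAnalytic := by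
  obtain ⟨ε, h0, h1, Rf, hRf⟩ := exists_resolvent_wideSector hM hres
  obtain ⟨T, T', B, hB, hder, hgr, hcomm, hlim⟩ := exists_holomorphic_family h0 h1 hRf hdense
  set κ := ε / 4 with hκd
  have hκ : 0 < κ := by positivity
  have hadd : ∀ z ∈ narrowSector κ, ∀ w ∈ narrowSector κ, T (z + w) = (T z).comp (T w) :=
    fun z hz w hw => family_add hB hder hgr hcomm hlim hz hw
  have hm : ∀ t : NNReal, 0 < t → ((t : ℝ) : ℂ) ∈ narrowSector κ := fun t ht =>
    ofReal_mem_narrowSector hκ ht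
  have hcoe : Tendsto (fun t : NNReal => ((t : ℝ) : ℂ)) (𝓝[>] 0) (𝓝[narrowSector κ] 0) := by
    rw [tendsto_nhdsWithin_iff]
    constructor
    · have : Continuous fun t : NNReal => ((t : ℝ) : ℂ) := by fun_prop
      have := this.tendsto 0
      simp only [NNReal.coe_zero, Complex.ofReal_zero] at this
      exact this.mono_left nhdsWithin_le_nhds
    · filter_upwards [self_mem_nhdsWithin] with t ht using hm t ht
  refine ⟨?_, fun S hS => ?_⟩
  · let S : C0Semigroup X :=
      { toFun := fun t => if t = 0 then ContinuousLinearMap.id ℂ X else T ((t : ℝ) : ℂ)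
        map_zero := by simp
        map_add := by
          intro s t
          rcases eq_or_ne s 0 with rfl | hs
          · simp
          rcases eq_or_ne t 0 with rfl | ht
          · simp
          have hst : s + t ≠ 0 := by simp [hs]
          simp only [hs, ht, hst, if_false]
          rw [← hadd _ (hm s (pos_iff_ne_zero.2 hs)) _ (hm t (pos_iff_ne_zero.2 ht))]
          push_cast; rfl
        tendsto_zero := by
          intro f
          refine ((hlim f).comp hcoe).congr' ?_
          filter_upwards [self_mem_nhdsWithin] with t ht
          have ht : 0 < t := ht
          simp [ht.ne'] }
    have hSt : ∀ t : NNReal, 0 < t → S.toFun t = T ((t : ℝ) : ℂ) := fun t ht => by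
      simp [S, ht.ne']
    refine ⟨S, S.hasGenerator_of_isResolventAt (hRf 1 ⟨one_ne_zero, by simp; linarith⟩).1
      (C := max B 1) (fun t => ?_) (fun f g hfg => ?_)⟩
    · rcases eq_or_ne t 0 with rfl | ht
      · rw [S.map_zero]
        exact ContinuousLinearMap.norm_id_le.trans (le_max_right _ _)
      · have ht := pos_iff_ne_zero.2 ht
        rw [hSt t ht]
        exact (hB _ (hm t ht)).trans (le_max_left _ _)
    · set F : ℝ → X := fun t => S.toFun t.toNNReal f with hF
      have hFd : ∀ t : ℝ, 0 < t → HasDerivAt F (T (t : ℂ) g) t := by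
        intro t ht
        have hmt := ofReal_mem_narrowSector hκ ht
        have d : HasDerivAt (fun z => T z f) (T (t : ℂ) g) (t : ℂ) := by
          rw [← family_deriv_mul hgr hcomm hmt hfg]
          exact ((ContinuousLinearMap.apply ℂ X f).hasFDerivAt.comp_hasDerivAt (t : ℂ) (hder _ hmt))
        have := d.scomp t (Complex.ofRealCLM.hasDerivAt (x := t))
        refine (this.congr_of_eventuallyEq ?_).congr_deriv (by simp)
        filter_upwards [Ioi_mem_nhds ht] with s hs
        have hs : 0 < s := hs
        rw [hF]
        simp only
        rw [hSt _ (by simpa using hs), Real.coe_toNNReal _ hs.le]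
        rfl
      -- The derivative T(t) g of the orbit tends to g as t ↓ 0, so the orbit has right derivative g
      -- at 0.
      have hd := hasDerivWithinAt_Ici_of_tendsto_deriv (f := F) (s := Ioi 0) (a := 0) (e := g)
        (fun t ht => (hFd t ht).differentiableAt.differentiableWithinAt)
        (((S.continuous_apply f).comp continuous_real_toNNReal).continuousWithinAt)
        self_mem_nhdsWithin (by
          have hc : Tendsto (fun t : ℝ => (t : ℂ)) (𝓝[>] 0) (𝓝[narrowSector κ] 0) := by
            rw [tendsto_nhdsWithin_iff]
            constructor
            · have := Complex.continuous_ofReal.tendsto 0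
              simp only [Complex.ofReal_zero] at this
              exact this.mono_left nhdsWithin_le_nhds
            · filter_upwards [self_mem_nhdsWithin] with t ht using ofReal_mem_narrowSector hκ ht
          refine ((hlim g).comp hc).congr' ?_
          filter_upwards [self_mem_nhdsWithin] with t ht
          exact (hFd t ht).deriv.symm)
      rw [hasDerivWithinAt_iff_tendsto_slope, Ici_sdiff_left] at hd
      have hco : Tendsto (fun t : NNReal => (t : ℝ)) (𝓝[>] 0) (𝓝[>] 0) := by
        rw [tendsto_nhdsWithin_iff]
        constructor
        · have := NNReal.continuous_coe.tendsto 0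
          simp only [NNReal.coe_zero] at this
          exact this.mono_left nhdsWithin_le_nhds
        · filter_upwards [self_mem_nhdsWithin] with t ht using ht
      refine (hd.comp hco).congr fun t => ?_
      simp only [Function.comp_apply, slope_def_module, hF, Real.toNNReal_coe, Real.toNNReal_zero,
        S.map_zero, sub_zero]
      rw [← Complex.ofReal_inv, Complex.coe_smul]; rfl
  · have hsub := openSector_subset_narrowSector (κ := κ)
    -- The sector of half-angle arctan κ is contained in {|Im z| < κ Re z}, where T is defined.
    refine ⟨Real.arctan κ, by rw [← Real.arctan_zero]; exact Real.arctan_strictMono hκ,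
      (Real.arctan_lt_pi_div_two κ).le, T, ?_, ?_, ?_, ?_⟩
    · intro t ht
      exact hS.eq_family hdense hκ hB hder hgr hcomm hlim ht
    · exact fun z hz w hw => hadd z (hsub hz) w (hsub hw)
    · exact fun z hz => (hder z (hsub hz)).differentiableAt.differentiableWithinAt
    · intro δ' _ hδ' f
      refine (hlim f).mono_left (nhdsWithin_mono _ (Subset.trans ?_ hsub))
      exact fun z hz => ⟨hz.1, hz.2.trans hδ'⟩

end Generation

/-! ### Fractional kernels and the Mittag-Leffler series. -/

section MittagLeffler

/-- The kernel `x^(a - 1) / Γ(a)` of the fractional integral of order `a`. -/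
def rlKernel (a x : ℝ) : ℝ := x ^ (a - 1) / Real.Gamma a

/-- The two-parameter Mittag-Leffler function. -/
def mittagLeffler (α b : ℝ) (z : ℂ) : ℂ := ∑' n : ℕ, z ^ n / (Real.Gamma (α * n + b) : ℂ)

/-- The function `x^(b - 1) E_{α,b}(l x^α)`. -/
def mlKernel (α b : ℝ) (l : ℂ) (x : ℝ) : ℂ :=
  ((x ^ (b - 1) : ℝ) : ℂ) * mittagLeffler α b (l * ((x ^ α : ℝ) : ℂ))

theorem rlKernel_nonneg {a x : ℝ} (ha : 0 < a) (hx : 0 ≤ x) : 0 ≤ rlKernel a x :=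
  div_nonneg (Real.rpow_nonneg hx _) (Real.Gamma_pos_of_pos ha).le

theorem rlKernel_pos {a x : ℝ} (ha : 0 < a) (hx : 0 < x) : 0 < rlKernel a x :=
  div_pos (Real.rpow_pos_of_pos hx _) (Real.Gamma_pos_of_pos ha)

theorem continuousOn_rlKernel (a : ℝ) : ContinuousOn (rlKernel a) (Ioi 0) := fun x hx =>
  ((Real.continuousAt_rpow_const x _ (Or.inl (ne_of_gt hx))).div_const _).continuousWithinAt

theorem measurable_rlKernel (a : ℝ) : Measurable (rlKernel a) := by
  unfold rlKernel; fun_prop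

/-- The semigroup law of the fractional integral kernels. -/
theorem integral_rlKernel_mul {a b x : ℝ} (ha : 0 < a) (hb : 0 < b) (hx : 0 < x) :
    ∫ s in (0 : ℝ)..x, rlKernel a (x - s) * rlKernel b s = rlKernel (a + b) x := by
  have h := Complex.betaIntegral_scaled (b : ℂ) (a : ℂ) hx
  rw [Complex.betaIntegral_eq_Gamma_mul_div _ _ (by simpa using hb) (by simpa using ha)] at h
  have e : (∫ s in (0 : ℝ)..x, (s : ℂ) ^ ((b : ℂ) - 1) * ((x : ℂ) - s) ^ ((a : ℂ) - 1)) =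
      ((∫ s in (0 : ℝ)..x, s ^ (b - 1) * (x - s) ^ (a - 1) : ℝ) : ℂ) := by
    rw [← intervalIntegral.integral_ofReal]
    apply intervalIntegral.integral_congr
    intro s hs
    rw [uIcc_of_le hx.le] at hs
    simp only
    rw [Complex.ofReal_mul, Complex.ofReal_cpow hs.1, Complex.ofReal_cpow (by linarith [hs.2])]
    push_cast; rfl
  have e2 : ((x : ℂ) ^ ((b : ℂ) + a - 1) * (Complex.Gamma b * Complex.Gamma a / Complex.Gamma (b + a)))
      = ((x ^ (b + a - 1) * (Real.Gamma b * Real.Gamma a / Real.Gamma (b + a)) : ℝ) : ℂ) := by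
    push_cast
    rw [Complex.ofReal_cpow hx.le, Complex.Gamma_ofReal, Complex.Gamma_ofReal, ← Complex.ofReal_add,
      Complex.Gamma_ofReal]
    push_cast; rfl
  rw [e, e2] at h
  have h := Complex.ofReal_injective h
  have ga := (Real.Gamma_pos_of_pos ha).ne'
  have gb := (Real.Gamma_pos_of_pos hb).ne'
  have hs : ∀ s, rlKernel a (x - s) * rlKernel b s =
      (Real.Gamma a * Real.Gamma b)⁻¹ * (s ^ (b - 1) * (x - s) ^ (a - 1)) := by
    intro s; unfold rlKernel; field_simp
  simp_rw [hs]
  rw [intervalIntegral.integral_const_mul, h, rlKernel, add_comm b a]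
  field_simp

/-- A nonintegrable function has integral 0 by convention, whereas this integral is positive. -/
theorem intervalIntegrable_rlKernel_mul {a b x : ℝ} (ha : 0 < a) (hb : 0 < b) (hx : 0 < x) :
    IntervalIntegrable (fun s => rlKernel a (x - s) * rlKernel b s) volume 0 x := by
  apply intervalIntegral.intervalIntegrable_of_integral_ne_zero
  rw [integral_rlKernel_mul ha hb hx]
  exact (rlKernel_pos (by linarith) hx).ne'

variable {α b : ℝ}

theorem summable_mittagLeffler (hα : 1 < α) (hb : 0 < b) (r : ℝ) :
    Summable fun n : ℕ => r ^ n / Real.Gamma (α * n + b) := by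
  -- Dropping two terms puts the arguments of Γ into [2,∞), where Γ is increasing; there Γ(α(n+2)+b)
  -- ≥ Γ(n+2) ≥ n! compares with the exponential series.
  rw [← summable_norm_iff, ← summable_nat_add_iff 2]
  refine Summable.of_nonneg_of_le (fun n => norm_nonneg _) (fun n => ?_)
    ((Real.summable_pow_div_factorial |r|).mul_left (|r| ^ 2))
  have hG : (n.factorial : ℝ) ≤ Real.Gamma (α * (n + 2 : ℕ) + b) := by
    have h1 : ((n : ℝ) + 2) ≤ α * (n + 2 : ℕ) + b := by
      push_cast
      have : 0 ≤ (n : ℝ) := n.cast_nonneg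
      nlinarith
    have h2 := Real.Gamma_strictMonoOn_Ici.monotoneOn (show (n : ℝ) + 2 ∈ Ici 2 by simp)
      (show α * (n + 2 : ℕ) + b ∈ Ici 2 by
        have : 0 ≤ (n : ℝ) := n.cast_nonneg
        simp only [mem_Ici]; linarith) h1
    refine le_trans ?_ h2
    have : ((n : ℝ) + 2) = ((n + 1 : ℕ) : ℝ) + 1 := by push_cast; ring
    rw [this, Real.Gamma_nat_eq_factorial]
    exact_mod_cast Nat.factorial_le (Nat.le_succ n)
  have hf : (0 : ℝ) < n.factorial := by exact_mod_cast n.factorial_pos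
  rw [norm_div, norm_pow, Real.norm_eq_abs, Real.norm_of_nonneg (hf.le.trans hG), pow_add, mul_comm,
    mul_div_assoc]
  gcongr

theorem hasSum_mittagLeffler (hα : 1 < α) (hb : 0 < b) (z : ℂ) :
    HasSum (fun n : ℕ => z ^ n / (Real.Gamma (α * n + b) : ℂ)) (mittagLeffler α b z) := by
  refine Summable.hasSum (Summable.of_norm ?_)
  refine (summable_mittagLeffler hα hb ‖z‖).congr fun n => ?_
  rw [norm_div, norm_pow, Complex.norm_real, Real.norm_of_nonneg]
  exact (Real.Gamma_pos_of_pos (by have := n.cast_nonneg (α := ℝ); positivity)).le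

theorem continuous_mittagLeffler (hα : 1 < α) (hb : 0 < b) : Continuous (mittagLeffler α b) := by
  rw [continuous_iff_continuousAt]
  intro z
  have : ContinuousOn (mittagLeffler α b) (Metric.ball 0 (‖z‖ + 1)) := by
    refine continuousOn_tsum (u := fun n : ℕ => (‖z‖ + 1) ^ n / Real.Gamma (α * n + b))
      (fun n => by fun_prop) (summable_mittagLeffler hα hb _) fun n w hw => ?_
    rw [mem_ball_zero_iff] at hw
    have hG := (Real.Gamma_pos_of_pos
      (show 0 < α * n + b by have := n.cast_nonneg (α := ℝ); positivity))
    rw [norm_div, norm_pow, Complex.norm_real, Real.norm_of_nonneg hG.le]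
    gcongr
  exact this.continuousAt (Metric.isOpen_ball.mem_nhds (by simp))

theorem mittagLeffler_zero (α b : ℝ) : mittagLeffler α b 0 = ((Real.Gamma b)⁻¹ : ℝ) := by
  unfold mittagLeffler
  rw [tsum_eq_single 0]
  · simp
  · intro n hn; simp [hn]

/-- Expansion in fractional kernels, whose orders add under convolution: convolution identities and
Laplace transforms of Mittag-Leffler kernels become termwise computations. -/
theorem hasSum_mlKernel (hα : 1 < α) (hb : 0 < b) (l : ℂ) {x : ℝ} (hx : 0 < x) :
    HasSum (fun n : ℕ => l ^ n * (rlKernel (α * n + b) x : ℂ)) (mlKernel α b l x) := by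
  refine ((hasSum_mittagLeffler hα hb (l * ((x ^ α : ℝ) : ℂ))).mul_left
    ((x ^ (b - 1) : ℝ) : ℂ)).congr_fun fun n => ?_
  have e : x ^ (α * n + b - 1) = x ^ (b - 1) * (x ^ α) ^ n := by
    rw [← Real.rpow_natCast, ← Real.rpow_mul hx.le, ← Real.rpow_add hx]; ring_nf
  rw [rlKernel, e]
  push_cast
  rw [mul_pow]; ring

theorem hasSum_mlKernel_norm (hα : 1 < α) (hb : 0 < b) (r : ℝ) {x : ℝ} (hx : 0 < x) :
    Summable (fun n : ℕ => r ^ n * rlKernel (α * n + b) x) := by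
  have := (hasSum_mlKernel hα hb (r : ℂ) hx).summable
  rw [← Complex.summable_ofReal]
  exact_mod_cast this

/-- The coefficients of the series are nonnegative, so replacing l by ‖l‖ majorises it. This reduces
integrability and domination to real nonnegative parameters. -/
theorem norm_mlKernel_le (hα : 1 < α) (hb : 0 < b) (l : ℂ) {x : ℝ} (hx : 0 < x) :
    ‖mlKernel α b l x‖ ≤ (mlKernel α b (‖l‖ : ℂ) x).re := by
  have h1 := hasSum_mlKernel hα hb l hx
  have h2 := Complex.hasSum_re (hasSum_mlKernel hα hb (‖l‖ : ℂ) hx)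
  rw [← h1.tsum_eq]
  refine tsum_of_norm_bounded h2 fun n => ?_
  have hp := rlKernel_nonneg (a := α * n + b) (x := x)
    (by have := n.cast_nonneg (α := ℝ); positivity) hx.le
  rw [norm_mul, norm_pow, Complex.norm_real, Real.norm_of_nonneg hp]
  norm_cast

theorem continuousOn_mlKernel (hα : 1 < α) (hb : 0 < b) (l : ℂ) :
    ContinuousOn (mlKernel α b l) (Ioi 0) := by
  intro x hx
  refine ContinuousAt.continuousWithinAt (ContinuousAt.mul ?_ ?_)
  · exact Complex.continuous_ofReal.continuousAt.comp
      (Real.continuousAt_rpow_const x _ (Or.inl (ne_of_gt hx)))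
  · refine (continuous_mittagLeffler hα hb).continuousAt.comp (continuousAt_const.mul ?_)
    exact Complex.continuous_ofReal.continuousAt.comp
      (Real.continuousAt_rpow_const x _ (Or.inl (ne_of_gt hx)))

/-- Convolution with a fractional integral kernel raises the second parameter. -/
theorem integral_rlKernel_mul_mlKernel {a : ℝ} (hα : 1 < α) (ha : 0 < a) (hb : 0 < b) (l : ℂ)
    {x : ℝ} (hx : 0 < x) :
    IntervalIntegrable (fun s => (rlKernel a (x - s) : ℂ) * mlKernel α b l s) volume 0 x ∧
    ∫ s in (0 : ℝ)..x, (rlKernel a (x - s) : ℂ) * mlKernel α b l s = mlKernel α (a + b) l x := by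
  have hpos : ∀ n : ℕ, 0 < α * n + b := fun n => by have := n.cast_nonneg (α := ℝ); positivity
  -- the value, by termwise integration
  have value : ∀ l : ℂ,
      ∫ s in (0 : ℝ)..x, (rlKernel a (x - s) : ℂ) * mlKernel α b l s = mlKernel α (a + b) l x := by
    intro l
    rw [intervalIntegral.integral_of_le hx.le]
    set F : ℕ → ℝ → ℂ := fun n s => l ^ n * ((rlKernel a (x - s) * rlKernel (α * n + b) s : ℝ) : ℂ)
    have hint : ∀ n : ℕ, IntegrableOn (fun s => rlKernel a (x - s) * rlKernel (α * n + b) s) (Ioc 0 x) :=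
      fun n => (intervalIntegrable_rlKernel_mul ha (hpos n) hx).1
    have hval : ∀ n : ℕ, ∫ s in Ioc 0 x, rlKernel a (x - s) * rlKernel (α * n + b) s =
        rlKernel (α * n + (a + b)) x := by
      intro n
      rw [← intervalIntegral.integral_of_le hx.le, integral_rlKernel_mul ha (hpos n) hx]
      ring_nf
    have hFi : ∀ n, Integrable (F n) (volume.restrict (Ioc 0 x)) := fun n =>
      ((hint n).ofReal (𝕜 := ℂ)).const_mul (l ^ n)
    have hFn : ∀ n, ∫ s in Ioc 0 x, ‖F n s‖ = ‖l‖ ^ n * rlKernel (α * n + (a + b)) x := by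
      intro n
      rw [← hval n, ← integral_const_mul]
      refine setIntegral_congr_fun measurableSet_Ioc fun s hs => ?_
      simp only [F]
      rw [norm_mul, norm_pow, Complex.norm_real, Real.norm_of_nonneg]
      exact mul_nonneg (rlKernel_nonneg ha (by linarith [hs.2])) (rlKernel_nonneg (hpos n) hs.1.le)
    have key := hasSum_integral_of_summable_integral_norm hFi (by
      simp_rw [hFn]
      exact hasSum_mlKernel_norm hα (by linarith) _ hx)
    have e1 : ∫ s in Ioc 0 x, ∑' n, F n s = ∫ s in Ioc 0 x, (rlKernel a (x - s) : ℂ) * mlKernel α b l s := by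
      refine setIntegral_congr_fun measurableSet_Ioc fun s hs => ?_
      rw [← (hasSum_mlKernel hα hb l hs.1).tsum_eq, ← tsum_mul_left]
      congr 1; ext n
      simp only [F]; push_cast; ring
    have e2 : ∀ n, ∫ s in Ioc 0 x, F n s = l ^ n * (rlKernel (α * n + (a + b)) x : ℂ) := by
      intro n
      simp only [F]
      rw [integral_const_mul, integral_complex_ofReal, hval n]
    simp_rw [e2] at key
    rw [← e1]
    exact key.unique (hasSum_mlKernel hα (by linarith) l hx)
  refine ⟨?_, value l⟩
  -- For the parameter ‖l‖ the integral is known and nonzero, which already forces integrability;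
  -- the general l is then dominated by it.
  have hreal : IntervalIntegrable (fun s => (rlKernel a (x - s) : ℂ) * mlKernel α b (‖l‖ : ℂ) s)
      volume 0 x := by
    apply intervalIntegral.intervalIntegrable_of_integral_ne_zero
    rw [value]
    intro h0
    have hs := Complex.hasSum_re (hasSum_mlKernel hα (by linarith : 0 < a + b) (‖l‖ : ℂ) hx)
    rw [h0] at hs
    have hnn : ∀ n : ℕ, 0 ≤ ((‖l‖ : ℂ) ^ n * (rlKernel (α * n + (a + b)) x : ℂ)).re := by
      intro n
      have := rlKernel_nonneg (a := α * n + (a + b)) (x := x) (by linarith [hpos n]) hx.le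
      norm_cast
      positivity
    have := le_hasSum hs 0 fun n _ => hnn n
    simp at this
    linarith [rlKernel_pos (by linarith : 0 < a + b) hx]
  rw [intervalIntegrable_iff_integrableOn_Ioo_of_le hx.le] at hreal ⊢
  refine hreal.norm.mono' (ContinuousOn.aestronglyMeasurable ?_ measurableSet_Ioo) ?_
  · refine ContinuousOn.mul ?_ ((continuousOn_mlKernel hα hb l).mono fun s hs => hs.1)
    exact Complex.continuous_ofReal.comp_continuousOn ((continuousOn_rlKernel a).comp
      (continuous_const.sub continuous_id).continuousOn fun s hs => sub_pos.2 hs.2)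
  · rw [ae_restrict_iff' measurableSet_Ioo]
    refine Eventually.of_forall fun s hs => ?_
    rw [norm_mul, norm_mul]
    exact mul_le_mul_of_nonneg_left ((norm_mlKernel_le hα hb l hs.1).trans
      ((le_abs_self _).trans (Complex.abs_re_le_norm _))) (norm_nonneg _)

end MittagLeffler

/-! ### Volterra equation, scaling and Laplace transform of the kernel. -/

section MittagLeffler

variable {α b : ℝ}

theorem rlKernel_one (x : ℝ) : rlKernel 1 x = 1 := by simp [rlKernel]

/-- The Volterra equation of the Mittag-Leffler kernel. -/
theorem mlKernel_eq_add (hα : 1 < α) (hb : 0 < b) (l : ℂ) {x : ℝ} (hx : 0 < x) :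
    mlKernel α b l x = (rlKernel b x : ℂ) + l * mlKernel α (α + b) l x := by
  have h1 := hasSum_mlKernel hα hb l hx
  have h2 := (hasSum_mlKernel hα (by linarith : 0 < α + b) l hx).mul_left l
  rw [← h1.tsum_eq, h1.summable.tsum_eq_zero_add, ← h2.tsum_eq]
  congr 1
  · simp
  · congr 1; ext n
    rw [pow_succ']
    push_cast
    ring_nf

theorem intervalIntegrable_mlKernel (hα : 1 < α) (hb : 0 < b) (l : ℂ) {x : ℝ} (hx : 0 < x) :
    IntervalIntegrable (mlKernel α b l) volume 0 x := by
  simpa [rlKernel_one] using (integral_rlKernel_mul_mlKernel hα zero_lt_one hb l hx).1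

theorem integral_mlKernel (hα : 1 < α) (hb : 0 < b) (l : ℂ) {x : ℝ} (hx : 0 < x) :
    ∫ s in (0 : ℝ)..x, mlKernel α b l s = mlKernel α (b + 1) l x := by
  rw [add_comm]
  simpa [rlKernel_one] using (integral_rlKernel_mul_mlKernel hα zero_lt_one hb l hx).2

theorem hasDerivAt_mlKernel (hα : 1 < α) (hb : 0 < b) (l : ℂ) {x : ℝ} (hx : 0 < x) :
    HasDerivAt (mlKernel α (b + 1) l) (mlKernel α b l x) x := by
  have h := intervalIntegral.integral_hasDerivAt_right (intervalIntegrable_mlKernel hα hb l hx)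
    ((continuousOn_mlKernel hα hb l).stronglyMeasurableAtFilter isOpen_Ioi x hx)
    ((continuousOn_mlKernel hα hb l).continuousAt (Ioi_mem_nhds hx))
  refine h.congr_of_eventuallyEq ?_
  filter_upwards [Ioi_mem_nhds hx] with y hy using (integral_mlKernel hα hb l hy).symm

theorem mlKernel_scale {t x : ℝ} (ht : 0 < t) (hx : 0 ≤ x) (l : ℂ) :
    mlKernel α b (((t ^ α : ℝ) : ℂ) * l) x = ((t ^ (1 - b) : ℝ) : ℂ) * mlKernel α b l (t * x) := by
  have e : x ^ (b - 1) = t ^ (1 - b) * (t * x) ^ (b - 1) := by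
    rw [Real.mul_rpow ht.le hx, ← mul_assoc, ← Real.rpow_add ht]
    simp
  unfold mlKernel
  rw [e, show (t * x) ^ α = t ^ α * x ^ α from Real.mul_rpow ht.le hx]
  push_cast
  ring_nf

/-- The Mittag-Leffler kernel of order `α`, extended by zero to the negative axis. -/
def mlSol (α : ℝ) (l : ℂ) (x : ℝ) : ℂ := mlKernel α α l (max x 0)

theorem mlSol_of_nonneg {l : ℂ} {x : ℝ} (hx : 0 ≤ x) : mlSol α l x = mlKernel α α l x := by
  rw [mlSol, max_eq_left hx]

theorem mlSol_of_nonpos (hα : 1 < α) {l : ℂ} {x : ℝ} (hx : x ≤ 0) : mlSol α l x = 0 := by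
  rw [mlSol, max_eq_right hx, mlKernel, Real.zero_rpow (by linarith)]
  simp

theorem continuous_mlSol (hα : 1 < α) : Continuous fun p : ℂ × ℝ => mlSol α p.1 p.2 := by
  have h1 : Continuous fun p : ℂ × ℝ => max p.2 0 := by fun_prop
  refine Continuous.mul ?_ ((continuous_mittagLeffler hα (by linarith)).comp
    (continuous_fst.mul ?_))
  · exact Complex.continuous_ofReal.comp ((Real.continuous_rpow_const (by linarith)).comp h1)
  · exact Complex.continuous_ofReal.comp ((Real.continuous_rpow_const (by linarith)).comp h1)

theorem mlSol_scale {t x : ℝ} (ht : 0 < t) (l : ℂ) :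
    mlSol α (((t ^ α : ℝ) : ℂ) * l) x = ((t ^ (1 - α) : ℝ) : ℂ) * mlSol α l (t * x) := by
  rw [mlSol, mlSol, mlKernel_scale ht (le_max_right _ _), mul_max_of_nonneg _ _ ht.le, mul_zero]

theorem integrableOn_cexp_mul_rlKernel (hb : 0 < b) {s : ℂ} (hs : 0 < s.re) :
    IntegrableOn (fun x : ℝ => Complex.exp (-(s * x)) * (rlKernel b x : ℂ)) (Ioi 0) := by
  refine ((integrableOn_rpow_mul_exp hb hs).div_const (Real.Gamma b)).mono' ?_ ?_
  · refine AEStronglyMeasurable.mul (by fun_prop) ?_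
    exact (Complex.measurable_ofReal.comp (measurable_rlKernel b)).aestronglyMeasurable
  · rw [ae_restrict_iff' measurableSet_Ioi]
    refine Eventually.of_forall fun x hx => le_of_eq ?_
    rw [norm_mul, Complex.norm_exp, Complex.norm_real, Real.norm_of_nonneg (rlKernel_nonneg hb (le_of_lt hx)),
      rlKernel]
    simp; ring

theorem integral_cexp_mul_rlKernel (hb : 0 < b) {s : ℂ} (hs : 0 < s.re) :
    ∫ x in Ioi (0 : ℝ), Complex.exp (-(s * x)) * (rlKernel b x : ℂ) = s ^ (-b : ℂ) := by
  have hG : (Real.Gamma b : ℂ) ≠ 0 := by exact_mod_cast (Real.Gamma_pos_of_pos hb).ne'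
  have := integral_rpow_mul_cexp hb hs
  have e : ∀ x : ℝ, Complex.exp (-(s * x)) * (rlKernel b x : ℂ) =
      (Real.Gamma b : ℂ)⁻¹ * (Complex.exp (-(s * x)) * ((x ^ (b - 1) : ℝ) : ℂ)) := by
    intro x; rw [rlKernel]; push_cast; field_simp
  simp_rw [e]
  rw [integral_const_mul, this]
  field_simp

theorem integral_norm_cexp_mul_rlKernel (hb : 0 < b) {s : ℂ} (hs : 0 < s.re) :
    ∫ x in Ioi (0 : ℝ), ‖Complex.exp (-(s * x)) * (rlKernel b x : ℂ)‖ = s.re ^ (-b) := by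
  apply Complex.ofReal_injective
  rw [Complex.ofReal_cpow hs.le, ← integral_complex_ofReal]
  have := integral_cexp_mul_rlKernel hb (s := (s.re : ℂ)) (by simpa using hs)
  push_cast
  rw [← this]
  refine setIntegral_congr_fun measurableSet_Ioi fun x hx => ?_
  rw [norm_mul, Complex.norm_exp, Complex.norm_real, Real.norm_of_nonneg (rlKernel_nonneg hb (le_of_lt hx))]
  simp

/-- The Laplace transform of the Mittag-Leffler kernel. -/
theorem laplace_mlKernel (hα : 1 < α) {l s : ℂ} (hs : 0 < s.re) (hl : ‖l‖ < s.re ^ α) :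
    IntegrableOn (fun x : ℝ => Complex.exp (-(s * x)) * mlKernel α α l x) (Ioi 0) ∧
    ∫ x in Ioi (0 : ℝ), Complex.exp (-(s * x)) * mlKernel α α l x = 1 / (s ^ (α : ℂ) - l) := by
  have hα0 : 0 < α := by linarith
  have hpos : ∀ n : ℕ, 0 < α * n + α := fun n => by have := n.cast_nonneg (α := ℝ); positivity
  -- A geometric series in l/s^α, convergent because |s^α| = |s|^α ≥ (Re s)^α > |l|.
  have hgeo : ∀ {l s : ℂ}, 0 < s.re → ‖l‖ < s.re ^ α →
      HasSum (fun n : ℕ => l ^ n * s ^ (-((α * n + α : ℝ)) : ℂ)) (1 / (s ^ (α : ℂ) - l)) := by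
    intro l s hs hl
    have hs0 : s ≠ 0 := fun h => by simp [h] at hs
    have hsn : ‖s ^ (α : ℂ)‖ = ‖s‖ ^ α := Complex.norm_cpow_real _ _
    have hsa : s ^ (α : ℂ) ≠ 0 := by simp [Complex.cpow_eq_zero_iff, hs0]
    have hlt : ‖l / s ^ (α : ℂ)‖ < 1 := by
      rw [norm_div, hsn, div_lt_one (by positivity)]
      refine hl.trans_le (Real.rpow_le_rpow hs.le ?_ hα0.le)
      exact (le_abs_self _).trans (Complex.abs_re_le_norm s)
    have h := (hasSum_geometric_of_norm_lt_one hlt).mul_left (s ^ (α : ℂ))⁻¹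
    have hne : s ^ (α : ℂ) - l ≠ 0 := by
      intro h0
      rw [sub_eq_zero] at h0
      rw [h0, div_self (h0 ▸ hsa)] at hlt
      simp at hlt
    rw [show 1 / (s ^ (α : ℂ) - l) = (s ^ (α : ℂ))⁻¹ * (1 - l / s ^ (α : ℂ))⁻¹ by
      rw [← mul_inv, mul_sub, mul_div_cancel₀ _ hsa, mul_one, one_div]]
    refine h.congr_fun fun n => ?_
    · rw [Complex.cpow_neg, show ((α * n + α : ℝ) : ℂ) = (α : ℂ) * n + α by push_cast; ring,
        Complex.cpow_add _ _ hs0, Complex.cpow_mul_nat]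
      rw [div_pow]
      field_simp
  set F : ℂ → ℂ → ℕ → ℝ → ℂ := fun l s n x =>
    l ^ n * (Complex.exp (-(s * x)) * (rlKernel (α * n + α) x : ℂ)) with hF
  have hFeq : ∀ l s : ℂ, ∀ x ∈ Ioi (0 : ℝ), ∑' n, F l s n x = Complex.exp (-(s * x)) * mlKernel α α l x := by
    intro l s x hx
    rw [← (hasSum_mlKernel hα hα0 l hx).tsum_eq, ← tsum_mul_left]
    congr 1; ext n; simp only [F]; ring
  have value : ∀ {l s : ℂ}, 0 < s.re → ‖l‖ < s.re ^ α →
      ∫ x in Ioi (0 : ℝ), Complex.exp (-(s * x)) * mlKernel α α l x = 1 / (s ^ (α : ℂ) - l) := by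
    intro l s hs hl
    have hFn : ∀ n, ∫ x in Ioi (0 : ℝ), ‖F l s n x‖ = ‖l‖ ^ n * s.re ^ (-(α * n + α)) := by
      intro n
      rw [← integral_norm_cexp_mul_rlKernel (hpos n) hs, ← integral_const_mul]
      simp_rw [F, norm_mul, norm_pow]
    -- The interchange of sum and integral is controlled by the same geometric series, taken at ‖l‖
    -- and Re s.
    have key := hasSum_integral_of_summable_integral_norm (F := F l s)
      (fun n => (integrableOn_cexp_mul_rlKernel (hpos n) hs).const_mul (l ^ n)) (by
        simp_rw [hFn]
        have := (hgeo (l := (‖l‖ : ℂ)) (s := (s.re : ℂ)) (by simpa using hs) (by simpa using hl)).summable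
        rw [← Complex.summable_ofReal]
        refine this.congr fun n => ?_
        push_cast
        rw [Complex.ofReal_cpow hs.le]
        push_cast; rfl)
    rw [← setIntegral_congr_fun measurableSet_Ioi (hFeq l s)]
    refine key.unique ?_
    have e2 : ∀ n, ∫ x in Ioi (0 : ℝ), F l s n x = l ^ n * s ^ (-((α * n + α : ℝ)) : ℂ) := by
      intro n
      simp only [F]
      rw [integral_const_mul, integral_cexp_mul_rlKernel (hpos n) hs]
    simp_rw [e2]
    exact hgeo hs hl
  refine ⟨?_, value hs hl⟩
  -- As above, a nonzero integral forces integrability; the majorant at ‖l‖ and Re s then serves for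
  -- general l and s.
  have hreal : IntegrableOn (fun x : ℝ => Complex.exp (-((s.re : ℂ) * x)) * mlKernel α α (‖l‖ : ℂ) x) (Ioi 0) := by
    apply Integrable.of_integral_ne_zero
    rw [value (by simpa using hs) (by simpa using hl)]
    refine one_div_ne_zero ?_
    rw [← Complex.ofReal_cpow hs.le, ← Complex.ofReal_sub]
    exact_mod_cast (sub_pos.2 hl).ne'
  refine hreal.norm.mono' (ContinuousOn.aestronglyMeasurable ?_ measurableSet_Ioi) ?_
  · exact ContinuousOn.mul (by fun_prop) (continuousOn_mlKernel hα hα0 l)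
  · rw [ae_restrict_iff' measurableSet_Ioi]
    refine Eventually.of_forall fun x hx => ?_
    rw [norm_mul, norm_mul, Complex.norm_exp, Complex.norm_exp]
    have := (norm_mlKernel_le hα hα0 l hx).trans
      ((le_abs_self _).trans (Complex.abs_re_le_norm _))
    simp only [Complex.neg_re, Complex.mul_re, Complex.ofReal_re, Complex.ofReal_im, mul_zero, sub_zero]
    gcongr

end MittagLeffler

/-! ### Contour integrals over a strip and a model simple pole. -/

section StripResidue

/-- The integrals of a decaying holomorphic function over the two sides of a strip agree. -/
theorem integral_strip_eq {D : ℂ → ℂ} {φ φ' : ℝ} (h0 : 0 < φ) (h1 : φ < φ')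
    (hD : DifferentiableOn ℂ D {w | |w.im| < φ'})
    (hp : Integrable fun τ : ℝ => D (τ + φ * Complex.I))
    (hm : Integrable fun τ : ℝ => D (τ + (-φ : ℝ) * Complex.I))
    (hlim : ∀ ε > 0, ∃ R : ℝ, ∀ w : ℂ, |w.im| ≤ φ → R ≤ |w.re| → ‖D w‖ ≤ ε) :
    ∫ τ : ℝ, D (τ + φ * Complex.I) = ∫ τ : ℝ, D (τ + (-φ : ℝ) * Complex.I) := by
  have hrect : ∀ n : ℕ, (∫ x : ℝ in (-(n : ℝ))..n, D (x + (-φ : ℝ) * Complex.I)) -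
      (∫ x : ℝ in (-(n : ℝ))..n, D (x + φ * Complex.I)) +
      Complex.I • (∫ y : ℝ in (-φ)..φ, D ((n : ℝ) + y * Complex.I)) -
      Complex.I • (∫ y : ℝ in (-φ)..φ, D ((-n : ℝ) + y * Complex.I)) = 0 := by
    intro n
    have := Complex.integral_boundary_rect_eq_zero_of_differentiableOn D ⟨-n, -φ⟩ ⟨n, φ⟩
      (hD.mono fun w hw => by
        have h2 := (Complex.mem_reProdIm.1 hw).2
        rw [uIcc_of_le (by simp; linarith)] at h2
        exact (abs_le.2 h2).trans_lt h1)
    exact this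
  have hv : ∀ σ : ℕ → ℝ, Tendsto (fun n => |σ n|) atTop atTop →
      Tendsto (fun n : ℕ => ∫ y : ℝ in (-φ)..φ, D (σ n + y * Complex.I)) atTop (𝓝 0) := by
    intro σ hσ
    rw [Metric.tendsto_atTop]
    intro ε hε
    obtain ⟨R, hR⟩ := hlim (ε / (4 * φ)) (by positivity)
    obtain ⟨N, hN⟩ := (tendsto_atTop.1 hσ R).exists_forall_of_atTop
    refine ⟨N, fun n hn => ?_⟩
    rw [dist_zero_right]
    have := intervalIntegral.norm_integral_le_of_norm_le_const (a := -φ) (b := φ)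
      (f := fun y : ℝ => D (σ n + y * Complex.I)) (C := ε / (4 * φ)) (fun y hy => by
        rw [uIoc_of_le (by linarith)] at hy
        refine hR _ ?_ ?_
        · simpa using abs_le.2 ⟨hy.1.le, hy.2⟩
        · simpa using hN n hn)
    refine this.trans_lt ?_
    rw [show φ - -φ = 2 * φ by ring, abs_of_pos (by positivity)]
    field_simp
    linarith
  have ha : Tendsto (fun n : ℕ => -(n : ℝ)) atTop atBot :=
    tendsto_neg_atTop_atBot.comp tendsto_natCast_atTop_atTop
  have t1 := intervalIntegral_tendsto_integral hp ha tendsto_natCast_atTop_atTop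
  have t2 := intervalIntegral_tendsto_integral hm ha tendsto_natCast_atTop_atTop
  have t3 := (hv (fun n => n) (by simpa using tendsto_natCast_atTop_atTop)).const_smul Complex.I
  have t4 := (hv (fun n => -n) (by simpa using tendsto_natCast_atTop_atTop)).const_smul Complex.I
  have t := ((t2.sub t1).add t3).sub t4
  simp only [hrect] at t
  have := tendsto_nhds_unique t tendsto_const_nhds
  simp only [smul_zero, add_zero, sub_zero] at this
  exact (sub_eq_zero.1 this).symm

/-- In the coordinate `w = log z`, the form `(1 / (z - e^p) - 1 / (z + 1)) dz`. -/
def expPole (p w : ℂ) : ℂ :=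
  Complex.exp w / (Complex.exp w - Complex.exp p) - Complex.exp w / (Complex.exp w + 1)

theorem exp_ne_exp_of_im {p w : ℂ} (h : |w.im - p.im| < 2 * Real.pi) (hne : w ≠ p) :
    Complex.exp w ≠ Complex.exp p := by
  intro he
  obtain ⟨n, hn⟩ := Complex.exp_eq_exp_iff_exists_int.1 he
  have him : w.im = p.im + n * (2 * Real.pi) := by rw [hn]; simp
  have hn0 : n = 0 := by
    rw [him, add_sub_cancel_left, abs_mul, abs_of_pos Real.two_pi_pos] at h
    have : |(n : ℝ)| < 1 := by
      have := Real.two_pi_pos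
      nlinarith
    have : |n| < 1 := by exact_mod_cast this
    exact Int.abs_lt_one_iff.1 this
  exact hne (by rw [hn, hn0]; simp)

theorem exp_add_one_ne_zero {w : ℂ} (h : |w.im| < Real.pi) : Complex.exp w + 1 ≠ 0 := by
  intro h0
  refine exp_ne_exp_of_im (p := Real.pi * Complex.I) (w := w) ?_ ?_ ?_
  · simp only [Complex.mul_im, Complex.ofReal_re, Complex.I_im, mul_one, Complex.ofReal_im,
      Complex.I_re, mul_zero, add_zero]
    rw [abs_lt] at h ⊢
    constructor <;> linarith [Real.pi_pos]
  · rintro rfl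
    simp [abs_of_pos Real.pi_pos] at h
  · rw [Complex.exp_pi_mul_I]; exact eq_neg_of_add_eq_zero_left h0

theorem expPole_eq {p w : ℂ} (h : |w.im| < Real.pi) (hw : Complex.exp w ≠ Complex.exp p) :
    expPole p w = Complex.exp w * (Complex.exp p + 1) /
      ((Complex.exp w - Complex.exp p) * (Complex.exp w + 1)) := by
  have h1 := exp_add_one_ne_zero h
  have h2 := sub_ne_zero.2 hw
  unfold expPole
  field_simp
  ring

/-- At Re w → -∞ each of the two fractions is O(e^(Re w)). At Re w → +∞ each tends to 1 and only
their difference decays, which is why the pole at z = -1 is subtracted; it lies on |Im w| = π,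
outside the strips used. -/
theorem exists_expPole_bound (p : ℂ) : ∃ C R : ℝ, 0 ≤ C ∧ |p.re| < R ∧ ∀ w : ℂ, |w.im| < Real.pi →
    R ≤ |w.re| → ‖expPole p w‖ ≤ C * Real.exp (-|w.re|) := by
  have hP : 0 < ‖Complex.exp p‖ := norm_pos_iff.2 (Complex.exp_ne_zero p)
  refine ⟨4 * ‖Complex.exp p + 1‖ * (1 + 1 / ‖Complex.exp p‖), |p.re| + 1, by positivity, by linarith,
    fun w him hw => ?_⟩
  have he : (2 : ℝ) ≤ Real.exp 1 := by linarith [Real.add_one_le_exp (1 : ℝ)]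
  have hne : Complex.exp w ≠ Complex.exp p := by
    intro h
    have := congrArg norm h
    rw [Complex.norm_exp, Complex.norm_exp] at this
    rw [Real.exp_injective this] at hw
    linarith
  have hz : 0 < ‖Complex.exp w‖ := norm_pos_iff.2 (Complex.exp_ne_zero w)
  rw [expPole_eq him hne, norm_div, norm_mul, norm_mul]
  have hPn : ‖Complex.exp p‖ = Real.exp p.re := Complex.norm_exp p
  have hzn : ‖Complex.exp w‖ = Real.exp w.re := Complex.norm_exp w
  have hle := neg_abs_le p.re
  have hle' := le_abs_self p.re
  have hab := abs_nonneg p.re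
  have two : ∀ a b : ℝ, a + 1 ≤ b → 2 * Real.exp a ≤ Real.exp b := fun a b hb => by
    refine le_trans ?_ (Real.exp_le_exp.2 hb)
    rw [Real.exp_add, mul_comm]
    exact mul_le_mul_of_nonneg_left he (Real.exp_pos a).le
  rcases le_total 0 w.re with h0 | h0
  · rw [abs_of_nonneg h0] at hw ⊢
    have a1 : 2 * ‖Complex.exp p‖ ≤ ‖Complex.exp w‖ := by rw [hPn, hzn]; exact two _ _ (by linarith)
    have a2 : 2 * 1 ≤ ‖Complex.exp w‖ := by
      rw [hzn, ← Real.exp_zero]; exact two _ _ (by linarith)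
    have b1 : ‖Complex.exp w‖ / 2 ≤ ‖Complex.exp w - Complex.exp p‖ := by
      have := norm_sub_norm_le (Complex.exp w) (Complex.exp p); linarith
    have b2 : ‖Complex.exp w‖ / 2 ≤ ‖Complex.exp w + 1‖ := by
      have := norm_sub_norm_le (Complex.exp w) (-1); simp at this; linarith
    calc _ ≤ ‖Complex.exp w‖ * ‖Complex.exp p + 1‖ / (‖Complex.exp w‖ / 2 * (‖Complex.exp w‖ / 2)) := by
          gcongr
      _ = 4 * ‖Complex.exp p + 1‖ * 1 * Real.exp (-w.re) := by
          rw [Real.exp_neg, ← hzn]; field_simp; ring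
      _ ≤ _ := by
          gcongr
          have : 0 ≤ 1 / ‖Complex.exp p‖ := by positivity
          linarith
  · rw [abs_of_nonpos h0] at hw ⊢
    have a1 : 2 * ‖Complex.exp w‖ ≤ ‖Complex.exp p‖ := by rw [hPn, hzn]; exact two _ _ (by linarith)
    have a2 : 2 * ‖Complex.exp w‖ ≤ 1 := by
      rw [hzn, ← Real.exp_zero]; exact two _ _ (by linarith)
    have b1 : ‖Complex.exp p‖ / 2 ≤ ‖Complex.exp w - Complex.exp p‖ := by
      have := norm_sub_norm_le (Complex.exp p) (Complex.exp w)
      rw [norm_sub_rev] at this; linarith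
    have b2 : 1 / 2 ≤ ‖Complex.exp w + 1‖ := by
      have := norm_sub_norm_le (1 : ℂ) (-Complex.exp w)
      simp only [norm_neg, norm_one, sub_neg_eq_add] at this
      rw [add_comm]; linarith
    calc _ ≤ ‖Complex.exp w‖ * ‖Complex.exp p + 1‖ / (‖Complex.exp p‖ / 2 * (1 / 2)) := by
          gcongr
      _ = 4 * ‖Complex.exp p + 1‖ * (1 / ‖Complex.exp p‖) * Real.exp (-(-w.re)) := by
          rw [neg_neg, ← hzn]; field_simp; ring
      _ ≤ _ := by gcongr; linarith

theorem integrable_of_exp_decay {h : ℝ → ℂ} (hc : Continuous h) {C R : ℝ}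
    (hb : ∀ τ, R ≤ |τ| → ‖h τ‖ ≤ C * Real.exp (-|τ|)) : Integrable h := by
  refine hc.locallyIntegrable.integrable_of_isBigO_atBot_atTop (g := Real.exp)
    (g' := fun x => Real.exp (-x)) ?_ ⟨Iic 0, Iic_mem_atBot 0, integrableOn_exp_Iic 0⟩ ?_
    ⟨Ioi 0, Ioi_mem_atTop 0, integrableOn_exp_neg_Ioi 0⟩
  · refine Asymptotics.IsBigO.of_bound C ?_
    filter_upwards [Iic_mem_atBot 0, Iic_mem_atBot (-R)] with τ h1 h2
    have := hb τ (by rw [abs_of_nonpos h1]; linarith [mem_Iic.1 h2])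
    rw [abs_of_nonpos h1, neg_neg] at this
    rwa [Real.norm_of_nonneg (Real.exp_pos _).le]
  · refine Asymptotics.IsBigO.of_bound C ?_
    filter_upwards [Ici_mem_atTop 0, Ici_mem_atTop R] with τ h1 h2
    have := hb τ (by rw [abs_of_nonneg h1]; exact h2)
    rw [abs_of_nonneg h1] at this
    rwa [Real.norm_of_nonneg (Real.exp_pos _).le]

theorem continuous_expPole_line {p : ℂ} {y : ℝ} (hy : |y| < Real.pi)
    (hp : ∀ τ : ℝ, Complex.exp (τ + y * Complex.I) ≠ Complex.exp p) :
    Continuous fun τ : ℝ => expPole p (τ + y * Complex.I) := by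
  unfold expPole
  refine Continuous.sub (Continuous.div (by fun_prop) (by fun_prop) fun τ => sub_ne_zero.2 (hp τ))
    (Continuous.div (by fun_prop) (by fun_prop) fun τ => exp_add_one_ne_zero (by simpa using hy))

theorem integrable_mul_expPole {g : ℂ → ℂ} {p : ℂ} {y B : ℝ} (hy : |y| < Real.pi)
    (hp : ∀ τ : ℝ, Complex.exp (τ + y * Complex.I) ≠ Complex.exp p)
    (hg : Continuous fun τ : ℝ => g (τ + y * Complex.I))
    (hB : ∀ τ : ℝ, ‖g (τ + y * Complex.I)‖ ≤ B) :
    Integrable fun τ : ℝ => g (τ + y * Complex.I) * expPole p (τ + y * Complex.I) := by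
  obtain ⟨C, R, hC, -, hb⟩ := exists_expPole_bound p
  refine integrable_of_exp_decay (C := B * C) (R := R) (hg.mul (continuous_expPole_line hy hp))
    fun τ hτ => ?_
  rw [norm_mul, mul_assoc]
  have := hb (τ + y * Complex.I) (by simpa using hy) (by simpa using hτ)
  simp only [Complex.add_re, Complex.ofReal_re, Complex.mul_re, Complex.I_re, mul_zero,
    Complex.ofReal_im, Complex.I_im, mul_one, sub_self, add_zero] at this
  exact mul_le_mul (hB τ) this (norm_nonneg _) ((norm_nonneg _).trans (hB τ))

end StripResidue

/-! ### Evaluation of the model pole and the residue formula. -/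

section StripResidue

theorem hasDerivAt_exp_line (y τ : ℝ) :
    HasDerivAt (fun τ : ℝ => Complex.exp (τ + y * Complex.I)) (Complex.exp (τ + y * Complex.I)) τ := by
  have h : HasDerivAt (fun τ : ℝ => (τ : ℂ) + y * Complex.I) 1 τ :=
    (Complex.ofRealCLM.hasDerivAt (x := τ)).add_const _
  simpa using h.cexp

theorem exp_line_re (y τ : ℝ) : (Complex.exp (τ + y * Complex.I)).re = Real.exp τ * Real.cos y := by
  simp [Complex.exp_re]

theorem exp_line_im (y τ : ℝ) : (Complex.exp (τ + y * Complex.I)).im = Real.exp τ * Real.sin y := by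
  simp [Complex.exp_im]

theorem exp_re_pos {p : ℂ} (hp : |p.im| < Real.pi / 2) : 0 < (Complex.exp p).re := by
  rw [Complex.exp_re]
  have := abs_lt.1 hp
  exact mul_pos (Real.exp_pos _) (Real.cos_pos_of_mem_Ioo ⟨by linarith, by linarith⟩)

theorem cos_neg_of_abs {y : ℝ} (h1 : Real.pi / 2 < |y|) (h2 : |y| < Real.pi) : Real.cos y < 0 := by
  rw [← Real.cos_abs]
  exact Real.cos_neg_of_pi_div_two_lt_of_lt h1 (by linarith [Real.pi_pos])

theorem exp_line_ne_exp {p : ℂ} (hp : |p.im| < Real.pi / 2) {y : ℝ} (h1 : Real.pi / 2 < |y|)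
    (h2 : |y| < Real.pi) (τ : ℝ) : Complex.exp (τ + y * Complex.I) ≠ Complex.exp p := by
  intro h
  have h3 := congrArg Complex.re h
  rw [exp_line_re] at h3
  have := mul_neg_of_pos_of_neg (Real.exp_pos τ) (cos_neg_of_abs h1 h2)
  linarith [exp_re_pos hp]

/-- The primitive log(e^p - e^w) - log(1 + e^w) stays on the principal branch along the line: the
first argument has positive real part because cos y < 0, the second has nonzero imaginary part. Its
limit at -∞ is p, and at +∞ the common factor e^τ drops out. -/
theorem integral_expPole_line {p : ℂ} (hp : |p.im| < Real.pi / 2) {y : ℝ} (h1 : Real.pi / 2 < |y|)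
    (h2 : |y| < Real.pi) :
    ∫ τ : ℝ, expPole p (τ + y * Complex.I) =
      Complex.log (-Complex.exp (y * Complex.I)) - Complex.log (Complex.exp (y * Complex.I)) - p := by
  have hP := exp_re_pos hp
  have hcos := cos_neg_of_abs h1 h2
  have hsin : Real.sin y ≠ 0 := by
    intro h0
    rcases lt_or_ge y 0 with hy | hy
    · rw [abs_of_neg hy] at h1 h2
      linarith [Real.sin_neg_of_neg_of_neg_pi_lt hy (by linarith)]
    · rw [abs_of_nonneg hy] at h1 h2
      linarith [Real.sin_pos_of_pos_of_lt_pi (by linarith [Real.pi_pos]) h2]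
  have hint : Integrable fun τ : ℝ => expPole p (τ + y * Complex.I) := by
    simpa using integrable_mul_expPole (g := fun _ => 1) (B := 1) h2 (exp_line_ne_exp hp h1 h2)
      continuous_const (by simp)
  have hs1 : ∀ τ : ℝ, Complex.exp p - Complex.exp (τ + y * Complex.I) ∈ Complex.slitPlane := by
    intro τ
    left
    rw [Complex.sub_re, exp_line_re]
    have := mul_neg_of_pos_of_neg (Real.exp_pos τ) hcos
    linarith
  have hs2 : ∀ τ : ℝ, 1 + Complex.exp (τ + y * Complex.I) ∈ Complex.slitPlane := by
    intro τ
    right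
    rw [Complex.add_im, exp_line_im]
    simpa using hsin
  refine integral_of_hasDerivAt_of_tendsto
    (f := fun τ : ℝ => Complex.log (Complex.exp p - Complex.exp (τ + y * Complex.I)) -
      Complex.log (1 + Complex.exp (τ + y * Complex.I))) (fun τ => ?_) hint ?_ ?_
  · have d1 := ((hasDerivAt_exp_line y τ).const_sub (Complex.exp p)).clog_real (hs1 τ)
    have d2 := ((hasDerivAt_exp_line y τ).const_add 1).clog_real (hs2 τ)
    refine (d1.sub d2).congr_deriv ?_
    rw [expPole, add_comm (1 : ℂ), neg_div, ← div_neg, neg_sub]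
  · have he : Tendsto (fun τ : ℝ => Complex.exp (τ + y * Complex.I)) atBot (𝓝 0) := by
      rw [tendsto_zero_iff_norm_tendsto_zero]
      simpa [Complex.norm_exp] using Real.tendsto_exp_atBot
    have t1 : Tendsto (fun τ : ℝ => Complex.exp p - Complex.exp (τ + y * Complex.I)) atBot
        (𝓝 (Complex.exp p)) := by simpa using he.const_sub (Complex.exp p)
    have t2 : Tendsto (fun τ : ℝ => 1 + Complex.exp (τ + y * Complex.I)) atBot (𝓝 1) := by
      simpa using he.const_add 1
    have := (t1.clog (Or.inl hP)).sub (t2.clog (by simp))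
    have hab := abs_lt.1 hp
    rwa [Complex.log_exp (by linarith) (by linarith), Complex.log_one, sub_zero] at this
  · have he : Tendsto (fun τ : ℝ => ((Real.exp (-τ) : ℝ) : ℂ)) atTop (𝓝 0) := by
      have := (Complex.continuous_ofReal.tendsto 0).comp
        (Real.tendsto_exp_atBot.comp tendsto_neg_atTop_atBot)
      simpa [Function.comp_def] using this
    have t1 : Tendsto (fun τ : ℝ => ((Real.exp (-τ) : ℝ) : ℂ) * Complex.exp p - Complex.exp (y * Complex.I))
        atTop (𝓝 (-Complex.exp (y * Complex.I))) := by
      simpa using (he.mul_const (Complex.exp p)).sub_const (Complex.exp (y * Complex.I))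
    have t2 : Tendsto (fun τ : ℝ => ((Real.exp (-τ) : ℝ) : ℂ) + Complex.exp (y * Complex.I))
        atTop (𝓝 (Complex.exp (y * Complex.I))) := by
      simpa using he.add_const (Complex.exp (y * Complex.I))
    have hre : (Complex.exp (y * Complex.I)).re = Real.cos y := by simp [Complex.exp_re]
    have him : (Complex.exp (y * Complex.I)).im = Real.sin y := by simp [Complex.exp_im]
    have := (t1.clog (Or.inl (by rw [Complex.neg_re, hre]; linarith))).sub
      (t2.clog (Or.inr (by rw [him]; exact hsin)))
    refine this.congr fun τ => ?_
    have hx : (Real.exp τ : ℂ) * (Real.exp (-τ) : ℂ) = 1 := by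
      norm_cast; rw [← Real.exp_add]; simp
    -- The positive factor e^τ is pulled out of both logarithms, so that its real logarithm cancels
    -- in the difference.
    have e1 : Complex.exp p - Complex.exp (τ + y * Complex.I) = (Real.exp τ : ℂ) *
        (((Real.exp (-τ) : ℝ) : ℂ) * Complex.exp p - Complex.exp (y * Complex.I)) := by
      rw [Complex.exp_add, ← Complex.ofReal_exp, mul_sub, ← mul_assoc, hx, one_mul]
    have e2 : 1 + Complex.exp (τ + y * Complex.I) = (Real.exp τ : ℂ) *
        (((Real.exp (-τ) : ℝ) : ℂ) + Complex.exp (y * Complex.I)) := by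
      rw [Complex.exp_add, ← Complex.ofReal_exp, mul_add, hx]
    have n1 : ((Real.exp (-τ) : ℝ) : ℂ) * Complex.exp p - Complex.exp (y * Complex.I) ≠ 0 := by
      intro h0
      have := hs1 τ
      rw [e1, h0, mul_zero] at this
      simp at this
    have n2 : ((Real.exp (-τ) : ℝ) : ℂ) + Complex.exp (y * Complex.I) ≠ 0 := by
      intro h0
      have := hs2 τ
      rw [e2, h0, mul_zero] at this
      simp at this
    rw [e1, e2, Complex.log_ofReal_mul (Real.exp_pos τ) n1, Complex.log_ofReal_mul (Real.exp_pos τ) n2]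
    ring

/-- On the upper line log(-e^(iφ)) - log(e^(iφ)) = -πi, on the lower line it is +πi; the terms -p
cancel. -/
theorem integral_expPole_strip {p : ℂ} (hp : |p.im| < Real.pi / 2) {φ : ℝ} (h1 : Real.pi / 2 < φ)
    (h2 : φ < Real.pi) :
    (∫ τ : ℝ, expPole p (τ + φ * Complex.I)) - ∫ τ : ℝ, expPole p (τ + (-φ : ℝ) * Complex.I) =
      -(2 * Real.pi * Complex.I) := by
  have hφ : 0 < φ := by linarith [Real.pi_pos]
  rw [integral_expPole_line hp (y := φ) (by rwa [abs_of_pos hφ]) (by rwa [abs_of_pos hφ]),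
    integral_expPole_line hp (y := -φ) (by rwa [abs_neg, abs_of_pos hφ])
      (by rwa [abs_neg, abs_of_pos hφ])]
  have l : ∀ t : ℝ, -Real.pi < t → t ≤ Real.pi →
      Complex.log (Complex.exp (t * Complex.I)) = t * Complex.I := fun t ha hb =>
    Complex.log_exp (by simpa using ha) (by simpa using hb)
  have e1 : -Complex.exp (φ * Complex.I) = Complex.exp ((φ - Real.pi : ℝ) * Complex.I) := by
    push_cast; rw [sub_mul, Complex.exp_sub, Complex.exp_pi_mul_I]; ring
  have e2 : -Complex.exp ((-φ : ℝ) * Complex.I) = Complex.exp ((-φ + Real.pi : ℝ) * Complex.I) := by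
    push_cast; rw [add_mul, Complex.exp_add, Complex.exp_pi_mul_I]; ring
  rw [e1, e2, l _ (by linarith) (by linarith), l _ (by linarith) (by linarith),
    l _ (by linarith) (by linarith), l _ (by linarith) (by linarith)]
  push_cast; ring

/-- The residue theorem on a strip for a bounded function times `expPole`. -/
theorem integral_strip_mul_expPole {g : ℂ → ℂ} {φ B : ℝ} (h1 : Real.pi / 2 < φ)
    (h2 : φ < 3 * Real.pi / 4) (hg : DifferentiableOn ℂ g {w | |w.im| < 3 * Real.pi / 4})
    (hB : ∀ w : ℂ, |w.im| ≤ φ → ‖g w‖ ≤ B) {p : ℂ} (hp : |p.im| < Real.pi / 2) :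
    (∫ τ : ℝ, g (τ + φ * Complex.I) * expPole p (τ + φ * Complex.I)) -
      ∫ τ : ℝ, g (τ + (-φ : ℝ) * Complex.I) * expPole p (τ + (-φ : ℝ) * Complex.I) =
      -(2 * Real.pi * Complex.I) * g p := by
  have hπ := Real.pi_pos
  have hφ : 0 < φ := by linarith
  have hopen : IsOpen {w : ℂ | |w.im| < 3 * Real.pi / 4} :=
    isOpen_lt (Complex.continuous_im.abs) continuous_const
  have hpm : {w : ℂ | |w.im| < 3 * Real.pi / 4} ∈ 𝓝 p :=
    hopen.mem_nhds (by simp only [mem_ofPred_eq]; linarith)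
  -- This is (g(w) - g(p)) times `expPole`, with the singularity at p removed through difference
  -- quotients. It is holomorphic in the strip, so its two line integrals agree, and only the
  -- constant g(p) times the model pole remains.
  set D : ℂ → ℂ := fun w => dslope g p w / dslope Complex.exp p w *
    (Complex.exp w * (Complex.exp p + 1) / (Complex.exp w + 1)) with hDdef
  have hDeq : ∀ w : ℂ, |w.im| < 3 * Real.pi / 4 → Complex.exp w ≠ Complex.exp p →
      D w = g w * expPole p w - g p * expPole p w := by
    intro w hw hne
    have hwp : w ≠ p := fun h => hne (by rw [h])
    rw [expPole_eq (by linarith) hne, hDdef]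
    simp only
    rw [dslope_of_ne _ hwp, dslope_of_ne _ hwp, slope_def_field, slope_def_field]
    have a1 := sub_ne_zero.2 hwp
    have a2 := sub_ne_zero.2 hne
    have a3 := exp_add_one_ne_zero (w := w) (by linarith)
    field_simp
  have hDd : DifferentiableOn ℂ D {w | |w.im| < 3 * Real.pi / 4} := by
    refine DifferentiableOn.mul (DifferentiableOn.div
      ((Complex.differentiableOn_dslope hpm).2 hg)
      ((Complex.differentiableOn_dslope hpm).2 Complex.differentiable_exp.differentiableOn)
      fun w hw => ?_) (DifferentiableOn.div (by fun_prop) (by fun_prop) fun w hw => ?_)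
    · rcases eq_or_ne w p with rfl | hwp
      · rw [dslope_same, Complex.deriv_exp]; exact Complex.exp_ne_zero _
      · rw [dslope_of_ne _ hwp, slope_def_field]
        refine div_ne_zero (sub_ne_zero.2 (exp_ne_exp_of_im ?_ hwp)) (sub_ne_zero.2 hwp)
        have := abs_sub w.im p.im
        simp only [mem_ofPred_eq] at hw
        linarith
    · simp only [mem_ofPred_eq] at hw
      exact exp_add_one_ne_zero (by linarith)
  have hline : ∀ y : ℝ, |y| = φ → Continuous fun τ : ℝ => g (τ + y * Complex.I) := by
    intro y hy
    exact hg.continuousOn.comp_continuous (by fun_prop) fun τ => by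
      simp only [mem_ofPred_eq, Complex.add_im, Complex.ofReal_im, Complex.mul_im, Complex.ofReal_re,
        Complex.I_im, mul_one, Complex.I_re, mul_zero, add_zero, zero_add]
      linarith
  have hi : ∀ y : ℝ, |y| = φ → Integrable fun τ : ℝ => g (τ + y * Complex.I) * expPole p (τ + y * Complex.I) :=
    fun y hy => integrable_mul_expPole (by linarith)
      (exp_line_ne_exp hp (by linarith) (by linarith)) (hline y hy)
      fun τ => hB _ (by simp [hy])
  have hi' : ∀ y : ℝ, |y| = φ → Integrable fun τ : ℝ => g p * expPole p (τ + y * Complex.I) :=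
    fun y hy => integrable_mul_expPole (g := fun _ => g p) (B := ‖g p‖) (by linarith)
      (exp_line_ne_exp hp (by linarith) (by linarith)) continuous_const
      fun τ => le_rfl
  have hDl : ∀ y : ℝ, |y| = φ → ∀ τ : ℝ, D (τ + y * Complex.I) =
      g (τ + y * Complex.I) * expPole p (τ + y * Complex.I) - g p * expPole p (τ + y * Complex.I) :=
    fun y hy τ => hDeq _ (by simpa [hy] using h2) (exp_line_ne_exp hp (by linarith) (by linarith) τ)
  have ha : |φ| = φ := abs_of_pos hφ
  have ha' : |-φ| = φ := by rw [abs_neg, ha]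
  have key := integral_strip_eq hφ h2 hDd
    (by simp_rw [hDl φ ha]; exact (hi φ ha).sub (hi' φ ha))
    (by simp_rw [hDl (-φ) ha']; exact (hi (-φ) ha').sub (hi' (-φ) ha')) (by
      intro ε hε
      obtain ⟨C, R, hC, hR, hb⟩ := exists_expPole_bound p
      have hB0 : 0 ≤ B := (norm_nonneg _).trans (hB 0 (by simp [hφ.le]))
      have ht : Tendsto (fun x : ℝ => (B + ‖g p‖) * (C * Real.exp (-x))) atTop (𝓝 0) := by
        have := ((Real.tendsto_exp_neg_atTop_nhds_zero).const_mul C).const_mul (B + ‖g p‖)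
        simpa using this
      obtain ⟨R', hR'⟩ := ((tendsto_order.1 ht).2 ε hε).exists_forall_of_atTop
      refine ⟨max R R', fun w hw hwR => ?_⟩
      have hne : Complex.exp w ≠ Complex.exp p := by
        intro h
        have := congrArg norm h
        rw [Complex.norm_exp, Complex.norm_exp] at this
        rw [Real.exp_injective this] at hwR
        linarith [le_max_left R R']
      rw [hDeq w (by linarith) hne, ← sub_mul, norm_mul]
      refine le_trans ?_ (hR' |w.re| ((le_max_right _ _).trans hwR)).le
      refine mul_le_mul ((norm_sub_le _ _).trans ?_)
        (hb w (by linarith) ((le_max_left _ _).trans hwR)) (norm_nonneg _) (by positivity)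
      gcongr
      exact hB w hw)
  simp_rw [hDl φ ha, hDl (-φ) ha'] at key
  rw [integral_sub (hi φ ha) (hi' φ ha), integral_sub (hi (-φ) ha') (hi' (-φ) ha'),
    integral_const_mul, integral_const_mul] at key
  have := integral_expPole_strip hp h1 (by linarith)
  linear_combination key + g p * this

end StripResidue

/-! ### Ray integrals: boundedness and decay. -/

section RayIntegrals

/-- The angle of the rays carrying the non-exponential part of the Mittag-Leffler kernel. -/
def rayAngle : ℝ := 5 * Real.pi / 8

theorem rayAngle_pos : 0 < rayAngle := by unfold rayAngle; positivity

theorem rayAngle_gt : Real.pi / 2 < rayAngle := by unfold rayAngle; linarith [Real.pi_pos]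

theorem rayAngle_lt : rayAngle < 3 * Real.pi / 4 := by unfold rayAngle; linarith [Real.pi_pos]

/-- The values of `z^α - e^(iαψ)` on the ray of angle `y`. -/
def rayDen (α ψ y ρ : ℝ) : ℂ :=
  ((ρ ^ α : ℝ) : ℂ) * Complex.exp ((α * y : ℝ) * Complex.I) - Complex.exp ((α * ψ : ℝ) * Complex.I)

/-- The contribution of the ray of angle `y`. -/
def rayIntegral (α ψ y x : ℝ) : ℂ :=
  ∫ ρ in Ioi (0 : ℝ), Complex.exp (ρ * Complex.exp (y * Complex.I) * x) *
    (Complex.exp (y * Complex.I) / rayDen α ψ y ρ)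

/-- The non-exponential part of the Mittag-Leffler kernel. -/
def mlRem (α ψ x : ℝ) : ℂ :=
  (2 * Real.pi * Complex.I)⁻¹ * (rayIntegral α ψ rayAngle x - rayIntegral α ψ (-rayAngle) x)

theorem cos_ray {y : ℝ} (hy : |y| = rayAngle) : Real.cos y = Real.cos rayAngle := by
  rw [← Real.cos_abs, hy]

theorem cos_rayAngle_neg : Real.cos rayAngle < 0 :=
  Real.cos_neg_of_pi_div_two_lt_of_lt rayAngle_gt (by linarith [Real.pi_pos, rayAngle_lt])

/-- The angle 5π/8 is taken so that both e^(iy) and e^(iαy) have negative real part for all 1 < α ≤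
2: then e^(zx) decays along the ray, and z^α stays away from the right half plane that contains
e^(iαψ). -/
theorem cos_mul_rayAngle_neg {α : ℝ} (hα : 1 < α) (hα' : α ≤ 2) : Real.cos (α * rayAngle) < 0 := by
  have := Real.pi_pos
  apply Real.cos_neg_of_pi_div_two_lt_of_lt <;> unfold rayAngle <;> nlinarith

theorem cos_mul_nonneg {α ψ : ℝ} (hα : 1 < α) (hψ : |ψ| ≤ Real.pi / (2 * α)) :
    0 ≤ Real.cos (α * ψ) := by
  rw [← Real.cos_abs, abs_mul, abs_of_pos (by linarith)]
  have : α * |ψ| ≤ Real.pi / 2 := by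
    rw [le_div_iff₀ (by linarith)] at hψ; linarith
  exact Real.cos_nonneg_of_neg_pi_div_two_le_of_le
    (by have := abs_nonneg ψ; have := Real.pi_pos; nlinarith) this

theorem norm_exp_mul_I_eq_one (y : ℝ) : ‖Complex.exp (y * Complex.I)‖ = 1 :=
  Complex.norm_exp_ofReal_mul_I y

/-- On the ray Re z^α = cos(αy) ρ^α < 0 while Re e^(iαψ) ≥ 0, so the modulus is at least |cos(αy)|
ρ^α; the triangle inequality gives 1 - ρ^α. The first bound is used when ρ^α ≥ 1/2 and the second
otherwise. -/
theorem exists_rayDen_bound {α : ℝ} (hα : 1 < α) (hα' : α ≤ 2) : ∃ c : ℝ, 0 < c ∧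
    ∀ ψ y ρ : ℝ, |ψ| ≤ Real.pi / (2 * α) → |y| = rayAngle → 0 ≤ ρ →
      c * (1 + ρ ^ α) ≤ ‖rayDen α ψ y ρ‖ := by
  have hδ := cos_mul_rayAngle_neg hα hα'
  set δ := Real.cos (α * rayAngle) with hδdef
  refine ⟨min (-δ) 1 / 3, by have := lt_min (neg_pos.2 hδ) one_pos; positivity,
    fun ψ y ρ hψ hy hρ => ?_⟩
  have hP : 0 ≤ ρ ^ α := Real.rpow_nonneg hρ _
  have hcy : Real.cos (α * y) = δ := by
    rw [← Real.cos_abs, abs_mul, hy, abs_of_pos (by linarith)]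
  have h1 : -δ * ρ ^ α ≤ ‖rayDen α ψ y ρ‖ := by
    have h := (neg_le_abs _).trans (Complex.abs_re_le_norm (rayDen α ψ y ρ))
    have e : (rayDen α ψ y ρ).re = ρ ^ α * Real.cos (α * y) - Real.cos (α * ψ) := by
      rw [rayDen, Complex.sub_re, Complex.re_ofReal_mul, Complex.exp_ofReal_mul_I_re,
        Complex.exp_ofReal_mul_I_re]
    rw [e, hcy] at h
    linarith [cos_mul_nonneg hα hψ]
  have h2 : 1 - ρ ^ α ≤ ‖rayDen α ψ y ρ‖ := by
    have := norm_sub_norm_le (Complex.exp ((α * ψ : ℝ) * Complex.I))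
      (((ρ ^ α : ℝ) : ℂ) * Complex.exp ((α * y : ℝ) * Complex.I))
    rw [norm_sub_rev, norm_mul, norm_exp_mul_I_eq_one, norm_exp_mul_I_eq_one, Complex.norm_real,
      Real.norm_of_nonneg hP, mul_one] at this
    exact this
  have m1 := min_le_left (-δ) 1
  have m2 := min_le_right (-δ) 1
  have m0 := lt_min (neg_pos.2 hδ) one_pos
  rcases le_total (1 / 2) (ρ ^ α) with h | h <;> nlinarith

theorem rayDen_ne_zero {α : ℝ} (hα : 1 < α) (hα' : α ≤ 2) {ψ y ρ : ℝ}
    (hψ : |ψ| ≤ Real.pi / (2 * α)) (hy : |y| = rayAngle) (hρ : 0 ≤ ρ) : rayDen α ψ y ρ ≠ 0 := by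
  obtain ⟨c, hc, h⟩ := exists_rayDen_bound hα hα'
  have := h ψ y ρ hψ hy hρ
  have hP : 0 ≤ ρ ^ α := Real.rpow_nonneg hρ _
  rw [← norm_pos_iff]
  exact lt_of_lt_of_le (by positivity) this

theorem integrableOn_inv_one_add_rpow {α : ℝ} (hα : 1 < α) :
    IntegrableOn (fun ρ : ℝ => (1 + ρ ^ α)⁻¹) (Ioi 0) := by
  rw [← Ioc_union_Ioi_eq_Ioi zero_le_one]
  have hm : Measurable (fun ρ : ℝ => (1 + ρ ^ α)⁻¹) := by fun_prop
  refine IntegrableOn.union ?_ ?_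
  · refine IntegrableOn.of_bound (by simp) hm.aestronglyMeasurable 1 ?_
    rw [ae_restrict_iff' measurableSet_Ioc]
    refine Eventually.of_forall fun ρ hρ => ?_
    have := Real.rpow_nonneg hρ.1.le α
    rw [Real.norm_of_nonneg (by positivity)]
    exact inv_le_one_of_one_le₀ (by linarith)
  · refine (integrableOn_Ioi_rpow_of_lt (a := -α) (by linarith) one_pos).mono' hm.aestronglyMeasurable ?_
    rw [ae_restrict_iff' measurableSet_Ioi]
    refine Eventually.of_forall fun ρ hρ => ?_
    have h0 : 0 < ρ := one_pos.trans hρ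
    have := Real.rpow_pos_of_pos h0 α
    rw [Real.norm_of_nonneg (by positivity), Real.rpow_neg h0.le]
    gcongr; linarith

theorem norm_exp_ray {y x ρ : ℝ} :
    ‖Complex.exp (ρ * Complex.exp (y * Complex.I) * x)‖ = Real.exp (ρ * Real.cos y * x) := by
  rw [Complex.norm_exp]
  congr 1
  rw [mul_right_comm, ← Complex.ofReal_mul, Complex.re_ofReal_mul, Complex.exp_ofReal_mul_I_re]
  ring

theorem norm_exp_ray_le_one {y x ρ : ℝ} (hy : |y| = rayAngle) (hx : 0 ≤ x) (hρ : 0 ≤ ρ) :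
    ‖Complex.exp (ρ * Complex.exp (y * Complex.I) * x)‖ ≤ 1 := by
  rw [norm_exp_ray, Real.exp_le_one_iff, cos_ray hy]
  have := cos_rayAngle_neg
  exact mul_nonpos_of_nonpos_of_nonneg (mul_nonpos_of_nonneg_of_nonpos hρ this.le) hx

theorem measurable_rayDen (α ψ y : ℝ) : Measurable (rayDen α ψ y) := by
  unfold rayDen; fun_prop

theorem norm_inv_rayDen_le {α c : ℝ} (hc : 0 < c) {ψ y ρ : ℝ} (hρ : 0 ≤ ρ)
    (h : c * (1 + ρ ^ α) ≤ ‖rayDen α ψ y ρ‖) :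
    ‖Complex.exp (y * Complex.I) / rayDen α ψ y ρ‖ ≤ c⁻¹ * (1 + ρ ^ α)⁻¹ := by
  have hP : 0 ≤ ρ ^ α := Real.rpow_nonneg hρ _
  rw [norm_div, norm_exp_mul_I_eq_one, one_div, ← mul_inv]
  gcongr

variable {α : ℝ}

theorem integrableOn_rayIntegrand (hα : 1 < α) (hα' : α ≤ 2) {ψ y x : ℝ}
    (hψ : |ψ| ≤ Real.pi / (2 * α)) (hy : |y| = rayAngle) (hx : 0 ≤ x) :
    IntegrableOn (fun ρ : ℝ => Complex.exp (ρ * Complex.exp (y * Complex.I) * x) *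
      (Complex.exp (y * Complex.I) / rayDen α ψ y ρ)) (Ioi 0) := by
  obtain ⟨c, hc, h⟩ := exists_rayDen_bound hα hα'
  have hm := measurable_rayDen α ψ y
  refine ((integrableOn_inv_one_add_rpow hα).const_mul c⁻¹).mono'
    (Measurable.aestronglyMeasurable (by fun_prop)) ?_
  rw [ae_restrict_iff' measurableSet_Ioi]
  refine Eventually.of_forall fun ρ hρ => ?_
  have hρ := le_of_lt (mem_Ioi.1 hρ)
  rw [norm_mul, ← one_mul (c⁻¹ * _)]
  exact mul_le_mul (norm_exp_ray_le_one hy hx hρ) (norm_inv_rayDen_le hc hρ (h ψ y ρ hψ hy hρ))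
    (norm_nonneg _) zero_le_one

theorem exists_rayIntegral_bound (hα : 1 < α) (hα' : α ≤ 2) : ∃ C : ℝ, 0 ≤ C ∧
    ∀ ψ y x : ℝ, |ψ| ≤ Real.pi / (2 * α) → |y| = rayAngle → 0 ≤ x →
      ‖rayIntegral α ψ y x‖ ≤ C := by
  obtain ⟨c, hc, h⟩ := exists_rayDen_bound hα hα'
  refine ⟨∫ ρ in Ioi (0 : ℝ), c⁻¹ * (1 + ρ ^ α)⁻¹, ?_, fun ψ y x hψ hy hx => ?_⟩
  · refine setIntegral_nonneg measurableSet_Ioi fun ρ hρ => ?_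
    have := Real.rpow_nonneg (le_of_lt (mem_Ioi.1 hρ)) α
    positivity
  · refine norm_integral_le_of_norm_le ((integrableOn_inv_one_add_rpow hα).const_mul c⁻¹) ?_
    rw [ae_restrict_iff' measurableSet_Ioi]
    refine Eventually.of_forall fun ρ hρ => ?_
    have hρ := le_of_lt (mem_Ioi.1 hρ)
    rw [norm_mul, ← one_mul (c⁻¹ * _)]
    exact mul_le_mul (norm_exp_ray_le_one hy hx hρ) (norm_inv_rayDen_le hc hρ (h ψ y ρ hψ hy hρ))
      (norm_nonneg _) zero_le_one

theorem continuousOn_rayIntegral (hα : 1 < α) (hα' : α ≤ 2) {ψ y : ℝ}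
    (hψ : |ψ| ≤ Real.pi / (2 * α)) (hy : |y| = rayAngle) :
    ContinuousOn (rayIntegral α ψ y) (Ici 0) := by
  obtain ⟨c, hc, h⟩ := exists_rayDen_bound hα hα'
  have hm := measurable_rayDen α ψ y
  refine continuousOn_of_dominated (bound := fun ρ => c⁻¹ * (1 + ρ ^ α)⁻¹)
    (fun x _ => Measurable.aestronglyMeasurable (by fun_prop)) (fun x hx => ?_)
    ((integrableOn_inv_one_add_rpow hα).const_mul c⁻¹)
    (Eventually.of_forall fun ρ => by fun_prop)
  rw [ae_restrict_iff' measurableSet_Ioi]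
  refine Eventually.of_forall fun ρ hρ => ?_
  have hρ := le_of_lt (mem_Ioi.1 hρ)
  rw [norm_mul, ← one_mul (c⁻¹ * _)]
  exact mul_le_mul (norm_exp_ray_le_one hy hx hρ) (norm_inv_rayDen_le hc hρ (h ψ y ρ hψ hy hρ))
    (norm_nonneg _) zero_le_one

theorem continuousOn_mlRem (hα : 1 < α) (hα' : α ≤ 2) {ψ : ℝ}
    (hψ : |ψ| ≤ Real.pi / (2 * α)) : ContinuousOn (mlRem α ψ) (Ici 0) :=
  continuousOn_const.mul ((continuousOn_rayIntegral hα hα' hψ (abs_of_pos rayAngle_pos)).sub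
    (continuousOn_rayIntegral hα hα' hψ (by rw [abs_neg, abs_of_pos rayAngle_pos])))

theorem norm_two_pi_I_inv_le : ‖(2 * Real.pi * Complex.I : ℂ)⁻¹‖ ≤ 1 := by
  rw [norm_inv]
  refine inv_le_one_of_one_le₀ ?_
  simp only [Complex.norm_mul, Complex.norm_ofNat, Complex.norm_real, Complex.norm_I, mul_one]
  rw [Real.norm_of_nonneg Real.pi_pos.le]
  linarith [Real.pi_gt_three]

theorem exists_mlRem_bound (hα : 1 < α) (hα' : α ≤ 2) : ∃ C : ℝ, 0 ≤ C ∧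
    ∀ ψ x : ℝ, |ψ| ≤ Real.pi / (2 * α) → 0 ≤ x → ‖mlRem α ψ x‖ ≤ C := by
  obtain ⟨C, hC, h⟩ := exists_rayIntegral_bound hα hα'
  refine ⟨2 * C, by positivity, fun ψ x hψ hx => ?_⟩
  have h1 := h ψ rayAngle x hψ (abs_of_pos rayAngle_pos) hx
  have h2 := h ψ (-rayAngle) x hψ (by rw [abs_neg, abs_of_pos rayAngle_pos]) hx
  rw [mlRem, norm_mul, ← one_mul (2 * C)]
  refine mul_le_mul norm_two_pi_I_inv_le ((norm_sub_le _ _).trans (by linarith)) (norm_nonneg _)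
    zero_le_one

theorem ray_re_neg {y : ℝ} (hy : |y| = rayAngle) : (Complex.exp (y * Complex.I)).re < 0 := by
  rw [Complex.exp_ofReal_mul_I_re, cos_ray hy]; exact cos_rayAngle_neg

/-- With L = e^(iαψ), replacing the denominator by its value -L at ρ = 0 gives exactly L⁻¹/x. The
error in 1/(z^α - L) is O(ρ^α), and integrating it against the decaying exponential yields Γ(α+1)
and the power x^(-(α+1)). -/
theorem exists_rayIntegral_decay (hα : 1 < α) (hα' : α ≤ 2) : ∃ C : ℝ, 0 ≤ C ∧
    ∀ ψ y x : ℝ, |ψ| ≤ Real.pi / (2 * α) → |y| = rayAngle → 0 < x →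
      ‖rayIntegral α ψ y x - Complex.exp (-((α * ψ : ℝ) * Complex.I)) / x‖ ≤ C * x ^ (-(α + 1)) := by
  obtain ⟨c, hc, h⟩ := exists_rayDen_bound hα hα'
  set κ := -Real.cos rayAngle with hκ
  have hκ0 : 0 < κ := neg_pos.2 cos_rayAngle_neg
  refine ⟨c⁻¹ * (κ ^ (-(α + 1)) * Real.Gamma (α + 1)), ?_, fun ψ y x hψ hy hx => ?_⟩
  · have := Real.Gamma_pos_of_pos (show 0 < α + 1 by linarith); positivity
  set ω := Complex.exp (y * Complex.I) with hω
  set L := Complex.exp ((α * ψ : ℝ) * Complex.I) with hL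
  have hL0 : L ≠ 0 := Complex.exp_ne_zero _
  have hLi : Complex.exp (-((α * ψ : ℝ) * Complex.I)) = L⁻¹ := Complex.exp_neg _
  have hωx : (ω * x).re < 0 := by
    rw [mul_comm, Complex.re_ofReal_mul]; exact mul_neg_of_pos_of_neg hx (ray_re_neg hy)
  have hω0 : ω ≠ 0 := Complex.exp_ne_zero _
  have hx0 : (x : ℂ) ≠ 0 := by exact_mod_cast hx.ne'
  have i2 : IntegrableOn (fun ρ : ℝ => Complex.exp (ω * x * ρ) * (ω * L⁻¹)) (Ioi 0) :=
    (integrableOn_exp_mul_complex_Ioi hωx 0).mul_const _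
  have v2 : ∫ ρ in Ioi (0 : ℝ), Complex.exp (ω * x * ρ) * (ω * L⁻¹) = -(L⁻¹ / x) := by
    rw [integral_mul_const, integral_exp_mul_complex_Ioi hωx 0]
    simp
    field_simp
  have e : rayIntegral α ψ y x - Complex.exp (-((α * ψ : ℝ) * Complex.I)) / x =
      ∫ ρ in Ioi (0 : ℝ), (Complex.exp (ρ * ω * x) * (ω / rayDen α ψ y ρ) +
        Complex.exp (ω * x * ρ) * (ω * L⁻¹)) := by
    rw [integral_add (integrableOn_rayIntegrand hα hα' hψ hy hx.le) i2, v2, hLi, rayIntegral]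
    ring
  rw [e]
  have hval := Real.integral_rpow_mul_exp_neg_mul_Ioi (show 0 < α + 1 by linarith)
    (show 0 < κ * x by positivity)
  have hint := integrableOn_rpow_mul_exp (show 0 < α + 1 by linarith) (show 0 < κ * x by positivity)
  rw [add_sub_cancel_right] at hval hint
  have hfin : c⁻¹ * (κ ^ (-(α + 1)) * Real.Gamma (α + 1)) * x ^ (-(α + 1)) =
      ∫ ρ in Ioi (0 : ℝ), c⁻¹ * (ρ ^ α * Real.exp (-(κ * x * ρ))) := by
    rw [integral_const_mul, hval, one_div, Real.inv_rpow (by positivity),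
      ← Real.rpow_neg (by positivity), Real.mul_rpow hκ0.le hx.le]
    ring
  rw [hfin]
  refine norm_integral_le_of_norm_le (hint.const_mul c⁻¹) ?_
  rw [ae_restrict_iff' measurableSet_Ioi]
  refine Eventually.of_forall fun ρ hρ => ?_
  have hρ := le_of_lt (mem_Ioi.1 hρ)
  have hd0 := rayDen_ne_zero hα hα' hψ hy hρ
  have hP : 0 ≤ ρ ^ α := Real.rpow_nonneg hρ _
  have hd := h ψ y ρ hψ hy hρ
  have e3 : Complex.exp (ρ * ω * x) * (ω / rayDen α ψ y ρ) + Complex.exp (ω * x * ρ) * (ω * L⁻¹) =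
      Complex.exp (ρ * ω * x) * (ω * (((ρ ^ α : ℝ) : ℂ) * Complex.exp ((α * y : ℝ) * Complex.I)) *
        L⁻¹ / rayDen α ψ y ρ) := by
    have : ((ρ ^ α : ℝ) : ℂ) * Complex.exp ((α * y : ℝ) * Complex.I) = rayDen α ψ y ρ + L := by
      rw [rayDen]; ring
    rw [this, show ω * x * ρ = ρ * ω * x by ring]
    field_simp
    ring
  rw [e3, norm_mul, norm_exp_ray, norm_div, norm_mul, norm_mul, norm_mul, norm_inv, hL,
    norm_exp_mul_I_eq_one, norm_exp_mul_I_eq_one, norm_exp_mul_I_eq_one, Complex.norm_real,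
    Real.norm_of_nonneg hP, inv_one, mul_one, mul_one, one_mul, cos_ray hy,
    show ρ * Real.cos rayAngle * x = -(κ * x * ρ) by rw [hκ]; ring]
  have hb : ρ ^ α / ‖rayDen α ψ y ρ‖ ≤ c⁻¹ * ρ ^ α := by
    rw [div_le_iff₀ (norm_pos_iff.2 hd0)]
    have h1 : 1 ≤ c⁻¹ * ‖rayDen α ψ y ρ‖ := by
      rw [inv_mul_eq_div, le_div_iff₀ hc]; nlinarith
    nlinarith
  calc _ ≤ Real.exp (-(κ * x * ρ)) * (c⁻¹ * ρ ^ α) := by gcongr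
    _ = _ := by ring

/-- The leading term L⁻¹/x does not depend on the ray, so it cancels in the difference of the two
rays. -/
theorem exists_mlRem_decay (hα : 1 < α) (hα' : α ≤ 2) : ∃ C : ℝ, 0 ≤ C ∧
    ∀ ψ x : ℝ, |ψ| ≤ Real.pi / (2 * α) → 0 < x → ‖mlRem α ψ x‖ ≤ C * x ^ (-(α + 1)) := by
  obtain ⟨C, hC, h⟩ := exists_rayIntegral_decay hα hα'
  refine ⟨2 * C, by positivity, fun ψ x hψ hx => ?_⟩
  have h1 := h ψ rayAngle x hψ (abs_of_pos rayAngle_pos) hx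
  have h2 := h ψ (-rayAngle) x hψ (by rw [abs_neg, abs_of_pos rayAngle_pos]) hx
  rw [mlRem, norm_mul, ← one_mul (2 * C * _)]
  refine mul_le_mul norm_two_pi_I_inv_le ?_ (norm_nonneg _) zero_le_one
  rw [← sub_sub_sub_cancel_right _ _ (Complex.exp (-((α * ψ : ℝ) * Complex.I)) / x)]
  exact (norm_sub_le _ _).trans (by linarith)

end RayIntegrals

/-! ### Laplace transform of the remainder and the exponential decomposition. -/

section Identification

variable {α : ℝ}

theorem integral_Ioi_eq_integral_exp (F : ℝ → ℂ) :
    ∫ ρ in Ioi (0 : ℝ), F ρ = ∫ τ : ℝ, (Real.exp τ : ℂ) * F (Real.exp τ) := by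
  have := integral_image_eq_integral_abs_deriv_smul (s := univ) (f := Real.exp) (f' := Real.exp)
    MeasurableSet.univ (fun x _ => (Real.hasDerivAt_exp x).hasDerivWithinAt)
    Real.exp_injective.injOn F
  rw [image_univ, Real.range_exp, setIntegral_univ] at this
  rw [this]
  congr 1; ext τ
  rw [abs_of_pos (Real.exp_pos τ), Complex.real_smul]

theorem ray_re_lt {y ρ : ℝ} {s : ℂ} (hy : |y| = rayAngle) (hs : 0 < s.re) (hρ : 0 ≤ ρ) :
    (-s + ρ * Complex.exp (y * Complex.I)).re < 0 := by
  rw [Complex.add_re, Complex.re_ofReal_mul, Complex.neg_re]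
  have := mul_nonpos_of_nonneg_of_nonpos hρ (ray_re_neg hy).le
  linarith

/-- Fubini, and ∫ e^(-(s-z)x) dx = 1/(s - z) because Re z ≤ 0 < Re s on the ray. -/
theorem laplace_rayIntegral (hα : 1 < α) (hα' : α ≤ 2) {ψ y : ℝ}
    (hψ : |ψ| ≤ Real.pi / (2 * α)) (hy : |y| = rayAngle) {s : ℂ} (hs : 0 < s.re) :
    ∫ x in Ioi (0 : ℝ), Complex.exp (-(s * x)) * rayIntegral α ψ y x =
      ∫ ρ in Ioi (0 : ℝ), Complex.exp (y * Complex.I) /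
        (rayDen α ψ y ρ * (s - ρ * Complex.exp (y * Complex.I))) := by
  obtain ⟨c, hc, h⟩ := exists_rayDen_bound hα hα'
  have hm := measurable_rayDen α ψ y
  have hexp : IntegrableOn (fun x : ℝ => Real.exp (-s.re * x)) (Ioi 0) :=
    integrableOn_exp_mul_Ioi (by linarith) 0
  have hint : Integrable (Function.uncurry fun (x ρ : ℝ) => Complex.exp (-(s * x)) *
      (Complex.exp (ρ * Complex.exp (y * Complex.I) * x) *
        (Complex.exp (y * Complex.I) / rayDen α ψ y ρ)))
      ((volume.restrict (Ioi 0)).prod (volume.restrict (Ioi 0))) := by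
    refine (hexp.mul_prod ((integrableOn_inv_one_add_rpow hα).const_mul c⁻¹)).mono'
      (Measurable.aestronglyMeasurable ?_) ?_
    · have : Measurable fun p : ℝ × ℝ => rayDen α ψ y p.2 := hm.comp measurable_snd
      simp only [Function.uncurry_def]
      fun_prop
    · rw [Measure.prod_restrict, ae_restrict_iff' (measurableSet_Ioi.prod measurableSet_Ioi)]
      refine Eventually.of_forall fun p hp => ?_
      have hx := le_of_lt (mem_Ioi.1 hp.1)
      have hρ := le_of_lt (mem_Ioi.1 hp.2)
      rw [Function.uncurry_def, norm_mul, norm_mul]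
      have e1 : ‖Complex.exp (-(s * p.1))‖ = Real.exp (-s.re * p.1) := by
        rw [Complex.norm_exp]; simp
      rw [e1]
      refine mul_le_mul_of_nonneg_left ?_ (Real.exp_pos _).le
      rw [← one_mul (c⁻¹ * _)]
      exact mul_le_mul (norm_exp_ray_le_one hy hx hρ) (norm_inv_rayDen_le hc hρ (h ψ y _ hψ hy hρ))
        (norm_nonneg _) zero_le_one
  unfold rayIntegral
  simp_rw [← integral_const_mul]
  rw [integral_integral_swap hint]
  refine setIntegral_congr_fun measurableSet_Ioi fun ρ hρ => ?_
  have hρ := le_of_lt (mem_Ioi.1 hρ)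
  have hre := ray_re_lt hy hs hρ
  have e : ∀ x : ℝ, Complex.exp (-(s * x)) * (Complex.exp (ρ * Complex.exp (y * Complex.I) * x) *
        (Complex.exp (y * Complex.I) / rayDen α ψ y ρ)) =
      Complex.exp ((-s + ρ * Complex.exp (y * Complex.I)) * x) *
        (Complex.exp (y * Complex.I) / rayDen α ψ y ρ) := by
    intro x
    rw [← mul_assoc, ← Complex.exp_add]; ring_nf
  simp_rw [e]
  rw [integral_mul_const, integral_exp_mul_complex_Ioi hre 0]
  have hd0 := rayDen_ne_zero hα hα' hψ hy hρ
  have h1 : (-s + ρ * Complex.exp (y * Complex.I)) ≠ 0 := fun h0 => by rw [h0] at hre; simp at hre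
  have h2 : (s - ρ * Complex.exp (y * Complex.I)) ≠ 0 := fun h0 => h1 (by linear_combination -h0)
  rw [Complex.ofReal_zero, mul_zero, Complex.exp_zero]
  have h3 : (-s + ρ * Complex.exp (y * Complex.I)) = -(s - ρ * Complex.exp (y * Complex.I)) := by ring
  rw [h3]
  field_simp

/-- `(e^w - e^p) / (e^(αw) - e^(αp))` with the singularity at `p` removed. -/
def expQuot (α : ℝ) (p w : ℂ) : ℂ :=
  dslope Complex.exp p w / dslope (fun w => Complex.exp (α * w)) p w

theorem expQuot_same (p : ℂ) :
    expQuot α p p = Complex.exp p / (α * Complex.exp (α * p)) := by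
  have h : HasDerivAt (fun w : ℂ => Complex.exp (α * w)) (Complex.exp (α * p) * (α * 1)) p :=
    ((hasDerivAt_id p).const_mul (α : ℂ)).cexp
  rw [expQuot, dslope_same, dslope_same, Complex.deriv_exp, h.deriv]
  ring

theorem expQuot_of_ne {p w : ℂ} (h : w ≠ p) : expQuot α p w =
    (Complex.exp w - Complex.exp p) / (Complex.exp (α * w) - Complex.exp (α * p)) := by
  rw [expQuot, dslope_of_ne _ h, dslope_of_ne _ h, slope_def_field, slope_def_field,
    div_div_div_cancel_right₀ (sub_ne_zero.2 h)]

/-- The denominator vanishes only at p, to first order: α|Im w - Im p| < 3π/2 + π/2 = 2π, so the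
exponential takes the value e^(αp) only once in the strip. This is what limits the strip to 3π/4. -/
theorem differentiableOn_expQuot (hα : 1 < α) (hα' : α ≤ 2) {p : ℂ} (hp : |p.im| ≤ Real.pi / (2 * α)) :
    DifferentiableOn ℂ (expQuot α p) {w | |w.im| < 3 * Real.pi / 4} := by
  have hπ := Real.pi_pos
  have hopen : IsOpen {w : ℂ | |w.im| < 3 * Real.pi / 4} :=
    isOpen_lt (Complex.continuous_im.abs) continuous_const
  have hp2 : α * |p.im| ≤ Real.pi / 2 := by
    rw [le_div_iff₀ (by linarith)] at hp; linarith
  have hpm : {w : ℂ | |w.im| < 3 * Real.pi / 4} ∈ 𝓝 p := by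
    refine hopen.mem_nhds ?_
    have := abs_nonneg p.im
    simp only [mem_ofPred_eq]
    nlinarith
  refine DifferentiableOn.div
      ((Complex.differentiableOn_dslope hpm).2 Complex.differentiable_exp.differentiableOn)
      ((Complex.differentiableOn_dslope hpm).2 (by fun_prop)) fun w hw => ?_
  rcases eq_or_ne w p with rfl | hwp
  · have h : HasDerivAt (fun w : ℂ => Complex.exp (α * w)) (Complex.exp (α * w) * (α * 1)) w :=
      ((hasDerivAt_id w).const_mul (α : ℂ)).cexp
    rw [dslope_same, h.deriv]
    have : (α : ℂ) ≠ 0 := by exact_mod_cast (by linarith : α ≠ 0)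
    simp [this]
  · rw [dslope_of_ne _ hwp, slope_def_field]
    have hα0 : (α : ℂ) ≠ 0 := by exact_mod_cast (by linarith : α ≠ 0)
    refine div_ne_zero (sub_ne_zero.2 (exp_ne_exp_of_im ?_ fun h => hwp (mul_left_cancel₀ hα0 h)))
      (sub_ne_zero.2 hwp)
    rw [Complex.im_ofReal_mul, Complex.im_ofReal_mul, ← mul_sub, abs_mul, abs_of_pos (by linarith)]
    have := abs_sub w.im p.im
    simp only [mem_ofPred_eq] at hw
    nlinarith

theorem exists_expQuot_bound (hα : 1 < α) (hα' : α ≤ 2) {ψ : ℝ} (hψ : |ψ| ≤ Real.pi / (2 * α)) :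
    ∃ B : ℝ, ∀ w : ℂ, |w.im| ≤ rayAngle → ‖expQuot α (ψ * Complex.I) w‖ ≤ B := by
  have hK : IsCompact (Icc (-1 : ℝ) 1 ×ℂ Icc (-rayAngle) rayAngle) := isCompact_Icc.reProdIm isCompact_Icc
  obtain ⟨B, hB⟩ := hK.exists_bound_of_continuousOn
    ((differentiableOn_expQuot hα hα' (p := ψ * Complex.I) (by simpa using hψ)).continuousOn.mono
      fun w hw => by
        have := abs_le.2 (Complex.mem_reProdIm.1 hw).2
        exact this.trans_lt rayAngle_lt)
  -- Compactness gives B for |Re w| ≤ 1. For |Re w| > 1, both the right end, (e^r + 1)/(e^(αr) - 1),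
  -- and the left end, 2/(1 - 1/2), are at most 4.
  refine ⟨max B 4, fun w hw => ?_⟩
  by_cases hre : |w.re| ≤ 1
  · exact (hB w (Complex.mem_reProdIm.2 ⟨abs_le.1 hre, abs_le.1 hw⟩)).trans (le_max_left _ _)
  refine le_trans ?_ (le_max_right _ _)
  push Not at hre
  have hne : w ≠ ψ * Complex.I := by
    rintro rfl; simp at hre; linarith
  have he : (2 : ℝ) ≤ Real.exp 1 := by linarith [Real.add_one_le_exp (1 : ℝ)]
  have n1 : ‖Complex.exp w‖ = Real.exp w.re := Complex.norm_exp w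
  have n2 : ‖Complex.exp (α * w)‖ = Real.exp (α * w.re) := by
    rw [Complex.norm_exp, Complex.re_ofReal_mul]
  have n3 : ‖Complex.exp (ψ * Complex.I)‖ = 1 := norm_exp_mul_I_eq_one _
  have n4 : ‖Complex.exp (α * (ψ * Complex.I))‖ = 1 := by
    rw [← mul_assoc, ← Complex.ofReal_mul]; exact norm_exp_mul_I_eq_one _
  have hnum := norm_sub_le (Complex.exp w) (Complex.exp (ψ * Complex.I))
  rw [n1, n3] at hnum
  rw [expQuot_of_ne hne, norm_div]
  rcases le_total 0 w.re with h0 | h0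
  · rw [abs_of_nonneg h0] at hre
    have hden := norm_sub_norm_le (Complex.exp (α * w)) (Complex.exp (α * (ψ * Complex.I)))
    rw [n2, n4] at hden
    have a1 : Real.exp 1 ≤ Real.exp w.re := Real.exp_le_exp.2 hre.le
    have a2 : Real.exp w.re ≤ Real.exp (α * w.re) := Real.exp_le_exp.2 (by nlinarith)
    rw [div_le_iff₀ (by linarith)]
    linarith
  · rw [abs_of_nonpos h0] at hre
    have hden := norm_sub_norm_le (Complex.exp (α * (ψ * Complex.I))) (Complex.exp (α * w))
    rw [norm_sub_rev, n2, n4] at hden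
    have a1 : Real.exp w.re ≤ 1 := Real.exp_le_one_iff.2 h0
    have a2 : Real.exp (α * w.re) ≤ Real.exp (-1) := Real.exp_le_exp.2 (by nlinarith)
    have a3 : Real.exp (-1) ≤ 1 / 2 := by
      rw [Real.exp_neg, inv_eq_one_div]
      exact one_div_le_one_div_of_le two_pos he
    rw [div_le_iff₀ (by linarith)]
    linarith

theorem abs_le_pi_div {α ψ : ℝ} (hα : 1 < α) (hψ : |ψ| ≤ Real.pi / (2 * α)) : |ψ| < Real.pi / 2 := by
  refine hψ.trans_lt ?_
  have := Real.pi_pos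
  gcongr
  linarith

/-- With μ = e^(iψ), L = μ^α and g = (z - μ)/(z^α - L), the integrand is g dz/((z - μ)(s - z)).
Partial fractions split it into (s - μ)⁻¹ g (1/(z - μ) - 1/(z - s)) dz; in the coordinate log z
these are model poles at p = log μ and q = log s, the auxiliary poles at -1 cancelling. The residue
formula gives (s - μ)⁻¹ (g(s) - g(μ)), with g(μ) = μ/(αL). The condition Re s > 1 keeps s away from
μ. -/
theorem laplace_mlRem (hα : 1 < α) (hα' : α ≤ 2) {ψ : ℝ} (hψ : |ψ| ≤ Real.pi / (2 * α)) {s : ℂ}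
    (hs : 1 < s.re) :
    ∫ x in Ioi (0 : ℝ), Complex.exp (-(s * x)) * mlRem α ψ x =
      1 / (s ^ (α : ℂ) - Complex.exp ((α * ψ : ℝ) * Complex.I)) -
        Complex.exp (ψ * Complex.I) / (α * Complex.exp ((α * ψ : ℝ) * Complex.I)) /
          (s - Complex.exp (ψ * Complex.I)) := by
  have hs0 : 0 < s.re := by linarith
  have hsne : s ≠ 0 := fun h => by simp [h] at hs0
  set μ := Complex.exp (ψ * Complex.I) with hμ
  have hsμ : s - μ ≠ 0 := by
    intro h
    have h1 := (Complex.re_le_norm μ)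
    rw [hμ, norm_exp_mul_I_eq_one, ← hμ, ← sub_eq_zero.1 h] at h1
    linarith
  have hψ2 := abs_le_pi_div hα hψ
  have hlogim : |(Complex.log s).im| < Real.pi / 2 := by
    rw [Complex.log_im]; exact Complex.abs_arg_lt_pi_div_two_iff.2 (Or.inl hs0)
  have hπ := Real.pi_pos
  set p : ℂ := ψ * Complex.I with hp
  set q : ℂ := Complex.log s with hq
  have hpim : p.im = ψ := by simp [hp]
  have hexpq : Complex.exp q = s := Complex.exp_log hsne
  have hqp : q ≠ p := fun h => hsμ (by rw [← hexpq, h, hμ, sub_self])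
  have line : ∀ y : ℝ, |y| = rayAngle →
      (∫ x in Ioi (0 : ℝ), Complex.exp (-(s * x)) * rayIntegral α ψ y x) = (s - μ)⁻¹ *
        ((∫ τ : ℝ, expQuot α p (τ + y * Complex.I) * expPole p (τ + y * Complex.I)) -
         ∫ τ : ℝ, expQuot α p (τ + y * Complex.I) * expPole q (τ + y * Complex.I)) := by
    intro y hy
    have hy1 : Real.pi / 2 < |y| := hy ▸ rayAngle_gt
    have hy2 : |y| < Real.pi := by rw [hy]; linarith [rayAngle_lt]
    obtain ⟨B, hB⟩ := exists_expQuot_bound hα hα' hψ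
    have hg : Continuous fun τ : ℝ => expQuot α p (τ + y * Complex.I) :=
      (differentiableOn_expQuot hα hα' (p := p) (by rwa [hpim])).continuousOn.comp_continuous
        (by fun_prop) fun τ => by
          have := rayAngle_lt
          simp [hy]; linarith
    have ne1 := exp_line_ne_exp (p := p) (by rwa [hpim]) hy1 hy2
    have ne2 := exp_line_ne_exp (p := q) hlogim hy1 hy2
    have i1 := integrable_mul_expPole (B := B) hy2 ne1 hg fun τ => hB _ (by simp [hy])
    have i2 := integrable_mul_expPole (B := B) hy2 ne2 hg fun τ => hB _ (by simp [hy])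
    rw [laplace_rayIntegral hα hα' hψ hy hs0, integral_Ioi_eq_integral_exp, ← integral_sub i1 i2,
      ← integral_const_mul]
    congr 1; ext τ
    have hw : Complex.exp (τ + y * Complex.I) = (Real.exp τ : ℂ) * Complex.exp (y * Complex.I) := by
      rw [Complex.exp_add, ← Complex.ofReal_exp]
    have hwp : (τ + y * Complex.I : ℂ) ≠ p := fun h => ne1 τ (by rw [h])
    have hden : rayDen α ψ y (Real.exp τ) =
        Complex.exp (α * (τ + y * Complex.I)) - Complex.exp (α * p) := by
      rw [rayDen, ← Real.exp_mul, Complex.ofReal_exp, ← Complex.exp_add]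
      congr 2
      · push_cast; ring
      · rw [hp]; push_cast; ring
    have hd0 := rayDen_ne_zero hα hα' hψ hy (Real.exp_pos τ).le
    rw [hden] at hd0
    have n1 := sub_ne_zero.2 (ne1 τ)
    have n2 := sub_ne_zero.2 (ne2 τ).symm
    rw [hden, expQuot_of_ne hwp, expPole, expPole]
    rw [← mul_sub, sub_sub_sub_cancel_right]
    rw [hexpq] at n2 ⊢
    have n3 : Complex.exp (τ + y * Complex.I) - s ≠ 0 := fun h => n2 (by linear_combination -h)
    rw [← hμ] at n1 ⊢
    rw [← hw] 
    have e1 : (Real.exp τ : ℂ) * (Complex.exp (y * Complex.I) / ((Complex.exp (α * (τ + y * Complex.I)) -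
        Complex.exp (α * p)) * (s - Complex.exp (τ + y * Complex.I)))) =
        Complex.exp (τ + y * Complex.I) / ((Complex.exp (α * (τ + y * Complex.I)) -
        Complex.exp (α * p)) * (s - Complex.exp (τ + y * Complex.I))) := by
      rw [hw, mul_div_assoc]
    rw [e1, div_sub_div _ _ n1 n3]
    have n4 : s - Complex.exp (τ + y * Complex.I) = -(Complex.exp (τ + y * Complex.I) - s) := by ring
    rw [n4]
    field_simp
    ring
  have hint : ∀ y : ℝ, |y| = rayAngle →
      IntegrableOn (fun x : ℝ => Complex.exp (-(s * x)) * rayIntegral α ψ y x) (Ioi 0) := by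
    intro y hy
    obtain ⟨C, hC, hb⟩ := exists_rayIntegral_bound hα hα'
    refine ((integrableOn_exp_mul_Ioi (a := -s.re) (by linarith) 0).mul_const C).mono'
      (ContinuousOn.aestronglyMeasurable ?_ measurableSet_Ioi) ?_
    · exact ContinuousOn.mul (by fun_prop)
        ((continuousOn_rayIntegral hα hα' hψ hy).mono Ioi_subset_Ici_self)
    · rw [ae_restrict_iff' measurableSet_Ioi]
      refine Eventually.of_forall fun x hx => ?_
      rw [norm_mul, Complex.norm_exp]
      simp only [Complex.neg_re, Complex.mul_re, Complex.ofReal_re, Complex.ofReal_im, mul_zero,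
        sub_zero, neg_mul]
      gcongr
      exact hb ψ y x hψ hy (le_of_lt hx)
  have ha : |rayAngle| = rayAngle := abs_of_pos rayAngle_pos
  have ha' : |-rayAngle| = rayAngle := by rw [abs_neg, ha]
  obtain ⟨B, hB⟩ := exists_expQuot_bound hα hα' hψ
  have hgd := differentiableOn_expQuot hα hα' (p := p) (by rwa [hpim])
  have r1 := integral_strip_mul_expPole rayAngle_gt rayAngle_lt hgd hB (p := p) (by rwa [hpim])
  have r2 := integral_strip_mul_expPole rayAngle_gt rayAngle_lt hgd hB (p := q) hlogim
  have e0 : ∀ x : ℝ, Complex.exp (-(s * x)) * mlRem α ψ x = (2 * Real.pi * Complex.I)⁻¹ *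
      (Complex.exp (-(s * x)) * rayIntegral α ψ rayAngle x -
        Complex.exp (-(s * x)) * rayIntegral α ψ (-rayAngle) x) := by
    intro x; rw [mlRem]; ring
  simp_rw [e0]
  rw [integral_const_mul, integral_sub (hint _ ha) (hint _ ha'), line _ ha, line _ ha', ← mul_sub]
  have e1 : ∀ a b c d : ℂ, a - b - (c - d) = (a - c) - (b - d) := fun a b c d => by ring
  rw [e1, r1, r2, expQuot_same, expQuot_of_ne hqp, hexpq]
  have hsa : Complex.exp (α * q) = s ^ (α : ℂ) := by
    rw [Complex.cpow_def_of_ne_zero hsne, mul_comm]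
  have hL : Complex.exp (α * p) = Complex.exp ((α * ψ : ℝ) * Complex.I) := by
    rw [hp]; push_cast; ring_nf
  rw [hsa, hL, ← hμ]
  have h2 : (2 * Real.pi * Complex.I : ℂ) ≠ 0 := Complex.two_pi_I_ne_zero
  have e2 : ∀ A B : ℂ, (2 * Real.pi * Complex.I)⁻¹ * ((s - μ)⁻¹ *
      (-(2 * Real.pi * Complex.I) * A - -(2 * Real.pi * Complex.I) * B)) = (s - μ)⁻¹ * (B - A) := by
    intro A B; field_simp; ring
  rw [e2, mul_sub]
  congr 1
  · rw [← mul_div_assoc, inv_mul_cancel₀ hsμ]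
  · rw [inv_mul_eq_div]

/-- The Mittag-Leffler kernel is an exponential plus a bounded integrable remainder. -/
theorem mlKernel_eq_exp_add_mlRem (hα : 1 < α) (hα' : α ≤ 2) {ψ : ℝ}
    (hψ : |ψ| ≤ Real.pi / (2 * α)) {x : ℝ} (hx : 0 < x) :
    mlKernel α α (Complex.exp ((α * ψ : ℝ) * Complex.I)) x =
      Complex.exp (ψ * Complex.I) / (α * Complex.exp ((α * ψ : ℝ) * Complex.I)) *
        Complex.exp (Complex.exp (ψ * Complex.I) * x) + mlRem α ψ x := by
  set μ := Complex.exp (ψ * Complex.I) with hμ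
  set l := Complex.exp ((α * ψ : ℝ) * Complex.I) with hl
  set a := μ / (α * l) with ha
  have hln : ‖l‖ = 1 := norm_exp_mul_I_eq_one _
  have hμre : μ.re ≤ 1 := (Complex.re_le_norm μ).trans (norm_exp_mul_I_eq_one _).le
  have hs : ∀ s : ℂ, s.re = 2 → ‖l‖ < s.re ^ α := fun s h => by
    rw [hln, h]; exact Real.one_lt_rpow one_lt_two (by linarith)
  have i1 : ∀ s : ℂ, s.re = 2 → IntegrableOn (fun x : ℝ => Complex.exp (-(s * x)) * mlKernel α α l x) (Ioi 0) :=
    fun s h => (laplace_mlKernel hα (by rw [h]; norm_num) (hs s h)).1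
  have i2 : ∀ s : ℂ, s.re = 2 → IntegrableOn (fun x : ℝ => Complex.exp ((μ - s) * x) * a) (Ioi 0) :=
    fun s h => (integrableOn_exp_mul_complex_Ioi (by rw [Complex.sub_re, h]; linarith) 0).mul_const a
  have i3 : ∀ s : ℂ, s.re = 2 → IntegrableOn (fun x : ℝ => Complex.exp (-(s * x)) * mlRem α ψ x) (Ioi 0) := by
    intro s h
    obtain ⟨C, hC, hb⟩ := exists_mlRem_bound hα hα'
    refine ((integrableOn_exp_mul_Ioi (a := -2) (by norm_num) 0).mul_const C).mono'
      (ContinuousOn.aestronglyMeasurable ?_ measurableSet_Ioi) ?_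
    · exact ContinuousOn.mul (by fun_prop) ((continuousOn_mlRem hα hα' hψ).mono Ioi_subset_Ici_self)
    · rw [ae_restrict_iff' measurableSet_Ioi]
      refine Eventually.of_forall fun x hx => ?_
      rw [norm_mul, Complex.norm_exp]
      simp only [Complex.neg_re, Complex.mul_re, Complex.ofReal_re, Complex.ofReal_im, mul_zero,
        sub_zero, neg_mul, h]
      gcongr
      exact hb ψ x hψ (le_of_lt hx)
  set f : ℝ → ℂ := fun x => mlKernel α α l x - a * Complex.exp (μ * x) - mlRem α ψ x with hf
  have split : ∀ s : ℂ, ∀ x : ℝ, Complex.exp (-(s * x)) * f x =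
      Complex.exp (-(s * x)) * mlKernel α α l x - Complex.exp ((μ - s) * x) * a -
        Complex.exp (-(s * x)) * mlRem α ψ x := by
    intro s x
    rw [hf, show (μ - s) * x = -(s * x) + μ * x by ring, Complex.exp_add]
    ring
  have hfc : ContinuousOn f (Ioi 0) :=
    ((continuousOn_mlKernel hα (by linarith) l).sub (by fun_prop)).sub
      ((continuousOn_mlRem hα hα' hψ).mono Ioi_subset_Ici_self)
  -- On Re s = 2 all three transforms converge, since |l| = 1 < 2^α and Re μ ≤ 1, and they cancel.
  have := laplace_injective (f := f) (σ := 2) hfc (by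
    have h2 : ((2 : ℝ) : ℂ).re = 2 := by simp
    simp_rw [split]
    exact ((i1 _ h2).sub (i2 _ h2)).sub (i3 _ h2)) (fun ξ => by
    have h2 : (((2 : ℝ) : ℂ) + ξ * Complex.I).re = 2 := by simp
    simp_rw [split]
    have hμs : (μ - (((2 : ℝ) : ℂ) + ξ * Complex.I)).re < 0 := by
      rw [Complex.sub_re, h2]; linarith
    have i12 : IntegrableOn (fun x : ℝ => Complex.exp (-((((2 : ℝ) : ℂ) + ξ * Complex.I) * x)) *
        mlKernel α α l x - Complex.exp ((μ - (((2 : ℝ) : ℂ) + ξ * Complex.I)) * x) * a) (Ioi 0) :=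
      (i1 _ h2).sub (i2 _ h2)
    rw [integral_sub i12 (i3 _ h2), integral_sub (i1 _ h2) (i2 _ h2),
      (laplace_mlKernel hα (by rw [h2]; norm_num) (hs _ h2)).2,
      laplace_mlRem hα hα' hψ (by rw [h2]; norm_num), integral_mul_const,
      integral_exp_mul_complex_Ioi hμs 0, ← hμ, ← hl, ← ha]
    have hne : (((2 : ℝ) : ℂ) + ξ * Complex.I) - μ ≠ 0 := by
      intro h0
      rw [← neg_sub, h0] at hμs
      simp at hμs
    rw [← neg_sub _ μ]
    simp only [Complex.ofReal_zero, mul_zero, Complex.exp_zero]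
    field_simp
    ring) hx
  rw [hf] at this
  linear_combination this

end Identification

/-! ### Energy identities for the fundamental solution. -/

section Nonvanishing

open scoped ComplexConjugate

variable {α : ℝ}

theorem hasDerivAt_mlSol (hα : 1 < α) (l : ℂ) {x : ℝ} (hx : 0 < x) :
    HasDerivAt (mlSol α l) (mlKernel α (α - 1) l x) x := by
  have h := hasDerivAt_mlKernel hα (by linarith : 0 < α - 1) l hx
  rw [sub_add_cancel] at h
  refine h.congr_of_eventuallyEq ?_
  filter_upwards [Ioi_mem_nhds hx] with y hy using mlSol_of_nonneg (le_of_lt hy)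

theorem continuous_mlSol_right (hα : 1 < α) (l : ℂ) : Continuous (mlSol α l) :=
  (continuous_mlSol hα).comp (continuous_const.prodMk continuous_id)

theorem mlKernel_one_eq (hα : 1 < α) (l : ℂ) {x : ℝ} (hx : 0 < x) :
    mlKernel α 1 l x = 1 + l * ∫ s in (0 : ℝ)..x, mlSol α l s := by
  rw [mlKernel_eq_add hα one_pos l hx, rlKernel_one, ← integral_mlKernel hα (by linarith) l hx]
  rw [Complex.ofReal_one]
  congr 2
  refine intervalIntegral.integral_congr fun s hs => ?_
  rw [uIcc_of_le hx.le] at hs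
  exact (mlSol_of_nonneg hs.1).symm

theorem intervalIntegrable_mlKernel_sub_one (hα : 1 < α) (l : ℂ) {x : ℝ} (hx : 0 < x) :
    IntervalIntegrable (mlKernel α (α - 1) l) volume 0 x :=
  intervalIntegrable_mlKernel hα (by linarith) l hx

theorem IntervalIntegrable.conj {f : ℝ → ℂ} {a b : ℝ} (hf : IntervalIntegrable f volume a b) :
    IntervalIntegrable (fun x => conj (f x)) volume a b := by
  rw [intervalIntegrable_iff] at hf ⊢
  exact Complex.conjCLE.toContinuousLinearMap.integrable_comp hf

/-- Integration by parts with P = 1 + l ∫ u, so that P' = l u; the boundary terms vanish because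
u(0) = u(1) = 0. -/
theorem integral_mlKernel_one_mul_conj (hα : 1 < α) {l : ℂ} (h1 : mlSol α l 1 = 0) :
    ∫ x in (0 : ℝ)..1, mlKernel α 1 l x * conj (mlKernel α (α - 1) l x) =
      -l * ((∫ x in (0 : ℝ)..1, ‖mlSol α l x‖ ^ 2 : ℝ) : ℂ) := by
  have hc := continuous_mlSol_right hα l
  have hP : ∀ x : ℝ, HasDerivAt (fun x => 1 + l * ∫ s in (0 : ℝ)..x, mlSol α l s)
      (l * mlSol α l x) x := fun x =>
    ((intervalIntegral.integral_hasDerivAt_right (hc.intervalIntegrable _ _)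
      (hc.stronglyMeasurableAtFilter _ _) hc.continuousAt).const_mul l).const_add 1
  have hPc : Continuous (fun x => 1 + l * ∫ s in (0 : ℝ)..x, mlSol α l s) :=
    continuous_iff_continuousAt.2 fun x => (hP x).continuousAt
  have hw := (intervalIntegrable_mlKernel_sub_one hα l one_pos).conj
  have i1 : IntervalIntegrable (fun x => l * mlSol α l x * conj (mlSol α l x)) volume 0 1 :=
    Continuous.intervalIntegrable (by fun_prop) _ _
  have i2 : IntervalIntegrable (fun x => (1 + l * ∫ s in (0 : ℝ)..x, mlSol α l s) *
      conj (mlKernel α (α - 1) l x)) volume 0 1 := hw.continuousOn_mul hPc.continuousOn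
  have key := intervalIntegral.integral_eq_sub_of_hasDerivAt_of_le zero_le_one
    (f := fun x => (1 + l * ∫ s in (0 : ℝ)..x, mlSol α l s) * conj (mlSol α l x))
    (f' := fun x => l * mlSol α l x * conj (mlSol α l x) +
      (1 + l * ∫ s in (0 : ℝ)..x, mlSol α l s) * conj (mlKernel α (α - 1) l x))
    (by fun_prop) (fun x hx => (hP x).mul (hasDerivAt_mlSol hα l hx.1).star) (i1.add i2)
  rw [h1, mlSol_of_nonpos hα le_rfl, map_zero, mul_zero, mul_zero, sub_zero,
    intervalIntegral.integral_add i1 i2] at key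
  have e1 : ∫ x in (0 : ℝ)..1, mlKernel α 1 l x * conj (mlKernel α (α - 1) l x) =
      ∫ x in (0 : ℝ)..1, (1 + l * ∫ s in (0 : ℝ)..x, mlSol α l s) *
        conj (mlKernel α (α - 1) l x) := by
    refine intervalIntegral.integral_congr_ae (Eventually.of_forall fun x hx => ?_)
    rw [uIoc_of_le zero_le_one] at hx
    rw [mlKernel_one_eq hα l hx.1]
  have e2 : ∫ x in (0 : ℝ)..1, l * mlSol α l x * conj (mlSol α l x) =
      l * ((∫ x in (0 : ℝ)..1, ‖mlSol α l x‖ ^ 2 : ℝ) : ℂ) := by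
    rw [← intervalIntegral.integral_ofReal, ← intervalIntegral.integral_const_mul]
    congr 1; ext x
    rw [mul_assoc, Complex.mul_conj, Complex.normSq_eq_norm_sq]
  rw [e1]
  rw [e2] at key
  linear_combination key

/-- The convolution of the derivative of the Mittag-Leffler kernel with `e^(-t x)`. -/
def mlDamp (α : ℝ) (l : ℂ) (t x : ℝ) : ℂ :=
  mlSol α l x - t * (Complex.exp (-(t * x)) * ∫ s in (0 : ℝ)..x, Complex.exp (t * s) * mlSol α l s)

theorem continuous_mlDamp (hα : 1 < α) (l : ℂ) :
    Continuous fun p : ℝ × ℝ => mlDamp α l p.1 p.2 := by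
  have hc := continuous_mlSol_right hα l
  have h : Continuous fun p : ℝ × ℝ =>
      ∫ s in (0 : ℝ)..p.2, Complex.exp (p.1 * s) * mlSol α l s := by
    refine intervalIntegral.continuous_parametric_intervalIntegral_of_continuous
      (f := fun (p : ℝ × ℝ) (s : ℝ) => Complex.exp (p.1 * s) * mlSol α l s) ?_ continuous_snd
    simp only [Function.uncurry_def]
    fun_prop
  unfold mlDamp
  fun_prop

theorem hasDerivAt_mlDamp (hα : 1 < α) (l : ℂ) (t : ℝ) {x : ℝ} (hx : 0 < x) :
    HasDerivAt (mlDamp α l t) (mlKernel α (α - 1) l x - t * mlDamp α l t x) x := by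
  have hc : Continuous fun s : ℝ => Complex.exp (t * s) * mlSol α l s := by
    have := continuous_mlSol_right hα l
    fun_prop
  have h1 := intervalIntegral.integral_hasDerivAt_right (hc.intervalIntegrable 0 x)
      (hc.stronglyMeasurableAtFilter _ _) hc.continuousAt
  have h2 : HasDerivAt (fun x : ℝ => Complex.exp (-(t * x))) (Complex.exp (-(t * x)) * (-(t * 1))) x :=
    (((Complex.ofRealCLM.hasDerivAt (x := x)).const_mul (t : ℂ)).neg).cexp
  refine ((hasDerivAt_mlSol hα l hx).sub ((h2.mul h1).const_mul (t : ℂ))).congr_deriv ?_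
  have h3 : Complex.exp (-(t * x)) * Complex.exp (t * x) = 1 := by rw [← Complex.exp_add]; simp
  unfold mlDamp
  linear_combination (-t * mlSol α l x) * h3

theorem mlDamp_zero (hα : 1 < α) (l : ℂ) (t : ℝ) : mlDamp α l t 0 = 0 := by
  simp [mlDamp, mlSol_of_nonpos hα le_rfl]

/-- The definition is this convolution after integration by parts: it avoids the derivative of u,
which may be singular at 0, and so makes joint continuity in t and x visible. -/
theorem mlDamp_eq_integral (hα : 1 < α) (l : ℂ) (t : ℝ) {x : ℝ} (hx : 0 < x) :
    mlDamp α l t x = ∫ s in (0 : ℝ)..x, ((Real.exp (-(t * (x - s))) : ℝ) : ℂ) * mlKernel α (α - 1) l s := by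
  have hc := continuous_mlSol_right hα l
  have hw := intervalIntegrable_mlKernel_sub_one hα l hx
  have i2 : IntervalIntegrable (fun s : ℝ => Complex.exp (t * s) * mlKernel α (α - 1) l s) volume 0 x :=
    hw.continuousOn_mul (by fun_prop)
  have i1 : IntervalIntegrable (fun s : ℝ => t * (Complex.exp (t * s) * mlSol α l s)) volume 0 x :=
    Continuous.intervalIntegrable (by fun_prop) _ _
  have d : ∀ s : ℝ, HasDerivAt (fun s : ℝ => Complex.exp (t * s)) (Complex.exp (t * s) * (t * 1)) s :=
    fun s => ((Complex.ofRealCLM.hasDerivAt (x := s)).const_mul (t : ℂ)).cexp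
  have key := intervalIntegral.integral_eq_sub_of_hasDerivAt_of_le hx.le
    (f := fun s : ℝ => Complex.exp (t * s) * mlSol α l s)
    (f' := fun s => t * (Complex.exp (t * s) * mlSol α l s) +
      Complex.exp (t * s) * mlKernel α (α - 1) l s)
    (by fun_prop) (fun s hs => ((d s).mul (hasDerivAt_mlSol hα l hs.1)).congr_deriv (by ring))
    (i1.add i2)
  rw [intervalIntegral.integral_add i1 i2, intervalIntegral.integral_const_mul,
    mlSol_of_nonpos hα le_rfl, mul_zero, sub_zero] at key
  have e : ∀ s : ℝ, ((Real.exp (-(t * (x - s))) : ℝ) : ℂ) * mlKernel α (α - 1) l s =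
      Complex.exp (-(t * x)) * (Complex.exp (t * s) * mlKernel α (α - 1) l s) := by
    intro s
    rw [← mul_assoc, ← Complex.exp_add]
    push_cast
    ring_nf
  simp_rw [e]
  rw [intervalIntegral.integral_const_mul]
  have h3 : Complex.exp (-(t * x)) * Complex.exp (t * x) = 1 := by rw [← Complex.exp_add]; simp
  unfold mlDamp
  linear_combination (-Complex.exp (-(t * x))) * key - mlSol α l x * h3

/-- The energy identity behind the positivity of the kernel `e^(-t x)`. -/
theorem re_integral_mlDamp_mul_conj (hα : 1 < α) (l : ℂ) (t : ℝ) :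
    (∫ x in (0 : ℝ)..1, mlDamp α l t x * conj (mlKernel α (α - 1) l x)).re =
      ‖mlDamp α l t 1‖ ^ 2 / 2 + t * ∫ x in (0 : ℝ)..1, ‖mlDamp α l t x‖ ^ 2 := by
  have hv : Continuous (mlDamp α l t) :=
    (continuous_mlDamp hα l).comp (continuous_const.prodMk continuous_id)
  have hw := intervalIntegrable_mlKernel_sub_one hα l one_pos
  have i1 : IntervalIntegrable (fun x => mlDamp α l t x * conj (mlKernel α (α - 1) l x)) volume 0 1 :=
    hw.conj.continuousOn_mul hv.continuousOn
  have hre := Complex.reCLM.intervalIntegral_comp_comm i1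
  have i1r : IntervalIntegrable (fun x => (mlDamp α l t x * conj (mlKernel α (α - 1) l x)).re) volume 0 1 := by
    rw [intervalIntegrable_iff] at i1 ⊢; exact i1.re
  have i2 : IntervalIntegrable (fun x => ‖mlDamp α l t x‖ ^ 2) volume 0 1 :=
    Continuous.intervalIntegrable (by fun_prop) _ _
  -- For v' = w - t v one has (|v|²)' = 2 Re(v conj w) - 2t|v|², and v(0) = 0.
  have key := intervalIntegral.integral_eq_sub_of_hasDerivAt_of_le zero_le_one
    (f := fun x => ‖mlDamp α l t x‖ ^ 2)
    (f' := fun x => 2 * (mlDamp α l t x * conj (mlKernel α (α - 1) l x)).re -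
      2 * t * ‖mlDamp α l t x‖ ^ 2)
    (by fun_prop) (fun x hx => by
      refine (hasDerivAt_mlDamp hα l t hx.1).norm_sq.congr_deriv ?_
      rw [inner_sub_right, Complex.inner, ← Complex.real_smul, real_inner_smul_right, real_inner_self_eq_norm_sq]
      have : (mlDamp α l t x * conj (mlKernel α (α - 1) l x)).re =
          (mlKernel α (α - 1) l x * conj (mlDamp α l t x)).re := by
        simp; ring
      rw [this]; ring) ((i1r.const_mul 2).sub (i2.const_mul (2 * t)))
  rw [intervalIntegral.integral_sub (i1r.const_mul 2) (i2.const_mul (2 * t)),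
    intervalIntegral.integral_const_mul, intervalIntegral.integral_const_mul, mlDamp_zero hα] at key
  simp only [Complex.reCLM_apply] at hre
  rw [← hre]
  simp only [norm_zero] at key
  linarith

end Nonvanishing

/-! ### Positivity of the fractional kernel and absence of zeros at 1. -/

section Nonvanishing

open scoped ComplexConjugate

variable {α γ : ℝ}

theorem integrableOn_stieltjes (h1 : γ < 1) {y : ℝ} (hy : 0 < y) :
    IntegrableOn (fun t : ℝ => t ^ (-γ) * Real.exp (-(t * y))) (Ioi 0) := by
  have := integrableOn_rpow_mul_exp (show 0 < 1 - γ by linarith) hy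
  rw [show 1 - γ - 1 = -γ by ring] at this
  simpa only [mul_comm y] using this

/-- The kernel of the fractional integral as a superposition of exponentials. -/
theorem integral_stieltjes (h0 : 0 < γ) (h1 : γ < 1) {y : ℝ} (hy : 0 < y) :
    ∫ t in Ioi (0 : ℝ), t ^ (-γ) * Real.exp (-(t * y)) =
      Real.Gamma (1 - γ) * Real.Gamma γ * rlKernel γ y := by
  have := Real.integral_rpow_mul_exp_neg_mul_Ioi (show 0 < 1 - γ by linarith) hy
  rw [show 1 - γ - 1 = -γ by ring] at this
  simp only [mul_comm y] at this
  have hG := (Real.Gamma_pos_of_pos h0).ne'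
  rw [this, rlKernel, one_div, Real.inv_rpow hy.le, ← Real.rpow_neg hy.le, neg_sub]
  field_simp

theorem integrable_stieltjes_prod (h0 : 0 < γ) (h1 : γ < 1) {x : ℝ} {w : ℝ → ℂ}
    (hwm : AEStronglyMeasurable w (volume.restrict (Ioo 0 x)))
    (hw : IntegrableOn (fun s => (rlKernel γ (x - s) : ℂ) * w s) (Ioo 0 x)) :
    Integrable (fun p : ℝ × ℝ => ((p.2 ^ (-γ) * Real.exp (-(p.2 * (x - p.1))) : ℝ) : ℂ) * w p.1)
      ((volume.restrict (Ioo 0 x)).prod (volume.restrict (Ioi 0))) := by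
  rw [integrable_prod_iff]
  · constructor
    · rw [ae_restrict_iff' measurableSet_Ioo]
      refine Eventually.of_forall fun s hs => ?_
      exact ((integrableOn_stieltjes h1 (sub_pos.2 hs.2)).ofReal (𝕜 := ℂ)).mul_const (w s)
    · refine (hw.norm.const_mul (Real.Gamma (1 - γ) * Real.Gamma γ)).congr ?_
      rw [Filter.EventuallyEq, ae_restrict_iff' measurableSet_Ioo]
      refine Eventually.of_forall fun s hs => ?_
      have hk := rlKernel_nonneg h0 (sub_pos.2 hs.2).le
      have e : ∀ t ∈ Ioi (0 : ℝ), ‖((t ^ (-γ) * Real.exp (-(t * (x - s))) : ℝ) : ℂ) * w s‖ =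
          t ^ (-γ) * Real.exp (-(t * (x - s))) * ‖w s‖ := by
        intro t ht
        rw [norm_mul, Complex.norm_real, Real.norm_of_nonneg]
        have := Real.rpow_nonneg (le_of_lt (mem_Ioi.1 ht)) (-γ)
        positivity
      simp only
      rw [setIntegral_congr_fun measurableSet_Ioi e, integral_mul_const,
        integral_stieltjes h0 h1 (sub_pos.2 hs.2), norm_mul, Complex.norm_real,
        Real.norm_of_nonneg hk]
      ring
  · refine AEStronglyMeasurable.mul (Measurable.aestronglyMeasurable (by fun_prop)) hwm.comp_fst

/-- Superposing the exponential kernels with weight t^(α-2) rebuilds the kernel of I^(2-α), whose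
convolution with u' is P. The norm estimate, stated with the majorant at ‖l‖, is the domination
needed for the later exchange of integrals. -/
theorem stieltjes_mlDamp (hα : 1 < α) (hα' : α < 2) (l : ℂ) {x : ℝ} (hx : 0 < x) :
    IntegrableOn (fun t : ℝ => ((t ^ (-(2 - α)) : ℝ) : ℂ) * mlDamp α l t x) (Ioi 0) ∧
    ∫ t in Ioi (0 : ℝ), ((t ^ (-(2 - α)) : ℝ) : ℂ) * mlDamp α l t x =
      ((Real.Gamma (1 - (2 - α)) * Real.Gamma (2 - α) : ℝ) : ℂ) * mlKernel α 1 l x ∧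
    ∫ t in Ioi (0 : ℝ), ‖((t ^ (-(2 - α)) : ℝ) : ℂ) * mlDamp α l t x‖ ≤
      Real.Gamma (1 - (2 - α)) * Real.Gamma (2 - α) * (mlKernel α 1 (‖l‖ : ℂ) x).re := by
  set γ := 2 - α with hγ
  have h0 : 0 < γ := by linarith
  have h1 : γ < 1 := by linarith
  have hα1 : 0 < α - 1 := by linarith
  set K := Real.Gamma (1 - γ) * Real.Gamma γ with hK
  have hγα : γ + (α - 1) = 1 := by rw [hγ]; ring
  have hconv : ∀ l : ℂ, IntegrableOn (fun s => (rlKernel γ (x - s) : ℂ) * mlKernel α (α - 1) l s) (Ioo 0 x) ∧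
      ∫ s in Ioo 0 x, (rlKernel γ (x - s) : ℂ) * mlKernel α (α - 1) l s = mlKernel α 1 l x := by
    intro l
    have := integral_rlKernel_mul_mlKernel hα h0 hα1 l hx
    rw [intervalIntegrable_iff_integrableOn_Ioo_of_le hx.le, intervalIntegral.integral_of_le hx.le,
      integral_Ioc_eq_integral_Ioo, hγα] at this
    exact this
  have hwm : ∀ l : ℂ, AEStronglyMeasurable (mlKernel α (α - 1) l) (volume.restrict (Ioo 0 x)) := fun l =>
    ((continuousOn_mlKernel hα hα1 l).mono fun s hs => hs.1).aestronglyMeasurable measurableSet_Ioo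
  have hprod := integrable_stieltjes_prod h0 h1 (hwm l) (hconv l).1
  have hV : ∀ t : ℝ, ((t ^ (-γ) : ℝ) : ℂ) * mlDamp α l t x =
      ∫ s in Ioo 0 x, ((t ^ (-γ) * Real.exp (-(t * (x - s))) : ℝ) : ℂ) * mlKernel α (α - 1) l s := by
    intro t
    rw [mlDamp_eq_integral hα l t hx, intervalIntegral.integral_of_le hx.le,
      integral_Ioc_eq_integral_Ioo, ← integral_const_mul]
    congr 1; ext s; push_cast; ring
  have hinner : ∀ s ∈ Ioo 0 x, ∀ w : ℂ, ∫ t in Ioi (0 : ℝ), ((t ^ (-γ) * Real.exp (-(t * (x - s))) : ℝ) : ℂ) *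
      w = (K : ℂ) * ((rlKernel γ (x - s) : ℂ) * w) := by
    intro s hs w
    rw [integral_mul_const, integral_complex_ofReal, integral_stieltjes h0 h1 (sub_pos.2 hs.2), ← hK]
    push_cast; ring
  simp_rw [hV]
  refine ⟨hprod.integral_prod_right, ?_, ?_⟩
  · rw [← integral_integral_swap hprod, setIntegral_congr_fun measurableSet_Ioo fun s hs => hinner s hs _,
      integral_const_mul, (hconv l).2]
  · have hswap := integral_integral_swap (f := fun s t : ℝ =>
      ‖((t ^ (-γ) * Real.exp (-(t * (x - s))) : ℝ) : ℂ) * mlKernel α (α - 1) l s‖) hprod.norm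
    have hmono : ∫ t in Ioi (0 : ℝ), ‖∫ s in Ioo 0 x, ((t ^ (-γ) * Real.exp (-(t * (x - s))) : ℝ) : ℂ) *
        mlKernel α (α - 1) l s‖ ≤ ∫ t in Ioi (0 : ℝ), ∫ s in Ioo 0 x,
          ‖((t ^ (-γ) * Real.exp (-(t * (x - s))) : ℝ) : ℂ) * mlKernel α (α - 1) l s‖ :=
      integral_mono hprod.integral_prod_right.norm hprod.norm.integral_prod_right
        fun t => norm_integral_le_integral_norm _
    refine hmono.trans ?_
    rw [← hswap]
    have e : ∀ s ∈ Ioo 0 x, ∫ t in Ioi (0 : ℝ),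
        ‖((t ^ (-γ) * Real.exp (-(t * (x - s))) : ℝ) : ℂ) * mlKernel α (α - 1) l s‖ =
        K * ‖(rlKernel γ (x - s) : ℂ) * mlKernel α (α - 1) l s‖ := by
      intro s hs
      have hk := rlKernel_nonneg h0 (sub_pos.2 hs.2).le
      rw [norm_mul, Complex.norm_real, Real.norm_of_nonneg hk, ← mul_assoc,
        ← integral_stieltjes h0 h1 (sub_pos.2 hs.2), ← integral_mul_const]
      refine setIntegral_congr_fun measurableSet_Ioi fun t ht => ?_
      rw [norm_mul, Complex.norm_real, Real.norm_of_nonneg]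
      have := Real.rpow_nonneg (le_of_lt (mem_Ioi.1 ht)) (-γ)
      positivity
    rw [setIntegral_congr_fun measurableSet_Ioo e, integral_const_mul, ← (hconv (‖l‖ : ℂ)).2]
    have hK0 : 0 ≤ K := mul_nonneg (Real.Gamma_pos_of_pos (by linarith)).le (Real.Gamma_pos_of_pos h0).le
    refine mul_le_mul_of_nonneg_left ?_ hK0
    have hre := integral_re (𝕜 := ℂ) (hconv (‖l‖ : ℂ)).1
    simp only [RCLike.re_to_complex] at hre
    rw [← hre]
    refine setIntegral_mono_on (hconv l).1.norm (hconv (‖l‖ : ℂ)).1.re measurableSet_Ioo fun s hs => ?_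
    have hk := rlKernel_nonneg h0 (sub_pos.2 hs.2).le
    rw [norm_mul, Complex.norm_real, Real.norm_of_nonneg hk, Complex.re_ofReal_mul]
    exact mul_le_mul_of_nonneg_left (norm_mlKernel_le hα hα1 l hs.1) hk

/-- If u vanished on (0,1) then so would u', and hence P = I^(2-α) u' at 1/2; but P = 1 + l ∫ u
would be 1 there. For α = 2, P is u' itself. -/
theorem not_eqOn_mlSol_zero (hα : 1 < α) (hα' : α ≤ 2) (l : ℂ) :
    ¬ ∀ x ∈ Ioo (0 : ℝ) 1, mlSol α l x = 0 := by
  intro h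
  have hw : ∀ x ∈ Ioo (0 : ℝ) 1, mlKernel α (α - 1) l x = 0 := fun x hx =>
    (hasDerivAt_mlSol hα l hx.1).unique ((hasDerivAt_const x (0 : ℂ)).congr_of_eventuallyEq
      (by filter_upwards [isOpen_Ioo.mem_nhds hx] with y hy using h y hy))
  have h1 : mlKernel α 1 l (1 / 2) = 1 := by
    rw [mlKernel_one_eq hα l (by norm_num), intervalIntegral.integral_congr_ae (g := fun _ => 0)]
    · simp
    · refine Eventually.of_forall fun s hs => ?_
      rw [uIoc_of_le (by norm_num)] at hs
      exact h s ⟨hs.1, by linarith [hs.2]⟩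
  rcases hα'.lt_or_eq with h2 | rfl
  · have h3 := (integral_rlKernel_mul_mlKernel hα (by linarith : 0 < 2 - α) (by linarith : 0 < α - 1) l
      (show (0 : ℝ) < 1 / 2 by norm_num)).2
    rw [show 2 - α + (α - 1) = 1 by ring, h1, intervalIntegral.integral_congr_ae (g := fun _ => 0)] at h3
    · simp at h3
    · refine Eventually.of_forall fun s hs => ?_
      rw [uIoc_of_le (by norm_num)] at hs
      rw [hw s ⟨hs.1, by linarith [hs.2]⟩, mul_zero]
  · have := hw (1 / 2) ⟨by norm_num, by norm_num⟩
    rw [show (2 : ℝ) - 1 = 1 by norm_num, h1] at this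
    exact one_ne_zero this

theorem intervalIntegral_sq_norm_eq_zero {v : ℝ → ℂ} (hv : Continuous v)
    (h : ∫ x in (0 : ℝ)..1, ‖v x‖ ^ 2 = 0) : ∀ x ∈ Ioo (0 : ℝ) 1, v x = 0 := by
  intro x hx
  by_contra hne
  have hpos : 0 < ∫ x in (0 : ℝ)..1, ‖v x‖ ^ 2 := by
    refine intervalIntegral.integral_pos zero_lt_one (by fun_prop) (fun _ _ => by positivity)
      ⟨x, Ioo_subset_Icc_self hx, ?_⟩
    have := norm_pos_iff.2 hne
    positivity
  linarith

/-- The Mittag-Leffler kernel has no zero at `1` in the closed right half plane. -/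
theorem mlSol_one_ne_zero (hα : 1 < α) (hα' : α ≤ 2) {l : ℂ} (hl : 0 ≤ l.re) : mlSol α l 1 ≠ 0 := by
  intro h1
  -- The real part of the energy identity is -Re(l) ∫ |u|², which is nonpositive for Re l ≥ 0.
  have hmain := congrArg Complex.re (integral_mlKernel_one_mul_conj hα h1)
  have hU : 0 ≤ ∫ x in (0 : ℝ)..1, ‖mlSol α l x‖ ^ 2 :=
    intervalIntegral.integral_nonneg zero_le_one fun _ _ => by positivity
  rw [Complex.re_mul_ofReal, Complex.neg_re] at hmain
  have hle : (∫ x in (0 : ℝ)..1, mlKernel α 1 l x * conj (mlKernel α (α - 1) l x)).re ≤ 0 := by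
    rw [hmain]; nlinarith
  rcases hα'.lt_or_eq with h2 | rfl
  · -- the kernel is a positive superposition of exponentials
    set γ := 2 - α with hγ
    have hγ0 : 0 < γ := by linarith
    set K := Real.Gamma (1 - γ) * Real.Gamma γ with hK
    have hK0 : 0 < K := mul_pos (Real.Gamma_pos_of_pos (by linarith)) (Real.Gamma_pos_of_pos hγ0)
    have hα1 : 0 < α - 1 := by linarith
    have hst := fun {x : ℝ} (hx : 0 < x) => stieltjes_mlDamp hα h2 l hx
    rw [← hγ, ← hK] at hst
    have hwint : IntegrableOn (mlKernel α (α - 1) l) (Ioo 0 1) := by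
      have := intervalIntegrable_mlKernel_sub_one hα l one_pos
      rwa [intervalIntegrable_iff_integrableOn_Ioo_of_le zero_le_one] at this
    have hPc : Continuous (fun x => 1 + (‖l‖ : ℂ) * ∫ s in (0 : ℝ)..x, mlSol α (‖l‖ : ℂ) s) :=
      continuous_const.add (continuous_const.mul (intervalIntegral.continuous_primitive
        (fun a b => (continuous_mlSol_right hα _).intervalIntegrable a b) 0))
    -- The majorant of P at ‖l‖ is bounded on [0,1], so an integrable multiple of |u'| dominates the
    -- double integral below.
    obtain ⟨B, hB⟩ := (isCompact_Icc (a := (0 : ℝ)) (b := 1)).exists_bound_of_continuousOn hPc.continuousOn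
    have hP : ∀ x ∈ Ioo (0 : ℝ) 1, (mlKernel α 1 (‖l‖ : ℂ) x).re ≤ B := by
      intro x hx
      rw [mlKernel_one_eq hα _ hx.1]
      exact ((le_abs_self _).trans (Complex.abs_re_le_norm _)).trans (hB x (Ioo_subset_Icc_self hx))
    have hF : Integrable (fun p : ℝ × ℝ => ((p.2 ^ (-γ) : ℝ) : ℂ) * mlDamp α l p.2 p.1 *
        conj (mlKernel α (α - 1) l p.1)) ((volume.restrict (Ioo 0 1)).prod (volume.restrict (Ioi 0))) := by
      rw [integrable_prod_iff]
      · constructor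
        · rw [ae_restrict_iff' measurableSet_Ioo]
          exact Eventually.of_forall fun x hx => (hst hx.1).1.mul_const (conj (mlKernel α (α - 1) l x))
        · refine (hwint.norm.const_mul (K * B)).mono' ?_ ?_
          · refine AEStronglyMeasurable.integral_prod_right' (f := fun p : ℝ × ℝ =>
              ‖((p.2 ^ (-γ) : ℝ) : ℂ) * mlDamp α l p.2 p.1 * conj (mlKernel α (α - 1) l p.1)‖) ?_
            refine AEStronglyMeasurable.norm (AEStronglyMeasurable.mul ?_ ?_)
            · refine Measurable.aestronglyMeasurable (Measurable.mul (by fun_prop) ?_)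
              exact ((continuous_mlDamp hα l).comp continuous_swap).measurable
            · exact (Complex.continuous_conj.comp_aestronglyMeasurable hwint.aestronglyMeasurable).comp_fst
          · rw [ae_restrict_iff' measurableSet_Ioo]
            refine Eventually.of_forall fun x hx => ?_
            simp_rw [norm_mul _ (conj _)]
            rw [integral_mul_const, RCLike.norm_conj, norm_mul, norm_norm]
            refine mul_le_mul_of_nonneg_right ?_ (norm_nonneg _)
            rw [Real.norm_of_nonneg (integral_nonneg fun _ => norm_nonneg _)]
            exact (hst hx.1).2.2.trans (mul_le_mul_of_nonneg_left (hP x hx) hK0.le)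
      · refine AEStronglyMeasurable.mul ?_ ?_
        · refine Measurable.aestronglyMeasurable (Measurable.mul (by fun_prop) ?_)
          exact ((continuous_mlDamp hα l).comp continuous_swap).measurable
        · exact (Complex.continuous_conj.comp_aestronglyMeasurable hwint.aestronglyMeasurable).comp_fst
    have hswap := integral_integral_swap (f := fun x t : ℝ => ((t ^ (-γ) : ℝ) : ℂ) * mlDamp α l t x *
        conj (mlKernel α (α - 1) l x)) hF
    set E : ℝ → ℝ := fun t => ‖mlDamp α l t 1‖ ^ 2 / 2 + t * ∫ x in (0 : ℝ)..1, ‖mlDamp α l t x‖ ^ 2 with hE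
    have hL : ∫ x in Ioo (0 : ℝ) 1, ∫ t in Ioi (0 : ℝ), ((t ^ (-γ) : ℝ) : ℂ) * mlDamp α l t x *
        conj (mlKernel α (α - 1) l x) =
        (K : ℂ) * ∫ x in (0 : ℝ)..1, mlKernel α 1 l x * conj (mlKernel α (α - 1) l x) := by
      rw [intervalIntegral.integral_of_le zero_le_one, integral_Ioc_eq_integral_Ioo, ← integral_const_mul]
      refine setIntegral_congr_fun measurableSet_Ioo fun x hx => ?_
      rw [integral_mul_const, (hst hx.1).2.1, mul_assoc]
    have hR : ∀ t : ℝ, (∫ x in Ioo (0 : ℝ) 1, ((t ^ (-γ) : ℝ) : ℂ) * mlDamp α l t x *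
        conj (mlKernel α (α - 1) l x)).re = t ^ (-γ) * E t := by
      intro t
      simp_rw [mul_assoc]
      rw [integral_const_mul, Complex.re_ofReal_mul, ← integral_Ioc_eq_integral_Ioo,
        ← intervalIntegral.integral_of_le zero_le_one, re_integral_mlDamp_mul_conj hα l t]
    have hEint : IntegrableOn (fun t => t ^ (-γ) * E t) (Ioi 0) := by
      have := hF.integral_prod_right.re
      simp only [RCLike.re_to_complex] at this
      simp_rw [hR] at this
      exact this
    have hre : ∫ t in Ioi (0 : ℝ), t ^ (-γ) * E t =
        K * (∫ x in (0 : ℝ)..1, mlKernel α 1 l x * conj (mlKernel α (α - 1) l x)).re := by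
      have h := integral_re (𝕜 := ℂ) hF.integral_prod_right
      simp only [RCLike.re_to_complex] at h
      simp_rw [hR] at h
      rw [h, ← hswap, hL, Complex.re_ofReal_mul]
    have hnn : ∀ t ∈ Ioi (0 : ℝ), 0 ≤ t ^ (-γ) * E t := by
      intro t ht
      have ht := mem_Ioi.1 ht
      have : 0 ≤ ∫ x in (0 : ℝ)..1, ‖mlDamp α l t x‖ ^ 2 :=
        intervalIntegral.integral_nonneg zero_le_one fun _ _ => by positivity
      have := Real.rpow_nonneg ht.le (-γ)
      positivity
    have hz : ∫ t in Ioi (0 : ℝ), t ^ (-γ) * E t = 0 :=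
      le_antisymm (by rw [hre]; exact mul_nonpos_of_nonneg_of_nonpos hK0.le hle)
        (setIntegral_nonneg measurableSet_Ioi hnn)
    rw [setIntegral_eq_zero_iff_of_nonneg_ae
      ((ae_restrict_iff' measurableSet_Ioi).2 (Eventually.of_forall hnn)) hEint] at hz
    have hne : (ae (volume.restrict (Ioi (0 : ℝ)))).NeBot := by
      rw [ae_neBot, Ne, Measure.restrict_eq_zero]; simp
    -- A single t > 0 of zero energy suffices: its damped convolution v vanishes identically, and v'
    -- = w - t v gives w = 0.
    obtain ⟨t, ht1, ht2⟩ := (hz.and (ae_restrict_mem measurableSet_Ioi)).exists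
    have ht0 := mem_Ioi.1 ht2
    have hE0 : E t = 0 := by
      have := (mul_eq_zero.1 ht1).resolve_left (Real.rpow_pos_of_pos ht0 _).ne'
      exact this
    have hi : 0 ≤ ∫ x in (0 : ℝ)..1, ‖mlDamp α l t x‖ ^ 2 :=
      intervalIntegral.integral_nonneg zero_le_one fun _ _ => by positivity
    have hi0 : ∫ x in (0 : ℝ)..1, ‖mlDamp α l t x‖ ^ 2 = 0 := by
      have h3 : 0 ≤ ‖mlDamp α l t 1‖ ^ 2 := by positivity
      simp only [hE] at hE0
      nlinarith
    have hV := intervalIntegral_sq_norm_eq_zero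
      ((continuous_mlDamp hα l).comp (continuous_const.prodMk continuous_id)) hi0
    simp only [Function.comp_apply, id] at hV
    have hw : ∀ x ∈ Ioo (0 : ℝ) 1, mlKernel α (α - 1) l x = 0 := by
      intro x hx
      have d := hasDerivAt_mlDamp hα l t hx.1
      rw [hV x hx, mul_zero, sub_zero] at d
      exact d.unique ((hasDerivAt_const x (0 : ℂ)).congr_of_eventuallyEq
        (by filter_upwards [isOpen_Ioo.mem_nhds hx] with y hy using hV y hy))
    refine not_eqOn_mlSol_zero hα hα' l fun x hx => ?_
    have h3 := integral_mlKernel hα hα1 l hx.1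
    rw [sub_add_cancel, intervalIntegral.integral_congr_ae (g := fun _ => 0)] at h3
    · rw [mlSol_of_nonneg hx.1.le, ← h3]; simp
    · refine Eventually.of_forall fun s hs => ?_
      rw [uIoc_of_le hx.1.le] at hs
      exact hw s ⟨hs.1, hs.2.trans_lt hx.2⟩
  · -- for `α = 2` the kernel is a multiple of the second derivative
    have e21 : (2 : ℝ) - 1 = 1 := by norm_num
    rw [e21] at hle
    have hc : Continuous (fun x => 1 + l * ∫ s in (0 : ℝ)..x, mlSol 2 l s) :=
      continuous_const.add (continuous_const.mul (intervalIntegral.continuous_primitive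
        (fun a b => (continuous_mlSol_right hα _).intervalIntegrable a b) 0))
    have e : ∫ x in (0 : ℝ)..1, mlKernel 2 1 l x * conj (mlKernel 2 1 l x) =
        ((∫ x in (0 : ℝ)..1, ‖1 + l * ∫ s in (0 : ℝ)..x, mlSol 2 l s‖ ^ 2 : ℝ) : ℂ) := by
      rw [← intervalIntegral.integral_ofReal]
      refine intervalIntegral.integral_congr_ae (Eventually.of_forall fun x hx => ?_)
      rw [uIoc_of_le zero_le_one] at hx
      rw [mlKernel_one_eq hα l hx.1, Complex.mul_conj, Complex.normSq_eq_norm_sq]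
    rw [e, Complex.ofReal_re] at hle
    have hz := intervalIntegral_sq_norm_eq_zero hc (le_antisymm hle
      (intervalIntegral.integral_nonneg zero_le_one fun _ _ => by positivity))
    refine not_eqOn_mlSol_zero hα hα' l fun x hx => ?_
    have h3 := integral_mlKernel hα one_pos l hx.1
    rw [one_add_one_eq_two, intervalIntegral.integral_congr_ae (g := fun _ => 0)] at h3
    · rw [mlSol_of_nonneg hx.1.le, ← h3]; simp
    · refine Eventually.of_forall fun s hs => ?_
      rw [uIoc_of_le hx.1.le] at hs
      rw [mlKernel_one_eq hα l hs.1]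
      exact hz s ⟨hs.1, hs.2.trans_lt hx.2⟩

end Nonvanishing

/-! ### Integral operators with continuous kernel on the unit interval. -/

section KernelOperators

/-- The integral operator on `[0,1]` with kernel `k`. -/
def kernelInt (k : ℝ → ℝ → ℂ) (g : ℝ → ℂ) (x : ℝ) : ℂ :=
  ∫ s in Icc (0 : ℝ) 1, k x s * g s

variable {k k' : ℝ → ℝ → ℂ} {g g' : ℝ → ℂ}

theorem exists_kernel_bound (hk : Continuous (Function.uncurry k)) :
    ∃ C : ℝ, ∀ x ∈ Icc (0 : ℝ) 1, ∀ s ∈ Icc (0 : ℝ) 1, ‖k x s‖ ≤ C := by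
  obtain ⟨C, hC⟩ := (isCompact_Icc.prod isCompact_Icc :
    IsCompact (Icc (0 : ℝ) 1 ×ˢ Icc (0 : ℝ) 1)).exists_bound_of_continuousOn hk.continuousOn
  exact ⟨C, fun x hx s hs => hC (x, s) ⟨hx, hs⟩⟩

theorem continuous_kernel_right (hk : Continuous (Function.uncurry k)) (x : ℝ) : Continuous (k x) :=
  hk.comp (continuous_const.prodMk continuous_id)

theorem continuous_kernel_left (hk : Continuous (Function.uncurry k)) (s : ℝ) :
    Continuous fun x => k x s :=
  hk.comp (continuous_id.prodMk continuous_const)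

theorem integrableOn_kernel_mul (hk : Continuous (Function.uncurry k))
    (hg : IntegrableOn g (Icc (0 : ℝ) 1)) (x : ℝ) :
    IntegrableOn (fun s => k x s * g s) (Icc (0 : ℝ) 1) :=
  IntegrableOn.continuousOn_mul (continuous_kernel_right hk x).continuousOn hg isCompact_Icc

theorem continuousOn_kernelInt (hk : Continuous (Function.uncurry k))
    (hg : IntegrableOn g (Icc (0 : ℝ) 1)) : ContinuousOn (kernelInt k g) (Icc 0 1) := by
  obtain ⟨C, hC⟩ := exists_kernel_bound hk
  refine continuousOn_of_dominated (bound := fun s => C * ‖g s‖)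
    (fun x _ => (integrableOn_kernel_mul hk hg x).aestronglyMeasurable) (fun x hx => ?_)
    (hg.norm.const_mul C) (Eventually.of_forall fun s => ?_)
  · rw [ae_restrict_iff' measurableSet_Icc]
    refine Eventually.of_forall fun s hs => ?_
    rw [norm_mul]
    exact mul_le_mul_of_nonneg_right (hC x hx s hs) (norm_nonneg _)
  · exact ((continuous_kernel_left hk s).mul continuous_const).continuousOn

theorem kernelInt_congr (h : g =ᵐ[volume.restrict (Icc (0 : ℝ) 1)] g') (x : ℝ) :
    kernelInt k g x = kernelInt k g' x :=
  integral_congr_ae (by filter_upwards [h] with s hs; rw [hs])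

theorem kernelInt_add (hk : Continuous (Function.uncurry k)) (hg : IntegrableOn g (Icc (0 : ℝ) 1))
    (hg' : IntegrableOn g' (Icc (0 : ℝ) 1)) (x : ℝ) :
    kernelInt k (g + g') x = kernelInt k g x + kernelInt k g' x := by
  unfold kernelInt
  rw [← integral_add (integrableOn_kernel_mul hk hg x) (integrableOn_kernel_mul hk hg' x)]
  simp only [Pi.add_apply, mul_add]

theorem kernelInt_smul (c : ℂ) (x : ℝ) : kernelInt k (c • g) x = c * kernelInt k g x := by
  unfold kernelInt
  rw [← integral_const_mul]
  congr 1; ext s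
  simp only [Pi.smul_apply, smul_eq_mul]; ring

theorem kernelInt_eq_zero {x : ℝ} (h : ∀ s ∈ Icc (0 : ℝ) 1, k x s = 0) : kernelInt k g x = 0 :=
  setIntegral_eq_zero_of_forall_eq_zero fun s hs => by rw [h s hs, zero_mul]

theorem integrable_kernel_prod (hk : Continuous (Function.uncurry k))
    (hg : IntegrableOn g (Icc (0 : ℝ) 1)) :
    Integrable (fun p : ℝ × ℝ => k p.1 p.2 * g p.2)
      ((volume.restrict (Icc (0 : ℝ) 1)).prod (volume.restrict (Icc (0 : ℝ) 1))) := by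
  obtain ⟨C, hC⟩ := exists_kernel_bound hk
  have h1 : Integrable (fun p : ℝ × ℝ => C * ‖g p.2‖)
      ((volume.restrict (Icc (0 : ℝ) 1)).prod (volume.restrict (Icc (0 : ℝ) 1))) :=
    Integrable.mul_prod (f := fun _ => C) (integrable_const C) hg.norm
  refine h1.mono' (hk.aestronglyMeasurable.mul hg.aestronglyMeasurable.comp_snd) ?_
  rw [Measure.prod_restrict, ae_restrict_iff' (measurableSet_Icc.prod measurableSet_Icc)]
  refine Eventually.of_forall fun p hp => ?_
  rw [norm_mul]
  exact mul_le_mul_of_nonneg_right (hC _ hp.1 _ hp.2) (norm_nonneg _)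

/-- The composition of two integral operators. -/
theorem kernelInt_kernelInt (hk : Continuous (Function.uncurry k))
    (hk' : Continuous (Function.uncurry k')) (hg : IntegrableOn g (Icc (0 : ℝ) 1)) (x : ℝ) :
    kernelInt k (kernelInt k' g) x =
      kernelInt (fun x s => ∫ y in Icc (0 : ℝ) 1, k x y * k' y s) g x := by
  unfold kernelInt
  have hprod := integrable_kernel_prod (k := fun y s => k x y * k' y s) (g := g)
    (((continuous_kernel_right hk x).comp continuous_fst).mul hk') hg
  have := integral_integral_swap (f := fun y s => k x y * k' y s * g s) hprod
  simp_rw [← integral_const_mul, ← mul_assoc]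
  rw [this]
  simp_rw [integral_mul_const]

/-- The L¹ half of Schur's test: by Tonelli the column integrals of |k| control the norm, as the row
integrals do for the supremum norm. -/
theorem integral_norm_kernelInt_le (hk : Continuous (Function.uncurry k))
    (hg : IntegrableOn g (Icc (0 : ℝ) 1)) {B : ℝ}
    (hB : ∀ s ∈ Icc (0 : ℝ) 1, ∫ x in Icc (0 : ℝ) 1, ‖k x s‖ ≤ B) :
    ∫ x in Icc (0 : ℝ) 1, ‖kernelInt k g x‖ ≤ B * ∫ s in Icc (0 : ℝ) 1, ‖g s‖ := by
  have hprod := (integrable_kernel_prod hk hg).norm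
  have hswap := integral_integral_swap (f := fun x s => ‖k x s * g s‖) hprod
  calc ∫ x in Icc (0 : ℝ) 1, ‖kernelInt k g x‖
      ≤ ∫ x in Icc (0 : ℝ) 1, ∫ s in Icc (0 : ℝ) 1, ‖k x s * g s‖ :=
        integral_mono ((continuousOn_kernelInt hk hg).norm.integrableOn_Icc) hprod.integral_prod_left
          fun x => norm_integral_le_integral_norm _
    _ = ∫ s in Icc (0 : ℝ) 1, (∫ x in Icc (0 : ℝ) 1, ‖k x s‖) * ‖g s‖ := by
        rw [hswap]; simp_rw [norm_mul, integral_mul_const]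
    _ ≤ ∫ s in Icc (0 : ℝ) 1, B * ‖g s‖ := by
        refine setIntegral_mono_on ?_ (hg.norm.const_mul B) measurableSet_Icc fun s hs =>
          mul_le_mul_of_nonneg_right (hB s hs) (norm_nonneg _)
        have := hprod.integral_prod_right
        simpa only [IntegrableOn, norm_mul, integral_mul_const] using this
    _ = _ := integral_const_mul _ _

theorem norm_kernelInt_le {x B C : ℝ} (hk : Continuous (Function.uncurry k))
    (hB : ∫ s in Icc (0 : ℝ) 1, ‖k x s‖ ≤ B) (hC : 0 ≤ C) (hg : ∀ s, ‖g s‖ ≤ C) :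
    ‖kernelInt k g x‖ ≤ B * C := by
  have hi : IntegrableOn (fun s => ‖k x s‖ * C) (Icc 0 1) :=
    ((continuous_kernel_right hk x).norm.mul continuous_const).integrableOn_Icc
  refine (norm_integral_le_of_norm_le hi (Eventually.of_forall fun s => ?_)).trans ?_
  · rw [norm_mul]; exact mul_le_mul_of_nonneg_left (hg s) (norm_nonneg _)
  · rw [integral_mul_const]; exact mul_le_mul_of_nonneg_right hB hC

/-- A function that is continuous on `[0,1]` and vanishes at `0` and `1`, as an element of
`C₀(0,1)`. -/
def C0Unit.ofContinuousOn (F : ℝ → ℂ) (hF : ContinuousOn F (Icc 0 1)) (h0 : F 0 = 0) (h1 : F 1 = 0) :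
    C0Unit where
  toFun x := F x
  continuous_toFun := (hF.mono Ioo_subset_Icc_self).domRestrict
  zero_at_infty' := by
    rw [Metric.tendsto_nhds]
    intro ε hε
    have hT : IsCompact (Icc (0 : ℝ) 1 ∩ (fun x => ‖F x‖) ⁻¹' Ici ε) :=
      isCompact_Icc.of_isClosed_subset
        (hF.norm.preimage_isClosed_of_isClosed isClosed_Icc isClosed_Ici) inter_subset_left
    have hsub : Icc (0 : ℝ) 1 ∩ (fun x => ‖F x‖) ⁻¹' Ici ε ⊆ Ioo 0 1 := by
      rintro x ⟨hx, hxε⟩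
      rw [mem_preimage, mem_Ici] at hxε
      refine ⟨lt_of_le_of_ne hx.1 ?_, lt_of_le_of_ne hx.2 ?_⟩
      · rintro rfl; rw [h0, norm_zero] at hxε; linarith
      · rintro rfl; rw [h1, norm_zero] at hxε; linarith
    refine Filter.mem_cocompact.2 ⟨Subtype.val ⁻¹' (Icc (0 : ℝ) 1 ∩ (fun x => ‖F x‖) ⁻¹' Ici ε), ?_, ?_⟩
    · rw [Subtype.isCompact_iff, Subtype.image_preimage_coe, inter_eq_self_of_subset_right hsub]
      exact hT
    · intro x hx
      rw [mem_compl_iff, mem_preimage, mem_inter_iff, not_and, mem_preimage, mem_Ici, not_le] at hx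
      simpa using hx (Ioo_subset_Icc_self x.2)

theorem C0Unit.ofContinuousOn_apply {F : ℝ → ℂ} {hF : ContinuousOn F (Icc 0 1)} {h0 : F 0 = 0}
    {h1 : F 1 = 0} (x : Ioo (0 : ℝ) 1) : C0Unit.ofContinuousOn F hF h0 h1 x = F x := rfl

theorem C0Unit.norm_le {f : C0Unit} {C : ℝ} (hC : 0 ≤ C) (h : ∀ x, ‖f x‖ ≤ C) : ‖f‖ ≤ C := by
  rw [← ZeroAtInftyContinuousMap.norm_toBCF_eq_norm]
  exact (BoundedContinuousFunction.norm_le hC).2 h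

theorem C0Unit.norm_zeroExtend_le (f : C0Unit) (x : ℝ) : ‖f.zeroExtend x‖ ≤ ‖f‖ := by
  by_cases hx : x ∈ Ioo (0 : ℝ) 1
  · rw [f.zeroExtend_coe ⟨x, hx⟩, ← ZeroAtInftyContinuousMap.norm_toBCF_eq_norm]
    exact f.toBCF.norm_coe_le_norm ⟨x, hx⟩
  · rw [f.zeroExtend_of_notMem hx, norm_zero]; exact norm_nonneg _

/-- Vanishing of the kernel at x = 0 and x = 1 is what makes the image satisfy the boundary
conditions. -/
theorem exists_kernel_operator_C0 (hk : Continuous (Function.uncurry k)) (h0 : ∀ s ∈ Icc (0 : ℝ) 1, k 0 s = 0)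
    (h1 : ∀ s ∈ Icc (0 : ℝ) 1, k 1 s = 0) {B : ℝ} (hB0 : 0 ≤ B)
    (hB : ∀ x ∈ Icc (0 : ℝ) 1, ∫ s in Icc (0 : ℝ) 1, ‖k x s‖ ≤ B) :
    ∃ R : C0Unit →L[ℂ] C0Unit, (∀ g x, R g x = kernelInt k g.zeroExtend x) ∧ ‖R‖ ≤ B := by
  set L : C0Unit →ₗ[ℂ] C0Unit :=
    { toFun := fun g => C0Unit.ofContinuousOn (kernelInt k g.zeroExtend)
        (continuousOn_kernelInt hk g.integrableOn_zeroExtend)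
        (kernelInt_eq_zero h0) (kernelInt_eq_zero h1)
      map_add' := fun g g' => by
        ext x
        rw [ZeroAtInftyContinuousMap.coe_add, Pi.add_apply, C0Unit.ofContinuousOn_apply,
          C0Unit.ofContinuousOn_apply, C0Unit.ofContinuousOn_apply, C0Unit.zeroExtend_add,
          kernelInt_add hk g.integrableOn_zeroExtend g'.integrableOn_zeroExtend]
      map_smul' := fun c g => by
        ext x
        rw [ZeroAtInftyContinuousMap.coe_smul, Pi.smul_apply, C0Unit.ofContinuousOn_apply,
          C0Unit.ofContinuousOn_apply, C0Unit.zeroExtend_smul, kernelInt_smul]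
        rfl } with hL
  refine ⟨L.mkContinuous B fun g => C0Unit.norm_le (by positivity) fun x => ?_, fun g x => rfl,
    L.mkContinuous_norm_le hB0 _⟩
  exact norm_kernelInt_le hk (hB x (Ioo_subset_Icc_self x.2)) (norm_nonneg g) g.norm_zeroExtend_le

theorem exists_kernel_operator_L1 (hk : Continuous (Function.uncurry k)) {B : ℝ} (hB0 : 0 ≤ B)
    (hB : ∀ s ∈ Icc (0 : ℝ) 1, ∫ x in Icc (0 : ℝ) 1, ‖k x s‖ ≤ B) :
    ∃ R : L1Unit →L[ℂ] L1Unit,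
      (∀ g : L1Unit, R g =ᵐ[volume.restrict (Icc (0 : ℝ) 1)] kernelInt k g) ∧ ‖R‖ ≤ B := by
  have hi : ∀ g : L1Unit, Integrable (kernelInt k g) (volume.restrict (Icc (0 : ℝ) 1)) := fun g =>
    (continuousOn_kernelInt hk (L1.integrable_coeFn g)).integrableOn_Icc
  set L : L1Unit →ₗ[ℂ] L1Unit :=
    { toFun := fun g => (hi g).toL1 _
      map_add' := fun g g' => by
        rw [← Integrable.toL1_add, Integrable.toL1_eq_toL1_iff]
        refine Eventually.of_forall fun x => ?_
        rw [Pi.add_apply, kernelInt_congr (Lp.coeFn_add g g'),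
          kernelInt_add hk (L1.integrable_coeFn g) (L1.integrable_coeFn g')]
      map_smul' := fun c g => by
        rw [RingHom.id_apply, ← Integrable.toL1_smul', Integrable.toL1_eq_toL1_iff]
        refine Eventually.of_forall fun x => ?_
        rw [Pi.smul_apply, kernelInt_congr (Lp.coeFn_smul c g), kernelInt_smul, smul_eq_mul] } with hL
  refine ⟨L.mkContinuous B fun g => ?_, fun g => Integrable.coeFn_toL1 (hi g),
    L.mkContinuous_norm_le hB0 _⟩
  rw [L1.norm_eq_integral_norm, L1.norm_eq_integral_norm]
  refine le_trans (le_of_eq ?_) (integral_norm_kernelInt_le hk (L1.integrable_coeFn g) hB)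
  refine integral_congr_ae ?_
  filter_upwards [Integrable.coeFn_toL1 (hi g)] with x hx
  exact congrArg norm hx

end KernelOperators

/-! ### Green kernels and their resolvent identity. -/

section Resolvent

/-- The kernel of the resolvent attached to the fundamental solution `a`. -/
def resKernel (a : ℝ → ℂ) (x s : ℝ) : ℂ := a x * (a (1 - s) / a 1) - a (x - s)

variable {a b : ℝ → ℂ} {g : ℝ → ℂ} {κ : ℂ}

theorem continuous_convKernel (ha : Continuous a) :
    Continuous (Function.uncurry fun x s : ℝ => a (x - s)) :=
  ha.comp (continuous_fst.sub continuous_snd)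

theorem continuous_resKernel (ha : Continuous a) : Continuous (Function.uncurry (resKernel a)) := by
  unfold resKernel
  simp only [Function.uncurry_def]
  fun_prop

theorem kernelInt_resKernel (ha : Continuous a) (hg : IntegrableOn g (Icc (0 : ℝ) 1)) (x : ℝ) :
    kernelInt (resKernel a) g x =
      a x * (kernelInt (fun x s => a (x - s)) g 1 / a 1) - kernelInt (fun x s => a (x - s)) g x := by
  have i1 := integrableOn_kernel_mul (continuous_convKernel ha) hg 1
  have i2 := integrableOn_kernel_mul (continuous_convKernel ha) hg x
  unfold kernelInt
  have e : ∀ s : ℝ, resKernel a x s * g s = a x / a 1 * (a (1 - s) * g s) - a (x - s) * g s := by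
    intro s; unfold resKernel; ring
  simp_rw [e]
  rw [integral_sub (i1.const_mul _) i2, integral_const_mul]
  ring

/-- The convolution identity, as an identity between kernels on the unit square. -/
theorem integral_conv_eq (ha : ∀ y ≤ 0, a y = 0) (hb : ∀ y ≤ 0, b y = 0)
    (hab : ∀ z ∈ Icc (0 : ℝ) 1, a z - b z = κ * ∫ y in (0 : ℝ)..z, b (z - y) * a y)
    {x s : ℝ} (hx : x ∈ Icc (0 : ℝ) 1) (hs : s ∈ Icc (0 : ℝ) 1) :
    κ * ∫ y in Icc (0 : ℝ) 1, b (x - y) * a (y - s) = a (x - s) - b (x - s) := by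
  rcases le_total x s with h | h
  · rw [ha _ (by linarith), hb _ (by linarith), setIntegral_eq_zero_of_forall_eq_zero]
    · simp
    · intro y _
      rcases le_total y s with h2 | h2
      · rw [ha (y - s) (by linarith), mul_zero]
      · rw [hb (x - y) (by linarith), zero_mul]
  · rw [hab (x - s) ⟨by linarith, by linarith [hx.2, hs.1]⟩]
    congr 1
    have e : ∫ y in Icc (0 : ℝ) 1, b (x - y) * a (y - s) = ∫ y in Ioc s x, b (x - y) * a (y - s) := by
      refine (setIntegral_eq_of_subset_of_forall_sdiff_eq_zero measurableSet_Icc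
        (fun y hy => ⟨hs.1.trans hy.1.le, hy.2.trans hx.2⟩) fun y hy => ?_)
      rcases le_or_gt y s with h2 | h2
      · rw [ha (y - s) (by linarith), mul_zero]
      · rw [hb (x - y) (by by_contra h3; exact hy.2 ⟨h2, by linarith⟩), zero_mul]
    rw [e, ← intervalIntegral.integral_of_le h]
    have := intervalIntegral.integral_comp_sub_right (a := s) (b := x)
      (fun y => b (x - s - y) * a y) s
    rw [sub_self] at this
    rw [← this]
    congr 1; ext y
    ring_nf

theorem kernelInt_conv_conv (hac : Continuous a) (hbc : Continuous b) (ha : ∀ y ≤ 0, a y = 0)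
    (hb : ∀ y ≤ 0, b y = 0)
    (hab : ∀ z ∈ Icc (0 : ℝ) 1, a z - b z = κ * ∫ y in (0 : ℝ)..z, b (z - y) * a y)
    (hg : IntegrableOn g (Icc (0 : ℝ) 1)) {x : ℝ} (hx : x ∈ Icc (0 : ℝ) 1) :
    κ * kernelInt (fun x s => b (x - s)) (kernelInt (fun x s => a (x - s)) g) x =
      kernelInt (fun x s => a (x - s)) g x - kernelInt (fun x s => b (x - s)) g x := by
  rw [kernelInt_kernelInt (continuous_convKernel hbc) (continuous_convKernel hac) hg]
  unfold kernelInt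
  rw [← integral_sub (integrableOn_kernel_mul (continuous_convKernel hac) hg x)
    (integrableOn_kernel_mul (continuous_convKernel hbc) hg x), ← integral_const_mul]
  refine setIntegral_congr_fun measurableSet_Icc fun s hs => ?_
  simp only
  rw [← mul_assoc, integral_conv_eq ha hb hab hx hs, sub_mul]

/-- The resolvent identity for the kernels `resKernel`. -/
theorem kernelInt_resKernel_comp (hac : Continuous a) (hbc : Continuous b) (ha : ∀ y ≤ 0, a y = 0)
    (hb : ∀ y ≤ 0, b y = 0) (ha1 : a 1 ≠ 0) (hb1 : b 1 ≠ 0)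
    (hab : ∀ z ∈ Icc (0 : ℝ) 1, a z - b z = κ * ∫ y in (0 : ℝ)..z, b (z - y) * a y)
    (hg : IntegrableOn g (Icc (0 : ℝ) 1)) {x : ℝ} (hx : x ∈ Icc (0 : ℝ) 1) :
    κ * kernelInt (resKernel b) (kernelInt (resKernel a) g) x =
      kernelInt (resKernel b) g x - kernelInt (resKernel a) g x := by
  set Sa := kernelInt (fun x s => a (x - s)) g with hSa
  set c := Sa 1 / a 1 with hc
  have hSai : IntegrableOn Sa (Icc (0 : ℝ) 1) :=
    (continuousOn_kernelInt (continuous_convKernel hac) hg).integrableOn_Icc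
  have hRai : IntegrableOn (kernelInt (resKernel a) g) (Icc (0 : ℝ) 1) :=
    (continuousOn_kernelInt (continuous_resKernel hac) hg).integrableOn_Icc
  -- The Green operator is the convolution S_a, up to sign, plus the multiple of a that restores the
  -- value 0 at x = 1.
  have hRa : kernelInt (resKernel a) g = c • a + (-1 : ℂ) • Sa := by
    ext x
    rw [kernelInt_resKernel hac hg]
    simp only [Pi.add_apply, Pi.smul_apply, smul_eq_mul]
    ring
  have hbb := continuous_convKernel hbc
  -- The convolution identity gives κ b * a = a - b and κ b * S_a g = S_a g - S_b g. Evaluating the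
  -- sum at x and at 1 gives the claim, since c a(1) = S_a g(1).
  have key : ∀ x ∈ Icc (0 : ℝ) 1, κ * kernelInt (fun x s => b (x - s)) (kernelInt (resKernel a) g) x =
      c * (a x - b x) - Sa x + kernelInt (fun x s => b (x - s)) g x := by
    intro x hx
    rw [hRa, kernelInt_add hbb ((hac.integrableOn_Icc).smul c) (hSai.smul (-1 : ℂ)), kernelInt_smul,
      kernelInt_smul]
    have h1 := kernelInt_conv_conv hac hbc ha hb hab hg hx
    have h2 := integral_conv_eq ha hb hab hx (s := 0) ⟨le_rfl, zero_le_one⟩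
    simp only [sub_zero] at h2
    have h3 : kernelInt (fun x s => b (x - s)) a x = ∫ y in Icc (0 : ℝ) 1, b (x - y) * a y := rfl
    rw [h3]
    rw [← hSa] at h1
    linear_combination c * h2 - h1
  have k1 := key 1 ⟨zero_le_one, le_rfl⟩
  have kx := key x hx
  rw [kernelInt_resKernel hbc hRai, kernelInt_resKernel hbc hg, kernelInt_resKernel hac hg, ← hSa, ← hc]
  have e : κ * (b x * (kernelInt (fun x s => b (x - s)) (kernelInt (resKernel a) g) 1 / b 1) -
      kernelInt (fun x s => b (x - s)) (kernelInt (resKernel a) g) x) =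
      b x / b 1 * (κ * kernelInt (fun x s => b (x - s)) (kernelInt (resKernel a) g) 1) -
      κ * kernelInt (fun x s => b (x - s)) (kernelInt (resKernel a) g) x := by ring
  rw [e, k1, kx]
  have hca : c * a 1 = Sa 1 := div_mul_cancel₀ _ ha1
  field_simp
  linear_combination (b x) * hca

variable {α : ℝ}

theorem mlSol_zero_of_nonneg (α : ℝ) {x : ℝ} (hx : 0 ≤ x) : mlSol α 0 x = (rlKernel α x : ℂ) := by
  rw [mlSol_of_nonneg hx, mlKernel, zero_mul, mittagLeffler_zero, rlKernel]
  push_cast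
  rw [div_eq_mul_inv]

theorem mlSol_volterra (hα : 1 < α) (l : ℂ) {z : ℝ} (hz : 0 ≤ z) :
    mlSol α l z - mlSol α 0 z = l * ∫ y in (0 : ℝ)..z, mlSol α 0 (z - y) * mlSol α l y := by
  rcases hz.eq_or_lt with rfl | hz
  · simp [mlSol_of_nonpos hα le_rfl]
  rw [mlSol_zero_of_nonneg α hz.le, mlSol_of_nonneg hz.le, mlKernel_eq_add hα (by linarith) l hz,
    ← (integral_rlKernel_mul_mlKernel hα (by linarith : 0 < α) (by linarith : 0 < α) l hz).2,
    add_sub_cancel_left]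
  congr 1
  refine intervalIntegral.integral_congr fun s hs => ?_
  rw [uIcc_of_le hz.le] at hs
  rw [mlSol_zero_of_nonneg α (sub_nonneg.2 hs.2), mlSol_of_nonneg hs.1]

/-- Convolution commutes, so the Volterra equation also reads with l and 0 exchanged. The two
versions give the right and the left inverse property of the resolvent. -/
theorem mlSol_volterra' (hα : 1 < α) (l : ℂ) {z : ℝ} (hz : 0 ≤ z) :
    mlSol α 0 z - mlSol α l z = -l * ∫ y in (0 : ℝ)..z, mlSol α l (z - y) * mlSol α 0 y := by
  have h := mlSol_volterra hα l hz
  have e := intervalIntegral.integral_comp_sub_left (a := 0) (b := z)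
    (fun y => mlSol α l (z - y) * mlSol α 0 y) z
  rw [sub_self, sub_zero] at e
  rw [← e]
  simp only [sub_sub_cancel, mul_comm (mlSol α l _)]
  linear_combination -h

theorem mlSol_zero_one_ne_zero (hα : 1 < α) : mlSol α 0 1 ≠ 0 := by
  rw [mlSol_zero_of_nonneg α zero_le_one]
  exact_mod_cast (rlKernel_pos (by linarith) one_pos).ne'

theorem fracIntegral_eq_kernelInt (hα : 1 < α) (g : ℝ → ℂ) {x : ℝ} (hx : x ∈ Icc (0 : ℝ) 1) :
    fracIntegral α g x = kernelInt (fun x s => mlSol α 0 (x - s)) g x := by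
  rw [fracIntegral, intervalIntegral.integral_of_le hx.1, kernelInt]
  have e : ∫ s in Icc (0 : ℝ) 1, mlSol α 0 (x - s) * g s = ∫ s in Icc (0 : ℝ) x, mlSol α 0 (x - s) * g s := by
    refine (setIntegral_eq_of_subset_of_forall_sdiff_eq_zero measurableSet_Icc
      (Icc_subset_Icc_right hx.2) fun s hs => ?_)
    rw [mlSol_of_nonpos hα (by by_contra h3; exact hs.2 ⟨hs.1.1, by linarith⟩), zero_mul]
  rw [e, integral_Icc_eq_integral_Ioc]
  refine setIntegral_congr_fun measurableSet_Ioc fun s hs => ?_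
  rw [mlSol_zero_of_nonneg α (by linarith [hs.2]), rlKernel]

/-- u_0(x) = x^(α-1)/Γ(α), so the Green kernel at l = 0 is that of -A⁻¹. -/
theorem dirichletAntideriv_eq_kernelInt (hα : 1 < α) (hg : IntegrableOn g (Icc (0 : ℝ) 1)) {x : ℝ}
    (hx : x ∈ Icc (0 : ℝ) 1) :
    dirichletAntideriv α g x = -kernelInt (resKernel (mlSol α 0)) g x := by
  rw [dirichletAntideriv, kernelInt_resKernel (continuous_mlSol_right hα 0) hg,
    fracIntegral_eq_kernelInt hα g hx, fracIntegral_eq_kernelInt hα g ⟨zero_le_one, le_rfl⟩,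
    mlSol_zero_of_nonneg α hx.1, mlSol_zero_of_nonneg α zero_le_one, rlKernel, rlKernel]
  have hG : (Real.Gamma α : ℂ) ≠ 0 := by exact_mod_cast (Real.Gamma_pos_of_pos (by linarith)).ne'
  simp only [Real.one_rpow]
  push_cast
  field_simp
  ring

theorem dirichletAntideriv_resolvent (hα : 1 < α) {l : ℂ} (hl : mlSol α l 1 ≠ 0)
    (hg : IntegrableOn g (Icc (0 : ℝ) 1)) {x : ℝ} (hx : x ∈ Icc (0 : ℝ) 1) :
    dirichletAntideriv α (l • kernelInt (resKernel (mlSol α l)) g - g) x =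
      kernelInt (resKernel (mlSol α l)) g x := by
  have hR : IntegrableOn (kernelInt (resKernel (mlSol α l)) g) (Icc (0 : ℝ) 1) :=
    (continuousOn_kernelInt (continuous_resKernel (continuous_mlSol_right hα l)) hg).integrableOn_Icc
  have hk := continuous_resKernel (continuous_mlSol_right hα 0)
  have key := kernelInt_resKernel_comp (continuous_mlSol_right hα l) (continuous_mlSol_right hα 0)
    (fun y hy => mlSol_of_nonpos hα hy) (fun y hy => mlSol_of_nonpos hα hy) hl
    (mlSol_zero_one_ne_zero hα) (fun z hz => mlSol_volterra hα l hz.1) hg hx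
  have e : l • kernelInt (resKernel (mlSol α l)) g - g =
      l • kernelInt (resKernel (mlSol α l)) g + (-1 : ℂ) • g := by
    ext x; simp [sub_eq_add_neg]
  rw [e, dirichletAntideriv_eq_kernelInt hα ((hR.smul l).add (hg.smul (-1 : ℂ))) hx,
    kernelInt_add hk (hR.smul l) (hg.smul (-1 : ℂ)), kernelInt_smul, kernelInt_smul]
  linear_combination -key

theorem resolvent_dirichletAntideriv (hα : 1 < α) {l : ℂ} (hl : mlSol α l 1 ≠ 0)
    (hg : IntegrableOn g (Icc (0 : ℝ) 1)) {x : ℝ} (hx : x ∈ Icc (0 : ℝ) 1) :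
    kernelInt (resKernel (mlSol α l)) (l • dirichletAntideriv α g - g) x =
      dirichletAntideriv α g x := by
  have hR : IntegrableOn (kernelInt (resKernel (mlSol α 0)) g) (Icc (0 : ℝ) 1) :=
    (continuousOn_kernelInt (continuous_resKernel (continuous_mlSol_right hα 0)) hg).integrableOn_Icc
  have hk := continuous_resKernel (continuous_mlSol_right hα l)
  have key := kernelInt_resKernel_comp (continuous_mlSol_right hα 0) (continuous_mlSol_right hα l)
    (fun y hy => mlSol_of_nonpos hα hy) (fun y hy => mlSol_of_nonpos hα hy)
    (mlSol_zero_one_ne_zero hα) hl (fun z hz => mlSol_volterra' hα l hz.1) hg hx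
  have e : l • dirichletAntideriv α g - g =ᵐ[volume.restrict (Icc (0 : ℝ) 1)]
      (-l) • kernelInt (resKernel (mlSol α 0)) g + (-1 : ℂ) • g := by
    filter_upwards [ae_restrict_mem measurableSet_Icc] with y hy
    simp only [Pi.sub_apply, Pi.smul_apply, Pi.add_apply, smul_eq_mul]
    rw [dirichletAntideriv_eq_kernelInt hα hg hy]
    ring
  rw [kernelInt_congr e, kernelInt_add hk (hR.smul (-l)) (hg.smul (-1 : ℂ)), kernelInt_smul,
    kernelInt_smul, dirichletAntideriv_eq_kernelInt hα hg hx]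
  linear_combination key

theorem resKernel_zero_left (ha : ∀ y ≤ 0, a y = 0) {s : ℝ} (hs : 0 ≤ s) : resKernel a 0 s = 0 := by
  rw [resKernel, ha 0 le_rfl, ha (0 - s) (by linarith)]; simp

theorem resKernel_one_left (ha1 : a 1 ≠ 0) (s : ℝ) : resKernel a 1 s = 0 := by
  rw [resKernel]; field_simp; simp

/-- Reflecting and exchanging the variables maps rows to columns, so a row bound valid for all x is
a column bound as well, and the C₀ estimate also gives the L¹ estimate. -/
theorem resKernel_symm (a : ℝ → ℂ) (x s : ℝ) : resKernel a (1 - s) (1 - x) = resKernel a x s := by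
  rw [resKernel, resKernel, sub_sub_cancel, show 1 - s - (1 - x) = x - s by ring]
  ring

theorem integral_norm_resKernel_symm (a : ℝ → ℂ) (s : ℝ) :
    ∫ x in Icc (0 : ℝ) 1, ‖resKernel a x s‖ = ∫ x in Icc (0 : ℝ) 1, ‖resKernel a (1 - s) x‖ := by
  rw [integral_Icc_eq_integral_Ioc, integral_Icc_eq_integral_Ioc,
    ← intervalIntegral.integral_of_le zero_le_one, ← intervalIntegral.integral_of_le zero_le_one]
  have e := intervalIntegral.integral_comp_sub_left (a := 0) (b := 1)
    (fun x => ‖resKernel a (1 - s) x‖) 1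
  rw [sub_self, sub_zero] at e
  rw [← e]
  simp_rw [resKernel_symm]

end Resolvent

/-! ### The resolvents on the two spaces. -/

section Resolvent

variable {α : ℝ}

theorem C0Unit.zeroExtend_ae {f : C0Unit} {F : ℝ → ℂ} (h : ∀ x : Ioo (0 : ℝ) 1, f x = F x) :
    f.zeroExtend =ᵐ[volume.restrict (Icc (0 : ℝ) 1)] F := by
  rw [← Measure.restrict_congr_set (Ioo_ae_eq_Icc (a := (0 : ℝ)) (b := 1))]
  filter_upwards [ae_restrict_mem measurableSet_Ioo] with x hx
  rw [f.zeroExtend_coe ⟨x, hx⟩, h]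

theorem C0Unit.zeroExtend_smul_sub (c : ℂ) (f g : C0Unit) :
    (c • f - g).zeroExtend = c • f.zeroExtend - g.zeroExtend := by
  have : c • f - g = c • f + (-1 : ℂ) • g := by
    rw [sub_eq_add_neg]; congr 1; ext x; simp
  rw [this, C0Unit.zeroExtend_add, C0Unit.zeroExtend_smul, C0Unit.zeroExtend_smul, neg_one_smul,
    sub_eq_add_neg]

theorem exists_isResolventAt_C0 (hα : 1 < α) (hα' : α ≤ 2) {l : ℂ} (hl : mlSol α l 1 ≠ 0) {B : ℝ}
    (hB : ∀ x ∈ Icc (0 : ℝ) 1, ∫ s in Icc (0 : ℝ) 1, ‖resKernel (mlSol α l) x s‖ ≤ B) :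
    ∃ R : C0Unit →L[ℂ] C0Unit, IsResolventAt (fracDirichletC0 α hα) l R ∧ ‖R‖ ≤ B := by
  have hB0 : 0 ≤ B := (integral_nonneg fun _ => norm_nonneg _).trans (hB 0 ⟨le_rfl, zero_le_one⟩)
  obtain ⟨R, hR, hRn⟩ := exists_kernel_operator_C0
    (continuous_resKernel (continuous_mlSol_right hα l))
    (fun s hs => resKernel_zero_left (fun y hy => mlSol_of_nonpos hα hy) hs.1)
    (fun s _ => resKernel_one_left hl s) hB0 hB
  refine ⟨R, IsResolventAt.of_graph ?_ ?_, hRn⟩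
  · intro g
    rw [fracDirichletC0_graph α hα hα']
    intro x
    have hx := Ioo_subset_Icc_self x.2
    have e : (l • R g - g).zeroExtend =ᵐ[volume.restrict (Icc (0 : ℝ) 1)]
        l • kernelInt (resKernel (mlSol α l)) g.zeroExtend - g.zeroExtend := by
      rw [C0Unit.zeroExtend_smul_sub]
      filter_upwards [C0Unit.zeroExtend_ae (hR g)] with y hy
      simp only [Pi.sub_apply, Pi.smul_apply, hy]
    simp only
    rw [dirichletAntideriv_congr e hx, dirichletAntideriv_resolvent hα hl g.integrableOn_zeroExtend hx,
      hR]
  · intro f g hfg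
    rw [fracDirichletC0_graph α hα hα'] at hfg
    have hfg : ∀ x : Ioo (0 : ℝ) 1, f x = dirichletAntideriv α g.zeroExtend x := hfg
    ext x
    have e : (l • f - g).zeroExtend =ᵐ[volume.restrict (Icc (0 : ℝ) 1)]
        l • dirichletAntideriv α g.zeroExtend - g.zeroExtend := by
      rw [C0Unit.zeroExtend_smul_sub]
      filter_upwards [C0Unit.zeroExtend_ae hfg] with y hy
      simp only [Pi.sub_apply, Pi.smul_apply, hy]
    rw [hR, kernelInt_congr e, resolvent_dirichletAntideriv hα hl g.integrableOn_zeroExtend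
      (Ioo_subset_Icc_self x.2), hfg]

theorem coeFn_smul_sub (c : ℂ) (f g : L1Unit) :
    ((c • f - g : L1Unit) : ℝ → ℂ) =ᵐ[volume.restrict (Icc (0 : ℝ) 1)] c • (f : ℝ → ℂ) - g := by
  filter_upwards [Lp.coeFn_sub (c • f) g, Lp.coeFn_smul c f] with y h1 h2
  rw [h1, Pi.sub_apply, h2, Pi.sub_apply]

theorem exists_isResolventAt_L1 (hα : 1 < α) (hα' : α ≤ 2) {l : ℂ} (hl : mlSol α l 1 ≠ 0) {B : ℝ}
    (hB : ∀ x ∈ Icc (0 : ℝ) 1, ∫ s in Icc (0 : ℝ) 1, ‖resKernel (mlSol α l) x s‖ ≤ B) :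
    ∃ R : L1Unit →L[ℂ] L1Unit, IsResolventAt (fracDirichletL1 α hα) l R ∧ ‖R‖ ≤ B := by
  have hB0 : 0 ≤ B := (integral_nonneg fun _ => norm_nonneg _).trans (hB 0 ⟨le_rfl, zero_le_one⟩)
  obtain ⟨R, hR, hRn⟩ := exists_kernel_operator_L1
    (continuous_resKernel (continuous_mlSol_right hα l)) hB0 (fun s hs => by
      rw [integral_norm_resKernel_symm]
      exact hB (1 - s) ⟨by linarith [hs.2], by linarith [hs.1]⟩)
  refine ⟨R, IsResolventAt.of_graph ?_ ?_, hRn⟩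
  · intro g
    rw [fracDirichletL1_graph α hα hα']
    have e : ((l • R g - g : L1Unit) : ℝ → ℂ) =ᵐ[volume.restrict (Icc (0 : ℝ) 1)]
        l • kernelInt (resKernel (mlSol α l)) g - g := by
      filter_upwards [coeFn_smul_sub l (R g) g, hR g] with y h1 h2
      rw [h1, Pi.sub_apply, Pi.smul_apply, h2, Pi.sub_apply, Pi.smul_apply]
    show R g =ᵐ[volume.restrict (Icc (0 : ℝ) 1)] dirichletAntideriv α (l • R g - g : L1Unit)
    filter_upwards [hR g, ae_restrict_mem measurableSet_Icc] with x h1 hx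
    rw [dirichletAntideriv_congr e hx, dirichletAntideriv_resolvent hα hl (L1.integrable_coeFn g) hx, h1]
  · intro f g hfg
    rw [fracDirichletL1_graph α hα hα'] at hfg
    have hfg : f =ᵐ[volume.restrict (Icc (0 : ℝ) 1)] dirichletAntideriv α g := hfg
    refine Lp.ext ?_
    have e : ((l • f - g : L1Unit) : ℝ → ℂ) =ᵐ[volume.restrict (Icc (0 : ℝ) 1)]
        l • dirichletAntideriv α g - g := by
      filter_upwards [coeFn_smul_sub l f g, hfg] with y h1 h2
      rw [h1, Pi.sub_apply, Pi.smul_apply, h2, Pi.sub_apply, Pi.smul_apply]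
    filter_upwards [hR (l • f - g), hfg, ae_restrict_mem measurableSet_Icc] with x h1 h2 hx
    rw [h1, kernelInt_congr e, resolvent_dirichletAntideriv hα hl (L1.integrable_coeFn g) hx, h2]

end Resolvent

/-! ### Asymptotics and the pointwise bound for the Green kernel. -/

section Estimates

variable {α : ℝ}

/-- Allows exponential terms and the algebraically decaying remainder to be measured by the same
bump (1 + z²)⁻¹. -/
theorem exp_neg_mul_le {c z : ℝ} (hc : 0 < c) (hz : 0 ≤ z) :
    Real.exp (-(c * z)) ≤ (1 + 2 / c ^ 2) * (1 + z ^ 2)⁻¹ := by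
  have h1 : 1 + c ^ 2 * z ^ 2 / 2 ≤ Real.exp (c * z) := by
    have := Real.quadratic_le_exp_of_nonneg (show 0 ≤ c * z by positivity)
    nlinarith [show 0 ≤ c * z by positivity]
  rw [Real.exp_neg, ← div_eq_mul_inv, le_div_iff₀ (by positivity), inv_mul_eq_div,
    div_le_iff₀ (Real.exp_pos _)]
  have h2 : 1 + z ^ 2 ≤ (1 + 2 / c ^ 2) * (1 + c ^ 2 * z ^ 2 / 2) := by
    have : (1 + 2 / c ^ 2) * (1 + c ^ 2 * z ^ 2 / 2) = 1 + z ^ 2 + (2 / c ^ 2 + c ^ 2 * z ^ 2 / 2) := by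
      field_simp; ring
    rw [this]
    have : 0 ≤ 2 / c ^ 2 + c ^ 2 * z ^ 2 / 2 := by positivity
    linarith
  exact h2.trans (mul_le_mul_of_nonneg_left h1 (by positivity))

/-- The pointwise bound for the Green kernel of an exponentially growing fundamental solution. -/
theorem norm_green_le {U : ℝ → ℂ} {a μ : ℂ} {c C t y σ : ℝ} (hc : 0 < c) (hμ : c ≤ μ.re)
    (ha1 : ‖a‖ ≤ 1) (hC : 0 ≤ C)
    (hU : ∀ y, 0 ≤ y → ‖U y - a * Complex.exp (μ * y)‖ ≤ C * (1 + y ^ 2)⁻¹)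
    (hU0 : ∀ y ≤ 0, U y = 0) (hq : 2 * C < ‖a‖ * Real.exp (μ.re * t))
    (hy : y ∈ Icc 0 t) (hσ : σ ∈ Icc 0 t) :
    ‖U y * (U (t - σ) / U t) - U (y - σ)‖ ≤ (3 * C + (4 * C + 2) * (1 + 2 / c ^ 2)) *
      ((1 + (t - σ) ^ 2)⁻¹ + (1 + (0 - σ) ^ 2)⁻¹ + (1 + (y - σ) ^ 2)⁻¹) := by
  set κ := μ.re with hκ
  have hκ0 : 0 < κ := hc.trans_le hμ
  set R : ℝ → ℂ := fun y => U y - a * Complex.exp (μ * y) with hR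
  have hUR : ∀ y, U y = a * Complex.exp (μ * y) + R y := fun y => by simp only [R]; ring
  have hexp : ∀ z : ℝ, ‖Complex.exp (μ * z)‖ = Real.exp (κ * z) := fun z => by
    rw [Complex.norm_exp, mul_comm, Complex.re_ofReal_mul, mul_comm]
  have hh : ∀ z : ℝ, (1 + z ^ 2)⁻¹ ≤ 1 := fun z => inv_le_one_of_one_le₀ (by nlinarith)
  have hhp : ∀ z : ℝ, 0 < (1 + z ^ 2)⁻¹ := fun z => by positivity
  have hRC : ∀ z : ℝ, 0 ≤ z → ‖R z‖ ≤ C := fun z hz =>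
    (hU z hz).trans (by nlinarith [hh z])
  have ht : 0 ≤ t := hy.1.trans hy.2
  set E := ‖a‖ * Real.exp (κ * t) with hE
  -- The hypothesis on t makes the exponential at least twice the remainder, so |U(t)| ≥ E/2 and the
  -- quotient in the kernel is under control.
  have hqn : E / 2 ≤ ‖U t‖ := by
    have h1 : E - ‖R t‖ ≤ ‖U t‖ := by
      have := norm_sub_le (U t) (R t)
      rw [show U t - R t = a * Complex.exp (μ * t) by rw [hUR]; ring, norm_mul, hexp, ← hE] at this
      linarith
    linarith [hRC t ht]
  have hE0 : 0 < E := by linarith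
  have hq0 : 0 < ‖U t‖ := by linarith
  have hq1 : U t ≠ 0 := norm_pos_iff.1 hq0
  set Q := ‖U t‖ with hQ
  have hCQ : C ≤ Q := by linarith
  set K := 1 + 2 / c ^ 2 with hK
  have hK0 : 0 < K := by positivity
  have eb : ∀ z, 0 ≤ z → Real.exp (-(κ * z)) ≤ K * (1 + z ^ 2)⁻¹ := fun z hz =>
    (Real.exp_le_exp.2 (by nlinarith)).trans (exp_neg_mul_le hc hz)
  have aE : ∀ z, ‖a‖ * Real.exp (κ * z) = E * Real.exp (-(κ * (t - z))) := fun z => by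
    rw [hE, mul_assoc, ← Real.exp_add]; ring_nf
  have aQ : ∀ z, z ≤ t → ‖a‖ * Real.exp (κ * z) ≤ 2 * Q * Real.exp (-(κ * (t - z))) := fun z _ => by
    rw [aE]; exact mul_le_mul_of_nonneg_right (by linarith) (Real.exp_pos _).le
  have hts : 0 ≤ t - σ := sub_nonneg.2 hσ.2
  set h1 := (1 + (t - σ) ^ 2)⁻¹ with hh1
  set h2 := (1 + (0 - σ) ^ 2)⁻¹ with hh2
  set h3 := (1 + (y - σ) ^ 2)⁻¹ with hh3
  have p1 : 0 < h1 := hhp _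
  have p2 : 0 < h2 := hhp _
  have p3 : 0 < h3 := hhp _
  have es : Real.exp (-(κ * σ)) ≤ K * h2 := by
    have := eb σ hσ.1
    rwa [hh2, zero_sub, neg_sq]
  -- the three common terms
  have T1 : ‖a * Complex.exp (μ * y) * R (t - σ)‖ ≤ 2 * C * h1 * Q := by
    rw [norm_mul, norm_mul, hexp]
    have b1 : ‖a‖ * Real.exp (κ * y) ≤ 2 * Q := (aQ y hy.2).trans (by
      have : Real.exp (-(κ * (t - y))) ≤ 1 := Real.exp_le_one_iff.2 (by nlinarith [hy.2])
      nlinarith)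
    calc _ ≤ 2 * Q * (C * h1) := mul_le_mul b1 (hU _ hts) (norm_nonneg _) (by positivity)
      _ = _ := by ring
  have T2 : ‖R y * (a * Complex.exp (μ * (t - σ : ℝ)))‖ ≤ 2 * C * K * h2 * Q := by
    rw [norm_mul, norm_mul, hexp]
    have b1 := aQ (t - σ) (by linarith [hσ.1])
    rw [sub_sub_cancel] at b1
    calc _ ≤ C * (2 * Q * (K * h2)) := mul_le_mul (hRC y hy.1)
          (b1.trans (mul_le_mul_of_nonneg_left es (by positivity))) (by positivity) hC
      _ = _ := by ring
  have T3 : ‖R y * R (t - σ)‖ ≤ C * h1 * Q := by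
    rw [norm_mul]
    calc _ ≤ Q * (C * h1) := mul_le_mul ((hRC y hy.1).trans hCQ) (hU _ hts) (norm_nonneg _) hq0.le
      _ = _ := by ring
  -- All estimates are made after multiplication by U(t), which clears the quotient.
  have fin : ∀ G : ℂ, ‖U t * G‖ ≤ ((3 * C + (4 * C + 2) * K) * (h1 + h2 + h3)) * Q →
      ‖G‖ ≤ (3 * C + (4 * C + 2) * K) * (h1 + h2 + h3) := fun G hG => by
    rw [norm_mul, mul_comm] at hG
    exact le_of_mul_le_mul_right hG hq0
  apply fin
  rcases le_total σ y with hsy | hsy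
  · have hys : 0 ≤ y - σ := sub_nonneg.2 hsy
    have T4 : ‖a * Complex.exp (μ * (y - σ : ℝ)) * R t‖ ≤ 2 * C * K * h2 * Q := by
      rw [norm_mul, norm_mul, hexp]
      have b1 := aQ (y - σ) (by linarith [hσ.1, hy.2])
      have b2 : Real.exp (-(κ * (t - (y - σ)))) ≤ K * h2 :=
        (Real.exp_le_exp.2 (by nlinarith [hy.2])).trans es
      calc _ ≤ 2 * Q * (K * h2) * C := mul_le_mul
            (b1.trans (mul_le_mul_of_nonneg_left b2 (by positivity))) (hRC t ht) (norm_nonneg _)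
            (by positivity)
        _ = _ := by ring
    have T5 : ‖R (y - σ) * U t‖ ≤ C * h3 * Q := by
      rw [norm_mul]; exact mul_le_mul_of_nonneg_right (hU _ hys) hq0.le
    -- For σ ≤ y the leading terms cancel, because e^(μy) e^(μ(t-σ)) = e^(μ(y-σ)) e^(μt); each
    -- surviving term carries a remainder.
    have e : U t * (U y * (U (t - σ) / U t) - U (y - σ)) =
        a * Complex.exp (μ * y) * R (t - σ) + R y * (a * Complex.exp (μ * (t - σ : ℝ))) +
          R y * R (t - σ) - a * Complex.exp (μ * (y - σ : ℝ)) * R t - R (y - σ) * U t := by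
      have e1 : U t * (U y * (U (t - σ) / U t) - U (y - σ)) = U y * U (t - σ) - U (y - σ) * U t := by
        field_simp
      have e2 : Complex.exp (μ * y) * Complex.exp (μ * (t - σ : ℝ)) =
          Complex.exp (μ * (y - σ : ℝ)) * Complex.exp (μ * t) := by
        rw [← Complex.exp_add, ← Complex.exp_add]; push_cast; ring_nf
      rw [e1]
      have u1 := hUR y
      have u2 := hUR (t - σ)
      have u3 := hUR (y - σ)
      have u4 := hUR t
      rw [u1, u2, u3]
      nth_rewrite 1 [u4]
      nth_rewrite 1 [u4]
      linear_combination a ^ 2 * e2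
    rw [e]
    refine (norm_sub_le _ _).trans ((add_le_add ((norm_sub_le _ _).trans (add_le_add
      ((norm_add_le _ _).trans (add_le_add ((norm_add_le _ _).trans (add_le_add T1 T2)) T3)) T4)) T5).trans ?_)
    have : 2 * C * h1 * Q + 2 * C * K * h2 * Q + C * h1 * Q + 2 * C * K * h2 * Q + C * h3 * Q =
        (3 * C * h1 + 4 * C * K * h2 + C * h3) * Q := by ring
    rw [this]
    refine mul_le_mul_of_nonneg_right ?_ hq0.le
    have n1 : 0 ≤ C * h2 := by positivity
    have n2 : 0 ≤ C * h3 := by positivity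
    have n3 : 0 ≤ (4 * C + 2) * K * (h1 + h3) := by positivity
    have n4 : 0 ≤ 2 * K * h2 := by positivity
    linarith
  -- For σ ≥ y nothing cancels, but relative to U(t) the product of exponentials is of size
  -- e^(-κ(σ-y)), which is already a bump around y.
  · rw [hU0 (y - σ) (by linarith), sub_zero]
    have T6 : ‖a * Complex.exp (μ * y) * (a * Complex.exp (μ * (t - σ : ℝ)))‖ ≤ 2 * K * h3 * Q := by
      rw [norm_mul, norm_mul, norm_mul, hexp, hexp]
      have b1 : ‖a‖ * Real.exp (κ * y) * (‖a‖ * Real.exp (κ * (t - σ))) =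
          ‖a‖ * (E * Real.exp (-(κ * (σ - y)))) := by
        have : Real.exp (κ * y) * Real.exp (κ * (t - σ)) =
            Real.exp (κ * t) * Real.exp (-(κ * (σ - y))) := by
          rw [← Real.exp_add, ← Real.exp_add]; ring_nf
        rw [hE]
        linear_combination ‖a‖ ^ 2 * this
      have b2 : Real.exp (-(κ * (σ - y))) ≤ K * h3 := by
        have := eb (σ - y) (by linarith)
        rwa [show (σ - y) ^ 2 = (y - σ) ^ 2 by ring] at this
      rw [b1]
      calc _ ≤ 1 * (2 * Q * (K * h3)) := by
            refine mul_le_mul ha1 (mul_le_mul (by linarith) b2 (Real.exp_pos _).le (by positivity))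
              (by positivity) zero_le_one
        _ = _ := by ring
    have e : U t * (U y * (U (t - σ) / U t)) =
        a * Complex.exp (μ * y) * R (t - σ) + R y * (a * Complex.exp (μ * (t - σ : ℝ))) +
          R y * R (t - σ) + a * Complex.exp (μ * y) * (a * Complex.exp (μ * (t - σ : ℝ))) := by
      have e1 : U t * (U y * (U (t - σ) / U t)) = U y * U (t - σ) := by field_simp
      rw [e1, hUR y, hUR (t - σ)]
      ring
    rw [e]
    refine ((norm_add_le _ _).trans (add_le_add
      ((norm_add_le _ _).trans (add_le_add ((norm_add_le _ _).trans (add_le_add T1 T2)) T3)) T6)).trans ?_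
    have : 2 * C * h1 * Q + 2 * C * K * h2 * Q + C * h1 * Q + 2 * K * h3 * Q =
        (3 * C * h1 + 2 * C * K * h2 + 2 * K * h3) * Q := by ring
    rw [this]
    refine mul_le_mul_of_nonneg_right ?_ hq0.le
    have n1 : 0 ≤ 3 * C * (h2 + h3) := by positivity
    have n2 : 0 ≤ 4 * C * K * (h1 + h3) := by positivity
    have n3 : 0 ≤ 2 * K * (h1 + h2) := by positivity
    have n4 : 0 ≤ 2 * C * K * h2 := by positivity
    linarith

/-- The exponential asymptotics of the Mittag-Leffler kernel. -/
theorem exists_mlSol_asymptotics (hα : 1 < α) (hα' : α ≤ 2) : ∃ C : ℝ, 0 ≤ C ∧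
    ∀ ψ y : ℝ, |ψ| ≤ Real.pi / (2 * α) → 0 ≤ y →
      ‖mlSol α (Complex.exp ((α * ψ : ℝ) * Complex.I)) y -
        Complex.exp (ψ * Complex.I) / (α * Complex.exp ((α * ψ : ℝ) * Complex.I)) *
          Complex.exp (Complex.exp (ψ * Complex.I) * y)‖ ≤ C * (1 + y ^ 2)⁻¹ := by
  obtain ⟨C1, hC1, hb1⟩ := exists_mlRem_bound hα hα'
  obtain ⟨C2, hC2, hb2⟩ := exists_mlRem_decay hα hα'
  -- The three summands cover y = 0 (where u vanishes and the exponential term is at most 1), 0 < y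
  -- ≤ 1 (bounded remainder, 1 + y² ≤ 2) and y ≥ 1 (decay y^(-(α+1)) ≤ y⁻²).
  refine ⟨1 + 2 * C1 + 2 * C2, by positivity, fun ψ y hψ hy => ?_⟩
  rcases hy.eq_or_lt with rfl | hy
  · rw [mlSol_of_nonpos hα le_rfl, zero_sub, norm_neg, norm_mul, norm_div, norm_mul,
      norm_exp_mul_I_eq_one, norm_exp_mul_I_eq_one, Complex.norm_real, Real.norm_of_nonneg (by linarith)]
    have : α⁻¹ ≤ 1 := inv_le_one_of_one_le₀ hα.le
    simp
    linarith
  rw [mlSol_of_nonneg hy.le, mlKernel_eq_exp_add_mlRem hα hα' hψ hy, add_sub_cancel_left]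
  rw [← div_eq_mul_inv, le_div_iff₀ (by positivity)]
  rcases le_total y 1 with h | h
  · have := hb1 ψ y hψ hy.le
    have h2 : 1 + y ^ 2 ≤ 2 := by nlinarith
    have h3 := norm_nonneg (mlRem α ψ y)
    nlinarith
  · have h1 := hb2 ψ y hψ hy
    have h2 : y ^ (-(α + 1)) ≤ y ^ (-2 : ℝ) := Real.rpow_le_rpow_of_exponent_le h (by linarith)
    have h3 : y ^ (-2 : ℝ) = (y ^ 2)⁻¹ := by
      rw [Real.rpow_neg hy.le]; norm_cast
    rw [h3] at h2
    have h4 : (y ^ 2)⁻¹ * (1 + y ^ 2) ≤ 2 := by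
      rw [inv_mul_le_iff₀ (by positivity)]; nlinarith
    calc _ ≤ C2 * (y ^ 2)⁻¹ * (1 + y ^ 2) :=
          mul_le_mul_of_nonneg_right (h1.trans (mul_le_mul_of_nonneg_left h2 hC2)) (by positivity)
      _ ≤ C2 * 2 := by rw [mul_assoc]; exact mul_le_mul_of_nonneg_left h4 hC2
      _ ≤ _ := by linarith

theorem integral_scaled_bump_le {t : ℝ} (ht : 0 < t) (z : ℝ) :
    IntegrableOn (fun s : ℝ => (1 + (z - t * s) ^ 2)⁻¹) (Icc 0 1) ∧
    ∫ s in Icc (0 : ℝ) 1, (1 + (z - t * s) ^ 2)⁻¹ ≤ t⁻¹ * Real.pi := by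
  have hi : Integrable fun s : ℝ => (1 + (z - s) ^ 2)⁻¹ := integrable_inv_one_add_sq.comp_sub_left z
  have hi2 : Integrable fun s : ℝ => (1 + (z - t * s) ^ 2)⁻¹ := hi.comp_mul_left' ht.ne'
  refine ⟨hi2.integrableOn, ?_⟩
  refine (setIntegral_le_integral hi2 (Eventually.of_forall fun s => by positivity)).trans (le_of_eq ?_)
  rw [Measure.integral_comp_mul_left (fun s : ℝ => (1 + (z - s) ^ 2)⁻¹) t,
    integral_sub_left_eq_self (fun s : ℝ => (1 + s ^ 2)⁻¹), integral_univ_inv_one_add_sq,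
    abs_of_pos (by positivity), smul_eq_mul]

end Estimates

/-! ### Row bounds for the Green kernel and the resolvent estimate. -/

section Estimates

variable {α : ℝ}

/-- Stretching [0,1] to [0,t] reduces a parameter of modulus t^α to one of modulus 1, at the price
of the factor t^(1-α). -/
theorem resKernel_scale {t : ℝ} (ht : 0 < t) (l : ℂ) (x s : ℝ) :
    resKernel (mlSol α (((t ^ α : ℝ) : ℂ) * l)) x s = ((t ^ (1 - α) : ℝ) : ℂ) *
      (mlSol α l (t * x) * (mlSol α l (t - t * s) / mlSol α l t) - mlSol α l (t * x - t * s)) := by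
  have h0 : ((t ^ (1 - α) : ℝ) : ℂ) ≠ 0 := by exact_mod_cast (Real.rpow_pos_of_pos ht _).ne'
  unfold resKernel
  rw [mlSol_scale ht, mlSol_scale ht, mlSol_scale ht, mlSol_scale ht, mul_one, mul_sub, mul_sub, mul_one,
    mul_div_mul_left _ _ h0]
  ring

theorem cos_ge_of_abs_le {α ψ : ℝ} (hα : 1 < α) (hψ : |ψ| ≤ Real.pi / (2 * α)) :
    Real.cos (Real.pi / (2 * α)) ≤ Real.cos ψ := by
  rw [← Real.cos_abs ψ]
  refine Real.cos_le_cos_of_nonneg_of_le_pi (abs_nonneg _) ?_ hψ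
  rw [div_le_iff₀ (by linarith)]
  nlinarith [Real.pi_pos]

theorem cos_pi_div_pos {α : ℝ} (hα : 1 < α) : 0 < Real.cos (Real.pi / (2 * α)) := by
  have hπ := Real.pi_pos
  have : 0 < Real.pi / (2 * α) := by positivity
  refine Real.cos_pos_of_mem_Ioo ⟨by linarith, ?_⟩
  gcongr
  linarith

theorem exists_polar_form (hα : 1 < α) {l : ℂ} (hl : 0 ≤ l.re) (hl0 : l ≠ 0) :
    ∃ ψ t : ℝ, 0 < t ∧ |ψ| ≤ Real.pi / (2 * α) ∧ t ^ α = ‖l‖ ∧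
      l = ((t ^ α : ℝ) : ℂ) * Complex.exp ((α * ψ : ℝ) * Complex.I) := by
  have hn : 0 < ‖l‖ := norm_pos_iff.2 hl0
  have hα0 : α ≠ 0 := by linarith
  have hta : (‖l‖ ^ α⁻¹) ^ α = ‖l‖ := by
    rw [← Real.rpow_mul hn.le, inv_mul_cancel₀ hα0, Real.rpow_one]
  refine ⟨l.arg / α, ‖l‖ ^ α⁻¹, Real.rpow_pos_of_pos hn _, ?_, hta, ?_⟩
  · rw [abs_div, abs_of_pos (by linarith : 0 < α), ← div_div]
    have := Complex.abs_arg_le_pi_div_two_iff.2 hl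
    gcongr
  · rw [hta, mul_div_cancel₀ _ hα0, Complex.norm_mul_exp_arg_mul_I]

/-- After scaling, the kernel is t^(1-α) times three bumps, each of integral at most π/t in s; since
t^α = ‖l‖, this is 3πD/‖l‖. The exponential rate cos ψ is at least cos(π/(2α)) > 0, uniformly in the
direction of l. -/
theorem exists_resKernel_bound_large (hα : 1 < α) (hα' : α ≤ 2) : ∃ M Λ : ℝ, 0 < M ∧ 0 < Λ ∧
    ∀ l : ℂ, 0 ≤ l.re → Λ < ‖l‖ → ∀ x ∈ Icc (0 : ℝ) 1,
      ∫ s in Icc (0 : ℝ) 1, ‖resKernel (mlSol α l) x s‖ ≤ M / ‖l‖ := by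
  obtain ⟨C, hC, hU⟩ := exists_mlSol_asymptotics hα hα'
  have hα0 : 0 < α := by linarith
  set c := Real.cos (Real.pi / (2 * α)) with hc
  have hc0 : 0 < c := cos_pi_div_pos hα
  set D := 3 * C + (4 * C + 2) * (1 + 2 / c ^ 2) with hD
  have hD0 : 0 < D := by positivity
  -- Makes c t₀ = 2Cα + 1, so that e^(ct) ≥ 1 + ct exceeds 2Cα for t > t₀, as the pointwise bound
  -- requires.
  set t₀ := (2 * C * α + 1) / c with ht₀
  have ht₀0 : 0 < t₀ := by positivity
  refine ⟨D * (3 * Real.pi), t₀ ^ α, by have := Real.pi_pos; positivity, by positivity,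
    fun l hl hlΛ x hx => ?_⟩
  have hl0 : l ≠ 0 := by
    rintro rfl; rw [norm_zero] at hlΛ; linarith [Real.rpow_pos_of_pos ht₀0 α]
  obtain ⟨ψ, t, ht, hψ, hta, hlt⟩ := exists_polar_form hα hl hl0
  have htt : t₀ < t := by
    rw [← hta] at hlΛ
    exact (Real.rpow_lt_rpow_iff ht₀0.le ht.le hα0).1 hlΛ
  set θ := Complex.exp ((α * ψ : ℝ) * Complex.I) with hθ
  set μ := Complex.exp (ψ * Complex.I) with hμ
  have hμre : μ.re = Real.cos ψ := Complex.exp_ofReal_mul_I_re ψ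
  have han : ‖μ / (α * θ)‖ = α⁻¹ := by
    rw [norm_div, norm_mul, norm_exp_mul_I_eq_one, norm_exp_mul_I_eq_one, Complex.norm_real,
      Real.norm_of_nonneg hα0.le]; simp
  have hq : 2 * C < ‖μ / (α * θ)‖ * Real.exp (μ.re * t) := by
    rw [han, inv_mul_eq_div, lt_div_iff₀ hα0]
    have h1 : c * t₀ ≤ μ.re * t := by
      rw [hμre]; exact mul_le_mul (cos_ge_of_abs_le hα hψ) htt.le ht₀0.le (hc0.le.trans (cos_ge_of_abs_le hα hψ))
    have h2 : c * t₀ = 2 * C * α + 1 := by rw [ht₀]; field_simp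
    have := Real.add_one_le_exp (μ.re * t)
    linarith
  have hpt : ∀ s ∈ Icc (0 : ℝ) 1, ‖resKernel (mlSol α l) x s‖ ≤ t ^ (1 - α) * (D *
      ((1 + (t - t * s) ^ 2)⁻¹ + (1 + (0 - t * s) ^ 2)⁻¹ + (1 + (t * x - t * s) ^ 2)⁻¹)) := by
    intro s hs
    rw [hlt, resKernel_scale ht, norm_mul, Complex.norm_real,
      Real.norm_of_nonneg (Real.rpow_nonneg ht.le _)]
    refine mul_le_mul_of_nonneg_left ?_ (Real.rpow_nonneg ht.le _)
    exact norm_green_le hc0 (by rw [hμre]; exact cos_ge_of_abs_le hα hψ)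
      (by rw [han]; exact inv_le_one_of_one_le₀ hα.le) hC (fun y hy => hU ψ y hψ hy)
      (fun y hy => mlSol_of_nonpos hα hy) hq ⟨by nlinarith [hx.1], by nlinarith [hx.2]⟩
      ⟨by nlinarith [hs.1], by nlinarith [hs.2]⟩
  obtain ⟨i1, b1⟩ := integral_scaled_bump_le ht t
  obtain ⟨i2, b2⟩ := integral_scaled_bump_le ht 0
  obtain ⟨i3, b3⟩ := integral_scaled_bump_le ht (t * x)
  have i12 : IntegrableOn (fun s : ℝ => (1 + (t - t * s) ^ 2)⁻¹ + (1 + (0 - t * s) ^ 2)⁻¹) (Icc 0 1) :=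
    i1.add i2
  have i123 : IntegrableOn (fun s : ℝ => (1 + (t - t * s) ^ 2)⁻¹ + (1 + (0 - t * s) ^ 2)⁻¹ +
      (1 + (t * x - t * s) ^ 2)⁻¹) (Icc 0 1) := i12.add i3
  have hmono := setIntegral_mono_on
    ((continuous_kernel_right (continuous_resKernel (continuous_mlSol_right hα l)) x).norm.integrableOn_Icc)
    ((i123.const_mul D).const_mul (t ^ (1 - α))) measurableSet_Icc hpt
  refine hmono.trans ?_
  rw [integral_const_mul, integral_const_mul, integral_add i12 i3, integral_add i1 i2]
  have e : D * (3 * Real.pi) / ‖l‖ = t ^ (1 - α) * (D * (t⁻¹ * Real.pi + t⁻¹ * Real.pi + t⁻¹ * Real.pi)) := by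
    rw [← hta, Real.rpow_sub ht, Real.rpow_one]
    have := (Real.rpow_pos_of_pos ht α).ne'
    field_simp
    ring
  rw [e]
  have := Real.rpow_nonneg ht.le (1 - α)
  gcongr

/-- On the compact half disc ‖l‖ ≤ Λ, Re l ≥ 0, the nonvanishing of u_l(1) makes the kernel jointly
continuous, hence bounded by some B, and B ≤ BΛ/‖l‖ there. -/
theorem exists_resKernel_bound (hα : 1 < α) (hα' : α ≤ 2) : ∃ M : ℝ, 0 < M ∧
    ∀ l : ℂ, 0 ≤ l.re → l ≠ 0 → ∀ x ∈ Icc (0 : ℝ) 1,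
      ∫ s in Icc (0 : ℝ) 1, ‖resKernel (mlSol α l) x s‖ ≤ M / ‖l‖ := by
  obtain ⟨M, Λ, hM, hΛ, hlarge⟩ := exists_resKernel_bound_large hα hα'
  set S : Set ℂ := Metric.closedBall 0 Λ ∩ {l | 0 ≤ l.re} with hS
  have hSc : IsCompact S := (isCompact_closedBall 0 Λ).inter_right
    (isClosed_le continuous_const Complex.continuous_re)
  have hU := continuous_mlSol hα
  have hcont : ContinuousOn (fun p : ℂ × ℝ × ℝ => resKernel (mlSol α p.1) p.2.1 p.2.2)
      (S ×ˢ Icc (0 : ℝ) 1 ×ˢ Icc (0 : ℝ) 1) := by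
    unfold resKernel
    refine ContinuousOn.sub (ContinuousOn.mul ?_ (ContinuousOn.div ?_ ?_ fun p hp =>
      mlSol_one_ne_zero hα hα' hp.1.2)) ?_
    · exact (hU.comp (continuous_fst.prodMk (by fun_prop : Continuous fun p : ℂ × ℝ × ℝ => p.2.1))).continuousOn
    · exact (hU.comp (continuous_fst.prodMk
        (by fun_prop : Continuous fun p : ℂ × ℝ × ℝ => 1 - p.2.2))).continuousOn
    · exact (hU.comp (continuous_fst.prodMk continuous_const)).continuousOn
    · exact (hU.comp (continuous_fst.prodMk
        (by fun_prop : Continuous fun p : ℂ × ℝ × ℝ => p.2.1 - p.2.2))).continuousOn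
  obtain ⟨B, hB⟩ := (hSc.prod (isCompact_Icc.prod isCompact_Icc)).exists_bound_of_continuousOn hcont
  refine ⟨max M (B * Λ), lt_max_of_lt_left hM, fun l hl hl0 x hx => ?_⟩
  have hn : 0 < ‖l‖ := norm_pos_iff.2 hl0
  rcases lt_or_ge Λ ‖l‖ with h | h
  · refine (hlarge l hl h x hx).trans ?_
    gcongr
    exact le_max_left _ _
  · have hlS : l ∈ S := ⟨by simpa using h, hl⟩
    have hpt : ∀ s ∈ Icc (0 : ℝ) 1, ‖resKernel (mlSol α l) x s‖ ≤ B := fun s hs => hB (l, x, s) ⟨hlS, hx, hs⟩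
    have hB0 : 0 ≤ B := (norm_nonneg _).trans (hpt 0 ⟨le_rfl, zero_le_one⟩)
    have hmono := setIntegral_mono_on
      ((continuous_kernel_right (continuous_resKernel (continuous_mlSol_right hα l)) x).norm.integrableOn_Icc)
      (show IntegrableOn (fun _ : ℝ => B) (Icc 0 1) volume from continuous_const.integrableOn_Icc) measurableSet_Icc hpt
    refine hmono.trans ?_
    rw [le_div_iff₀ hn]
    simp only [integral_const, MeasurableSet.univ, measureReal_restrict_apply, univ_inter,
      Real.volume_real_Icc, sub_zero, smul_eq_mul, max_eq_left zero_le_one, one_mul]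
    exact (mul_le_mul_of_nonneg_left h hB0).trans (le_max_right _ _)

theorem exists_resKernel_bound_at (hα : 1 < α) (hα' : α ≤ 2) : ∃ M : ℝ, 0 < M ∧
    ∀ l : ℂ, 0 ≤ l.re → ∃ B : ℝ, (l ≠ 0 → B ≤ M / ‖l‖) ∧ ∀ x ∈ Icc (0 : ℝ) 1,
      ∫ s in Icc (0 : ℝ) 1, ‖resKernel (mlSol α l) x s‖ ≤ B := by
  obtain ⟨M, hM, h⟩ := exists_resKernel_bound hα hα'
  refine ⟨M, hM, fun l hl => ?_⟩
  by_cases hl0 : l = 0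
  · subst hl0
    have hk := continuous_resKernel (continuous_mlSol_right hα 0)
    obtain ⟨B, hB⟩ := exists_kernel_bound hk
    refine ⟨B, fun h => absurd rfl h, fun x hx => ?_⟩
    refine (setIntegral_mono_on ((continuous_kernel_right hk x).norm.integrableOn_Icc)
      (show IntegrableOn (fun _ : ℝ => B) (Icc 0 1) volume from continuous_const.integrableOn_Icc) measurableSet_Icc (hB x hx)).trans (le_of_eq ?_)
    simp
  · exact ⟨M / ‖l‖, fun _ => le_rfl, h l hl hl0⟩

theorem exists_resolvent_C0 (hα : 1 < α) (hα' : α ≤ 2) : ∃ M : ℝ, 0 < M ∧ ∀ z : ℂ, 0 ≤ z.re →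
    ∃ R : C0Unit →L[ℂ] C0Unit, IsResolventAt (fracDirichletC0 α hα) z R ∧ (z ≠ 0 → ‖R‖ ≤ M / ‖z‖) := by
  obtain ⟨M, hM, h⟩ := exists_resKernel_bound_at hα hα'
  refine ⟨M, hM, fun z hz => ?_⟩
  obtain ⟨B, hB, hx⟩ := h z hz
  obtain ⟨R, hR, hRn⟩ := exists_isResolventAt_C0 hα hα' (mlSol_one_ne_zero hα hα' hz) hx
  exact ⟨R, hR, fun h0 => hRn.trans (hB h0)⟩

theorem exists_resolvent_L1 (hα : 1 < α) (hα' : α ≤ 2) : ∃ M : ℝ, 0 < M ∧ ∀ z : ℂ, 0 ≤ z.re →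
    ∃ R : L1Unit →L[ℂ] L1Unit, IsResolventAt (fracDirichletL1 α hα) z R ∧ (z ≠ 0 → ‖R‖ ≤ M / ‖z‖) := by
  obtain ⟨M, hM, h⟩ := exists_resKernel_bound_at hα hα'
  refine ⟨M, hM, fun z hz => ?_⟩
  obtain ⟨B, hB, hx⟩ := h z hz
  obtain ⟨R, hR, hRn⟩ := exists_isResolventAt_L1 hα hα' (mlSol_one_ne_zero hα hα' hz) hx
  exact ⟨R, hR, fun h0 => hRn.trans (hB h0)⟩

end Estimates

/-! ### Density of the domain in C₀(0,1). -/

section Density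

variable {α : ℝ}

theorem fracIntegral_pow (hα : 1 < α) (m : ℕ) {x : ℝ} (hx : 0 ≤ x) :
    fracIntegral α (fun s => ((s ^ m : ℝ) : ℂ)) x =
      ((Real.Gamma (m + 1) / Real.Gamma (α + (m + 1)) * (x ^ (α - 1) * x ^ (m + 1)) : ℝ) : ℂ) := by
  rcases hx.eq_or_lt with rfl | hx
  · simp [fracIntegral]
  have h := integral_rlKernel_mul (a := α) (b := m + 1) (by linarith) (by positivity) hx
  have hG : Real.Gamma (m + 1) ≠ 0 := (Real.Gamma_pos_of_pos (by positivity)).ne'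
  have e : ∀ s : ℝ, (((x - s) ^ (α - 1) / Real.Gamma α : ℝ) : ℂ) * ((s ^ m : ℝ) : ℂ) =
      ((Real.Gamma (m + 1) * (rlKernel α (x - s) * rlKernel (m + 1) s) : ℝ) : ℂ) := by
    intro s
    rw [← Complex.ofReal_mul, rlKernel, rlKernel, add_sub_cancel_right, Real.rpow_natCast]
    congr 1
    field_simp
  unfold fracIntegral
  simp_rw [e]
  rw [intervalIntegral.integral_ofReal, intervalIntegral.integral_const_mul, h, rlKernel,
    show α + (m + 1) - 1 = (α - 1) + ((m + 1 : ℕ) : ℝ) by push_cast; ring, Real.rpow_add hx,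
    Real.rpow_natCast]
  congr 1
  ring

theorem dirichletAntideriv_pow (hα : 1 < α) (m : ℕ) {x : ℝ} (hx : 0 ≤ x) :
    dirichletAntideriv α (fun s => ((s ^ m : ℝ) : ℂ)) x =
      ((Real.Gamma (m + 1) / Real.Gamma (α + (m + 1)) : ℝ) : ℂ) *
        ((x ^ (α - 1) * (x ^ (m + 1) - 1) : ℝ) : ℂ) := by
  rw [dirichletAntideriv, fracIntegral_pow hα m hx, fracIntegral_pow hα m zero_le_one]
  simp only [Real.one_rpow, one_pow, mul_one]
  push_cast
  ring

/-- A cut-off function that vanishes at `0` and `1` and tends to one as `ε → 0`. -/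
def cutoff (α ε x : ℝ) : ℝ := x ^ (α - 1) * (1 - x) / (x ^ (α - 1) * (1 - x) + ε)

theorem weight_nonneg (α : ℝ) {x : ℝ} (hx : x ∈ Icc (0 : ℝ) 1) : 0 ≤ x ^ (α - 1) * (1 - x) :=
  mul_nonneg (Real.rpow_nonneg hx.1 _) (by linarith [hx.2])

theorem continuous_rpow_sub_one (hα : 1 < α) : Continuous fun x : ℝ => x ^ (α - 1) :=
  Real.continuous_rpow_const (by linarith)

theorem continuousOn_cutoff (hα : 1 < α) {ε : ℝ} (hε : 0 < ε) : ContinuousOn (cutoff α ε) (Icc 0 1) := by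
  have h := continuous_rpow_sub_one hα
  have h1 : Continuous fun x : ℝ => x ^ (α - 1) * (1 - x) := by fun_prop
  refine ContinuousOn.div h1.continuousOn (by fun_prop) fun x hx => ?_
  have := weight_nonneg α hx
  positivity

theorem cutoff_zero (hα : 1 < α) (ε : ℝ) : cutoff α ε 0 = 0 := by
  simp [cutoff, Real.zero_rpow (by linarith : α - 1 ≠ 0)]

theorem cutoff_one (α ε : ℝ) : cutoff α ε 1 = 0 := by simp [cutoff]

theorem one_sub_cutoff {ε x : ℝ} (hε : 0 < ε) (hx : x ∈ Icc (0 : ℝ) 1) :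
    1 - cutoff α ε x = ε / (x ^ (α - 1) * (1 - x) + ε) := by
  have := weight_nonneg α hx
  rw [cutoff, eq_div_iff (by positivity), sub_mul, div_mul_cancel₀ _ (by positivity)]
  ring

theorem abs_one_sub_cutoff_le {ε x : ℝ} (hε : 0 < ε) (hx : x ∈ Icc (0 : ℝ) 1) :
    |1 - cutoff α ε x| ≤ 1 := by
  have := weight_nonneg α hx
  rw [one_sub_cutoff hε hx, abs_of_nonneg (by positivity)]
  exact (div_le_one (by positivity)).2 (by linarith)

theorem tendsto_integral_cutoff (hα : 1 < α) {f : ℝ → ℂ} (hf : ContinuousOn f (Icc 0 1)) :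
    Tendsto (fun n : ℕ => ∫ x in Icc (0 : ℝ) 1, ‖f x * (cutoff α (1 / (n + 1)) x : ℂ) - f x‖) atTop (𝓝 0) := by
  have hε : ∀ n : ℕ, (0 : ℝ) < 1 / (n + 1) := fun n => by positivity
  have hn : ∀ (n : ℕ) (x : ℝ), ‖f x * (cutoff α (1 / (n + 1)) x : ℂ) - f x‖ =
      ‖f x‖ * |1 - cutoff α (1 / (n + 1)) x| := by
    intro n x
    rw [show f x * (cutoff α (1 / (n + 1)) x : ℂ) - f x =
      -(f x * ((1 - cutoff α (1 / (n + 1)) x : ℝ) : ℂ)) by push_cast; ring, norm_neg, norm_mul,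
      Complex.norm_real, Real.norm_eq_abs]
  have := tendsto_integral_of_dominated_convergence (μ := volume.restrict (Icc (0 : ℝ) 1))
    (F := fun (n : ℕ) x => ‖f x * (cutoff α (1 / (n + 1)) x : ℂ) - f x‖) (f := fun _ => 0)
    (fun x => ‖f x‖) (fun n => ?_) hf.norm.integrableOn_Icc (fun n => ?_) ?_
  · simpa using this
  · have hc := continuousOn_cutoff hα (hε n)
    exact (ContinuousOn.norm ((hf.mul (Complex.continuous_ofReal.comp_continuousOn hc)).sub hf)).aestronglyMeasurable
      measurableSet_Icc
  · rw [ae_restrict_iff' measurableSet_Icc]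
    refine Eventually.of_forall fun x hx => ?_
    rw [norm_norm, hn]
    exact mul_le_of_le_one_right (norm_nonneg _) (abs_one_sub_cutoff_le (hε n) hx)
  · rw [← Measure.restrict_congr_set (Ioo_ae_eq_Icc (a := (0 : ℝ)) (b := 1)),
      ae_restrict_iff' measurableSet_Ioo]
    refine Eventually.of_forall fun x hx => ?_
    have hw : 0 < x ^ (α - 1) * (1 - x) :=
      mul_pos (Real.rpow_pos_of_pos hx.1 _) (by linarith [hx.2])
    simp_rw [hn, one_sub_cutoff (hε _) (Ioo_subset_Icc_self hx)]
    have h0 : Tendsto (fun n : ℕ => (1 : ℝ) / (n + 1)) atTop (𝓝 0) :=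
      tendsto_one_div_add_atTop_nhds_zero_nat
    have h1 := h0.div (h0.const_add (x ^ (α - 1) * (1 - x))) (by rw [add_zero]; exact hw.ne')
    rw [zero_div] at h1
    simpa using h1.abs.const_mul ‖f x‖

/-- The element of `C₀(0,1)` obtained from a continuous function by cutting it off. -/
def cutC0 (hα : 1 < α) (f : ℝ → ℂ) (hf : ContinuousOn f (Icc 0 1)) (n : ℕ) : C0Unit :=
  C0Unit.ofContinuousOn (fun x => f x * (cutoff α (1 / (n + 1)) x : ℂ))
    (hf.mul (Complex.continuous_ofReal.comp_continuousOn (continuousOn_cutoff hα (by positivity))))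
    (by simp [cutoff_zero hα]) (by simp [cutoff_one])

/-- The functions that agree on `(0,1)` with an element of the closure of the domain. -/
def InDomainClosure (hα : 1 < α) (F : ℝ → ℂ) : Prop :=
  ∃ f ∈ (fracDirichletC0 α hα).domain.topologicalClosure, ∀ x : Ioo (0 : ℝ) 1, f x = F x

theorem InDomainClosure.add {hα : 1 < α} {F G : ℝ → ℂ} (hF : InDomainClosure hα F)
    (hG : InDomainClosure hα G) : InDomainClosure hα (fun x => F x + G x) := by
  obtain ⟨f, hf, hfF⟩ := hF
  obtain ⟨g, hg, hgG⟩ := hG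
  exact ⟨f + g, Submodule.add_mem _ hf hg, fun x => by
    rw [ZeroAtInftyContinuousMap.coe_add, Pi.add_apply, hfF, hgG]⟩

theorem InDomainClosure.const_mul {hα : 1 < α} {F : ℝ → ℂ} (hF : InDomainClosure hα F) (c : ℂ) :
    InDomainClosure hα (fun x => c * F x) := by
  obtain ⟨f, hf, hfF⟩ := hF
  exact ⟨c • f, Submodule.smul_mem _ c hf, fun x => by
    rw [ZeroAtInftyContinuousMap.coe_smul, Pi.smul_apply, hfF, smul_eq_mul]⟩

theorem InDomainClosure.congr {hα : 1 < α} {F G : ℝ → ℂ} (hF : InDomainClosure hα F)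
    (h : ∀ x ∈ Ioo (0 : ℝ) 1, F x = G x) : InDomainClosure hα G := by
  obtain ⟨f, hf, hfF⟩ := hF
  exact ⟨f, hf, fun x => by rw [hfF, h x x.2]⟩

theorem mem_closure_of_approx {hα : 1 < α} {f : C0Unit}
    (h : ∀ ε > 0, ∃ G, InDomainClosure hα G ∧ ∀ x : Ioo (0 : ℝ) 1, ‖f x - G x‖ ≤ ε) :
    f ∈ (fracDirichletC0 α hα).domain.topologicalClosure := by
  have hcl := (fracDirichletC0 α hα).domain.isClosed_topologicalClosure
  rw [← SetLike.mem_coe, ← hcl.closure_eq, Metric.mem_closure_iff]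
  intro ε hε
  obtain ⟨G, ⟨g, hg, hgG⟩, hb⟩ := h (ε / 2) (by positivity)
  refine ⟨g, hg, ?_⟩
  rw [dist_eq_norm]
  refine (C0Unit.norm_le (by positivity : 0 ≤ ε / 2) fun x => ?_).trans_lt (by linarith)
  rw [ZeroAtInftyContinuousMap.coe_sub, Pi.sub_apply, hgG]
  exact hb x

/-- φ need not vanish at the end points, so its antiderivative need not be in the domain. Cutting φ
off changes it little in L¹, and the bounded kernel of A⁻¹ turns this into a small uniform change.
-/
theorem inDomainClosure_dirichletAntideriv (hα : 1 < α) (hα' : α ≤ 2) {φ : ℝ → ℂ}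
    (hφ : ContinuousOn φ (Icc 0 1)) : InDomainClosure hα (dirichletAntideriv α φ) := by
  have hk := continuous_resKernel (continuous_mlSol_right hα 0)
  have h0 : ∀ s ∈ Icc (0 : ℝ) 1, resKernel (mlSol α 0) 0 s = 0 := fun s hs =>
    resKernel_zero_left (fun y hy => mlSol_of_nonpos hα hy) hs.1
  have h1 : ∀ s ∈ Icc (0 : ℝ) 1, resKernel (mlSol α 0) 1 s = 0 := fun s _ =>
    resKernel_one_left (mlSol_zero_one_ne_zero hα) s
  have hG : ∀ ψ : ℝ → ℂ, IntegrableOn ψ (Icc (0 : ℝ) 1) → ∃ f : C0Unit,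
      ∀ x : Ioo (0 : ℝ) 1, f x = dirichletAntideriv α ψ x := fun ψ hψ =>
    ⟨C0Unit.ofContinuousOn (fun x => -kernelInt (resKernel (mlSol α 0)) ψ x)
      (continuousOn_kernelInt hk hψ).neg (by rw [kernelInt_eq_zero h0, neg_zero])
      (by rw [kernelInt_eq_zero h1, neg_zero]), fun x => by
        rw [dirichletAntideriv_eq_kernelInt hα hψ (Ioo_subset_Icc_self x.2)]; rfl⟩
  have hdom : ∀ g : C0Unit, InDomainClosure hα (dirichletAntideriv α g.zeroExtend) := by
    intro g
    obtain ⟨f, hf⟩ := hG _ g.integrableOn_zeroExtend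
    refine ⟨f, Submodule.le_topologicalClosure _ ?_, hf⟩
    have : (f, g) ∈ (fracDirichletC0 α hα).graph := by
      rw [fracDirichletC0_graph α hα hα']; exact hf
    exact LinearPMap.mem_domain_of_mem_graph this
  obtain ⟨f, hf⟩ := hG φ hφ.integrableOn_Icc
  refine ⟨f, mem_closure_of_approx fun ε hε => ?_, hf⟩
  obtain ⟨B, hB⟩ := exists_kernel_bound hk
  have hB0 : 0 ≤ B := (norm_nonneg _).trans (hB 0 ⟨le_rfl, zero_le_one⟩ 0 ⟨le_rfl, zero_le_one⟩)
  have hlim := (tendsto_integral_cutoff hα hφ).const_mul B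
  rw [mul_zero] at hlim
  obtain ⟨n, hn⟩ := ((tendsto_order.1 hlim).2 ε hε).exists
  set g := cutC0 hα φ hφ n with hg
  have hge : g.zeroExtend =ᵐ[volume.restrict (Icc (0 : ℝ) 1)]
      fun x => φ x * (cutoff α (1 / (n + 1)) x : ℂ) := C0Unit.zeroExtend_ae fun x => rfl
  refine ⟨_, hdom g, fun x => ?_⟩
  have hx := Ioo_subset_Icc_self x.2
  have hψi : IntegrableOn (fun x => φ x * (cutoff α (1 / (n + 1)) x : ℂ)) (Icc (0 : ℝ) 1) :=
    (hφ.mul (Complex.continuous_ofReal.comp_continuousOn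
      (continuousOn_cutoff hα (by positivity)))).integrableOn_Icc
  rw [hf, dirichletAntideriv_congr hge hx, dirichletAntideriv_eq_kernelInt hα hφ.integrableOn_Icc hx,
    dirichletAntideriv_eq_kernelInt hα hψi hx, neg_sub_neg]
  unfold kernelInt
  rw [← integral_sub (integrableOn_kernel_mul hk hψi _) (integrableOn_kernel_mul hk hφ.integrableOn_Icc _)]
  refine le_trans ?_ hn.le
  rw [← integral_const_mul]
  refine norm_integral_le_of_norm_le (((hψi.sub hφ.integrableOn_Icc).norm).const_mul B) ?_
  rw [ae_restrict_iff' measurableSet_Icc]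
  refine Eventually.of_forall fun s hs => ?_
  rw [← mul_sub, norm_mul]
  exact mul_le_mul_of_nonneg_right (hB _ hx s hs) (norm_nonneg _)

/-- By linearity only monomials matter: x^(m+1) comes from the antiderivative of s^m, and the
constant monomial contributes 0. -/
theorem inDomainClosure_polynomial (hα : 1 < α) (hα' : α ≤ 2) (p : Polynomial ℝ) :
    InDomainClosure hα (fun x => ((x ^ (α - 1) * (p.eval x - p.eval 1) : ℝ) : ℂ)) := by
  induction p using Polynomial.induction_on' with
  | add p q hp hq =>
    refine (hp.add hq).congr fun x _ => ?_
    simp only [Polynomial.eval_add]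
    push_cast; ring
  | monomial n a =>
    rcases n with _ | m
    · refine ⟨0, Submodule.zero_mem _, fun x => by simp⟩
    · have h := (inDomainClosure_dirichletAntideriv hα hα' (φ := fun s => ((s ^ m : ℝ) : ℂ))
        (by fun_prop)).const_mul
        ((a * (Real.Gamma (m + 1) / Real.Gamma (α + (m + 1)))⁻¹ : ℝ) : ℂ)
      refine h.congr fun x hx => ?_
      have hG : (Real.Gamma (m + 1) / Real.Gamma (α + (m + 1))) ≠ 0 :=
        (div_pos (Real.Gamma_pos_of_pos (by positivity)) (Real.Gamma_pos_of_pos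
          (by have := m.cast_nonneg (α := ℝ); linarith))).ne'
      rw [dirichletAntideriv_pow hα m hx.1.le, ← Complex.ofReal_mul, ← Complex.ofReal_mul]
      congr 1
      rw [Polynomial.eval_monomial, Polynomial.eval_monomial, one_pow, mul_one]
      generalize Real.Gamma (m + 1) / Real.Gamma (α + (m + 1)) = G at hG
      field_simp

/-- Weierstrass: approximate h within ε/2 by a polynomial p and subtract p(1), which is itself below
ε/2 because h(1) = 0. -/
theorem inDomainClosure_real (hα : 1 < α) (hα' : α ≤ 2) {h : ℝ → ℝ} (hc : ContinuousOn h (Icc 0 1))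
    (h1 : h 1 = 0) : InDomainClosure hα (fun x => ((x ^ (α - 1) * h x : ℝ) : ℂ)) := by
  have hr := continuous_rpow_sub_one hα
  refine ⟨C0Unit.ofContinuousOn (fun x => ((x ^ (α - 1) * h x : ℝ) : ℂ))
    (Complex.continuous_ofReal.comp_continuousOn (hr.continuousOn.mul hc))
    (by simp [Real.zero_rpow (by linarith : α - 1 ≠ 0)]) (by simp [h1]),
    mem_closure_of_approx fun ε hε => ?_, fun x => rfl⟩
  obtain ⟨p, hp⟩ := exists_polynomial_near_of_continuousOn 0 1 h hc (ε / 2) (by positivity)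
  refine ⟨_, inDomainClosure_polynomial hα hα' p, fun x => ?_⟩
  have hx := Ioo_subset_Icc_self x.2
  have a1 := abs_lt.1 (hp x hx)
  have a2 := abs_lt.1 (hp 1 ⟨zero_le_one, le_rfl⟩)
  rw [h1] at a2
  have a3 : ((x : ℝ)) ^ (α - 1) ≤ 1 := Real.rpow_le_one hx.1 hx.2 (by linarith)
  rw [C0Unit.ofContinuousOn_apply, ← Complex.ofReal_sub, Complex.norm_real, Real.norm_eq_abs, ← mul_sub,
    abs_mul, abs_of_nonneg (Real.rpow_nonneg hx.1 _)]
  have a4 : |h x - (p.eval (x : ℝ) - p.eval 1)| ≤ ε := by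
    rw [abs_le]; constructor <;> linarith
  calc _ ≤ 1 * ε := mul_le_mul a3 a4 (abs_nonneg _) zero_le_one
    _ = ε := one_mul ε

theorem inDomainClosure_complex (hα : 1 < α) (hα' : α ≤ 2) {h : ℝ → ℂ} (hc : ContinuousOn h (Icc 0 1))
    (h1 : h 1 = 0) : InDomainClosure hα (fun x => ((x ^ (α - 1) : ℝ) : ℂ) * h x) := by
  have hr := inDomainClosure_real hα hα' (h := fun x => (h x).re)
    (Complex.continuous_re.comp_continuousOn hc) (by simp [h1])
  have hi := inDomainClosure_real hα hα' (h := fun x => (h x).im)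
    (Complex.continuous_im.comp_continuousOn hc) (by simp [h1])
  refine (hr.add (hi.const_mul Complex.I)).congr fun x _ => ?_
  conv_rhs => rw [← Complex.re_add_im (h x)]
  push_cast; ring

theorem C0Unit.continuousOn_zeroExtend_Icc (f : C0Unit) : ContinuousOn f.zeroExtend (Icc 0 1) := by
  refine Continuous.continuousOn ?_
  rw [continuous_iff_continuousAt]
  intro x
  by_cases hx : x ∈ Ioo (0 : ℝ) 1
  · exact f.continuousOn_zeroExtend.continuousAt (isOpen_Ioo.mem_nhds hx)
  · rw [ContinuousAt, f.zeroExtend_of_notMem hx, Metric.tendsto_nhds]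
    intro ε hε
    have h0 := Metric.tendsto_nhds.1 (ZeroAtInftyContinuousMapClass.zero_at_infty f) ε hε
    obtain ⟨K, hK, hKs⟩ := Filter.mem_cocompact.1 h0
    have hKc : IsCompact ((↑) '' K : Set ℝ) := hK.image continuous_subtype_val
    have hxK : x ∉ ((↑) '' K : Set ℝ) := by
      rintro ⟨y, -, rfl⟩; exact hx y.2
    filter_upwards [hKc.isClosed.isOpen_compl.mem_nhds hxK] with y hy
    by_cases hyI : y ∈ Ioo (0 : ℝ) 1
    · rw [f.zeroExtend_coe ⟨y, hyI⟩]
      exact hKs fun hyK => hy ⟨_, hyK, rfl⟩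
    · rw [f.zeroExtend_of_notMem hyI]; simpa using hε

/-- With the weight W = x^(α-1)(1-x), the function f W/(W + δ) equals x^(α-1) h with h continuous
and h(1) = 0, and it is uniformly close to f for small δ. -/
theorem dense_domain_fracDirichletC0 (hα : 1 < α) (hα' : α ≤ 2) :
    Dense ((fracDirichletC0 α hα).domain : Set C0Unit) := by
  intro f
  rw [← Submodule.topologicalClosure_coe, SetLike.mem_coe]
  refine mem_closure_of_approx fun ε hε => ?_
  have hfc := f.continuousOn_zeroExtend_Icc
  have hr := continuous_rpow_sub_one hα
  have hwc : Continuous fun x : ℝ => x ^ (α - 1) * (1 - x) := by fun_prop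
  -- the weight is bounded below where `f` is not small
  have hT : IsCompact (Icc (0 : ℝ) 1 ∩ (fun x => ‖f.zeroExtend x‖) ⁻¹' Ici ε) :=
    isCompact_Icc.of_isClosed_subset
      (hfc.norm.preimage_isClosed_of_isClosed isClosed_Icc isClosed_Ici) inter_subset_left
  have hsub : ∀ x ∈ Icc (0 : ℝ) 1 ∩ (fun x => ‖f.zeroExtend x‖) ⁻¹' Ici ε, x ∈ Ioo (0 : ℝ) 1 := by
    rintro x ⟨-, hxε⟩
    by_contra h
    rw [mem_preimage, f.zeroExtend_of_notMem h, norm_zero, mem_Ici] at hxε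
    linarith
  obtain ⟨m, hm, hmw⟩ : ∃ m > 0, ∀ x ∈ Icc (0 : ℝ) 1 ∩ (fun x => ‖f.zeroExtend x‖) ⁻¹' Ici ε,
      m ≤ x ^ (α - 1) * (1 - x) := by
    rcases (Icc (0 : ℝ) 1 ∩ (fun x => ‖f.zeroExtend x‖) ⁻¹' Ici ε).eq_empty_or_nonempty with he | hne
    · exact ⟨1, one_pos, fun x hx => by rw [he] at hx; exact hx.elim⟩
    · obtain ⟨x₀, hx₀, hmin⟩ := hT.exists_isMinOn hne hwc.continuousOn
      have := hsub x₀ hx₀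
      exact ⟨_, mul_pos (Real.rpow_pos_of_pos this.1 _) (by linarith [this.2]), fun x hx => hmin hx⟩
  -- The relative error of the cut-off is at most 1 everywhere, which suffices where |f| < ε; where
  -- |f| ≥ ε the weight is at least m and the error is at most ‖f‖ δ/m ≤ ε.
  set δ := ε * m / (‖f‖ + 1) with hδ
  have hδ0 : 0 < δ := by positivity
  refine ⟨fun x => ((x ^ (α - 1) : ℝ) : ℂ) * (f.zeroExtend x * (((1 - x) / (x ^ (α - 1) * (1 - x) + δ) : ℝ) : ℂ)),
    inDomainClosure_complex hα hα' ?_ (by simp), fun x => ?_⟩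
  · refine hfc.mul (Complex.continuous_ofReal.comp_continuousOn
      (ContinuousOn.div (by fun_prop) (by fun_prop) fun x hx => ?_))
    have := weight_nonneg α hx
    positivity
  have hx := Ioo_subset_Icc_self x.2
  have e : f x - (((x : ℝ) ^ (α - 1) : ℝ) : ℂ) * (f.zeroExtend x *
      (((1 - x) / ((x : ℝ) ^ (α - 1) * (1 - x) + δ) : ℝ) : ℂ)) =
      f x * ((1 - cutoff α δ x : ℝ) : ℂ) := by
    rw [f.zeroExtend_coe, cutoff]
    push_cast; ring
  rw [e, norm_mul, Complex.norm_real, Real.norm_eq_abs]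
  rcases lt_or_ge ‖f x‖ ε with h | h
  · exact (mul_le_of_le_one_right (norm_nonneg _) (abs_one_sub_cutoff_le hδ0 hx)).trans h.le
  · have hmx := hmw x ⟨hx, by rw [mem_preimage, f.zeroExtend_coe]; exact h⟩
    have hfn : ‖f x‖ ≤ ‖f‖ := by rw [← f.zeroExtend_coe]; exact f.norm_zeroExtend_le x
    rw [one_sub_cutoff hδ0 hx, abs_of_nonneg (by have := weight_nonneg α hx; positivity)]
    calc ‖f x‖ * (δ / ((x : ℝ) ^ (α - 1) * (1 - x) + δ)) ≤ ‖f‖ * (δ / m) := by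
          refine mul_le_mul hfn ?_ (by have := weight_nonneg α hx; positivity) (norm_nonneg _)
          gcongr; linarith
      _ = ε * (‖f‖ / (‖f‖ + 1)) := by rw [hδ]; field_simp
      _ ≤ ε * 1 := by
          gcongr
          exact (div_le_one (by positivity)).2 (by linarith)
      _ = ε := mul_one ε

end Density

/-! ### Density of the domain in L¹[0,1]. -/

section DensityL1

variable {α : ℝ}

theorem C0Unit.integrable_zeroExtend (f : C0Unit) :
    Integrable f.zeroExtend (volume.restrict (Icc (0 : ℝ) 1)) :=
  f.integrableOn_zeroExtend

/-- The inclusion of `C₀(0,1)` in `L¹[0,1]`. -/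
def C0Unit.toL1 : C0Unit →L[ℂ] L1Unit :=
  LinearMap.mkContinuous
    { toFun := fun f => f.integrable_zeroExtend.toL1 f.zeroExtend
      map_add' := fun f g => 
        (Integrable.toL1_eq_toL1_iff _ _ _ (f.integrable_zeroExtend.add g.integrable_zeroExtend)).2
          (by rw [C0Unit.zeroExtend_add])
      map_smul' := fun c f => 
        (Integrable.toL1_eq_toL1_iff _ _ _ (f.integrable_zeroExtend.smul c)).2
          (by rw [C0Unit.zeroExtend_smul]) } 1 fun f => by
    rw [one_mul, L1.norm_eq_integral_norm]
    have h : ∀ᵐ x ∂volume.restrict (Icc (0 : ℝ) 1),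
        ‖‖(f.integrable_zeroExtend.toL1 f.zeroExtend : ℝ → ℂ) x‖‖ ≤ ‖f‖ := by
      filter_upwards [f.integrable_zeroExtend.coeFn_toL1] with x hx
      rw [hx, norm_norm]
      exact f.norm_zeroExtend_le x
    refine ((Real.le_norm_self _).trans (norm_integral_le_of_norm_le_const h)).trans_eq ?_
    simp

theorem C0Unit.coeFn_toL1 (f : C0Unit) :
    (C0Unit.toL1 f : ℝ → ℂ) =ᵐ[volume.restrict (Icc (0 : ℝ) 1)] f.zeroExtend :=
  f.integrable_zeroExtend.coeFn_toL1

theorem denseRange_toL1 : DenseRange C0Unit.toL1 := by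
  intro f
  rw [Metric.mem_closure_range_iff]
  intro ε hε
  obtain ⟨g, -, hg, hgc, hgi⟩ :=
    (L1.integrable_coeFn f).exists_hasCompactSupport_integral_sub_le (half_pos hε)
  -- The exponent 2 of the cut-off is immaterial here; any exponent above 1 would do.
  have hlim := tendsto_integral_cutoff one_lt_two hgc.continuousOn
  obtain ⟨n, hn⟩ := ((tendsto_order.1 hlim).2 (ε / 2) (half_pos hε)).exists
  set k := cutC0 one_lt_two g hgc.continuousOn n
  have hk : k.zeroExtend =ᵐ[volume.restrict (Icc (0 : ℝ) 1)]
      fun x => g x * (cutoff 2 (1 / (n + 1)) x : ℂ) := C0Unit.zeroExtend_ae fun x => rfl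
  refine ⟨k, ?_⟩
  have hd : IntegrableOn (fun x => g x * (cutoff 2 (1 / (n + 1)) x : ℂ)) (Icc (0 : ℝ) 1) :=
    k.integrableOn_zeroExtend.congr hk
  have i1 : IntegrableOn (fun x => ‖f x - g x‖) (Icc (0 : ℝ) 1) :=
    ((L1.integrable_coeFn f).sub hgi).norm
  have i2 : IntegrableOn (fun x => ‖g x * (cutoff 2 (1 / (n + 1)) x : ℂ) - g x‖) (Icc (0 : ℝ) 1) :=
    (hd.sub hgi).norm
  calc dist f (C0Unit.toL1 k) = ∫ x in Icc (0 : ℝ) 1, ‖(f - C0Unit.toL1 k : L1Unit) x‖ := by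
        rw [dist_eq_norm, L1.norm_eq_integral_norm]
    _ ≤ ∫ x in Icc (0 : ℝ) 1, (‖f x - g x‖ + ‖g x * (cutoff 2 (1 / (n + 1)) x : ℂ) - g x‖) := by
        refine integral_mono_ae (L1.integrable_coeFn _).norm (i1.add i2) ?_
        filter_upwards [Lp.coeFn_sub f (C0Unit.toL1 k), k.coeFn_toL1, hk] with x h1 h2 h3
        rw [h1, Pi.sub_apply, h2, h3, norm_sub_rev (g x * _)]
        exact norm_sub_le_norm_sub_add_norm_sub _ _ _
    _ = (∫ x in Icc (0 : ℝ) 1, ‖f x - g x‖) +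
        ∫ x in Icc (0 : ℝ) 1, ‖g x * (cutoff 2 (1 / (n + 1)) x : ℂ) - g x‖ := integral_add i1 i2
    _ < ε := by linarith

/-- The inclusion of C₀(0,1) is continuous with dense range and carries the C₀ domain into the L¹
domain, so the image of a dense subspace is dense. -/
theorem dense_domain_fracDirichletL1 (hα : 1 < α) (hα' : α ≤ 2) :
    Dense ((fracDirichletL1 α hα).domain : Set L1Unit) := by
  refine (denseRange_toL1.dense_image C0Unit.toL1.continuous
    (dense_domain_fracDirichletC0 hα hα')).mono ?_
  rintro _ ⟨f, hf, rfl⟩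
  obtain ⟨g, hfg⟩ := LinearPMap.mem_domain_iff.1 hf
  rw [fracDirichletC0_graph α hα hα'] at hfg
  refine LinearPMap.mem_domain_of_mem_graph (y := C0Unit.toL1 g) ?_
  rw [fracDirichletL1_graph α hα hα']
  change (C0Unit.toL1 f : ℝ → ℂ) =ᵐ[volume.restrict (Icc (0 : ℝ) 1)] dirichletAntideriv α (C0Unit.toL1 g)
  filter_upwards [f.coeFn_toL1, C0Unit.zeroExtend_ae hfg, ae_restrict_mem measurableSet_Icc]
    with x h1 h2 hx
  rw [h1, h2, dirichletAntideriv_congr g.coeFn_toL1 hx]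

end DensityL1

end

theorem mainTheorem6 (α : ℝ) (hα : 1 < α) (hα' : α ≤ 2) :
    ((∃ M : ℝ, 0 < M ∧ ∀ z : ℂ, 0 ≤ z.re →
        ∃ R : C0Unit →L[ℂ] C0Unit, IsResolventAt (fracDirichletC0 α hα) z R ∧
          (z ≠ 0 → ‖R‖ ≤ M / ‖z‖)) ∧
      (∃ S : C0Semigroup C0Unit, S.HasGenerator (fracDirichletC0 α hα)) ∧
      ∀ S : C0Semigroup C0Unit, S.HasGenerator (fracDirichletC0 α hα) → S.IsAnalytic) ∧
    ((∃ M : ℝ, 0 < M ∧ ∀ z : ℂ, 0 ≤ z.re →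
        ∃ R : L1Unit →L[ℂ] L1Unit, IsResolventAt (fracDirichletL1 α hα) z R ∧
          (z ≠ 0 → ‖R‖ ≤ M / ‖z‖)) ∧
      (∃ S : C0Semigroup L1Unit, S.HasGenerator (fracDirichletL1 α hα)) ∧
      ∀ S : C0Semigroup L1Unit, S.HasGenerator (fracDirichletL1 α hα) → S.IsAnalytic) := by
  obtain ⟨M, hM, hR⟩ := exists_resolvent_C0 hα hα'
  obtain ⟨N, hN, hS⟩ := exists_resolvent_L1 hα hα'
  exact ⟨⟨⟨M, hM, hR⟩, exists_analytic_semigroup hM hR (dense_domain_fracDirichletC0 hα hα')⟩,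
    ⟨⟨N, hN, hS⟩, exists_analytic_semigroup hN hS (dense_domain_fracDirichletL1 hα hα')⟩⟩
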